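/- Let $k$ be a field of characteristic $0$ and $K=k[[h]]$. Tensor products of superalgebras carry the multiplication $(a\otimes b)(a'\otimes b')=(-1)^{|b||a'|}aa'\otimes bb'$, and $\hat\otimes$ denotes the $h$-adically completed tensor product over $K$. Let $U(osp(2/1))$ be the $k$-superalgebra generated by even $J_0,J_\pm$ and odd $v_\pm$ with relations $$[J_0,v_\pm]=\pm\tfrac12 v_\pm,\quad \{v_+,v_-\}=-\tfrac12J_0,\quad [J_0,J_\pm]=\pm J_\pm,\quad [J_+,J_-]=2J_0,$$ $$J_\pm=\pm4v_\pm^2,\quad [J_\pm,v_\pm]=0,\quad [J_\pm,v_\mp]=v_\pm .$$ Let $r_2=J_0\wedge J_+-v_+\wedge v_+$, where $x\wedge y=x\otimes y-(-1)^{|x||y|}y\otimes x$, and $\delta(g)=[r_2,g\otimes1+1\otimes g]$ for the generators $g$. Let $U_h=U_h(osp(2/1))$ be the $K$-superalgebra topologically generated (in the $h$-adic topology) by even $H,X,Y$ and odd $V_\pm$ with relations $$[H,V_+]=\tfrac12V_+\cosh(hX),\quad [H,V_-]=-\tfrac14V_-\cosh(hX)-\tfrac14\cosh(hX)V_-,\quad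 \{V_+,V_-\}=-\tfrac12H,\quad [H,X]=\tfrac1h\sinh(hX),$$ $$[H,Y]=-\tfrac12Y\cosh(hX)-\tfrac12\cosh(hX)Y+hV_-\sinh(hX)V_+-hV_+\sinh(hX)V_-,$$ $$[X,Y]=2H,\quad V_+^2=\tfrac1{4h}\sinh(hX),\quad V_-^2=-\tfrac14Y,\quad [X,V_+]=[Y,V_-]=0,\quad [X,V_-]=V_+,$$ $$[Y,V_+]=\tfrac12V_-\cosh(hX)+\tfrac12\cosh(hX)V_- .$$ That is, $U_h$ is the quotient of the $h$-adically completed free algebra by the closure of the two-sided ideal generated by these relations. Put $T=\exp(hX)$. Then the following hold. 1. $U_h$ is a one-parameter deformation of $U(osp(2/1))$: it is $h$-adically complete and separated and $h$-torsion free, and reduction modulo $h$ induces an isomorphism $U_h/hU_h\cong U(osp(2/1))$ with $H,X,Y,V_\pm\mapsto J_0,J_+,J_-,v_\pm$. Moreover $U_h$ is topologically generated by $H,V_+,V_-$. 2. $U_h$ has a structure of topological Hopf superalgebra (coproduct $\Delta:U_h\to U_h\hat\otimes U_h$ and counit $\epsilon$, which are superalgebra homomorphisms, and antipode $S$, a super-antihomomorphism)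 with $$\Delta(H)=H\otimes T^{-1}+T\otimes H+2hV_+T^{1/2}\otimes V_+T^{-1/2},\qquad \Delta(X)=X\otimes1+1\otimes X,$$ $$\Delta(Y)=Y\otimes T^{-1}+T\otimes Y+2hV_+T^{1/2}\otimes T^{-1/2}V_-+2hT^{1/2}V_-\otimes V_+T^{-1/2},$$ $$\Delta(V_\pm)=V_\pm\otimes T^{-1/2}+T^{1/2}\otimes V_\pm,\qquad \epsilon(H)=\epsilon(X)=\epsilon(Y)=\epsilon(V_\pm)=0,$$ $$S(H)=-H-2hV_+^2,\quad S(X)=-X,\quad S(Y)=-Y+hH+h^2V_+^2,\quad S(V_+)=-V_+,\quad S(V_-)=-V_-+\tfrac h2V_+ .$$ 3. The classical limit of this Hopf superalgebra is the bialgebra $osp(2/1)$ with $r$-matrix $r_2$. Explicitly, $r_2$ is super-skew-symmetric and satisfies the classical Yang–Baxter equation; the cocommutator is $$\delta(J_0)=-r_2,\quad \delta(J_+)=0,\quad \delta(J_-)=J_+\otimes J_--J_-\otimes J_++2v_+\otimes v_-+2v_-\otimes v_+,\quad \delta(v_\pm)=\tfrac12(J_+\otimes v_\pm-v_\pm\otimes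 J_+);$$ for each generator $g\in\{H,X,Y,V_\pm\}$ with image $\bar g$ modulo $h$, $\Delta(g)=g\otimes1+1\otimes g+hw$ with $w\equiv\delta(\bar g)$ modulo $h$; and for all $a\in U_h$, with $\Delta^{op}$ the coproduct followed by the super flip, $\Delta(a)-\Delta^{op}(a)=hw_a$ with $w_a\equiv2[r_2,\Delta(a)\bmod h]$ modulo $h$. 4. This Hopf superalgebra is triangular: there is an even invertible $R\in U_h\hat\otimes U_h$ with $R\,\Delta(a)=\Delta^{op}(a)\,R$ for all $a$, $(\Delta\otimes\mathrm{id})R=R_{13}R_{23}$, $(\mathrm{id}\otimes\Delta)R=R_{13}R_{12}$, $R_{21}R=1\otimes1$, and moreover $R=1\otimes1+hw$ with $w\equiv-2r_2$ modulo $h$. -/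

import Mathlib

open scoped TensorProduct DirectSum

noncomputable section

namespace SuperJordanian

/-! ### The `h`-adic completion of an algebra -/

section Completion

variable {K : Type*} [CommRing K] (h : K)

/-- The two-sided ideal `hⁿ A` of a `K`-algebra `A`. -/
def hPow (A : Type*) [Ring A] [Algebra K A] (n : ℕ) : Ideal A where
  carrier := {x | ∃ y : A, x = h ^ n • y}
  add_mem' := by
    rintro _ _ ⟨a, rfl⟩ ⟨b, rfl⟩
    exact ⟨a + b, (smul_add _ _ _).symm⟩
  zero_mem' := ⟨0, (smul_zero _).symm⟩
  smul_mem' := by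
    rintro c _ ⟨a, rfl⟩
    exact ⟨c * a, by rw [smul_eq_mul, mul_smul_comm]⟩

instance (A : Type*) [Ring A] [Algebra K A] (n : ℕ) : (hPow h A n).IsTwoSided where
  mul_mem_of_left := by
    rintro _ b ⟨a, rfl⟩
    exact ⟨a * b, by rw [smul_mul_assoc]⟩

theorem hPow_anti (A : Type*) [Ring A] [Algebra K A] {m n : ℕ} (hmn : m ≤ n) :
    hPow h A n ≤ hPow h A m := by
  rintro _ ⟨a, rfl⟩
  exact ⟨h ^ (n - m) • a, by rw [smul_smul, ← pow_add, Nat.add_sub_cancel' hmn]⟩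

/-- The inverse limit of the algebras `A / hⁿ A`, as a subalgebra of their product. -/
def complSubalgebra (A : Type*) [Ring A] [Algebra K A] :
    Subalgebra K (∀ n : ℕ, A ⧸ hPow h A n) where
  carrier := {f | ∀ (m n : ℕ) (hmn : m ≤ n), Ideal.Quotient.factor (hPow_anti h A hmn) (f n) = f m}
  mul_mem' := by
    intro f g hf hg m n hmn
    simp only [Pi.mul_apply, map_mul, hf m n hmn, hg m n hmn]
  add_mem' := by
    intro f g hf hg m n hmn
    simp only [Pi.add_apply, map_add, hf m n hmn, hg m n hmn]
  algebraMap_mem' := fun _ _ _ _ => rfl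

/-- The `h`-adic completion of the `K`-algebra `A`. -/
abbrev Compl (A : Type*) [Ring A] [Algebra K A] : Type _ := complSubalgebra h A

namespace Compl

variable {A B : Type*} [Ring A] [Algebra K A] [Ring B] [Algebra K B]

/-- The canonical map from an algebra to its completion. -/
def of : A →ₐ[K] Compl h A where
  toFun a := ⟨fun n => Ideal.Quotient.mk (hPow h A n) a, fun _ _ _ => rfl⟩
  map_one' := rfl
  map_mul' _ _ := rfl
  map_zero' := rfl
  map_add' _ _ := rfl
  commutes' _ := rfl

variable {h}

/-- The component modulo `hⁿ` of the extension of a linear map `A → Compl B`. -/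
def liftLevel (f : A →ₗ[K] Compl h B) (n : ℕ) : A ⧸ hPow h A n →ₗ[K] B ⧸ hPow h B n :=
  (Submodule.liftQ ((hPow h A n).restrictScalars K)
      (LinearMap.proj n ∘ₗ (complSubalgebra h B).val.toLinearMap ∘ₗ f) (by
        rintro _ ⟨a, rfl⟩
        rw [LinearMap.mem_ker, map_smul]
        generalize (LinearMap.proj n ∘ₗ (complSubalgebra h B).val.toLinearMap ∘ₗ f) a = z
        obtain ⟨b, rfl⟩ := Ideal.Quotient.mk_surjective z
        exact Ideal.Quotient.eq_zero_iff_mem.2 ⟨b, rfl⟩)) ∘ₗ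
    (Submodule.Quotient.restrictScalarsEquiv K (hPow h A n)).symm.toLinearMap

theorem liftLevel_mk (f : A →ₗ[K] Compl h B) (n : ℕ) (a : A) :
    liftLevel f n (Ideal.Quotient.mk _ a) = (f a).1 n := rfl

/-- The unique `h`-adically continuous extension `Compl A → Compl B` of a linear map
`A → Compl B`. -/
def lift (f : A →ₗ[K] Compl h B) : Compl h A →ₗ[K] Compl h B where
  toFun x := ⟨fun n => liftLevel f n (x.1 n), by
    intro m n hmn
    dsimp only
    rw [← x.2 m n hmn]
    obtain ⟨a, ha⟩ := Ideal.Quotient.mk_surjective (x.1 n)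
    rw [← ha, Ideal.Quotient.factor_mk, liftLevel_mk, liftLevel_mk]
    exact (f a).2 m n hmn⟩
  map_add' x y := Subtype.ext (funext fun n => map_add (liftLevel f n) (x.1 n) (y.1 n))
  map_smul' c x := Subtype.ext (funext fun n => map_smul (liftLevel f n) c (x.1 n))

theorem lift_of (f : A →ₗ[K] Compl h B) (a : A) : lift f (of h a) = f a := rfl

/-- The map of completions induced by a linear map. -/
def map (f : A →ₗ[K] B) : Compl h A →ₗ[K] Compl h B := lift ((of h).toLinearMap ∘ₗ f)

theorem map_of (f : A →ₗ[K] B) (a : A) : map f (of h a) = of h (f a) := rfl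

theorem liftLevel_add (f g : A →ₗ[K] Compl h B) (n : ℕ) (x : A ⧸ hPow h A n) :
    liftLevel (f + g) n x = liftLevel f n x + liftLevel g n x := by
  obtain ⟨a, rfl⟩ := Ideal.Quotient.mk_surjective x
  rfl

theorem liftLevel_smul (c : K) (f : A →ₗ[K] Compl h B) (n : ℕ) (x : A ⧸ hPow h A n) :
    liftLevel (c • f) n x = c • liftLevel f n x := by
  obtain ⟨a, rfl⟩ := Ideal.Quotient.mk_surjective x
  rfl

theorem map_add (f g : A →ₗ[K] B) (x : Compl h A) : map (f + g) x = map f x + map g x := by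
  refine Subtype.ext (funext fun n => ?_)
  exact liftLevel_add ((of h).toLinearMap ∘ₗ f) ((of h).toLinearMap ∘ₗ g) n (x.1 n)

theorem map_smul (c : K) (f : A →ₗ[K] B) (x : Compl h A) : map (c • f) x = c • map f x := by
  refine Subtype.ext (funext fun n => ?_)
  exact liftLevel_smul c ((of h).toLinearMap ∘ₗ f) n (x.1 n)

/-- A family of linear maps `A → B` depending linearly on a parameter `b` induces such a family of
maps between the completions. -/
def act {M : Type*} [AddCommGroup M] [Module K M] (β : M →ₗ[K] A →ₗ[K] B) :
    M →ₗ[K] Compl h A →ₗ[K] Compl h B where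
  toFun b := map (β b)
  map_add' b c := LinearMap.ext fun x => by rw [_root_.map_add, map_add, LinearMap.add_apply]
  map_smul' c b := LinearMap.ext fun x => by
    rw [_root_.map_smul, map_smul, RingHom.id_apply, LinearMap.smul_apply]

end Compl

end Completion

/-! ### Superalgebras: gradings and graded tensor products -/

section Grading

variable {K A B : Type*} [CommRing K] [Ring A] [Algebra K A] [Ring B] [Algebra K B]

/-- A family of complementary projections onto the submodules `𝒜 i` decomposes the module. -/
@[reducible]
def decompositionOfProj (𝒜 : ZMod 2 → Submodule K A) (P : ZMod 2 → A →ₗ[K] A)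
    (hP : ∀ i a, P i a ∈ 𝒜 i) (hsum : ∀ a, ∑ i, P i a = a)
    (hid : ∀ i j, ∀ a ∈ 𝒜 i, P j a = if i = j then a else 0) : DirectSum.Decomposition 𝒜 :=
  DirectSum.Decomposition.ofLinearMap 𝒜
    (∑ i, DirectSum.lof K (ZMod 2) (fun i => 𝒜 i) i ∘ₗ (P i).codRestrict (𝒜 i) (hP i))
    (by
      ext a
      simp [hsum])
    (by
      ext i ⟨a, ha⟩ : 2
      have key : ∀ j, (P j).codRestrict (𝒜 j) (hP j) a =
          if hij : i = j then hij ▸ ⟨a, ha⟩ else 0 := by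
        intro j
        split_ifs with hij
        · subst hij
          ext
          simp [hid i i a ha]
        · ext
          simp [hid i j a ha, hij]
      simp only [LinearMap.comp_apply, DirectSum.coeLinearMap_lof, LinearMap.sum_apply, key,
        LinearMap.id_apply]
      rw [Finset.sum_eq_single i]
      · simp
      · intro j _ hj
        simp [Ne.symm hj]
      · simp)

/-- The `ℤ/2`-grading defined by a parity automorphism `σ`: the even part is `{a | σ a = a}` and
the odd part is `{a | σ a = -a}`. -/
def parityGrading (σ : A →ₐ[K] A) (i : ZMod 2) : Submodule K A where
  carrier := {a | σ a = ((-1 : ℤˣ) ^ i) • a}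
  add_mem' := by
    intro a b ha hb
    simp only [Set.mem_ofPred_eq] at *
    rw [map_add, ha, hb, smul_add]
  zero_mem' := by simp
  smul_mem' := by
    intro c a ha
    simp only [Set.mem_ofPred_eq] at *
    rw [map_smul, ha, smul_comm]

theorem mem_parityGrading {σ : A →ₐ[K] A} {i : ZMod 2} {a : A} :
    a ∈ parityGrading σ i ↔ σ a = ((-1 : ℤˣ) ^ i) • a := Iff.rfl

/-- A parity automorphism of order two makes an algebra over a ring containing `1/2` into a
superalgebra. -/
@[reducible]
def parityGradedAlgebra [Invertible (2 : K)] (σ : A →ₐ[K] A) (hσ : ∀ a, σ (σ a) = a) :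
    GradedAlgebra (parityGrading σ) where
  one_mem := by simp [mem_parityGrading]
  mul_mem := by
    intro i j a b ha hb
    rw [mem_parityGrading] at *
    rw [map_mul, ha, hb, uzpow_add, smul_mul_smul_comm]
  toDecomposition := decompositionOfProj (parityGrading σ)
    (fun i => (⅟2 : K) • (LinearMap.id + ((-1 : ℤˣ) ^ i) • σ.toLinearMap))
    (by
      intro i a
      have hi : ((-1 : ℤˣ) ^ i) * ((-1 : ℤˣ) ^ i) = 1 := Int.units_mul_self _
      simp only [mem_parityGrading, LinearMap.smul_apply, LinearMap.add_apply, LinearMap.id_apply,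
        AlgHom.toLinearMap_apply, map_smul, map_add]
      rw [smul_comm]
      congr 1
      rw [smul_add, smul_smul, hi, one_smul, add_comm, Units.smul_def, map_zsmul, hσ,
        ← Units.smul_def])
    (by
      intro a
      have : (Finset.univ : Finset (ZMod 2)) = {0, 1} := rfl
      rw [this, Finset.sum_pair (by decide)]
      simp only [LinearMap.smul_apply, LinearMap.add_apply, LinearMap.id_apply,
        AlgHom.toLinearMap_apply, uzpow_zero, one_smul, uzpow_one, Units.neg_smul,
        LinearMap.neg_apply]
      rw [← smul_add, ← sub_eq_add_neg, add_add_sub_cancel, ← two_smul K a, smul_smul,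
        invOf_mul_self, one_smul])
    (by
      intro i j a ha
      rw [mem_parityGrading] at ha
      simp only [LinearMap.smul_apply, LinearMap.add_apply, LinearMap.id_apply,
        AlgHom.toLinearMap_apply, ha, smul_smul, ← uzpow_add]
      have : i + j = if i = j then 0 else 1 := by
        clear ha
        revert i j
        decide
      rw [add_comm j i, this]
      split_ifs
      · rw [uzpow_zero, one_smul, ← two_smul K a, smul_smul, invOf_mul_self, one_smul]
      · rw [uzpow_one, Units.neg_smul, one_smul, add_neg_cancel, smul_zero])

/-- The `ℤ/2`-grading of a graded tensor product: the part of degree `i` is spanned by the tensors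
`a ⊗ b` with `a`, `b` homogeneous and `|a| + |b| = i`. -/
def tensorGrading (𝒜 : ZMod 2 → Submodule K A) (ℬ : ZMod 2 → Submodule K B)
    [GradedAlgebra 𝒜] [GradedAlgebra ℬ] (i : ZMod 2) : Submodule K (𝒜 ᵍ⊗[K] ℬ) :=
  Submodule.span K {z | ∃ j l, j + l = i ∧ ∃ a ∈ 𝒜 j, ∃ b ∈ ℬ l, z = a ᵍ⊗ₜ[K] b}

section TensorGrading

variable (𝒜 : ZMod 2 → Submodule K A) (ℬ : ZMod 2 → Submodule K B)
  [GradedAlgebra 𝒜] [GradedAlgebra ℬ]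

theorem sum_proj (a : A) : ∑ j, GradedAlgebra.proj 𝒜 j a = a := by
  classical
  simp only [GradedAlgebra.proj_apply]
  conv_rhs => rw [← DirectSum.sum_support_decompose 𝒜 a]
  refine (Finset.sum_subset (Finset.subset_univ _) fun i _ hi => ?_).symm
  simpa using hi

/-- The projection of a graded tensor product onto its part of degree `i`. -/
def tensorProj (i : ZMod 2) : 𝒜 ᵍ⊗[K] ℬ →ₗ[K] 𝒜 ᵍ⊗[K] ℬ :=
  (GradedTensorProduct.of K 𝒜 ℬ).toLinearMap ∘ₗ
    (∑ j, TensorProduct.map (GradedAlgebra.proj 𝒜 j) (GradedAlgebra.proj ℬ (i - j))) ∘ₗ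
    (GradedTensorProduct.of K 𝒜 ℬ).symm.toLinearMap

theorem tensorProj_tmul (i : ZMod 2) (a : A) (b : B) :
    tensorProj 𝒜 ℬ i (a ᵍ⊗ₜ[K] b) =
      ∑ j, (GradedAlgebra.proj 𝒜 j a) ᵍ⊗ₜ[K] (GradedAlgebra.proj ℬ (i - j) b) := by
  simp [tensorProj]

theorem tensor_induction {p : 𝒜 ᵍ⊗[K] ℬ → Prop} (h0 : p 0)
    (ht : ∀ a b, p (a ᵍ⊗ₜ[K] b)) (ha : ∀ x y, p x → p y → p (x + y)) (z : 𝒜 ᵍ⊗[K] ℬ) : p z :=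
  TensorProduct.induction_on (motive := p) z h0 ht ha

instance tensorGradedAlgebra : GradedAlgebra (tensorGrading 𝒜 ℬ) where
  one_mem := Submodule.subset_span
    ⟨0, 0, add_zero 0, 1, SetLike.one_mem_graded 𝒜, 1, SetLike.one_mem_graded ℬ, rfl⟩
  mul_mem := by
    intro i j x y hx hy
    induction hx using Submodule.span_induction with
    | zero =>
      rw [zero_mul]
      exact zero_mem _
    | add x x' _ _ h h' =>
      rw [add_mul]
      exact add_mem h h'
    | smul c x _ h =>
      rw [smul_mul_assoc]
      exact Submodule.smul_mem _ _ h
    | mem x hx =>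
      induction hy using Submodule.span_induction with
      | zero =>
        rw [mul_zero]
        exact zero_mem _
      | add x x' _ _ h h' =>
        rw [mul_add]
        exact add_mem h h'
      | smul c x _ h =>
        rw [mul_smul_comm]
        exact Submodule.smul_mem _ _ h
      | mem y hy =>
        obtain ⟨j₁, l₁, h₁, a₁, ha₁, b₁, hb₁, rfl⟩ := hx
        obtain ⟨j₂, l₂, h₂, a₂, ha₂, b₂, hb₂, rfl⟩ := hy
        have := GradedTensorProduct.tmul_coe_mul_coe_tmul 𝒜 ℬ a₁ ⟨b₁, hb₁⟩ ⟨a₂, ha₂⟩ b₂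
        rw [this, Units.smul_def]
        refine zsmul_mem (Submodule.subset_span ?_) _
        refine ⟨j₁ + j₂, l₁ + l₂, ?_, _, SetLike.mul_mem_graded ha₁ ha₂, _,
          SetLike.mul_mem_graded hb₁ hb₂, rfl⟩
        rw [← h₁, ← h₂]
        abel
  toDecomposition := decompositionOfProj (tensorGrading 𝒜 ℬ) (tensorProj 𝒜 ℬ)
    (by
      intro i z
      induction z using tensor_induction with
      | h0 =>
        rw [map_zero]
        exact zero_mem _
      | ha x y hx hy =>
        rw [map_add]
        exact add_mem hx hy
      | ht a b =>
        rw [tensorProj_tmul]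
        refine sum_mem fun j _ => Submodule.subset_span ?_
        exact ⟨j, i - j, by abel, _, SetLike.coe_mem _, _, SetLike.coe_mem _, rfl⟩)
    (by
      intro z
      induction z using tensor_induction with
      | h0 => simp
      | ha x y hx hy =>
        simp only [map_add, Finset.sum_add_distrib, hx, hy]
      | ht a b =>
        simp only [tensorProj_tmul]
        rw [Finset.sum_comm]
        have hb : ∀ j, ∑ i, GradedAlgebra.proj ℬ (i - j) b = b := by
          intro j
          refine ((Equiv.subRight j).sum_comp (fun i => GradedAlgebra.proj ℬ i b)).trans ?_
          exact sum_proj ℬ b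
        have ha : ∑ j, GradedAlgebra.proj 𝒜 j a = a := sum_proj 𝒜 a
        simp only [GradedTensorProduct.tmul, ← map_sum, ← TensorProduct.tmul_sum,
          ← TensorProduct.sum_tmul, hb, ha])
    (by
      intro i j z hz
      induction hz using Submodule.span_induction with
      | zero => simp
      | add x y _ _ hx hy =>
        rw [map_add, hx, hy]
        split_ifs <;> simp
      | smul c x _ hx =>
        rw [map_smul, hx]
        split_ifs <;> simp
      | mem x hx =>
        obtain ⟨m, l, rfl, a, ha, b, hb, rfl⟩ := hx
        rw [tensorProj_tmul]
        have pa : ∀ n, GradedAlgebra.proj 𝒜 n a = if m = n then a else 0 := by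
          intro n
          rw [GradedAlgebra.proj_apply, DirectSum.decompose_of_mem 𝒜 ha, DirectSum.coe_of_apply]
          split_ifs <;> rfl
        have pb : ∀ n, GradedAlgebra.proj ℬ n b = if l = n then b else 0 := by
          intro n
          rw [GradedAlgebra.proj_apply, DirectSum.decompose_of_mem ℬ hb, DirectSum.coe_of_apply]
          split_ifs <;> rfl
        rw [Finset.sum_eq_single m]
        · rw [pa, pb, if_pos rfl]
          have : l = j - m ↔ m + l = j := by
            rw [eq_sub_iff_add_eq, add_comm]
          simp only [this]
          split_ifs <;> simp [GradedTensorProduct.tmul]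
        · intro n _ hn
          rw [pa, if_neg (Ne.symm hn)]
          simp [GradedTensorProduct.tmul]
        · simp)

end TensorGrading

end Grading
/-! ### Topological Hopf superalgebras and triangular structures -/

section Hopf

variable {K A : Type*} [CommRing K] [Ring A] [Algebra K A]

/-- The super tensor square `A ⊗ A`, with `(a ⊗ b)(a' ⊗ b') = (-1)^{|b||a'|} aa' ⊗ bb'`. -/
abbrev T2 (𝒜 : ZMod 2 → Submodule K A) [GradedAlgebra 𝒜] : Type _ := 𝒜 ᵍ⊗[K] 𝒜

/-- The super tensor cube `(A ⊗ A) ⊗ A`. -/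
abbrev T3 (𝒜 : ZMod 2 → Submodule K A) [GradedAlgebra 𝒜] : Type _ := tensorGrading 𝒜 𝒜 ᵍ⊗[K] 𝒜

section Maps

variable (𝒜 : ZMod 2 → Submodule K A) [GradedAlgebra 𝒜]

/-- `b ↦ (z ↦ z ⊗ b)`, for `z` in the tensor square. -/
def snocTensor : A →ₗ[K] T2 𝒜 →ₗ[K] T3 𝒜 :=
  (TensorProduct.mk K (T2 𝒜) A).flip.compr₂ (GradedTensorProduct.of K (tensorGrading 𝒜 𝒜) 𝒜)

/-- `a ↦ (x ⊗ y ↦ (a ⊗ x) ⊗ y)`. -/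
def consTensor : A →ₗ[K] T2 𝒜 →ₗ[K] T3 𝒜 :=
  ((TensorProduct.mk K A (A ⊗[K] A)).compl₂ (GradedTensorProduct.of K 𝒜 𝒜).symm.toLinearMap).compr₂
    ((GradedTensorProduct.of K (tensorGrading 𝒜 𝒜) 𝒜).toLinearMap ∘ₗ
      TensorProduct.map (GradedTensorProduct.of K 𝒜 𝒜).toLinearMap LinearMap.id ∘ₗ
      (TensorProduct.assoc K A A A).symm.toLinearMap)

theorem snocTensor_tmul (a b c : A) :
    snocTensor 𝒜 c (a ᵍ⊗ₜ[K] b) = (a ᵍ⊗ₜ[K] b : T2 𝒜) ᵍ⊗ₜ[K] c := rfl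

theorem consTensor_tmul (a b c : A) :
    consTensor 𝒜 a (b ᵍ⊗ₜ[K] c) = (a ᵍ⊗ₜ[K] b : T2 𝒜) ᵍ⊗ₜ[K] c := rfl

/-- `z ↦ z₁₂`, that is, `a ⊗ b ↦ a ⊗ b ⊗ 1`. -/
def leg12 : T2 𝒜 →ₗ[K] T3 𝒜 := snocTensor 𝒜 1

/-- `z ↦ z₂₃`, that is, `a ⊗ b ↦ 1 ⊗ a ⊗ b`. -/
def leg23 : T2 𝒜 →ₗ[K] T3 𝒜 := consTensor 𝒜 1

/-- `z ↦ z₁₃`, that is, `a ⊗ b ↦ a ⊗ 1 ⊗ b`. -/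
def leg13 : T2 𝒜 →ₗ[K] T3 𝒜 :=
  (GradedTensorProduct.of K (tensorGrading 𝒜 𝒜) 𝒜).toLinearMap ∘ₗ
    TensorProduct.map (GradedTensorProduct.includeLeft 𝒜 𝒜).toLinearMap LinearMap.id ∘ₗ
    (GradedTensorProduct.of K 𝒜 𝒜).symm.toLinearMap

theorem leg13_tmul (a b : A) :
    leg13 𝒜 (a ᵍ⊗ₜ[K] b) = (a ᵍ⊗ₜ[K] 1 : T2 𝒜) ᵍ⊗ₜ[K] b := rfl

/-- The super flip `a ⊗ b ↦ (-1)^{|a||b|} b ⊗ a`. -/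
def superFlip : T2 𝒜 →ₗ[K] T2 𝒜 := (GradedTensorProduct.comm 𝒜 𝒜).toLinearMap

/-- `a ⊗ b ↦ f a * g b`. -/
def mulMap (f g : A →ₗ[K] A) : T2 𝒜 →ₗ[K] A :=
  LinearMap.mul' K A ∘ₗ TensorProduct.map f g ∘ₗ (GradedTensorProduct.of K 𝒜 𝒜).symm.toLinearMap

/-- `a ⊗ b ↦ f a * b`, for a linear functional `f`. -/
def functionalLeft (f : A →ₗ[K] K) : T2 𝒜 →ₗ[K] A := mulMap 𝒜 (Algebra.linearMap K A ∘ₗ f) .id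

/-- `a ⊗ b ↦ a * f b`, for a linear functional `f`. -/
def functionalRight (f : A →ₗ[K] K) : T2 𝒜 →ₗ[K] A := mulMap 𝒜 .id (Algebra.linearMap K A ∘ₗ f)

variable {𝒜} {h : K}

/-- `f ⊗ id`, extended to the completed tensor square. -/
def applyLeft (f : A →ₗ[K] Compl h (T2 𝒜)) : Compl h (T2 𝒜) →ₗ[K] Compl h (T3 𝒜) :=
  Compl.lift (TensorProduct.lift ((Compl.act (h := h) (snocTensor 𝒜)).flip ∘ₗ f) ∘ₗ
    (GradedTensorProduct.of K 𝒜 𝒜).symm.toLinearMap)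

/-- `id ⊗ f`, extended to the completed tensor square. -/
def applyRight (f : A →ₗ[K] Compl h (T2 𝒜)) : Compl h (T2 𝒜) →ₗ[K] Compl h (T3 𝒜) :=
  Compl.lift (TensorProduct.lift ((Compl.act (h := h) (consTensor 𝒜)).compl₂ f) ∘ₗ
    (GradedTensorProduct.of K 𝒜 𝒜).symm.toLinearMap)

theorem applyLeft_tmul (f : A →ₗ[K] Compl h (T2 𝒜)) (a b : A) :
    applyLeft f (Compl.of h (a ᵍ⊗ₜ[K] b)) = Compl.map (snocTensor 𝒜 b) (f a) := rfl

theorem applyRight_tmul (f : A →ₗ[K] Compl h (T2 𝒜)) (a b : A) :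
    applyRight f (Compl.of h (a ᵍ⊗ₜ[K] b)) = Compl.map (consTensor 𝒜 a) (f b) := rfl

/-- An element of the completed tensor square is homogeneous of degree `i`. -/
def IsHomog (i : ZMod 2) (z : Compl h (T2 𝒜)) : Prop :=
  ∀ n, ∃ t ∈ tensorGrading 𝒜 𝒜 i, z.1 n = Ideal.Quotient.mk _ t

end Maps

/-- The structure of a topological Hopf superalgebra on a `K`-superalgebra `A`, with respect to the
`h`-adic topology: the coproduct takes values in the completed super tensor square.  All structure
maps are `K`-linear, hence `h`-adically continuous.  (For `K` and `A` complete and separated in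
the `h`-adic topology.) -/
structure HopfSuperalgebra (h : K) (𝒜 : ZMod 2 → Submodule K A) [GradedAlgebra 𝒜] where
  /-- the coproduct -/
  comul : A →ₐ[K] Compl h (T2 𝒜)
  /-- the counit -/
  counit : A →ₐ[K] K
  /-- the antipode -/
  antipode : A →ₗ[K] A
  comul_even : ∀ i, ∀ a ∈ 𝒜 i, IsHomog i (comul a)
  counit_even : ∀ a ∈ 𝒜 1, counit a = 0
  antipode_even : ∀ i, ∀ a ∈ 𝒜 i, antipode a ∈ 𝒜 i
  coassoc : ∀ a, applyLeft comul.toLinearMap (comul a) = applyRight comul.toLinearMap (comul a)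
  counit_left : ∀ a, Compl.map (functionalLeft 𝒜 counit.toLinearMap) (comul a) = Compl.of h a
  counit_right : ∀ a, Compl.map (functionalRight 𝒜 counit.toLinearMap) (comul a) = Compl.of h a
  antipode_left : ∀ a, Compl.map (mulMap 𝒜 antipode .id) (comul a) =
    Compl.of h (algebraMap K A (counit a))
  antipode_right : ∀ a, Compl.map (mulMap 𝒜 .id antipode) (comul a) =
    Compl.of h (algebraMap K A (counit a))

namespace HopfSuperalgebra

variable {h : K} {𝒜 : ZMod 2 → Submodule K A} [GradedAlgebra 𝒜] (𝓗 : HopfSuperalgebra h 𝒜)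

/-- The opposite coproduct, that is, the coproduct followed by the super flip. -/
def comulOp : A →ₗ[K] Compl h (T2 𝒜) := Compl.map (superFlip 𝒜) ∘ₗ 𝓗.comul.toLinearMap

/-- `R` is a universal `R`-matrix: an even invertible element with `R Δ(a) = Δᵒᵖ(a) R`,
`(Δ ⊗ id) R = R₁₃ R₂₃` and `(id ⊗ Δ) R = R₁₃ R₁₂`. -/
structure IsQuasitriangular (R : Compl h (T2 𝒜)) : Prop where
  even : IsHomog 0 R
  isUnit : IsUnit R
  intertwines : ∀ a, R * 𝓗.comul a = 𝓗.comulOp a * R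
  comul_left : applyLeft 𝓗.comul.toLinearMap R =
    Compl.map (leg13 𝒜) R * Compl.map (leg23 𝒜) R
  comul_right : applyRight 𝓗.comul.toLinearMap R =
    Compl.map (leg13 𝒜) R * Compl.map (leg12 𝒜) R

/-- `R` is a triangular structure: a universal `R`-matrix with `R₂₁ R = 1`. -/
structure IsTriangular (R : Compl h (T2 𝒜)) : Prop extends 𝓗.IsQuasitriangular R where
  unitary : Compl.map (superFlip 𝒜) R * R = 1

end HopfSuperalgebra

end Hopf
/-! ### The superalgebras `U(osp(2/1))` and `U_h(osp(2/1))` -/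

open scoped PowerSeries Nat

/-- Names of the generators; `Vp` and `Vm` stand for `V₊` and `V₋`.  In the classical algebra
they are `J₀`, `J₊`, `J₋`, `v₊`, `v₋`. -/
inductive Gen
  | H | X | Y | Vp | Vm

section Algebras

variable (k : Type*) [Field k]

/-- The parity automorphism of the free algebra: `H, X, Y` are even and `V₊, V₋` are odd. -/
def freeParity : FreeAlgebra k Gen →ₐ[k] FreeAlgebra k Gen :=
  FreeAlgebra.lift k fun g => match g with
    | .H => FreeAlgebra.ι k .H
    | .X => FreeAlgebra.ι k .X
    | .Y => FreeAlgebra.ι k .Y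
    | .Vp => -FreeAlgebra.ι k .Vp
    | .Vm => -FreeAlgebra.ι k .Vm

@[simp] theorem freeParity_H : freeParity k (.ι k .H) = .ι k .H := FreeAlgebra.lift_ι_apply _ _
@[simp] theorem freeParity_X : freeParity k (.ι k .X) = .ι k .X := FreeAlgebra.lift_ι_apply _ _
@[simp] theorem freeParity_Y : freeParity k (.ι k .Y) = .ι k .Y := FreeAlgebra.lift_ι_apply _ _
@[simp] theorem freeParity_Vp : freeParity k (.ι k .Vp) = -.ι k .Vp := FreeAlgebra.lift_ι_apply _ _
@[simp] theorem freeParity_Vm : freeParity k (.ι k .Vm) = -.ι k .Vm := FreeAlgebra.lift_ι_apply _ _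

theorem freeParity_freeParity (x : FreeAlgebra k Gen) : freeParity k (freeParity k x) = x := by
  have : (freeParity k).comp (freeParity k) = AlgHom.id k _ := by
    ext g
    cases g <;> simp
  exact DFunLike.congr_fun this x

/-! #### The classical superalgebra -/

section Classical

local notation "J₀" => FreeAlgebra.ι k Gen.H
local notation "J₊" => FreeAlgebra.ι k Gen.X
local notation "J₋" => FreeAlgebra.ι k Gen.Y
local notation "v₊" => FreeAlgebra.ι k Gen.Vp
local notation "v₋" => FreeAlgebra.ι k Gen.Vm

/-- The defining relations of `osp(2/1)`. -/
inductive ClassicalRel : FreeAlgebra k Gen → FreeAlgebra k Gen → Prop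
  | J0_vp : ClassicalRel (J₀ * v₊ - v₊ * J₀) ((1 / 2 : k) • v₊)
  | J0_vm : ClassicalRel (J₀ * v₋ - v₋ * J₀) (-(1 / 2 : k) • v₋)
  | vp_vm : ClassicalRel (v₊ * v₋ + v₋ * v₊) (-(1 / 2 : k) • J₀)
  | J0_Jp : ClassicalRel (J₀ * J₊ - J₊ * J₀) J₊
  | J0_Jm : ClassicalRel (J₀ * J₋ - J₋ * J₀) (-J₋)
  | Jp_Jm : ClassicalRel (J₊ * J₋ - J₋ * J₊) ((2 : k) • J₀)
  | Jp_eq : ClassicalRel J₊ ((4 : k) • (v₊ * v₊))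
  | Jm_eq : ClassicalRel J₋ (-(4 : k) • (v₋ * v₋))
  | Jp_vp : ClassicalRel (J₊ * v₊ - v₊ * J₊) 0
  | Jm_vm : ClassicalRel (J₋ * v₋ - v₋ * J₋) 0
  | Jp_vm : ClassicalRel (J₊ * v₋ - v₋ * J₊) v₊
  | Jm_vp : ClassicalRel (J₋ * v₊ - v₊ * J₋) v₋

end Classical

/-- The two-sided ideal generated by the relations of `osp(2/1)`. -/
def classicalIdeal : TwoSidedIdeal (FreeAlgebra k Gen) :=
  TwoSidedIdeal.span {x | ∃ a b, ClassicalRel k a b ∧ x = a - b}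

/-- The universal enveloping superalgebra `U(osp(2/1))`. -/
def U0 : Type _ := FreeAlgebra k Gen ⧸ (classicalIdeal k).asIdeal

namespace U0

instance : Ring (U0 k) := inferInstanceAs (Ring (FreeAlgebra k Gen ⧸ (classicalIdeal k).asIdeal))

instance : Algebra k (U0 k) :=
  inferInstanceAs (Algebra k (FreeAlgebra k Gen ⧸ (classicalIdeal k).asIdeal))

/-- The quotient map from the free algebra. -/
def mk : FreeAlgebra k Gen →ₐ[k] U0 k := Ideal.Quotient.mkₐ k (classicalIdeal k).asIdeal

theorem mk_surjective : Function.Surjective (mk k) := Ideal.Quotient.mk_surjective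

theorem mk_eq_zero {x : FreeAlgebra k Gen} : mk k x = 0 ↔ x ∈ classicalIdeal k :=
  Ideal.Quotient.eq_zero_iff_mem

variable {k} in
theorem mk_rel {a b : FreeAlgebra k Gen} (hab : ClassicalRel k a b) : mk k a = mk k b := by
  rw [← sub_eq_zero, ← map_sub, mk_eq_zero]
  exact TwoSidedIdeal.subset_span ⟨a, b, hab, rfl⟩

/-- The generators `J₀`, `J₊`, `J₋`, `v₊`, `v₋`. -/
def gen (g : Gen) : U0 k := mk k (FreeAlgebra.ι k g)

/-- The parity automorphism. -/
def parity : U0 k →ₐ[k] U0 k :=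
  Ideal.Quotient.liftₐ (classicalIdeal k).asIdeal ((mk k).comp (freeParity k)) (by
    intro x hx
    have : classicalIdeal k ≤ TwoSidedIdeal.comap (freeParity k) (classicalIdeal k) := by
      refine TwoSidedIdeal.span_le.2 ?_
      rintro _ ⟨a, b, hab, rfl⟩
      rw [SetLike.mem_coe, TwoSidedIdeal.mem_comap, ← mk_eq_zero, map_sub, map_sub]
      have e := sub_eq_zero.2 (mk_rel hab)
      cases hab <;>
        simp only [map_add, map_sub, map_mul, map_smul, map_neg, map_zero, freeParity_H,
          freeParity_X, freeParity_Y, freeParity_Vp, freeParity_Vm, neg_mul, mul_neg, neg_neg,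
          smul_neg, neg_smul] at e ⊢ <;>
        first
          | exact e
          | (refine neg_eq_zero.1 (Eq.trans ?_ e); abel1)
    exact (mk_eq_zero k).2 ((TwoSidedIdeal.mem_comap _).1 (this hx)))

theorem parity_mk (x : FreeAlgebra k Gen) : parity k (mk k x) = mk k (freeParity k x) := rfl

theorem parity_parity (u : U0 k) : parity k (parity k u) = u := by
  obtain ⟨x, rfl⟩ := mk_surjective k u
  rw [parity_mk, parity_mk, freeParity_freeParity]

/-- The `ℤ/2`-grading of `U(osp(2/1))`. -/
def grading : ZMod 2 → Submodule k (U0 k) := parityGrading (parity k)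

variable [CharZero k]

instance : GradedAlgebra (grading k) :=
  letI : Invertible (2 : k) := invertibleOfNonzero two_ne_zero
  parityGradedAlgebra (parity k) (parity_parity k)

/-- `x ∧ y = x ⊗ y - (-1)^{|x||y|} y ⊗ x`. -/
def wedge (x y : U0 k) : T2 (grading k) :=
  x ᵍ⊗ₜ[k] y - superFlip (grading k) (x ᵍ⊗ₜ[k] y)

/-- The classical `r`-matrix `r₂ = J₀ ∧ J₊ - v₊ ∧ v₊`. -/
def rMatrix : T2 (grading k) :=
  wedge k (gen k .H) (gen k .X) - wedge k (gen k .Vp) (gen k .Vp)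

/-- `x ⊗ 1 + 1 ⊗ x`. -/
def primitive (x : U0 k) : T2 (grading k) := x ᵍ⊗ₜ[k] 1 + 1 ᵍ⊗ₜ[k] x

/-- The cocommutator `δ(x) = [r₂, x ⊗ 1 + 1 ⊗ x]` (the tensor `r₂` being even, this is an ordinary
commutator), for `x` in the span of the generators. -/
def cocommutator (x : U0 k) : T2 (grading k) :=
  rMatrix k * primitive k x - primitive k x * rMatrix k

/-- The classical Yang-Baxter equation
`[r₁₂, r₁₃] + [r₁₂, r₂₃] + [r₁₃, r₂₃] = 0` (for an even tensor `r`). -/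
def CYBE (r : T2 (grading k)) : Prop :=
  (leg12 (grading k) r * leg13 (grading k) r - leg13 (grading k) r * leg12 (grading k) r) +
  (leg12 (grading k) r * leg23 (grading k) r - leg23 (grading k) r * leg12 (grading k) r) +
  (leg13 (grading k) r * leg23 (grading k) r - leg23 (grading k) r * leg13 (grading k) r) = 0

end U0

/-! #### The quantum superalgebra -/

/-- The `h`-adically completed free algebra over `k⟦h⟧` on the generators: formal power series in a
central variable `h` with coefficients in the free algebra over `k`. -/
abbrev FreeSer : Type _ := PowerSeries (FreeAlgebra k Gen)

instance : Algebra k⟦X⟧ (FreeSer k) :=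
  (PowerSeries.map (algebraMap k (FreeAlgebra k Gen))).toAlgebra' (by
    intro c x
    ext n
    rw [PowerSeries.coeff_mul, PowerSeries.coeff_mul, ← Finset.Nat.sum_antidiagonal_swap]
    refine Finset.sum_congr rfl fun p _ => ?_
    rw [PowerSeries.coeff_map]
    exact Algebra.commutes _ _)

/-- The deformation parameter `h`. -/
abbrev hbar : k⟦X⟧ := PowerSeries.X

variable {k} in
/-- `exp (c h x)`. -/
def expSer (c : k) (x : FreeAlgebra k Gen) : FreeSer k :=
  PowerSeries.mk fun n => (c ^ n / (n ! : k)) • x ^ n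

variable {k} in
/-- `cosh (h x)`. -/
def coshSer (x : FreeAlgebra k Gen) : FreeSer k := (1 / 2 : k) • (expSer 1 x + expSer (-1) x)

variable {k} in
/-- `sinh (h x)`. -/
def sinhSer (x : FreeAlgebra k Gen) : FreeSer k := (1 / 2 : k) • (expSer 1 x - expSer (-1) x)

variable {k} in
/-- `(1 / h) sinh (h x)`. -/
def sinhDivSer (x : FreeAlgebra k Gen) : FreeSer k :=
  PowerSeries.mk fun n => PowerSeries.coeff (n + 1) (sinhSer x)

variable {k} in
theorem X_mul_sinhDivSer (x : FreeAlgebra k Gen) : PowerSeries.X * sinhDivSer x = sinhSer x := by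
  ext n
  cases n with
  | zero => simp [sinhSer, expSer]
  | succ n => simp [PowerSeries.coeff_succ_X_mul, sinhDivSer]

section Quantum

local notation "H" => (PowerSeries.C (FreeAlgebra.ι k Gen.H) : FreeSer k)
local notation "X" => (PowerSeries.C (FreeAlgebra.ι k Gen.X) : FreeSer k)
local notation "Y" => (PowerSeries.C (FreeAlgebra.ι k Gen.Y) : FreeSer k)
local notation "V₊" => (PowerSeries.C (FreeAlgebra.ι k Gen.Vp) : FreeSer k)
local notation "V₋" => (PowerSeries.C (FreeAlgebra.ι k Gen.Vm) : FreeSer k)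
local notation "ch" => coshSer (FreeAlgebra.ι k Gen.X)
local notation "sh" => sinhSer (FreeAlgebra.ι k Gen.X)
local notation "shDiv" => sinhDivSer (FreeAlgebra.ι k Gen.X)
local notation "h" => (PowerSeries.X : FreeSer k)

/-- The defining relations of `U_h(osp(2/1))`. -/
inductive QuantumRel : FreeSer k → FreeSer k → Prop
  | H_Vp : QuantumRel (H * V₊ - V₊ * H) ((1 / 2 : k) • (V₊ * ch))
  | H_Vm : QuantumRel (H * V₋ - V₋ * H) (-(1 / 4 : k) • (V₋ * ch) - (1 / 4 : k) • (ch * V₋))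
  | Vp_Vm : QuantumRel (V₊ * V₋ + V₋ * V₊) (-(1 / 2 : k) • H)
  | H_X : QuantumRel (H * X - X * H) shDiv
  | H_Y : QuantumRel (H * Y - Y * H) (-(1 / 2 : k) • (Y * ch) - (1 / 2 : k) • (ch * Y)
      + h * V₋ * sh * V₊ - h * V₊ * sh * V₋)
  | X_Y : QuantumRel (X * Y - Y * X) ((2 : k) • H)
  | Vp_sq : QuantumRel (V₊ * V₊) ((1 / 4 : k) • shDiv)
  | Vm_sq : QuantumRel (V₋ * V₋) (-(1 / 4 : k) • Y)
  | X_Vp : QuantumRel (X * V₊ - V₊ * X) 0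
  | Y_Vm : QuantumRel (Y * V₋ - V₋ * Y) 0
  | X_Vm : QuantumRel (X * V₋ - V₋ * X) V₊
  | Y_Vp : QuantumRel (Y * V₊ - V₊ * Y) ((1 / 2 : k) • (V₋ * ch) + (1 / 2 : k) • (ch * V₋))

end Quantum

/-- The closure, in the `h`-adic topology, of the two-sided ideal generated by the relations:
the intersection over `n` of the two-sided ideals generated by the relations and `hⁿ`. -/
def quantumIdeal : TwoSidedIdeal (FreeSer k) :=
  ⨅ n : ℕ, TwoSidedIdeal.span
    ({x | ∃ a b, QuantumRel k a b ∧ x = a - b} ∪ {(PowerSeries.X : FreeSer k) ^ n})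

/-- The quantum superalgebra `U_h(osp(2/1))`: the `k⟦h⟧`-algebra topologically generated by
`H, X, Y, V₊, V₋` subject to the relations. -/
def Uh : Type _ := FreeSer k ⧸ (quantumIdeal k).asIdeal

namespace Uh

instance : Ring (Uh k) := inferInstanceAs (Ring (FreeSer k ⧸ (quantumIdeal k).asIdeal))

instance : Algebra k⟦X⟧ (Uh k) :=
  inferInstanceAs (Algebra k⟦X⟧ (FreeSer k ⧸ (quantumIdeal k).asIdeal))

/-- The quotient map from the completed free algebra. -/
def mk : FreeSer k →ₐ[k⟦X⟧] Uh k := Ideal.Quotient.mkₐ k⟦X⟧ (quantumIdeal k).asIdeal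

theorem mk_surjective : Function.Surjective (mk k) := Ideal.Quotient.mk_surjective

theorem mk_eq_zero {x : FreeSer k} : mk k x = 0 ↔ x ∈ quantumIdeal k :=
  Ideal.Quotient.eq_zero_iff_mem

theorem mem_quantumIdeal {x : FreeSer k} : x ∈ quantumIdeal k ↔ ∀ n : ℕ, x ∈ TwoSidedIdeal.span
    ({x | ∃ a b, QuantumRel k a b ∧ x = a - b} ∪ {(PowerSeries.X : FreeSer k) ^ n}) := by
  rw [quantumIdeal, TwoSidedIdeal.mem_iInf]

/-- The generators `H`, `X`, `Y`, `V₊`, `V₋`. -/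
def gen (g : Gen) : Uh k := mk k (PowerSeries.C (FreeAlgebra.ι k g))

/-- The generator `H`. -/
abbrev H : Uh k := gen k .H
/-- The generator `X`. -/
abbrev X : Uh k := gen k .X
/-- The generator `Y`. -/
abbrev Y : Uh k := gen k .Y
/-- The generator `V₊`. -/
abbrev Vp : Uh k := gen k .Vp
/-- The generator `V₋`. -/
abbrev Vm : Uh k := gen k .Vm

/-- `T ^ c = exp (c h X)`, where `T = exp (h X)`. -/
def Tpow (c : k) : Uh k := mk k (expSer c (FreeAlgebra.ι k Gen.X))

theorem smul_def (c : k⟦X⟧) (x : FreeSer k) :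
    c • x = PowerSeries.map (algebraMap k (FreeAlgebra k Gen)) c * x := rfl

/-- The parity automorphism of the completed free algebra. -/
def serParity : FreeSer k →ₐ[k⟦X⟧] FreeSer k where
  __ := PowerSeries.map (freeParity k : FreeAlgebra k Gen →+* FreeAlgebra k Gen)
  commutes' c := by
    ext n
    exact (freeParity k).commutes (PowerSeries.coeff n c)

theorem coeff_serParity (n : ℕ) (x : FreeSer k) :
    PowerSeries.coeff n (serParity k x) = freeParity k (PowerSeries.coeff n x) := rfl

theorem serParity_serParity (x : FreeSer k) : serParity k (serParity k x) = x := by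
  ext n
  exact freeParity_freeParity k _

theorem serParity_C (x : FreeAlgebra k Gen) :
    serParity k (PowerSeries.C x) = PowerSeries.C (freeParity k x) := PowerSeries.map_C _ _

theorem serParity_X : serParity k PowerSeries.X = PowerSeries.X := PowerSeries.map_X _

theorem serParity_smul (c : k) (x : FreeSer k) : serParity k (c • x) = c • serParity k x := by
  ext n
  simp only [coeff_serParity, PowerSeries.coeff_smul, map_smul]

theorem serParity_expSer (c : k) :
    serParity k (expSer c (FreeAlgebra.ι k Gen.X)) = expSer c (FreeAlgebra.ι k Gen.X) := by
  ext n
  simp only [coeff_serParity, expSer, PowerSeries.coeff_mk, map_smul, map_pow, freeParity_X]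

theorem serParity_coshSer :
    serParity k (coshSer (FreeAlgebra.ι k Gen.X)) = coshSer (FreeAlgebra.ι k Gen.X) := by
  simp only [coshSer, serParity_smul, map_add, serParity_expSer]

theorem serParity_sinhSer :
    serParity k (sinhSer (FreeAlgebra.ι k Gen.X)) = sinhSer (FreeAlgebra.ι k Gen.X) := by
  simp only [sinhSer, serParity_smul, map_sub, serParity_expSer]

theorem serParity_sinhDivSer :
    serParity k (sinhDivSer (FreeAlgebra.ι k Gen.X)) = sinhDivSer (FreeAlgebra.ι k Gen.X) := by
  ext n
  simp only [coeff_serParity, sinhDivSer, PowerSeries.coeff_mk]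
  rw [← coeff_serParity, serParity_sinhSer]

theorem serParity_rel {a b : FreeSer k} (hab : QuantumRel k a b) :
    serParity k (a - b) = a - b ∨ serParity k (a - b) = -(a - b) := by
  cases hab <;>
    simp only [map_add, map_sub, map_mul, serParity_smul, map_neg, map_zero, serParity_C,
      serParity_X, serParity_coshSer, serParity_sinhSer, serParity_sinhDivSer, freeParity_H,
      freeParity_X, freeParity_Y, freeParity_Vp, freeParity_Vm, neg_mul, mul_neg, neg_neg,
      smul_neg, neg_smul] <;>
    first
      | exact Or.inl trivial
      | (right; abel1)

theorem serParity_mem {x : FreeSer k} (hx : x ∈ quantumIdeal k) :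
    serParity k x ∈ quantumIdeal k := by
  rw [mem_quantumIdeal] at hx ⊢
  intro n
  have : TwoSidedIdeal.span
      ({x | ∃ a b, QuantumRel k a b ∧ x = a - b} ∪ {(PowerSeries.X : FreeSer k) ^ n}) ≤
      TwoSidedIdeal.comap (serParity k) (TwoSidedIdeal.span
        ({x | ∃ a b, QuantumRel k a b ∧ x = a - b} ∪ {(PowerSeries.X : FreeSer k) ^ n})) := by
    refine TwoSidedIdeal.span_le.2 ?_
    rintro _ (⟨a, b, hab, rfl⟩ | rfl) <;> rw [SetLike.mem_coe, TwoSidedIdeal.mem_comap]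
    · have hmem : a - b ∈ TwoSidedIdeal.span
          ({x | ∃ a b, QuantumRel k a b ∧ x = a - b} ∪ {(PowerSeries.X : FreeSer k) ^ n}) :=
        TwoSidedIdeal.subset_span (Or.inl ⟨a, b, hab, rfl⟩)
      rcases serParity_rel k hab with e | e <;> rw [e]
      · exact hmem
      · exact neg_mem hmem
    · rw [map_pow, serParity_X]
      exact TwoSidedIdeal.subset_span (Or.inr rfl)
  exact (TwoSidedIdeal.mem_comap _).1 (this (hx n))

/-- The parity automorphism of `U_h(osp(2/1))`. -/
def parity : Uh k →ₐ[k⟦X⟧] Uh k :=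
  Ideal.Quotient.liftₐ (quantumIdeal k).asIdeal ((mk k).comp (serParity k)) (by
    intro x hx
    exact (mk_eq_zero k).2 (serParity_mem k hx))

theorem parity_mk (x : FreeSer k) : parity k (mk k x) = mk k (serParity k x) := rfl

theorem parity_parity (u : Uh k) : parity k (parity k u) = u := by
  obtain ⟨x, rfl⟩ := mk_surjective k u
  rw [parity_mk, parity_mk, serParity_serParity]

/-- The `ℤ/2`-grading of `U_h(osp(2/1))`. -/
def grading : ZMod 2 → Submodule k⟦X⟧ (Uh k) := parityGrading (parity k)

instance [CharZero k] : GradedAlgebra (grading k) :=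
  letI : Invertible (2 : k⟦X⟧) :=
    ((isUnit_iff_ne_zero.2 (two_ne_zero' k)).map (algebraMap k k⟦X⟧)).invertible.copy 2
      (map_ofNat _ 2).symm
  parityGradedAlgebra (parity k) (parity_parity k)

/-! #### The classical limit -/

/-- Constant coefficient, followed by the quotient map to `U(osp(2/1))`. -/
def preReduction : FreeSer k →+* U0 k :=
  (U0.mk k : FreeAlgebra k Gen →+* U0 k).comp PowerSeries.constantCoeff

theorem preReduction_C (x : FreeAlgebra k Gen) :
    preReduction k (PowerSeries.C x) = U0.mk k x := rfl

theorem preReduction_X : preReduction k PowerSeries.X = 0 := by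
  simp [preReduction]

theorem preReduction_smul (c : k) (x : FreeSer k) :
    preReduction k (c • x) = c • preReduction k x := by
  rw [preReduction, RingHom.comp_apply, RingHom.comp_apply,
    ← PowerSeries.coeff_zero_eq_constantCoeff_apply, PowerSeries.coeff_smul,
    PowerSeries.coeff_zero_eq_constantCoeff_apply]
  exact map_smul (U0.mk k) _ _

theorem preReduction_expSer (c : k) (x : FreeAlgebra k Gen) :
    preReduction k (expSer c x) = 1 := by
  simp [preReduction, expSer]

theorem preReduction_sinhSer (x : FreeAlgebra k Gen) : preReduction k (sinhSer x) = 0 := by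
  rw [sinhSer, preReduction_smul, map_sub, preReduction_expSer, preReduction_expSer, sub_self,
    smul_zero]

variable [CharZero k]

theorem preReduction_coshSer (x : FreeAlgebra k Gen) : preReduction k (coshSer x) = 1 := by
  rw [coshSer, preReduction_smul, map_add, preReduction_expSer, preReduction_expSer,
    ← two_smul k (1 : U0 k), smul_smul]
  norm_num

theorem preReduction_sinhDivSer (x : FreeAlgebra k Gen) :
    preReduction k (sinhDivSer x) = U0.mk k x := by
  change U0.mk k (PowerSeries.constantCoeff (sinhDivSer x)) = _
  congr 1
  simp only [sinhDivSer, sinhSer, expSer, PowerSeries.constantCoeff_mk, PowerSeries.coeff_smul,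
    map_sub, PowerSeries.coeff_mk, zero_add, pow_one, Nat.factorial_one, Nat.cast_one, div_one]
  module

theorem preReduction_rel {a b : FreeSer k} (hab : QuantumRel k a b) :
    preReduction k (a - b) = 0 := by
  have key : ∀ (a' b' : FreeAlgebra k Gen) (c : k), ClassicalRel k a' b' →
      preReduction k (a - b) = c • (U0.mk k a' - U0.mk k b') → preReduction k (a - b) = 0 := by
    intro a' b' c hab' e
    rw [e, U0.mk_rel hab', sub_self, smul_zero]
  cases hab <;>
    [refine key _ _ 1 .J0_vp ?_; refine key _ _ 1 .J0_vm ?_; refine key _ _ 1 .vp_vm ?_;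
      refine key _ _ 1 .J0_Jp ?_; refine key _ _ 1 .J0_Jm ?_; refine key _ _ 1 .Jp_Jm ?_;
      refine key _ _ (-(1 / 4)) .Jp_eq ?_; refine key _ _ (1 / 4) .Jm_eq ?_;
      refine key _ _ 1 .Jp_vp ?_; refine key _ _ 1 .Jm_vm ?_; refine key _ _ 1 .Jp_vm ?_;
      refine key _ _ 1 .Jm_vp ?_] <;>
    simp only [map_add, map_sub, map_mul, map_neg, map_smul, map_zero, preReduction_smul,
      preReduction_C, preReduction_X, preReduction_coshSer, preReduction_sinhSer,
      preReduction_sinhDivSer, mul_one, one_mul, mul_zero, zero_mul] <;>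
    module

theorem reduction_aux {x : FreeSer k} (hx : x ∈ quantumIdeal k) :
    U0.mk k (PowerSeries.constantCoeff x) = 0 := by
  have : TwoSidedIdeal.span
      ({x | ∃ a b, QuantumRel k a b ∧ x = a - b} ∪ {(PowerSeries.X : FreeSer k) ^ 1}) ≤
      TwoSidedIdeal.comap (PowerSeries.constantCoeff (R := FreeAlgebra k Gen))
        (classicalIdeal k) := by
    refine TwoSidedIdeal.span_le.2 ?_
    rintro _ (⟨a, b, hab, rfl⟩ | rfl) <;>
      rw [SetLike.mem_coe, TwoSidedIdeal.mem_comap, ← U0.mk_eq_zero]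
    · exact preReduction_rel k hab
    · exact (pow_one (PowerSeries.X : FreeSer k)).symm ▸ preReduction_X k
  rw [U0.mk_eq_zero]
  exact (TwoSidedIdeal.mem_comap _).1 (this ((mem_quantumIdeal k).1 hx 1))

/-- Reduction modulo `h`, as a ring homomorphism `U_h(osp(2/1)) → U(osp(2/1))` sending each
generator to the generator of the same name. -/
def reduction : Uh k →+* U0 k :=
  Ideal.Quotient.lift (quantumIdeal k).asIdeal (preReduction k)
    (fun _ hx => reduction_aux k hx)

theorem reduction_mk (x : FreeSer k) :
    reduction k (mk k x) = U0.mk k (PowerSeries.constantCoeff x) := rfl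

theorem reduction_gen (g : Gen) : reduction k (gen k g) = U0.gen k g := by
  rw [gen, reduction_mk, PowerSeries.constantCoeff_C]
  rfl

theorem reduction_smul (c : k⟦X⟧) (u : Uh k) :
    reduction k (c • u) = PowerSeries.constantCoeff c • reduction k u := by
  obtain ⟨x, rfl⟩ := mk_surjective k u
  rw [← map_smul, reduction_mk, reduction_mk, smul_def, map_mul, map_mul,
    Algebra.smul_def]
  rfl

/-- Reduction modulo `h` as a semilinear map over `k⟦h⟧ → k`. -/
def reductionₛₗ : Uh k →ₛₗ[PowerSeries.constantCoeff (R := k)] U0 k where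
  toFun := reduction k
  map_add' := map_add _
  map_smul' := reduction_smul k

/-- Reduction modulo `h` of the uncompleted tensor square. -/
def reductionTensor :
    T2 (grading k) →ₛₗ[PowerSeries.constantCoeff (R := k)] T2 (U0.grading k) :=
  (GradedTensorProduct.of k (U0.grading k) (U0.grading k)).toLinearMap.comp
    ((TensorProduct.map (reductionₛₗ k) (reductionₛₗ k)).comp
      (GradedTensorProduct.of k⟦X⟧ (grading k) (grading k)).symm.toLinearMap)

/-- Reduction modulo `h` of the completed tensor square. -/
def reduction₂ : Compl (hbar k) (T2 (grading k)) →ₛₗ[PowerSeries.constantCoeff (R := k)]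
    T2 (U0.grading k) :=
  (Submodule.liftQ ((hPow (hbar k) (T2 (grading k)) 1).restrictScalars k⟦X⟧) (reductionTensor k) (by
    rintro _ ⟨y, rfl⟩
    rw [LinearMap.mem_ker, LinearMap.map_smulₛₗ, pow_one, PowerSeries.constantCoeff_X,
      zero_smul])).comp
  ((Submodule.Quotient.restrictScalarsEquiv k⟦X⟧ (hPow (hbar k) (T2 (grading k)) 1)).symm.toLinearMap
    ∘ₗ LinearMap.proj 1 ∘ₗ (complSubalgebra (hbar k) (T2 (grading k))).val.toLinearMap)

theorem reduction₂_tmul (a b : Uh k) : reduction₂ k (Compl.of (hbar k) (a ᵍ⊗ₜ[k⟦X⟧] b)) =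
    (reduction k a) ᵍ⊗ₜ[k] (reduction k b) := rfl

/-- The element `a ⊗ b` of the completed tensor square. -/
def tens (a b : Uh k) : Compl (hbar k) (T2 (grading k)) := Compl.of (hbar k) (a ᵍ⊗ₜ[k⟦X⟧] b)

end Uh

end Algebras

end SuperJordanian

end

open SuperJordanian
open scoped TensorProduct PowerSeries

set_option linter.unusedSimpArgs false
set_option linter.unusedSectionVars false

noncomputable section

namespace SuperJordanian

open PowerSeries (C coeff)
open scoped Nat

/-! ### Algebras that are complete and separated in the `h`-adic topology -/

section HAdic

variable (k : Type*) [Field k]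

/-! As an algebra, `Uh k` is U(osp(2/1))⟦h⟧ in nonlinear generators, and its coproduct is the
undeformed one conjugated by an explicit twist.

Put v = v₊, W = 8v₋ and J = -(vW + Wv) = 4J₀. In any algebra that is complete and separated for the
h-adic topology the elements X = (1/2h) log(1 + 8hv²), T^c = exp(chX) and g = v(1 + T)⁻¹ exist. Set
V₊ = vT^{-1/2} and V₋ = (1/8)κT^{1/2}, where κ = W - 4h(Jg + g - gT⁻¹). If the algebra is also
h-torsion free, the twelve quantum relations follow from four relations among X, V₊, V₋
(`QuantumRelations.of_triple`), and these four hold for the elements above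
(`IsClassicalPair.isQuantumTriple`). This gives a homomorphism `Uh.toSeries` to U(osp(2/1))⟦h⟧ which
reduces to the identity modulo h. Successive approximation makes it bijective, so `Uh k` is torsion
free, and the classical generators can be pulled back to elements `clv`, `clW` of `Uh k`.

In the completed tensor square the sums of the two copies of v and of W again form a classical pair,
which defines the undeformed coproduct Δ₀. The twist is F = (1 - 8h g⊗g) exp(½h J⊗X), and Δ =
FΔ₀F⁻¹. The formulas for Δ(V₊) and Δ(V₋) are `IsSuperPair.twist_Vp` and `IsSuperPair.twist_Vm`;
those for H and Y follow because H = -2{V₊,V₋} and Y = -4V₋². Since V₊ and V₋ generate topologically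
(`Uh.hom_ext`), coassociativity and the counit axioms need to be checked on them only. The antipode
comes from a homomorphism into the endomorphism algebra of `Uh k`, acting by signed right
multiplications; its axioms define a subalgebra containing V₊ and V₋.

The twist satisfies the cocycle identity `twist_cocycle` and Δ₀ is cocommutative, so R = F₂₁F⁻¹ is a
triangular structure (`HexagonData.map_left`, `HexagonData.map_right`). Expanding F to first order
gives R = 1 - 2h r₂ modulo h², and the first-order part of RΔ = ΔᵒᵖR gives the formula for Δ - Δᵒᵖ.
-/

instance : Algebra ℕ k⟦X⟧ := Semiring.toNatAlgebra

instance : Algebra ℤ k⟦X⟧ := Ring.toIntAlgebra _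

/-- A `k⟦h⟧`-algebra that is complete and separated in the `h`-adic topology. -/
class HAdic (𝒞 : Type*) [Ring 𝒞] [Algebra k⟦X⟧ 𝒞] : Prop where
  eq_zero : ∀ x : 𝒞, (∀ n : ℕ, ∃ y : 𝒞, x = hbar k ^ n • y) → x = 0
  exists_sum : ∀ a : ℕ → 𝒞, ∃ s : 𝒞, ∀ n : ℕ, ∃ y : 𝒞,
    s = ∑ i ∈ Finset.range n, hbar k ^ i • a i + hbar k ^ n • y

/-- Multiplication by `h` is injective. -/
class HTorsionFree (𝒞 : Type*) [Ring 𝒞] [Algebra k⟦X⟧ 𝒞] : Prop where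
  eq_zero : ∀ x : 𝒞, hbar k • x = 0 → x = 0

section

variable {k}
variable {𝒞 𝒟 : Type*} [Ring 𝒞] [Algebra k⟦X⟧ 𝒞] [Ring 𝒟] [Algebra k⟦X⟧ 𝒟]

theorem hbar_smul_inj [HTorsionFree k 𝒞] {x y : 𝒞} (e : hbar k • x = hbar k • y) : x = y := by
  rw [← sub_eq_zero] at e ⊢
  exact HTorsionFree.eq_zero (k := k) _ (by rw [smul_sub, e])

variable [HAdic k 𝒞] [HAdic k 𝒟]

theorem eq_of_forall_mod {x y : 𝒞} (e : ∀ n : ℕ, ∃ z : 𝒞, x = y + hbar k ^ n • z) : x = y := by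
  rw [← sub_eq_zero]
  refine HAdic.eq_zero (k := k) _ fun n => ?_
  obtain ⟨z, hz⟩ := e n
  exact ⟨z, by rw [hz, add_sub_cancel_left]⟩

variable (k) in
/-- The sum `∑ hⁿ aₙ`. -/
def hsum (a : ℕ → 𝒞) : 𝒞 := (HAdic.exists_sum (k := k) a).choose

theorem hsum_spec (a : ℕ → 𝒞) (n : ℕ) : ∃ y : 𝒞,
    hsum k a = ∑ i ∈ Finset.range n, hbar k ^ i • a i + hbar k ^ n • y :=
  (HAdic.exists_sum (k := k) a).choose_spec n

/-- Separatedness makes the sum unique: the partial sums modulo every power of h determine it.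
Identities between series are proved in this way. -/
theorem eq_hsum {a : ℕ → 𝒞} {s : 𝒞} (e : ∀ n : ℕ, ∃ y : 𝒞,
    s = ∑ i ∈ Finset.range n, hbar k ^ i • a i + hbar k ^ n • y) : s = hsum k a := by
  refine eq_of_forall_mod (k := k) fun n => ?_
  obtain ⟨y, hy⟩ := e n
  obtain ⟨z, hz⟩ := hsum_spec (k := k) a n
  exact ⟨y - z, by rw [hy, hz, smul_sub]; abel⟩

/-- Linearity over k⟦h⟧ is continuity: it sends hⁿ𝒞 into hⁿ𝒟. -/
theorem map_hsum {F : Type*} [FunLike F 𝒞 𝒟] [LinearMapClass F k⟦X⟧ 𝒞 𝒟] (f : F) (a : ℕ → 𝒞) :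
    f (hsum k a) = hsum k fun n => f (a n) := by
  refine eq_hsum fun n => ?_
  obtain ⟨y, hy⟩ := hsum_spec (k := k) a n
  exact ⟨f y, by rw [hy]; simp only [map_add, map_sum, map_smul]⟩

theorem mul_hsum (x : 𝒞) (a : ℕ → 𝒞) : x * hsum k a = hsum k fun n => x * a n :=
  map_hsum (LinearMap.mulLeft k⟦X⟧ x) a

theorem hsum_mul (x : 𝒞) (a : ℕ → 𝒞) : hsum k a * x = hsum k fun n => a n * x :=
  map_hsum (LinearMap.mulRight k⟦X⟧ x) a

theorem smul_hsum (c : k⟦X⟧) (a : ℕ → 𝒞) : c • hsum k a = hsum k fun n => c • a n :=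
  map_hsum (LinearMap.lsmul k⟦X⟧ 𝒞 c) a

theorem hsum_add (a b : ℕ → 𝒞) : hsum k (fun n => a n + b n) = hsum k a + hsum k b := by
  refine (eq_hsum fun n => ?_).symm
  obtain ⟨y, hy⟩ := hsum_spec (k := k) a n
  obtain ⟨z, hz⟩ := hsum_spec (k := k) b n
  exact ⟨y + z, by rw [hy, hz]; simp only [smul_add, Finset.sum_add_distrib]; abel⟩

theorem hsum_eq_zero_add (a : ℕ → 𝒞) :
    hsum k a = a 0 + hbar k • hsum k fun n => a (n + 1) := by
  refine (eq_hsum fun n => ?_).symm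
  cases n with
  | zero => exact ⟨_, by rw [Finset.sum_range_zero, zero_add, pow_zero, one_smul]⟩
  | succ n =>
    obtain ⟨y, hy⟩ := hsum_spec (k := k) (fun n => a (n + 1)) n
    refine ⟨y, ?_⟩
    rw [hy, Finset.sum_range_succ']
    simp only [smul_add, smul_smul, Finset.smul_sum, pow_succ', pow_zero, one_smul]
    abel

theorem hsum_eq_single {a : ℕ → 𝒞} (ha : ∀ n, a (n + 1) = 0) : hsum k a = a 0 := by
  rw [hsum_eq_zero_add]
  have : hsum k (fun n => a (n + 1)) = 0 := by
    refine (eq_hsum fun n => ⟨0, ?_⟩).symm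
    simp [ha]
  rw [this, smul_zero, add_zero]

theorem hsum_mul_hsum (a b : ℕ → 𝒞) : hsum k a * hsum k b =
    hsum k fun n => ∑ p ∈ Finset.HasAntidiagonal.antidiagonal n, a p.1 * b p.2 := by
  refine eq_hsum fun n => ?_
  -- Each step splits off `a 0`. The induction hypothesis is applied to the shifted series, which
  -- carries an extra h, while the series `a 0 * b` must be cut at n + 1.
  induction n generalizing a with
  | zero => exact ⟨_, by rw [Finset.sum_range_zero, zero_add, pow_zero, one_smul]⟩
  | succ n ih =>
    obtain ⟨y, hy⟩ := ih fun n => a (n + 1)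
    obtain ⟨z, hz⟩ := hsum_spec (k := k) (fun n => a 0 * b n) (n + 1)
    refine ⟨y + z, ?_⟩
    rw [hsum_eq_zero_add a, add_mul, mul_hsum, hz, smul_mul_assoc, hy, Finset.sum_range_succ',
      Finset.sum_range_succ']
    simp only [Finset.Nat.antidiagonal_succ, Finset.sum_cons, Finset.sum_map, smul_add,
      Finset.sum_add_distrib, Finset.smul_sum, smul_smul, pow_succ']
    simp
    abel

theorem hsum_congr {a b : ℕ → 𝒞} (e : ∀ n, a n = b n) : hsum k a = hsum k b :=
  congrArg _ (funext e)

/-! #### Geometric series and units -/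

variable (k) in
/-- The inverse of `1 - h z`. -/
def hgeom (z : 𝒞) : 𝒞 := hsum k fun n => z ^ n

theorem one_sub_mul_hgeom (z : 𝒞) : (1 - hbar k • z) * hgeom k z = 1 := by
  have : hgeom k z = 1 + hbar k • (z * hgeom k z) := by
    conv_lhs => rw [hgeom, hsum_eq_zero_add]
    rw [pow_zero, hgeom, mul_hsum]
    simp only [pow_succ']
  rw [sub_mul, one_mul, smul_mul_assoc, sub_eq_iff_eq_add]
  exact this

theorem hgeom_mul_one_sub (z : 𝒞) : hgeom k z * (1 - hbar k • z) = 1 := by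
  have : hgeom k z = 1 + hbar k • (hgeom k z * z) := by
    conv_lhs => rw [hgeom, hsum_eq_zero_add]
    rw [pow_zero, hgeom, hsum_mul]
    simp only [pow_succ]
  rw [mul_sub, mul_one, mul_smul_comm, sub_eq_iff_eq_add]
  exact this

variable (k) in
theorem isUnit_one_add_hbar_smul (z : 𝒞) : IsUnit (1 + hbar k • z) := by
  have e : 1 + hbar k • z = 1 - hbar k • -z := by rw [smul_neg, sub_neg_eq_add]
  rw [e]
  exact ⟨⟨_, hgeom k (-z), one_sub_mul_hgeom _, hgeom_mul_one_sub _⟩, rfl⟩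

/-! #### The exponential series -/

variable (k) in
/-- The exponential `exp (h z)`. -/
def expH (z : 𝒞) : 𝒞 := hsum k fun n => (C (1 / n ! : k) : k⟦X⟧) • z ^ n

theorem expH_eq_one_add (z : 𝒞) : ∃ y : 𝒞, expH k z = 1 + hbar k • z + hbar k ^ 2 • y := by
  obtain ⟨y, hy⟩ := hsum_spec (k := k) (fun n => (C (1 / n ! : k) : k⟦X⟧) • z ^ n) 2
  exact ⟨y, by rw [expH, hy]; simp [Finset.sum_range_succ]⟩

theorem expH_zero : expH k (0 : 𝒞) = 1 := by
  rw [expH, hsum_eq_single]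
  · simp
  · simp

theorem map_expH {F : Type*} [FunLike F 𝒞 𝒟] [AlgHomClass F k⟦X⟧ 𝒞 𝒟] (f : F) (z : 𝒞) :
    f (expH k z) = expH k (f z) := by
  rw [expH, map_hsum]
  simp only [map_smul, map_pow]
  rfl

theorem expH_semiconj {y z z' : 𝒞} (e : z * y = y * z') : expH k z * y = y * expH k z' := by
  rw [expH, expH, mul_hsum, hsum_mul]
  refine hsum_congr fun n => ?_
  have : z ^ n * y = y * z' ^ n := ((show SemiconjBy y z' z from e.symm).pow_right n).symm
  rw [smul_mul_assoc, this, mul_smul_comm]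

theorem expH_commute {y z : 𝒞} (e : z * y = y * z) : expH k z * y = y * expH k z :=
  expH_semiconj e

variable [CharZero k]

theorem expH_add {y z : 𝒞} (e : y * z = z * y) : expH k (y + z) = expH k y * expH k z := by
  rw [expH, expH, expH, hsum_mul_hsum]
  refine hsum_congr fun n => ?_
  rw [(show Commute y z from e).add_pow', Finset.smul_sum]
  refine Finset.sum_congr rfl fun p hp => ?_
  rw [smul_mul_smul_comm, ← Nat.cast_smul_eq_nsmul k⟦X⟧, smul_smul, ← map_mul,
    ← map_natCast (C (R := k)), ← map_mul]
  congr 2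
  rw [Finset.HasAntidiagonal.mem_antidiagonal] at hp
  subst hp
  have h1 := Nat.cast_ne_zero (R := k).2 (Nat.factorial_ne_zero p.1)
  have h2 := Nat.cast_ne_zero (R := k).2 (Nat.factorial_ne_zero p.2)
  have h3 := Nat.cast_ne_zero (R := k).2 (Nat.factorial_ne_zero (p.1 + p.2))
  have h4 := congrArg (Nat.cast (R := k))
    (Nat.add_choose_mul_factorial_mul_factorial p.1 p.2)
  rw [← Nat.choose_symm_add] at h4
  push_cast at h4
  field_simp
  linear_combination h4

theorem expH_mul_expH_neg (z : 𝒞) : expH k z * expH k (-z) = 1 := by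
  rw [← expH_add (by simp), add_neg_cancel, expH_zero]

theorem expH_neg_mul_expH (z : 𝒞) : expH k (-z) * expH k z = 1 := by
  rw [← expH_add (by simp), neg_add_cancel, expH_zero]

theorem expH_isUnit (z : 𝒞) : IsUnit (expH k z) :=
  ⟨⟨_, _, expH_mul_expH_neg z, expH_neg_mul_expH z⟩, rfl⟩

/-- Since u = [z, y] commutes with z, one has [zⁿ⁺¹, y] = (n + 1) u zⁿ; summing against 1/(n + 1)!
shifts the index by one and leaves a factor h. -/
theorem expH_derivation {y z u : 𝒞} (e : z * y = y * z + u) (hu : z * u = u * z) :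
    expH k z * y = y * expH k z + hbar k • (u * expH k z) := by
  have hpow : ∀ n : ℕ, z ^ (n + 1) * y = y * z ^ (n + 1) + (n + 1 : ℕ) • (u * z ^ n) := by
    intro n
    induction n with
    | zero => simpa using e
    | succ n ih =>
      rw [pow_succ' z (n + 1), mul_assoc, ih, mul_add, ← mul_assoc, e, mul_smul_comm, ← mul_assoc z,
        hu, mul_assoc u, ← pow_succ', add_mul, mul_assoc y, ← pow_succ', add_smul (n + 1) 1,
        one_smul]
      abel
  rw [expH, hsum_mul, mul_hsum, mul_hsum]
  rw [hsum_eq_zero_add, hsum_eq_zero_add (fun n => y * _), add_assoc, ← smul_add, ← hsum_add]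
  congr 1
  · simp
  · congr 1
    refine hsum_congr fun n => ?_
    rw [smul_mul_assoc, hpow, smul_add, mul_smul_comm, mul_smul_comm,
      ← Nat.cast_smul_eq_nsmul k⟦X⟧, smul_smul, ← map_natCast (C (R := k)), ← map_mul]
    congr 3
    have h1 := Nat.cast_ne_zero (R := k).2 (Nat.factorial_ne_zero n)
    have h2 : (n : k) + 1 ≠ 0 := by exact_mod_cast n.succ_ne_zero
    rw [Nat.factorial_succ]
    push_cast
    field_simp

/-- Put d = y - z. The equation exp(hd) = 1, divided by h, reads d(1 + h(...)) = 0, and the second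
factor is a unit. -/
theorem expH_injective [HTorsionFree k 𝒞] {y z : 𝒞} (e : y * z = z * y)
    (hyz : expH k y = expH k z) : y = z := by
  have e1 : expH k (y - z) = 1 := by
    rw [sub_eq_add_neg, expH_add (by rw [mul_neg, e, neg_mul]), hyz, expH_mul_expH_neg]
  have e2 : (y - z) * (1 + hbar k • hsum k fun n =>
      (C (1 / (n + 2)! : k) : k⟦X⟧) • (y - z) ^ (n + 1)) = 0 := by
    refine hbar_smul_inj (k := k) ?_
    rw [smul_zero]
    rw [expH, hsum_eq_zero_add, hsum_eq_zero_add] at e1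
    simp only [pow_zero, Nat.factorial_zero, Nat.cast_one, div_one, map_one, one_smul, zero_add,
      Nat.factorial_one, pow_one, add_eq_left] at e1
    rw [mul_add, mul_one, mul_smul_comm, mul_hsum]
    simp only [mul_smul_comm, ← pow_succ']
    exact e1
  rw [(isUnit_one_add_hbar_smul k _).mul_left_eq_zero, sub_eq_zero] at e2
  exact e2

end

end HAdic

end SuperJordanian

end

noncomputable section

namespace SuperJordanian

open PowerSeries (C coeff)
open scoped Nat

/-! ### Power series in `h e`, and the logarithm -/

section Log

variable (k : Type*) [Field k]

/-- Let f = exp ∘ log and l the derivative of the logarithm, so l(1 + X) = 1 and f' = fl. Then (fl)'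
= fl² + fl' = 0 and fl has constant term 1, so fl = 1 and f = 1 + X. -/
theorem exp_subst_log [CharZero k] :
    (PowerSeries.exp k).subst (PowerSeries.log k) = 1 + PowerSeries.X := by
  set f := (PowerSeries.exp k).subst (PowerSeries.log k) with hf
  set l := PowerSeries.derivative k (PowerSeries.log k) with hl
  have h1 : l * (1 + PowerSeries.X) = 1 := by
    rw [hl, PowerSeries.deriv_log]
    ext n
    cases n with
    | zero => simp [mul_add]
    | succ n =>
      rw [mul_add, mul_one, map_add, PowerSeries.coeff_succ_mul_X, PowerSeries.coeff_mk,
        PowerSeries.coeff_mk, PowerSeries.coeff_one, pow_succ]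
      simp
  have h2 : PowerSeries.derivative k f = f * l := by
    rw [hf, PowerSeries.derivative_subst PowerSeries.HasSubst.log, PowerSeries.derivative_exp]
  have h3 : PowerSeries.derivative k l * (1 + PowerSeries.X) + l = 0 := by
    have := congrArg (PowerSeries.derivative k) h1
    rw [Derivation.leibniz, map_add, PowerSeries.derivative_X, PowerSeries.derivative_one] at this
    simpa [add_comm, mul_comm] using this
  have h4 : PowerSeries.derivative k (f * l) = 0 := by
    rw [Derivation.leibniz, h2, smul_eq_mul, smul_eq_mul]
    linear_combination (f * l) * h3 - (f * PowerSeries.derivative k l) * h1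
  have h5 : f * l = 1 := by
    refine PowerSeries.derivative.ext (by rw [h4, PowerSeries.derivative_one]) ?_
    have h6 : f = 1 + (PowerSeries.exp k - 1).subst (PowerSeries.log k) := by
      rw [hf, ← PowerSeries.coe_substAlgHom PowerSeries.HasSubst.log, map_sub, map_one]
      abel
    have h7 : PowerSeries.constantCoeff f = 1 := by
      rw [h6, map_add, map_one, add_eq_left]
      exact PowerSeries.constantCoeff_subst_eq_zero PowerSeries.constantCoeff_log _ (by simp)
    rw [map_mul, h7, hl, PowerSeries.deriv_log]
    simp
  linear_combination (1 + PowerSeries.X) * h5 - f * h1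

variable {k}
variable {𝒞 𝒟 : Type*} [Ring 𝒞] [Algebra k⟦X⟧ 𝒞] [Ring 𝒟] [Algebra k⟦X⟧ 𝒟]
  [HAdic k 𝒞] [HAdic k 𝒟]

/-- Evaluation `f ↦ f (h e)` of formal power series. -/
def evH (e : 𝒞) : k⟦X⟧ →+* 𝒞 where
  toFun f := hsum k fun n => (C (coeff n f) : k⟦X⟧) • e ^ n
  map_one' := by
    rw [hsum_eq_single] <;> simp [PowerSeries.coeff_one]
  map_zero' := by
    rw [hsum_eq_single] <;> simp
  map_add' f g := by
    rw [← hsum_add]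
    simp only [map_add, add_smul]
  map_mul' f g := by
    rw [hsum_mul_hsum]
    refine hsum_congr fun n => ?_
    rw [PowerSeries.coeff_mul, map_sum, Finset.sum_smul]
    refine Finset.sum_congr rfl fun p hp => ?_
    rw [smul_mul_smul_comm, ← pow_add, Finset.HasAntidiagonal.mem_antidiagonal.1 hp, map_mul]

theorem evH_X (e : 𝒞) : evH e (PowerSeries.X : k⟦X⟧) = hbar k • e := by
  change hsum k _ = _
  rw [hsum_eq_zero_add, hsum_eq_single]
  · simp
  · intro n
    simp [PowerSeries.coeff_X]

theorem evH_C (e : 𝒞) (c : k) : evH e (C c : k⟦X⟧) = (C c : k⟦X⟧) • (1 : 𝒞) := by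
  change hsum k _ = _
  rw [hsum_eq_single]
  · simp
  · intro n
    simp

variable (k) in
/-- The series `(1 / h) log (1 + h e)`. -/
def hlog (e : 𝒞) : 𝒞 := hsum k fun n => (C ((-1) ^ n / (n + 1) : k) : k⟦X⟧) • e ^ (n + 1)

theorem map_hlog {F : Type*} [FunLike F 𝒞 𝒟] [AlgHomClass F k⟦X⟧ 𝒞 𝒟] (f : F) (e : 𝒞) :
    f (hlog k e) = hlog k (f e) := by
  rw [hlog, map_hsum]
  simp only [map_smul, map_pow]
  rfl

theorem hlog_mul_comm {e y : 𝒞} (h : e * y = y * e) : hlog k e * y = y * hlog k e := by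
  rw [hlog, mul_hsum, hsum_mul]
  refine hsum_congr fun n => ?_
  rw [smul_mul_assoc, mul_smul_comm, ((show Commute e y from h).pow_left _).eq]

variable [CharZero k]

theorem evH_log (e : 𝒞) : evH e (PowerSeries.log k) = hbar k • hlog k e := by
  change hsum k _ = _
  rw [hsum_eq_zero_add, hlog]
  simp only [PowerSeries.coeff_log, if_true, map_zero, zero_smul, zero_add]
  congr 1
  refine hsum_congr fun n => ?_
  rw [if_neg n.succ_ne_zero]
  congr 3
  push_cast
  simp [pow_succ]

/-- The identity exp(log(1 + X)) = 1 + X is evaluated at X = he by the ring homomorphism `evH e`. To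
see that the evaluation of the composite is the exponential of `hlog`, it is compared with the
partial sums modulo each hⁿ. -/
theorem expH_hlog (e : 𝒞) : expH k (hlog k e) = 1 + hbar k • e := by
  have e1 : 1 + hbar k • e = evH e (((PowerSeries.exp k).subst (PowerSeries.log k) : k⟦X⟧)) := by
    rw [exp_subst_log, map_add, map_one, evH_X]
  rw [e1]
  refine (eq_hsum fun n => ?_).symm
  have hs : PowerSeries.HasSubst (PowerSeries.log k) := PowerSeries.HasSubst.log
  obtain ⟨l, hl⟩ : (PowerSeries.X : k⟦X⟧) ∣ PowerSeries.log k :=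
    PowerSeries.X_dvd_iff.2 (PowerSeries.constantCoeff_log)
  have e2 := PowerSeries.eq_X_pow_mul_shift_add_trunc n (PowerSeries.exp k)
  -- The exponential series is cut after n terms. Its tail is divisible by Xⁿ, and stays so after
  -- the substitution because log(1 + X) = X l.
  have e3 : (PowerSeries.exp k).subst (PowerSeries.log k) =
      ∑ i ∈ Finset.range n, (C (1 / i ! : k) : k⟦X⟧) * PowerSeries.log k ^ i +
        PowerSeries.X ^ n * (l ^ n * ((PowerSeries.mk fun i => coeff (i + n)
          (PowerSeries.exp k)).subst (PowerSeries.log k) : k⟦X⟧)) := by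
    conv_lhs => rw [e2]
    have e4 : ((PowerSeries.trunc n (PowerSeries.exp k) : Polynomial k) : k⟦X⟧) =
        ∑ i ∈ Finset.range n, (C (1 / i ! : k) : k⟦X⟧) * PowerSeries.X ^ i := by
      ext m
      simp [PowerSeries.coeff_trunc, PowerSeries.coeff_X_pow]
    rw [e4, ← PowerSeries.coe_substAlgHom hs, map_add, add_comm, map_sum, map_mul, map_pow,
      PowerSeries.coe_substAlgHom hs, PowerSeries.subst_X hs, ← mul_assoc, ← mul_pow, ← hl]
    congr 1
    refine Finset.sum_congr rfl fun i _ => ?_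
    rw [PowerSeries.subst_mul hs, PowerSeries.subst_pow hs, PowerSeries.subst_X hs]
    congr 1
    exact PowerSeries.subst_C _
  -- Evaluation sends Xⁿ to hⁿeⁿ, whence the factor eⁿ in the witness.
  refine ⟨evH e (l ^ n * ((PowerSeries.mk fun i => coeff (i + n)
          (PowerSeries.exp k)).subst (PowerSeries.log k) : k⟦X⟧)) |> fun y => e ^ n * y, ?_⟩
  rw [e3, map_add, map_sum, map_mul, map_pow, evH_X]
  congr 1
  · refine Finset.sum_congr rfl fun i _ => ?_
    rw [map_mul, map_pow, evH_log, evH_C, smul_mul_assoc, one_mul, smul_pow, smul_comm]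
  · rw [smul_pow, smul_mul_assoc]

/-- The derivative of (1/h) log(1 + he) with respect to e is (1 + he)⁻¹, and this inverse equals
exp(-h · `hlog k e`) by `expH_hlog`. -/
theorem hlog_derivation {e y u : 𝒞} (h : e * y = y * e + u) (hu : e * u = u * e) :
    hlog k e * y = y * hlog k e + u * expH k (-hlog k e) := by
  have hpow : ∀ n : ℕ, e ^ (n + 1) * y = y * e ^ (n + 1) + (n + 1 : ℕ) • (u * e ^ n) := by
    intro n
    induction n with
    | zero => simpa using h
    | succ n ih =>
      rw [pow_succ' e (n + 1), mul_assoc, ih, mul_add, ← mul_assoc, h, mul_smul_comm, ← mul_assoc e,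
        hu, mul_assoc u, ← pow_succ', add_mul, mul_assoc y, ← pow_succ', add_smul (n + 1) 1,
        one_smul]
      abel
  have hg : expH k (-hlog k e) = hgeom k (-e) := by
    have e1 := expH_neg_mul_expH (k := k) (hlog k e)
    have e2 := one_sub_mul_hgeom (k := k) (-e)
    rw [smul_neg, sub_neg_eq_add, ← expH_hlog] at e2
    exact left_inv_eq_right_inv e1 e2
  rw [hg, hgeom, hlog, hsum_mul, mul_hsum, mul_hsum, ← hsum_add]
  refine hsum_congr fun n => ?_
  rw [smul_mul_assoc, hpow, smul_add, mul_smul_comm, ← Nat.cast_smul_eq_nsmul k⟦X⟧, smul_smul,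
    ← map_natCast (C (R := k)), ← map_mul]
  have h2 : (n : k) + 1 ≠ 0 := by exact_mod_cast n.succ_ne_zero
  have : ((-1) ^ n / (n + 1) : k) * ((n + 1 : ℕ) : k) = (-1) ^ n := by
    push_cast
    field_simp
  rw [this, map_pow, map_neg, map_one]
  congr 1
  rcases Nat.even_or_odd n with hn | hn <;> simp [hn.neg_pow]

end Log

end SuperJordanian

end

noncomputable section

namespace SuperJordanian

open PowerSeries (C coeff)
open scoped Nat

/-! ### The universal property of the quantum superalgebra -/

/-! ### From four relations to the full presentation -/

section Relations

variable {R 𝒞 : Type*} [CommRing R] [Ring 𝒞] [Algebra R 𝒞]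

/-- The defining relations of `U_h(osp(2/1))`, with `a = 1 / 2`. -/
structure QuantumRelations (h a : R) (H X Y Vp Vm ch sh shd : 𝒞) : Prop where
  H_Vp : H * Vp - Vp * H = a • (Vp * ch)
  H_Vm : H * Vm - Vm * H = -((a * a) • (Vm * ch)) - (a * a) • (ch * Vm)
  Vp_Vm : Vp * Vm + Vm * Vp = -(a • H)
  H_X : H * X - X * H = shd
  H_Y : H * Y - Y * H = -(a • (Y * ch)) - a • (ch * Y) + h • (Vm * sh * Vp) - h • (Vp * sh * Vm)
  X_Y : X * Y - Y * X = (2 : R) • H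
  Vp_sq : Vp * Vp = (a * a) • shd
  Vm_sq : Vm * Vm = -((a * a) • Y)
  X_Vp : X * Vp - Vp * X = 0
  Y_Vm : Y * Vm - Vm * Y = 0
  X_Vm : X * Vm - Vm * X = Vp
  Y_Vp : Y * Vp - Vp * Y = a • (Vm * ch) + a • (ch * Vm)

/-- H and Y are eliminated by H = -2{V₊,V₋} and Y = -4V₋². The other relations come from brackets of
the four given ones, after T and T' = T⁻¹ have been moved to the right. Cancelling h is needed
because `Vp_sq` involves V₊² only multiplied by h. -/
theorem QuantumRelations.of_triple (h a : R) (ha : 2 * a = 1)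
    (hreg : ∀ x y : 𝒞, h • x = h • y → x = y) {X Vp Vm T T' : 𝒞}
    (X_Vp : X * Vp = Vp * X) (Vp_sq : (8 : R) • h • (Vp * Vp) = T - T')
    (X_Vm : X * Vm = Vm * X + Vp)
    (H_Vm : (16 : R) • ((Vp * Vm + Vm * Vp) * Vm - Vm * (Vp * Vm + Vm * Vp)) =
      Vm * (T + T') + (T + T') * Vm)
    (c1 : T * Vp = Vp * T) (c2 : T' * Vp = Vp * T')
    (d1 : T * Vm = Vm * T + h • (Vp * T)) (d2 : T' * Vm = Vm * T' - h • (Vp * T')) :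
    QuantumRelations h a (-(2 : R) • (Vp * Vm + Vm * Vp)) X (-(4 : R) • (Vm * Vm)) Vp Vm
      (a • (T + T')) (a • (T - T')) ((4 : R) • (Vp * Vp)) := by
  -- The bracket of `Vp_sq` with V₋ is h times this equation.
  have e1 : (8 : R) • (Vp * (Vp * Vm) - Vm * (Vp * Vp)) = Vp * T + Vp * T' := by
    refine hreg _ _ ?_
    have h1 := congrArg (fun z => z * Vm - Vm * z) Vp_sq
    simp only [sub_mul, mul_sub, d1, d2, smul_mul_assoc, mul_smul_comm, mul_assoc] at h1
    linear_combination (norm := module) h1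
  have c1' : ∀ z, T * (Vp * z) = Vp * (T * z) := fun z => by rw [← mul_assoc, c1, mul_assoc]
  have c2' : ∀ z, T' * (Vp * z) = Vp * (T' * z) := fun z => by rw [← mul_assoc, c2, mul_assoc]
  have d1' : ∀ z, T * (Vm * z) = Vm * (T * z) + h • (Vp * (T * z)) := fun z => by
    rw [← mul_assoc, d1, add_mul, smul_mul_assoc, mul_assoc, mul_assoc]
  have d2' : ∀ z, T' * (Vm * z) = Vm * (T' * z) - h • (Vp * (T' * z)) := fun z => by
    rw [← mul_assoc, d2, sub_mul, smul_mul_assoc, mul_assoc, mul_assoc]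
  constructor
  · linear_combination (norm := (
      simp only [mul_add, add_mul, mul_sub, sub_mul, mul_assoc, d1, d2, c1, c2, d1', d2', c1', c2',
        smul_mul_assoc, mul_smul_comm, smul_add, smul_sub]
      match_scalars <;> clear d1' d2' c1' c2' hreg <;> grind))
      (a * a) • e1
  · linear_combination (norm := (
      simp only [mul_add, add_mul, mul_sub, sub_mul, mul_assoc, d1, d2, c1, c2, d1', d2', c1', c2',
        smul_mul_assoc, mul_smul_comm, smul_add, smul_sub]
      match_scalars <;> clear d1' d2' c1' c2' hreg <;> grind))
      -- As 2a = 1, one has 16a³ = 2, and -2 is the coefficient of {V₊,V₋} in H.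
      -(a * a * a) • H_Vm
  · linear_combination (norm := (
      simp only [mul_add, add_mul, mul_sub, sub_mul, mul_assoc, d1, d2, c1, c2, d1', d2', c1', c2',
        smul_mul_assoc, mul_smul_comm, smul_add, smul_sub]
      match_scalars <;> clear d1' d2' c1' c2' hreg <;> grind))
      (0 : R) • e1
  · linear_combination (norm := (
      simp only [mul_add, add_mul, mul_sub, sub_mul, mul_assoc, d1, d2, c1, c2, d1', d2', c1', c2',
        smul_mul_assoc, mul_smul_comm, smul_add, smul_sub]
      match_scalars <;> clear d1' d2' c1' c2' hreg <;> grind))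
      (2 : R) • (Vp * X_Vm + X_Vm * Vp + X_Vp * Vm + Vm * X_Vp)
  · linear_combination (norm := (
      simp only [mul_add, add_mul, mul_sub, sub_mul, mul_assoc, d1, d2, c1, c2, d1', d2', c1', c2',
        smul_mul_assoc, mul_smul_comm, smul_add, smul_sub]
      match_scalars <;> clear d1' d2' c1' c2' hreg <;> grind))
      a • (H_Vm * Vm + Vm * H_Vm)
  · linear_combination (norm := (
      simp only [mul_add, add_mul, mul_sub, sub_mul, mul_assoc, d1, d2, c1, c2, d1', d2', c1', c2',
        smul_mul_assoc, mul_smul_comm, smul_add, smul_sub]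
      match_scalars <;> clear d1' d2' c1' c2' hreg <;> grind))
      -(4 : R) • (X_Vm * Vm + Vm * X_Vm)
  · linear_combination (norm := (
      simp only [mul_add, add_mul, mul_sub, sub_mul, mul_assoc, d1, d2, c1, c2, d1', d2', c1', c2',
        smul_mul_assoc, mul_smul_comm, smul_add, smul_sub]
      match_scalars <;> clear d1' d2' c1' c2' hreg <;> grind))
      (0 : R) • e1
  · linear_combination (norm := (
      simp only [mul_add, add_mul, mul_sub, sub_mul, mul_assoc, d1, d2, c1, c2, d1', d2', c1', c2',
        smul_mul_assoc, mul_smul_comm, smul_add, smul_sub]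
      match_scalars <;> clear d1' d2' c1' c2' hreg <;> grind))
      (0 : R) • e1
  · exact sub_eq_zero.2 X_Vp
  · linear_combination (norm := (
      simp only [mul_add, add_mul, mul_sub, sub_mul, mul_assoc, d1, d2, c1, c2, d1', d2', c1', c2',
        smul_mul_assoc, mul_smul_comm, smul_add, smul_sub]
      match_scalars <;> clear d1' d2' c1' c2' hreg <;> grind))
      (0 : R) • e1
  · rw [X_Vm, add_sub_cancel_left]
  · linear_combination (norm := (
      simp only [mul_add, add_mul, mul_sub, sub_mul, mul_assoc, d1, d2, c1, c2, d1', d2', c1', c2',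
        smul_mul_assoc, mul_smul_comm, smul_add, smul_sub]
      match_scalars <;> clear d1' d2' c1' c2' hreg <;> grind))
      (a * a) • H_Vm

end Relations

section UniversalProperty

variable {k : Type*} [Field k]
variable {𝒞 𝒟 : Type*} [Ring 𝒞] [Algebra k⟦X⟧ 𝒞] [Ring 𝒟] [Algebra k⟦X⟧ 𝒟]

/-- The algebra homomorphism from the free algebra over `k` with prescribed values. -/
def freeHom (f : Gen → 𝒞) : FreeAlgebra k Gen →+* 𝒞 :=
  letI : Algebra k 𝒞 := Algebra.compHom 𝒞 (C : k →+* k⟦X⟧)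
  (FreeAlgebra.lift k f : FreeAlgebra k Gen →+* 𝒞)

theorem freeHom_ι (f : Gen → 𝒞) (g : Gen) : freeHom f (FreeAlgebra.ι k g) = f g :=
  letI : Algebra k 𝒞 := Algebra.compHom 𝒞 (C : k →+* k⟦X⟧)
  FreeAlgebra.lift_ι_apply f g

theorem freeHom_algebraMap (f : Gen → 𝒞) (c : k) :
    freeHom f (algebraMap k (FreeAlgebra k Gen) c) = algebraMap k⟦X⟧ 𝒞 (C c) :=
  letI : Algebra k 𝒞 := Algebra.compHom 𝒞 (C : k →+* k⟦X⟧)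
  (FreeAlgebra.lift k f).commutes c

theorem freeHom_smul (f : Gen → 𝒞) (c : k) (x : FreeAlgebra k Gen) :
    freeHom f (c • x) = (C c : k⟦X⟧) • freeHom f x := by
  rw [Algebra.smul_def, map_mul, freeHom_algebraMap, ← Algebra.smul_def]

theorem ofNat_smul_inj [CharZero k] (m : ℕ) [m.AtLeastTwo] {x y : 𝒞}
    (e : (OfNat.ofNat m : k⟦X⟧) • x = (OfNat.ofNat m : k⟦X⟧) • y) : x = y := by
  have h0 : (OfNat.ofNat m : k) ≠ 0 := OfNat.ofNat_ne_zero m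
  have := congrArg (fun z => (C (OfNat.ofNat m : k)⁻¹ : k⟦X⟧) • z) e
  simp only [smul_smul, ← map_ofNat (C : k →+* k⟦X⟧) m, ← map_mul, inv_mul_cancel₀ h0, map_one,
    one_smul] at this
  exact this

variable [HAdic k 𝒞] [HAdic k 𝒟]

theorem algebraMap_eq_hsum (c : k⟦X⟧) :
    algebraMap k⟦X⟧ 𝒞 c = hsum k fun n => algebraMap k⟦X⟧ 𝒞 (C (coeff n c)) := by
  refine eq_hsum fun n => ?_
  refine ⟨algebraMap k⟦X⟧ 𝒞 (PowerSeries.mk fun i => coeff (i + n) c), ?_⟩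
  have e : c = ∑ i ∈ Finset.range n, PowerSeries.X ^ i * C (coeff i c) +
      PowerSeries.X ^ n * (PowerSeries.mk fun i => coeff (i + n) c) := by
    conv_lhs => rw [PowerSeries.eq_X_pow_mul_shift_add_trunc n c, add_comm]
    congr 1
    ext m
    simp [PowerSeries.coeff_trunc, PowerSeries.coeff_mul_C, PowerSeries.coeff_X_pow]
  conv_lhs => rw [e]
  rw [map_add, map_sum, map_mul]
  simp only [Algebra.smul_def, map_mul]

/-- The continuous algebra homomorphism from the completed free algebra with prescribed values. -/
def serLift (f : Gen → 𝒞) : FreeSer k →ₐ[k⟦X⟧] 𝒞 where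
  toFun x := hsum k fun n => freeHom f (coeff n x)
  map_one' := by
    rw [hsum_eq_single] <;> simp [PowerSeries.coeff_one]
  map_zero' := by
    rw [hsum_eq_single] <;> simp
  map_add' x y := by
    rw [← hsum_add]
    simp only [map_add]
  map_mul' x y := by
    rw [hsum_mul_hsum]
    refine hsum_congr fun n => ?_
    rw [PowerSeries.coeff_mul, map_sum]
    simp only [map_mul]
  commutes' c := by
    rw [algebraMap_eq_hsum (𝒞 := 𝒞)]
    refine hsum_congr fun n => ?_
    rw [← freeHom_algebraMap f]
    rfl

theorem serLift_const (f : Gen → 𝒞) (x : FreeAlgebra k Gen) :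
    serLift f (C x) = freeHom f x := by
  change hsum k _ = _
  rw [hsum_eq_single]
  · simp
  · intro n
    simp

theorem serLift_smul (f : Gen → 𝒞) (c : k) (x : FreeSer k) :
    serLift f (c • x) = (C c : k⟦X⟧) • serLift f x := by
  change hsum k _ = _ • hsum k _
  rw [smul_hsum]
  simp only [PowerSeries.coeff_smul, freeHom_smul]

theorem serLift_X (f : Gen → 𝒞) : serLift f (PowerSeries.X : FreeSer k) = hbar k • (1 : 𝒞) := by
  have e : (PowerSeries.X : FreeSer k) = hbar k • 1 := by
    rw [Uh.smul_def, PowerSeries.map_X, mul_one]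
  rw [e, map_smul, map_one]

theorem serLift_expSer (f : Gen → 𝒞) (c : k) (g : Gen) :
    serLift f (expSer c (FreeAlgebra.ι k g)) = expH k ((C c : k⟦X⟧) • f g) := by
  change hsum k _ = hsum k _
  refine hsum_congr fun n => ?_
  rw [expSer, PowerSeries.coeff_mk, freeHom_smul, map_pow, freeHom_ι, smul_pow, smul_smul,
    ← map_pow, ← map_mul, one_div_mul_eq_div]

theorem hbar_smul_eq_X_mul (x : FreeSer k) : hbar k • x = PowerSeries.X * x := by
  rw [Uh.smul_def, PowerSeries.map_X]

/-- For each n, an element of the closed ideal lies in the ideal generated by the relations and hⁿ,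
whose image is contained in hⁿ𝒞. Separatedness of 𝒞 finishes. -/
theorem serLift_eq_zero (f : Gen → 𝒞)
    (hf : ∀ a b, QuantumRel k a b → serLift f a = serLift f b) {x : FreeSer k}
    (hx : x ∈ quantumIdeal k) : serLift f x = 0 := by
  refine HAdic.eq_zero (k := k) _ fun n => ?_
  have : TwoSidedIdeal.span
      ({x | ∃ a b, QuantumRel k a b ∧ x = a - b} ∪ {(PowerSeries.X : FreeSer k) ^ n}) ≤
      TwoSidedIdeal.comap (serLift f : FreeSer k →ₐ[k⟦X⟧] 𝒞) (hPow (hbar k) 𝒞 n).toTwoSided := by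
    refine TwoSidedIdeal.span_le.2 ?_
    rintro _ (⟨a, b, hab, rfl⟩ | rfl) <;>
      rw [SetLike.mem_coe, TwoSidedIdeal.mem_comap, Ideal.mem_toTwoSided]
    · rw [map_sub, hf a b hab, sub_self]
      exact zero_mem _
    · exact ⟨1, by rw [map_pow, serLift_X, smul_pow, one_pow]⟩
  have h := this ((Uh.mem_quantumIdeal k).1 hx n)
  rw [TwoSidedIdeal.mem_comap, Ideal.mem_toTwoSided] at h
  exact h

/-- Elements `X`, `V₊`, `V₋` from which a representation of `U_h(osp(2/1))` can be built. -/
structure IsQuantumTriple (X Vp Vm : 𝒞) : Prop where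
  X_Vp : X * Vp = Vp * X
  Vp_sq : (8 : k⟦X⟧) • hbar k • (Vp * Vp) = expH k X - expH k (-X)
  X_Vm : X * Vm = Vm * X + Vp
  H_Vm : (16 : k⟦X⟧) • ((Vp * Vm + Vm * Vp) * Vm - Vm * (Vp * Vm + Vm * Vp)) =
    Vm * (expH k X + expH k (-X)) + (expH k X + expH k (-X)) * Vm

namespace IsQuantumTriple

variable {X Vp Vm : 𝒞}

/-- The images of the generators. -/
def toFun (X Vp Vm : 𝒞) : Gen → 𝒞
  | .H => (C (-2 : k) : k⟦X⟧) • (Vp * Vm + Vm * Vp)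
  | .X => X
  | .Y => (C (-4 : k) : k⟦X⟧) • (Vm * Vm)
  | .Vp => Vp
  | .Vm => Vm

variable [CharZero k] [HTorsionFree k 𝒞] (t : IsQuantumTriple (k := k) X Vp Vm)

include t

theorem rel {a b : FreeSer k} (hab : QuantumRel k a b) :
    serLift (toFun (k := k) X Vp Vm) a = serLift (toFun (k := k) X Vp Vm) b := by
  have q1 := t.Vp_sq
  have q2 := t.H_Vm
  set T := expH k X with hT
  set T' := expH k (-X) with hT'
  have hch : serLift (toFun (k := k) X Vp Vm) (coshSer (FreeAlgebra.ι k Gen.X)) =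
      (C (1 / 2) : k⟦X⟧) • (T + T') := by
    rw [coshSer, serLift_smul, map_add, serLift_expSer, serLift_expSer]
    simp [toFun, hT, hT']
  have hsh : serLift (toFun (k := k) X Vp Vm) (sinhSer (FreeAlgebra.ι k Gen.X)) =
      (C (1 / 2) : k⟦X⟧) • (T - T') := by
    rw [sinhSer, serLift_smul, map_sub, serLift_expSer, serLift_expSer]
    simp [toFun, hT, hT']
  have hhalf : (8 : k⟦X⟧) * C (1 / 2 : k) = 4 := by
    rw [← map_ofNat (C : k →+* k⟦X⟧) 8, ← map_mul, ← map_ofNat (C : k →+* k⟦X⟧) 4]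
    norm_num
  have hhalf2 : (2 : k⟦X⟧) * C (1 / 2 : k) = 1 := by
    rw [← map_ofNat (C : k →+* k⟦X⟧) 2, ← map_mul, ← map_one (C : k →+* k⟦X⟧)]
    norm_num
  -- The quotient sinh(hX)/h is known through its product with h, so its image is found by
  -- cancelling h in `Vp_sq`.
  have hD : serLift (toFun (k := k) X Vp Vm) (sinhDivSer (FreeAlgebra.ι k Gen.X)) =
      (4 : k⟦X⟧) • (Vp * Vp) := by
    refine hbar_smul_inj (k := k) ?_
    rw [← map_smul, hbar_smul_eq_X_mul, X_mul_sinhDivSer, hsh, ← q1, smul_smul, smul_smul,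
      smul_smul]
    congr 1
    linear_combination (hbar k) * hhalf
  have c1 : T * Vp = Vp * T := expH_commute t.X_Vp
  have c2 : T' * Vp = Vp * T' := expH_commute (by rw [neg_mul, t.X_Vp, mul_neg])
  have d1 : T * Vm = Vm * T + hbar k • (Vp * T) := expH_derivation t.X_Vm t.X_Vp
  have d2 : T' * Vm = Vm * T' - hbar k • (Vp * T') := by
    have := expH_derivation (k := k) (z := -X) (y := Vm) (u := -Vp)
      (by rw [neg_mul, t.X_Vm, neg_add, mul_neg]) (by rw [neg_mul_neg, t.X_Vp, neg_mul_neg])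
    rw [neg_mul, smul_neg, ← sub_eq_add_neg] at this
    exact this
  have hhalf4 : (C (1 / 4 : k) : k⟦X⟧) = C (1 / 2 : k) * C (1 / 2 : k) := by
    rw [← map_mul]
    norm_num
  have key := QuantumRelations.of_triple (hbar k) (C (1 / 2 : k)) hhalf2
    (fun x y e => hbar_smul_inj e) t.X_Vp q1 t.X_Vm q2 c1 c2 d1 d2
  have n2 : (C (2 : k) : k⟦X⟧) = 2 := map_ofNat _ 2
  have n4 : (C (4 : k) : k⟦X⟧) = 4 := map_ofNat _ 4
  cases hab <;>
    simp only [map_add, map_sub, map_mul, map_neg, map_zero, serLift_smul, serLift_const,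
      freeHom_ι, serLift_X, hch, hsh, hD, neg_smul, toFun, n2, n4, hhalf4, smul_one_mul]
  · simpa only [neg_smul] using key.H_Vp
  · simpa only [neg_smul] using key.H_Vm
  · simpa only [neg_smul] using key.Vp_Vm
  · simpa only [neg_smul] using key.H_X
  · simpa only [neg_smul, smul_mul_assoc] using key.H_Y
  · simpa only [neg_smul] using key.X_Y
  · exact key.Vp_sq
  · simpa only [neg_smul] using key.Vm_sq
  · exact key.X_Vp
  · simpa only [neg_smul] using key.Y_Vm
  · exact key.X_Vm
  · simpa only [neg_smul] using key.Y_Vp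

/-- The homomorphism `U_h(osp(2/1)) → 𝒞` determined by `X`, `V₊`, `V₋`. -/
def lift : Uh k →ₐ[k⟦X⟧] 𝒞 :=
  Ideal.Quotient.liftₐ (quantumIdeal k).asIdeal (serLift (toFun (k := k) X Vp Vm)) fun _ hx =>
    serLift_eq_zero _ (fun _ _ => t.rel) hx

theorem lift_gen (g : Gen) : t.lift (Uh.gen k g) = toFun (k := k) X Vp Vm g :=
  (serLift_const _ _).trans (freeHom_ι _ _)

theorem lift_X : t.lift (Uh.X k) = X := t.lift_gen .X

theorem lift_Vp : t.lift (Uh.Vp k) = Vp := t.lift_gen .Vp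

theorem lift_Vm : t.lift (Uh.Vm k) = Vm := t.lift_gen .Vm

theorem lift_H : t.lift (Uh.H k) = -((2 : k⟦X⟧) • (Vp * Vm + Vm * Vp)) := by
  rw [Uh.H, t.lift_gen, toFun, map_neg, map_ofNat, neg_smul]

theorem lift_Y : t.lift (Uh.Y k) = -((4 : k⟦X⟧) • (Vm * Vm)) := by
  rw [Uh.Y, t.lift_gen, toFun, map_neg, map_ofNat, neg_smul]

theorem lift_Tpow (c : k) : t.lift (Uh.Tpow k c) = expH k ((C c : k⟦X⟧) • X) :=
  serLift_expSer _ c .X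

end IsQuantumTriple

end UniversalProperty

end SuperJordanian

end

noncomputable section

namespace SuperJordanian


open PowerSeries (C coeff)
open scoped Nat

/-! ### From `osp(2/1)` to the quantum superalgebra -/

theorem assoc_of_eq {M : Type*} [Semigroup M] {a b c : M} (e : a * b = c) (z : M) :
    a * (b * z) = c * z := by
  rw [← mul_assoc, e]

section Calculus

variable {R 𝒞 : Type*} [CommRing R] [Ring 𝒞] [Algebra R 𝒞]

/-- Commutation relations between (rescaled) generators `g`, `W`, `J` of `osp(2/1)` and functions
`T`, `T' = T⁻¹` of the positive even root vector. -/
structure TwistedCalculus (η : R) (W J g T T' : 𝒞) : Prop where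
  T_T' : T * T' = 1
  T'_T : T' * T = 1
  T_g : T * g = g * T
  T'_g : T' * g = g * T'
  T_W : T * W = W * T + (2 : R) • η • (g * T' + g)
  T'_W : T' * W = W * T' - (2 : R) • η • (g * (T' * (T' * T')) + g * (T' * T'))
  T_J : T * J = J * T - (2 : R) • (T - T')
  T'_J : T' * J = J * T' + (2 : R) • (T' - T' * (T' * T'))
  J_W : J * W = W * J - (2 : R) • W
  g_J : g * J = J * g - (2 : R) • (g * T')
  g_W : g * W + g * (T * W) = -J - W * g - W * (g * T)
  g_g : (2 : R) • η • (g * g + g * (g * T)) = T - 1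

/-- The element `8 V₋ T^{-1/2}`. -/
def kappa (η : R) (W J g T' : 𝒞) : 𝒞 := W - η • (J * g) - η • (g - g * T')

namespace TwistedCalculus

variable {η : R} {W J g T T' : 𝒞} (c : TwistedCalculus η W J g T T')
include c

/-- This is the relation for [H, V₋] with the powers T^{±1/2} stripped off. Only integral powers of
T remain, and putting all monomials in the order W, J, g, T proves it. -/
theorem kappa_bracket : (J * T + T + T') * kappa η W J g T' + (2 : R) • (kappa η W J g T' * T) =
    kappa η W J g T' * (J * T + T + T') := by
  simp only [kappa, mul_add, add_mul, mul_sub, sub_mul, mul_assoc, smul_mul_assoc, mul_smul_comm,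
    c.T_T', c.T'_T, c.T_g, c.T'_g, c.T_W, c.T'_W, c.T_J, c.T'_J, c.J_W, c.g_J,
    assoc_of_eq c.T_T', assoc_of_eq c.T'_T, assoc_of_eq c.T_g, assoc_of_eq c.T'_g,
    assoc_of_eq c.T_W, assoc_of_eq c.T'_W, assoc_of_eq c.T_J, assoc_of_eq c.T'_J,
    assoc_of_eq c.J_W, assoc_of_eq c.g_J, smul_add, smul_sub, one_mul, mul_one]
  module

/-- This is the bracket {V₊,V₋} without half-integral powers: v = g + gT, and κ - η(g + gT⁻¹) is
T^{-1/2}κT^{1/2} by `IsClassicalPair.conj_kappa`. The terms quadratic in g are removed by `g_g`, by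
its product with T⁻¹ on the right and by its product with J on the left. -/
theorem kappa_anticomm : (2 : R) • ((g + g * T) * (kappa η W J g T' - η • (g + g * T')) +
    kappa η W J g T' * (g + g * T)) = -((2 : R) • (J * T) + T - (2 : R) • 1 + T') := by
  have h1 := c.g_W
  have h2 : (2 : R) • η • (g * (g * T') + g * g) = 1 - T' := by
    have := congrArg (fun z => z * T') c.g_g
    simpa only [smul_mul_assoc, add_mul, sub_mul, mul_assoc, c.T_T', one_mul, mul_one] using this
  have h4 : (2 : R) • η • (J * (g * g) + J * (g * (g * T))) = J * T - J := by
    have := congrArg (fun z => J * z) c.g_g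
    simpa only [mul_smul_comm, mul_add, mul_sub, mul_one] using this
  simp only [kappa, mul_add, add_mul, mul_sub, sub_mul, mul_assoc, smul_mul_assoc, mul_smul_comm,
    c.T_T', c.T'_T, c.T_g, c.T'_g, c.T_W, c.T'_W, c.T_J, c.T'_J, c.J_W, c.g_J,
    assoc_of_eq c.T_T', assoc_of_eq c.T'_T, assoc_of_eq c.T_g, assoc_of_eq c.T'_g,
    assoc_of_eq c.T_W, assoc_of_eq c.T'_W, assoc_of_eq c.T_J, assoc_of_eq c.T'_J,
    assoc_of_eq c.J_W, assoc_of_eq c.g_J, smul_add, smul_sub, one_mul, mul_one] at h1 ⊢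
  have h3 := c.g_g
  linear_combination (norm := module) (2 : R) • h1 - (2 : R) • h4 - h3 + h2

end TwistedCalculus

theorem sq_mul_J_of_pair {v J : 𝒞} (hJ : J * v = v * J + (2 : R) • v) :
    v * v * J = J * (v * v) - (4 : R) • (v * v) := by
  have h1 := congrArg (fun z => v * z) hJ
  have h2 := congrArg (fun z => z * v) hJ
  simp only [mul_add, add_mul, mul_assoc, smul_mul_assoc, mul_smul_comm] at h1 h2 ⊢
  linear_combination (norm := module) -h1 - h2

theorem sq_mul_W_of_pair {v W J : 𝒞} (hJ : J * v = v * J + (2 : R) • v)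
    (h : J = -(v * W + W * v)) : v * v * W = W * (v * v) + (2 : R) • v := by
  have h1 := congrArg (fun z => v * z) h
  have h2 := congrArg (fun z => z * v) h
  simp only [mul_add, add_mul, mul_neg, neg_mul, neg_add, mul_assoc] at h1 h2 ⊢
  linear_combination (norm := module) h1 - h2 + hJ

end Calculus

section Classical

variable {k : Type*} [Field k]
variable {𝒞 𝒟 : Type*} [Ring 𝒞] [Algebra k⟦X⟧ 𝒞] [Ring 𝒟] [Algebra k⟦X⟧ 𝒟]

/-- Odd root vectors `v = v₊` and `W = 8 v₋` of a representation of `osp(2/1)`. -/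
structure IsClassicalPair (v W : 𝒞) : Prop where
  J_v : -(v * W + W * v) * v = v * -(v * W + W * v) + (2 : k⟦X⟧) • v
  J_W : -(v * W + W * v) * W = W * -(v * W + W * v) - (2 : k⟦X⟧) • W

namespace IsClassicalPair

theorem map {F : Type*} [FunLike F 𝒞 𝒟] [AlgHomClass F k⟦X⟧ 𝒞 𝒟] (f : F) {v W : 𝒞}
    (p : IsClassicalPair (k := k) v W) : IsClassicalPair (k := k) (f v) (f W) where
  J_v := by simpa only [map_neg, map_add, map_mul, map_smul] using congrArg f p.J_v
  J_W := by simpa only [map_neg, map_add, map_mul, map_sub, map_smul] using congrArg f p.J_W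

variable [HAdic k 𝒞] [HAdic k 𝒟]

variable (k) in
/-- The element `X = (1 / 2h) log (1 + 8 h v²)`. -/
def X (v : 𝒞) : 𝒞 := (C (1 / 2 : k) : k⟦X⟧) • hlog k ((8 : k⟦X⟧) • (v * v))

variable (k) in
/-- The powers of `T = (1 + 8 h v²)^{1/2}`. -/
def T (c : k) (v : 𝒞) : 𝒞 := expH k ((C c : k⟦X⟧) • X k v)

theorem map_X {F : Type*} [FunLike F 𝒞 𝒟] [AlgHomClass F k⟦X⟧ 𝒞 𝒟] (f : F) (v : 𝒞) :
    f (X k v) = X k (f v) := by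
  rw [X, map_smul, map_hlog, map_smul, map_mul, X]

theorem map_T {F : Type*} [FunLike F 𝒞 𝒟] [AlgHomClass F k⟦X⟧ 𝒞 𝒟] (f : F) (c : k) (v : 𝒞) :
    f (T k c v) = T k c (f v) := by
  rw [T, map_expH, map_smul, map_X, T]

theorem T_one (v : 𝒞) : T k 1 v = expH k (X k v) := by
  rw [T, map_one, one_smul]

theorem T_neg_one (v : 𝒞) : T k (-1) v = expH k (-X k v) := by
  rw [T, map_neg, map_one, neg_one_smul]

theorem T_zero (v : 𝒞) : T k 0 v = 1 := by
  rw [T, map_zero, zero_smul, expH_zero]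

/-- X and all T^c are series in v², so commutation with v² is enough. In particular an element that
anticommutes with v commutes with X. -/
theorem X_mul_comm {v y : 𝒞} (h : v * v * y = y * (v * v)) : X k v * y = y * X k v := by
  rw [X, smul_mul_assoc, mul_smul_comm, hlog_mul_comm]
  rw [smul_mul_assoc, mul_smul_comm, h]

theorem T_mul_comm (c : k) {v y : 𝒞} (h : v * v * y = y * (v * v)) :
    T k c v * y = y * T k c v :=
  expH_commute (by rw [smul_mul_assoc, mul_smul_comm, X_mul_comm h])

theorem X_mul_self (v : 𝒞) : X k v * v = v * X k v := X_mul_comm (mul_assoc v v v)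

theorem T_mul_self (c : k) (v : 𝒞) : T k c v * v = v * T k c v := T_mul_comm c (mul_assoc v v v)

theorem X_mul_T (c : k) (v : 𝒞) : X k v * T k c v = T k c v * X k v :=
  (T_mul_comm c (X_mul_comm rfl).symm).symm

theorem T_eq_one_add (c : k) (v : 𝒞) : ∃ y : 𝒞, T k c v = 1 + hbar k • y := by
  obtain ⟨y, hy⟩ := expH_eq_one_add (k := k) ((C c : k⟦X⟧) • X k v)
  exact ⟨(C c : k⟦X⟧) • X k v + hbar k • y, by
    rw [T, hy, pow_two, mul_smul, add_assoc, ← smul_add]⟩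

variable [CharZero k]

theorem T_mul_T (c d : k) (v : 𝒞) : T k c v * T k d v = T k (c + d) v := by
  rw [T, T, T, ← expH_add, map_add, add_smul]
  rw [smul_mul_smul_comm, smul_mul_smul_comm, mul_comm]

/-- The factor ½ in X is cancelled by the exponent 2, and exp inverts the logarithm. -/
theorem T_sq (v : 𝒞) : T k 1 v * T k 1 v = 1 + (8 : k⟦X⟧) • hbar k • (v * v) := by
  have e : T k 2 v = 1 + hbar k • ((8 : k⟦X⟧) • (v * v)) := by
    rw [← expH_hlog, T, X, smul_smul, ← map_mul]
    norm_num
  rw [T_mul_T, one_add_one_eq_two, e, smul_comm]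

variable (k) in
-- T is 1 modulo h, so 1 + T is 2 times a unit of the form 1 + hz; 2 is invertible in characteristic
-- zero.
theorem isUnit_one_add_T (v : 𝒞) : IsUnit (1 + T k 1 v) := by
  obtain ⟨y, hy⟩ := T_eq_one_add (k := k) 1 v
  have e : 1 + T k 1 v = (2 : k⟦X⟧) • (1 + hbar k • ((C (1 / 2 : k) : k⟦X⟧) • y)) := by
    have h2 : (2 : k⟦X⟧) * C (1 / 2 : k) = 1 := by
      rw [← map_ofNat (C : k →+* k⟦X⟧) 2, ← map_mul, ← map_one (C : k →+* k⟦X⟧)]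
      norm_num
    rw [hy, smul_add, smul_comm (2 : k⟦X⟧) (hbar k), smul_smul (2 : k⟦X⟧), h2, one_smul, two_smul]
    abel
  have h2 : IsUnit (2 : k⟦X⟧) := by
    have := (isUnit_iff_ne_zero.2 (two_ne_zero' k)).map (C : k →+* k⟦X⟧)
    rwa [map_ofNat] at this
  rw [e, Algebra.smul_def]
  exact (h2.map (algebraMap k⟦X⟧ 𝒞)).mul (isUnit_one_add_hbar_smul k _)

variable (k) in
/-- The element `g = v (1 + T)⁻¹`. -/
def g (v : 𝒞) : 𝒞 := v * ↑(isUnit_one_add_T k v).unit⁻¹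

theorem g_mul (v : 𝒞) : g k v * (1 + T k 1 v) = v := by
  rw [g, mul_assoc]
  have : (↑(isUnit_one_add_T k v).unit⁻¹ : 𝒞) * (1 + T k 1 v) = 1 :=
    (isUnit_one_add_T k v).unit.inv_mul
  rw [this, mul_one]

/-- This characterisation gives the naturality of g; the behaviour of g under signs and commutation
is likewise obtained by multiplying by the unit 1 + T. -/
theorem eq_g {v z : 𝒞} (h : z * (1 + T k 1 v) = v) : z = g k v :=
  (isUnit_one_add_T k v).mul_right_cancel (h.trans (g_mul v).symm)

theorem map_g {F : Type*} [FunLike F 𝒞 𝒟] [AlgHomClass F k⟦X⟧ 𝒞 𝒟] (f : F) (v : 𝒞) :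
    f (g k v) = g k (f v) :=
  eq_g (by rw [← map_T, ← map_one f, ← map_add, ← map_mul, g_mul])

theorem T_mul_g (c : k) (v : 𝒞) : T k c v * g k v = g k v * T k c v := by
  refine (isUnit_one_add_T k v).mul_right_cancel ?_
  have e : T k c v * (1 + T k 1 v) = (1 + T k 1 v) * T k c v := by
    rw [mul_add, add_mul, T_mul_T, T_mul_T, add_comm c, mul_one, one_mul]
  rw [mul_assoc, g_mul, T_mul_self, mul_assoc, e, ← mul_assoc, g_mul]

theorem g_mul_self (v : 𝒞) : g k v * v = v * g k v := by
  have h := T_mul_g (k := k) 1 v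
  have e := g_mul (k := k) v
  have e1 : v * (1 + T k 1 v) = (1 + T k 1 v) * v := by
    rw [mul_add, add_mul, T_mul_self, mul_one, one_mul]
  refine (isUnit_one_add_T k v).mul_right_cancel ?_
  rw [mul_assoc, e1, ← mul_assoc, e, mul_assoc, e]

theorem g_eq (v : 𝒞) : g k v + g k v * T k 1 v = v := by
  rw [← mul_one_add, g_mul]

variable {v W J : 𝒞} (p : IsClassicalPair (k := k) v W) (hJ : J = -(v * W + W * v))
include p hJ

/-- From [8v², W] = 16v and the derivative of (1/2h) log(1 + 8hv²), where 1 + 8hv² = T². -/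
theorem X_W : X k v * W = W * X k v + (8 : k⟦X⟧) • (v * T k (-2) v) := by
  have e1 := hJ ▸ p.J_v
  have e2 : ((8 : k⟦X⟧) • (v * v)) * W = W * ((8 : k⟦X⟧) • (v * v)) + (16 : k⟦X⟧) • v := by
    rw [smul_mul_assoc, sq_mul_W_of_pair e1 hJ, mul_smul_comm]
    module
  have e3 := hlog_derivation (k := k) e2 (by
    simp only [smul_mul_assoc, mul_smul_comm, mul_assoc]
    module)
  have e4 : expH k (-hlog k ((8 : k⟦X⟧) • (v * v))) = T k (-2) v := by
    rw [T, X, smul_smul, ← map_mul]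
    norm_num
  rw [e4] at e3
  rw [X, smul_mul_assoc, e3, smul_add, mul_smul_comm, smul_mul_assoc, smul_smul _ (16 : k⟦X⟧)]
  congr 2
  rw [← map_ofNat (C : k →+* k⟦X⟧) 16, ← map_ofNat (C : k →+* k⟦X⟧) 8, ← map_mul]
  norm_num

theorem X_J : X k v * J = J * X k v - (16 : k⟦X⟧) • (v * v * T k (-2) v) := by
  have e1 := hJ ▸ p.J_v
  have e2 : ((8 : k⟦X⟧) • (v * v)) * J = J * ((8 : k⟦X⟧) • (v * v)) + -((32 : k⟦X⟧) • (v * v)) := by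
    rw [smul_mul_assoc, sq_mul_J_of_pair e1, mul_smul_comm]
    module
  have e3 := hlog_derivation (k := k) e2 (by
    simp only [smul_mul_assoc, mul_smul_comm, mul_assoc, mul_neg, neg_mul]
    module)
  have e4 : expH k (-hlog k ((8 : k⟦X⟧) • (v * v))) = T k (-2) v := by
    rw [T, X, smul_smul, ← map_mul]
    norm_num
  rw [e4] at e3
  rw [X, smul_mul_assoc, e3, smul_add, mul_smul_comm, neg_mul, smul_neg, ← sub_eq_add_neg,
    smul_mul_assoc (32 : k⟦X⟧), smul_smul _ (32 : k⟦X⟧)]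
  congr 2
  rw [← map_ofNat (C : k →+* k⟦X⟧) 16, ← map_ofNat (C : k →+* k⟦X⟧) 32, ← map_mul]
  norm_num

theorem T_W (c : k) : T k c v * W =
    W * T k c v + (8 : k⟦X⟧) • (C c : k⟦X⟧) • hbar k • (v * T k (c - 2) v) := by
  have e := p.X_W hJ
  have e2 : v * T k (-2) v * T k c v = v * T k (c - 2) v := by
    rw [mul_assoc, T_mul_T]
    ring_nf
  rw [T, expH_derivation (u := (8 : k⟦X⟧) • (C c : k⟦X⟧) • (v * T k (-2) v)) (y := W), ← T,
    smul_mul_assoc, smul_mul_assoc, e2]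
  · module
  · rw [smul_mul_assoc, e, smul_add, mul_smul_comm, smul_comm (C c)]
  · have e5 : X k v * (v * T k (-2) v) = v * T k (-2) v * X k v := by
      rw [← mul_assoc, X_mul_self, mul_assoc, X_mul_T, mul_assoc]
    simp only [smul_mul_assoc, mul_smul_comm, e5]
    module

theorem T_J (c : k) : T k c v * J =
    J * T k c v - (2 : k⟦X⟧) • (C c : k⟦X⟧) • (T k c v - T k (c - 2) v) := by
  have e := p.X_J hJ
  -- This is 8hv² = T² - 1 multiplied by T^{c-2}; it turns the commutator into a difference of
  -- powers of T.
  have e2 : (8 : k⟦X⟧) • hbar k • (v * v * T k (-2) v * T k c v) = T k c v - T k (c - 2) v := by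
    have := congrArg (fun z => z * T k (c - 2) v) (T_sq (k := k) v)
    rw [T_mul_T, T_mul_T, add_mul, one_mul, smul_mul_assoc, smul_mul_assoc] at this
    rw [mul_assoc, T_mul_T, eq_sub_iff_add_eq', show (-2 : k) + c = c - 2 by ring, ← this]
    ring_nf
  rw [T, expH_derivation (u := -((16 : k⟦X⟧) • (C c : k⟦X⟧) • (v * v * T k (-2) v))) (y := J), ← T,
    ← e2]
  · rw [neg_mul, smul_mul_assoc, smul_mul_assoc]
    module
  · rw [smul_mul_assoc, e, smul_sub, mul_smul_comm, smul_comm (C c), sub_eq_add_neg]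
  · have e5 : X k v * (v * v * T k (-2) v) = v * v * T k (-2) v * X k v := by
      rw [← mul_assoc, X_mul_comm rfl, mul_assoc, X_mul_T, ← mul_assoc]
    simp only [smul_mul_assoc, mul_smul_comm, mul_neg, neg_mul, e5]
    module

/-- Replacing v by g + gT in the commutation rules of T with W and J makes them polynomial in g and
T^{±1}, with η = 4h. The relations of g itself are obtained from those of v. -/
theorem twistedCalculus : TwistedCalculus ((4 : k⟦X⟧) * hbar k) W J (g k v) (T k 1 v)
    (T k (-1) v) where
  T_T' := by rw [T_mul_T, add_neg_cancel, T_zero]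
  T'_T := by rw [T_mul_T, neg_add_cancel, T_zero]
  T_g := T_mul_g 1 v
  T'_g := T_mul_g (-1) v
  T_W := by
    have e : v * T k (1 - 2) v = g k v * T k (-1) v + g k v := by
      nth_rw 1 [← g_eq (k := k) v]
      rw [add_mul, mul_assoc, T_mul_T]
      norm_num [T_zero]
    rw [p.T_W hJ, e, map_one]
    module
  T'_W := by
    have e : v * T k (-1 - 2) v = g k v * (T k (-1) v * (T k (-1) v * T k (-1) v)) +
        g k v * (T k (-1) v * T k (-1) v) := by
      nth_rw 1 [← g_eq (k := k) v]
      rw [add_mul, mul_assoc, T_mul_T, T_mul_T, T_mul_T]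
      norm_num
    rw [p.T_W hJ, e, map_neg, map_one]
    module
  T_J := by
    rw [p.T_J hJ, map_one, one_smul]
    norm_num
  T'_J := by
    rw [p.T_J hJ, T_mul_T, T_mul_T, map_neg, map_one, show (-1 : k) + (-1 + -1) = -1 - 2 by norm_num]
    module
  J_W := hJ ▸ p.J_W
  g_J := by
    have e1 : J * v = v * J + (2 : k⟦X⟧) • v := hJ ▸ p.J_v
    have e2 := p.T_J hJ 1
    rw [map_one, one_smul, show (1 : k) - 2 = -1 by norm_num] at e2
    have e3 := g_eq (k := k) v
    have e4 : T k (-1) v * T k 1 v = 1 := by rw [T_mul_T, neg_add_cancel, T_zero]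
    -- After multiplication by 1 + T on the right, the relation follows from the commutation rules
    -- of J with v and with T.
    refine (isUnit_one_add_T k v).mul_right_cancel ?_
    linear_combination (norm := (simp only [mul_add, add_mul, mul_sub, sub_mul, mul_assoc,
      smul_mul_assoc, mul_smul_comm, smul_add, smul_sub, mul_one, e4]; module))
      -(g k v * e2) + e3 * J - J * e3 - e1 + (2 : k⟦X⟧) • e3
  g_W := by
    have e3 := g_eq (k := k) v
    linear_combination (norm := (simp only [mul_add, add_mul, mul_assoc]; module))
      e3 * W + W * e3 + hJ
  g_g := by
    refine (isUnit_one_add_T k v).mul_right_cancel ?_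
    have e := T_sq (k := k) v
    rw [smul_mul_assoc, smul_mul_assoc, ← mul_add, g_eq, g_mul_self, mul_assoc, g_mul, sub_mul,
      mul_add, mul_one, one_mul, e]
    module

variable (k) in
/-- The element `V₊ = v T^{-1/2}`. -/
def Vp (v : 𝒞) : 𝒞 := v * T k (-(1 / 2)) v

variable (k) in
/-- The element `V₋`. -/
def Vm (v W : 𝒞) : 𝒞 := (C (1 / 8 : k) : k⟦X⟧) •
  (kappa ((4 : k⟦X⟧) * hbar k) W (-(v * W + W * v)) (g k v) (T k (-1) v) * T k (1 / 2) v)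


/-- Conjugation by T^{-1/2} fixes g and T, sends W to W - 4h vT⁻² and J to J + 1 - T⁻². The
half-integral powers in V₊V₋ are absorbed in this way. -/
theorem conj_kappa {κ : 𝒞} (hκ : κ = kappa ((4 : k⟦X⟧) * hbar k) W J (g k v) (T k (-1) v)) :
    T k (-(1 / 2)) v * κ * T k (1 / 2) v =
      κ - ((4 : k⟦X⟧) * hbar k) • (g k v + g k v * T k (-1) v) := by
  have e1 := p.T_W hJ (-(1 / 2))
  have e2 := p.T_J hJ (-(1 / 2))
  have a : T k (-(1 / 2)) v * T k (1 / 2) v = 1 := by rw [T_mul_T, neg_add_cancel, T_zero]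
  have a2 : T k (-(1 / 2) - 2) v * T k (1 / 2) v = T k (-1) v * T k (-1) v := by
    rw [T_mul_T, T_mul_T]
    ring_nf
  have c : T k (-(1 / 2)) v * g k v = g k v * T k (-(1 / 2)) v := T_mul_g _ v
  have c' : g k v * T k (1 / 2) v = T k (1 / 2) v * g k v := (T_mul_g _ v).symm
  have d : T k (-1) v * T k (1 / 2) v = T k (1 / 2) v * T k (-1) v := by
    rw [T_mul_T, T_mul_T, add_comm]
  have d' : T k (-(1 / 2)) v * T k (-1) v = T k (-1) v * T k (-(1 / 2)) v := by
    rw [T_mul_T, T_mul_T, add_comm]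
  have e3 := g_eq (k := k) v
  have e4 : T k 1 v * T k (-1) v = 1 := by rw [T_mul_T, add_neg_cancel, T_zero]
  have h1 : T k (-(1 / 2)) v * W * T k (1 / 2) v =
      W - (4 : k⟦X⟧) • hbar k • (g k v * (T k (-1) v * T k (-1) v) + g k v * T k (-1) v) := by
    have e5 : v * (T k (-1) v * T k (-1) v) =
        g k v * (T k (-1) v * T k (-1) v) + g k v * T k (-1) v := by
      nth_rw 1 [← e3]
      rw [add_mul, mul_assoc (g k v), ← mul_assoc (T k 1 v), e4, one_mul]
    rw [e1, add_mul, smul_mul_assoc, smul_mul_assoc, smul_mul_assoc, mul_assoc, mul_assoc, a, a2,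
      mul_one, e5, smul_smul (8 : k⟦X⟧), sub_eq_add_neg]
    have : (8 : k⟦X⟧) * C (-(1 / 2) : k) = -4 := by
      rw [← map_ofNat (C : k →+* k⟦X⟧) 8, ← map_mul, ← map_ofNat (C : k →+* k⟦X⟧) 4, ← map_neg]
      norm_num
    rw [this, neg_smul]
  have h2 : T k (-(1 / 2)) v * J * T k (1 / 2) v = J + 1 - T k (-1) v * T k (-1) v := by
    have : (2 : k⟦X⟧) * C (-(1 / 2) : k) = -1 := by
      rw [← map_ofNat (C : k →+* k⟦X⟧) 2, ← map_mul, ← map_one (C : k →+* k⟦X⟧), ← map_neg]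
      norm_num
    rw [e2, smul_smul, this, neg_one_smul, sub_neg_eq_add, add_mul, mul_assoc, a, sub_mul, a, a2,
      mul_one]
    abel
  have h3 : T k (-(1 / 2)) v * (J * g k v) * T k (1 / 2) v =
      T k (-(1 / 2)) v * J * T k (1 / 2) v * g k v := by
    simp only [mul_assoc, c']
  have h4 : T k (-(1 / 2)) v * g k v * T k (1 / 2) v = g k v := by
    rw [c, mul_assoc, a, mul_one]
  have h5 : T k (-(1 / 2)) v * (g k v * T k (-1) v) * T k (1 / 2) v = g k v * T k (-1) v := by
    rw [mul_assoc, mul_assoc (g k v), d, ← mul_assoc, ← mul_assoc, h4]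
  have t := (T_mul_g (k := k) (-1) v)
  rw [hκ, kappa]
  simp only [mul_sub, sub_mul, mul_smul_comm, smul_mul_assoc, h1, h3, h2, h4, h5, add_mul, one_mul,
    mul_assoc, t, assoc_of_eq t]
  module

/-- Multiplied by T^{1/2} this becomes [X, V₋] = V₊. The term of [X, Jg] quadratic in v is removed
by 8hv² = T² - 1. -/
theorem X_kappa {κ : 𝒞} (hκ : κ = kappa ((4 : k⟦X⟧) * hbar k) W J (g k v) (T k (-1) v)) :
    X k v * κ = κ * X k v + (8 : k⟦X⟧) • (v * T k (-1) v) := by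
  have e1 := p.X_W hJ
  have e2 := p.X_J hJ
  have a : T k (-2) v = T k (-1) v * T k (-1) v := by
    rw [T_mul_T]
    norm_num
  have b := X_mul_T (k := k) (-1) v
  have c : X k v * g k v = g k v * X k v := by
    refine X_mul_comm ?_
    rw [mul_assoc, ← g_mul_self, ← mul_assoc, ← g_mul_self, mul_assoc]
  have e3 := g_eq (k := k) v
  have e4 : T k 1 v * T k (-1) v = 1 := by rw [T_mul_T, add_neg_cancel, T_zero]
  have e5 : T k (-1) v * T k 1 v = 1 := by rw [T_mul_T, neg_add_cancel, T_zero]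
  have t := T_mul_g (k := k) (-1) v
  have t' := T_mul_g (k := k) 1 v
  have h1 : v * (T k (-1) v * T k (-1) v) =
      g k v * (T k (-1) v * T k (-1) v) + g k v * T k (-1) v := by
    nth_rw 1 [← e3]
    rw [add_mul, mul_assoc (g k v), ← mul_assoc (T k 1 v), e4, one_mul]
  have h2 : v * T k (-1) v = g k v * T k (-1) v + g k v := by
    nth_rw 1 [← e3]
    rw [add_mul, mul_assoc, e4, mul_one]
  have h3 : (8 : k⟦X⟧) • hbar k • (v * v * T k (-2) v * g k v) =
      g k v - g k v * (T k (-1) v * T k (-1) v) := by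
    have := congrArg (fun z => z * (T k (-2) v * g k v)) (T_sq (k := k) v)
    simp only [add_mul, a, one_mul, smul_mul_assoc, mul_assoc, e4, assoc_of_eq e4, t, mul_one,
      assoc_of_eq t, assoc_of_eq t'] at this ⊢
    linear_combination (norm := module) -this
  rw [hκ, kappa]
  have h4 := congrArg (fun z => z * g k v) e2
  simp only [mul_sub, sub_mul, mul_smul_comm, smul_mul_assoc, mul_assoc, a, h1, h2, c, b,
    assoc_of_eq c, assoc_of_eq b, e1] at h3 h4 ⊢
  linear_combination (norm := module) -((4 : k⟦X⟧) * hbar k) • h4 + (8 : k⟦X⟧) • h3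

omit p hJ in
theorem eq_Vm_smul (v W : 𝒞) : (8 : k⟦X⟧) • Vm k v W =
    kappa ((4 : k⟦X⟧) * hbar k) W (-(v * W + W * v)) (g k v) (T k (-1) v) * T k (1 / 2) v := by
  rw [Vm, smul_smul, ← map_ofNat (C : k →+* k⟦X⟧) 8, ← map_mul]
  norm_num

/-- 8V₊V₋ = v(T^{-1/2}κT^{1/2}) and 8V₋V₊ = κv, so `conj_kappa` and `kappa_anticomm` apply. With H =
-2{V₊,V₋} the result says 8H = 2JT + T - 2 + T⁻¹, a deformation of 8J₀ = 2J. -/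
theorem anticomm_Vp_Vm : (16 : k⟦X⟧) • (Vp k v * Vm k v W + Vm k v W * Vp k v) =
    -((2 : k⟦X⟧) • (J * T k 1 v) + T k 1 v - (2 : k⟦X⟧) • 1 + T k (-1) v) := by
  have e := eq_Vm_smul (k := k) v W
  rw [← hJ] at e
  set κ := kappa ((4 : k⟦X⟧) * hbar k) W J (g k v) (T k (-1) v) with hκ
  have h := p.conj_kappa hJ hκ
  have h2 := (p.twistedCalculus hJ).kappa_anticomm
  rw [← hκ, g_eq] at h2
  rw [← h2, ← h]
  have h3 : T k (1 / 2) v * (v * T k (-(1 / 2)) v) = v := by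
    rw [← mul_assoc, T_mul_self, mul_assoc, T_mul_T, add_neg_cancel, T_zero, mul_one]
  have h4 : (8 : k⟦X⟧) • (Vp k v * Vm k v W) = v * (T k (-(1 / 2)) v * κ * T k (1 / 2) v) := by
    rw [← mul_smul_comm, e, Vp]
    simp only [mul_assoc]
  have h5 : (8 : k⟦X⟧) • (Vm k v W * Vp k v) = κ * v := by
    rw [← smul_mul_assoc, e, Vp, mul_assoc, h3]
  rw [← h4, ← h5]
  module

variable (k) in
omit hJ in
-- `Vp_sq` is T² = 1 + 8hv² times T⁻¹, `X_Vm` is `X_kappa` times T^{1/2}, and `H_Vm` is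
-- `kappa_bracket` times T^{1/2}, in view of the value of {V₊,V₋}.
theorem isQuantumTriple : IsQuantumTriple (k := k) (X k v) (Vp k v) (Vm k v W) where
  X_Vp := by
    rw [Vp, ← mul_assoc, X_mul_self, mul_assoc, X_mul_T, mul_assoc]
  Vp_sq := by
    have e : Vp k v * Vp k v = v * v * T k (-1) v := by
      rw [Vp, mul_assoc, ← mul_assoc (T k _ v) v, T_mul_self, mul_assoc, T_mul_T, mul_assoc]
      norm_num
    have e2 := congrArg (fun z => z * T k (-1) v) (T_sq (k := k) v)
    simp only [add_mul, mul_assoc, T_mul_T, add_neg_cancel, add_zero, one_mul, smul_mul_assoc,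
      add_neg_cancel_right] at e2
    rw [e, ← T_one, ← T_neg_one, e2, mul_assoc, add_sub_cancel_left]
  X_Vm := by
    have e := eq_Vm_smul (k := k) v W
    set J := -(v * W + W * v) with hJ
    set κ := kappa ((4 : k⟦X⟧) * hbar k) W J (g k v) (T k (-1) v) with hκ
    have h := p.X_kappa hJ hκ
    refine ofNat_smul_inj (k := k) 8 ?_
    have e2 : T k (-1) v * T k (1 / 2) v = T k (-(1 / 2)) v := by
      rw [T_mul_T]
      norm_num
    rw [smul_add, ← mul_smul_comm, ← smul_mul_assoc, e, ← mul_assoc, h, add_mul, mul_assoc, X_mul_T,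
      ← mul_assoc, smul_mul_assoc, mul_assoc v, e2, Vp]
  H_Vm := by
    have e := eq_Vm_smul (k := k) v W
    set J := -(v * W + W * v) with hJ
    have ha := p.anticomm_Vp_Vm hJ
    set κ := kappa ((4 : k⟦X⟧) * hbar k) W J (g k v) (T k (-1) v) with hκ
    have hc := (p.twistedCalculus hJ).kappa_bracket
    rw [← hκ] at hc
    have e2 : T k (1 / 2) v * J = J * T k (1 / 2) v - (T k (1 / 2) v - T k (1 / 2 - 2) v) := by
      have : (2 : k⟦X⟧) * C (1 / 2 : k) = 1 := by
        rw [← map_ofNat (C : k →+* k⟦X⟧) 2, ← map_mul, ← map_one (C : k →+* k⟦X⟧)]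
        norm_num
      rw [p.T_J hJ, smul_smul, this, one_smul]
    refine ofNat_smul_inj (k := k) 8 ?_
    rw [← T_one, ← T_neg_one]
    have h1 : T k 1 v * T k (1 / 2) v = T k (1 / 2) v * T k 1 v := by
      rw [T_mul_T, T_mul_T, add_comm]
    have h2 : T k (-1) v * T k (1 / 2) v = T k (1 / 2) v * T k (-1) v := by
      rw [T_mul_T, T_mul_T, add_comm]
    have h3 : T k (1 / 2 - 2) v * T k 1 v = T k (1 / 2) v * T k (-1) v := by
      rw [T_mul_T, T_mul_T]
      ring_nf
    -- Both sides are multiplied by 8 so that κT^{1/2} replaces 8V₋; the scalar term of {V₊,V₋}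
    -- drops out of the bracket.
    have h5 := congrArg (fun z => z * T k (1 / 2) v) hc
    change (8 : k⟦X⟧) • _ = (8 : k⟦X⟧) • _
    linear_combination (norm := (simp only [mul_add, add_mul, mul_sub, sub_mul, mul_neg, neg_mul,
      mul_assoc, smul_mul_assoc, mul_smul_comm, mul_one, one_mul, h1, h2, h3]; module))
      (8 : k⟦X⟧) • (ha * Vm k v W - Vm k v W * ha)
        - ((2 : k⟦X⟧) • (J * T k 1 v + T k 1 v + T k (-1) v - 1)) * e
        + e * ((2 : k⟦X⟧) • (J * T k 1 v - 1)) - (2 : k⟦X⟧) • h5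
        + (2 : k⟦X⟧) • (κ * e2 * T k 1 v)

section Lift

variable [HTorsionFree k 𝒞]

variable (k) in
omit hJ J in
/-- The homomorphism `U_h(osp(2/1)) → 𝒞` defined by a classical pair in `𝒞`. -/
def lift : Uh k →ₐ[k⟦X⟧] 𝒞 := (p.isQuantumTriple k).lift

omit hJ in
theorem lift_X : p.lift k (Uh.X k) = X k v := IsQuantumTriple.lift_X _

omit hJ in
theorem lift_Vp : p.lift k (Uh.Vp k) = Vp k v := IsQuantumTriple.lift_Vp _

omit hJ in
theorem lift_Vm : p.lift k (Uh.Vm k) = Vm k v W := IsQuantumTriple.lift_Vm _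

omit hJ in
theorem lift_Tpow (c : k) : p.lift k (Uh.Tpow k c) = T k c v := IsQuantumTriple.lift_Tpow _ c

end Lift

end IsClassicalPair

end Classical

end SuperJordanian

end

noncomputable section

namespace SuperJordanian


open PowerSeries (C coeff)
open scoped Nat

/-! ### Topological freeness of `U_h(osp(2/1))` -/

section PowerSeriesModule

variable {k : Type*} [Field k] {A : Type*} [Ring A]

theorem hbar_pow_smul [Algebra k⟦X⟧ A⟦X⟧] (hX : ∀ x : A⟦X⟧, hbar k • x = PowerSeries.X * x)
    (n : ℕ) (x : A⟦X⟧) : hbar k ^ n • x = PowerSeries.X ^ n * x := by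
  induction n with
  | zero => rw [pow_zero, one_smul, pow_zero, one_mul]
  | succ n ih => rw [pow_succ', mul_smul, ih, hX, pow_succ', mul_assoc]

theorem HAdic.powerSeries [Algebra k⟦X⟧ A⟦X⟧] (hX : ∀ x : A⟦X⟧, hbar k • x = PowerSeries.X * x) :
    HAdic k A⟦X⟧ where
  eq_zero x hx := by
    ext n
    obtain ⟨y, rfl⟩ := hx (n + 1)
    rw [hbar_pow_smul hX, PowerSeries.coeff_X_pow_mul', if_neg (by simp), map_zero]
  exists_sum a := by
    refine ⟨PowerSeries.mk fun m => ∑ i ∈ Finset.range (m + 1), coeff (m - i) (a i), fun n => ?_⟩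
    refine ⟨PowerSeries.mk fun m => ∑ i ∈ Finset.range (m + n + 1), coeff (m + n - i) (a i) -
      ∑ i ∈ Finset.range n, coeff (m + n - i) (a i), ?_⟩
    ext m
    simp only [hbar_pow_smul hX, map_add, map_sum, PowerSeries.coeff_X_pow_mul',
      PowerSeries.coeff_mk]
    split_ifs with h
    · have e : ∀ i ∈ Finset.range n, (if i ≤ m then coeff (m - i) (a i) else 0) =
          coeff (m - i) (a i) := fun i hi => if_pos ((Finset.mem_range.1 hi).le.trans h)
      rw [Nat.sub_add_cancel h, Finset.sum_congr rfl e, add_sub_cancel]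
    · rw [add_zero, ← Finset.sum_filter]
      refine Finset.sum_congr ?_ fun _ _ => rfl
      ext i
      simp only [Finset.mem_range, Finset.mem_filter]
      lia

theorem HTorsionFree.powerSeries [Algebra k⟦X⟧ A⟦X⟧]
    (hX : ∀ x : A⟦X⟧, hbar k • x = PowerSeries.X * x) : HTorsionFree k A⟦X⟧ where
  eq_zero x hx := by
    ext n
    have := congrArg (coeff (n + 1)) hx
    rwa [hX, PowerSeries.coeff_succ_X_mul, map_zero] at this

end PowerSeriesModule

section Adic

variable {k : Type*} [Field k] {𝒞 𝒟 : Type*} [Ring 𝒞] [Algebra k⟦X⟧ 𝒞] [Ring 𝒟] [Algebra k⟦X⟧ 𝒟]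

theorem smodEq_hbar_iff {x y : 𝒞} {n : ℕ} :
    x ≡ y [SMOD (Ideal.span {hbar k} ^ n • ⊤ : Submodule k⟦X⟧ 𝒞)] ↔
      ∃ z : 𝒞, x = y + hbar k ^ n • z := by
  rw [SModEq.sub_mem, Ideal.span_singleton_pow, Submodule.ideal_span_singleton_smul,
    Submodule.mem_smul_pointwise_iff_exists]
  constructor
  · rintro ⟨z, -, hz⟩
    exact ⟨z, by rw [hz, add_sub_cancel]⟩
  · rintro ⟨z, rfl⟩
    exact ⟨z, trivial, by rw [add_sub_cancel_left]⟩

theorem HAdic.isAdicComplete [HAdic k 𝒞] : IsAdicComplete (Ideal.span {hbar k}) 𝒞 where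
  haus' x hx := by
    refine HAdic.eq_zero (k := k) x fun n => ?_
    obtain ⟨z, hz⟩ := smodEq_hbar_iff.1 (hx n)
    exact ⟨z, by rw [hz, zero_add]⟩
  prec' f hf := by
    -- Consecutive terms of a Cauchy sequence differ by hⁿzₙ, so its limit is the sum of a series.
    choose z hz using fun n => smodEq_hbar_iff.1 (hf (Nat.le_succ n)).symm
    have e : ∀ n, f n = f 0 + ∑ i ∈ Finset.range n, hbar k ^ i • z i := by
      intro n
      induction n with
      | zero => simp
      | succ n ih => rw [Finset.sum_range_succ, ← add_assoc, ← ih, hz]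
    refine ⟨f 0 + hsum k z, fun n => smodEq_hbar_iff.2 ?_⟩
    obtain ⟨y, hy⟩ := hsum_spec (k := k) z n
    exact ⟨-y, by rw [e, hy, smul_neg]; abel⟩

end Adic

namespace Uh

variable {k : Type*} [Field k]

instance : HAdic k (FreeSer k) := HAdic.powerSeries hbar_smul_eq_X_mul

/-- Separatedness holds because the ideal divided out is closed. Sums are formed by lifting the
coefficients to the completed free algebra. -/
instance : HAdic k (Uh k) where
  eq_zero u hu := by
    obtain ⟨x, rfl⟩ := mk_surjective k u
    rw [mk_eq_zero, mem_quantumIdeal]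
    intro n
    obtain ⟨y, hy⟩ := hu n
    obtain ⟨y, rfl⟩ := mk_surjective k y
    rw [← map_smul, ← sub_eq_zero, ← map_sub, mk_eq_zero, mem_quantumIdeal,
      hbar_pow_smul hbar_smul_eq_X_mul] at hy
    rw [← sub_add_cancel x (PowerSeries.X ^ n * y)]
    refine add_mem (hy n) ?_
    exact TwoSidedIdeal.mul_mem_right _ _ _ (TwoSidedIdeal.subset_span (Or.inr rfl))
  exists_sum a := by
    choose x hx using fun n => mk_surjective k (a n)
    obtain ⟨s, hs⟩ := HAdic.exists_sum (k := k) x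
    refine ⟨mk k s, fun n => ?_⟩
    obtain ⟨y, hy⟩ := hs n
    exact ⟨mk k y, by simp only [hy, map_add, map_sum, map_smul, hx]⟩

theorem mk_eq_of_rel {a b : FreeSer k} (hab : QuantumRel k a b) : mk k a = mk k b := by
  rw [← sub_eq_zero, ← map_sub, mk_eq_zero, mem_quantumIdeal]
  exact fun n => TwoSidedIdeal.subset_span (Or.inl ⟨a, b, hab, rfl⟩)

theorem exists_mk_eq (x : FreeSer k) :
    ∃ w, mk k x = mk k (C (PowerSeries.constantCoeff x)) + hbar k • w := by
  refine ⟨mk k (PowerSeries.mk fun n => coeff (n + 1) x), ?_⟩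
  rw [← map_smul, ← map_add, hbar_smul_eq_X_mul, add_comm]
  exact congrArg _ x.eq_X_mul_shift_add_const

/-- A classical relation that is c times the constant term of a quantum relation becomes divisible
by h in the quantum algebra. -/
theorem exists_mk_C_eq {a b : FreeAlgebra k Gen} {a' b' : FreeSer k} (c : k)
    (hab : QuantumRel k a' b')
    (e : a - b = c • PowerSeries.constantCoeff a' - c • PowerSeries.constantCoeff b') :
    ∃ w, mk k (C (a - b)) = hbar k • w := by
  obtain ⟨w, hw⟩ := exists_mk_eq a'
  obtain ⟨w', hw'⟩ := exists_mk_eq b'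
  have h := mk_eq_of_rel hab
  have key : ∀ x : FreeAlgebra k Gen, (C (c • x) : FreeSer k) = (C c : k⟦X⟧) • C x := by
    intro x
    rw [smul_def, PowerSeries.map_C, ← map_mul, Algebra.smul_def]
  refine ⟨(C c : k⟦X⟧) • (w' - w), ?_⟩
  rw [e, map_sub, key, key, map_sub, map_smul, map_smul]
  rw [hw, hw'] at h
  rw [eq_sub_of_add_eq h]
  module

theorem constantCoeff_smul (c : k) (x : FreeSer k) :
    PowerSeries.constantCoeff (c • x) = c • PowerSeries.constantCoeff x := rfl

theorem constantCoeff_expSer (c : k) (x : FreeAlgebra k Gen) :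
    PowerSeries.constantCoeff (expSer c x) = 1 := by
  simp [expSer]

theorem constantCoeff_sinhSer (x : FreeAlgebra k Gen) :
    PowerSeries.constantCoeff (sinhSer x) = 0 := by
  rw [sinhSer, constantCoeff_smul, map_sub, constantCoeff_expSer, constantCoeff_expSer, sub_self,
    smul_zero]

variable [CharZero k]

theorem constantCoeff_coshSer (x : FreeAlgebra k Gen) :
    PowerSeries.constantCoeff (coshSer x) = 1 := by
  rw [coshSer, constantCoeff_smul, map_add, constantCoeff_expSer, constantCoeff_expSer]
  module

theorem constantCoeff_sinhDivSer (x : FreeAlgebra k Gen) :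
    PowerSeries.constantCoeff (sinhDivSer x) = x := by
  simp only [sinhDivSer, sinhSer, expSer, PowerSeries.constantCoeff_mk, PowerSeries.coeff_smul,
    map_sub, PowerSeries.coeff_mk, zero_add, pow_one, Nat.factorial_one, Nat.cast_one, div_one]
  module

theorem exists_mk_C_sub_eq {a b : FreeAlgebra k Gen} (hab : ClassicalRel k a b) :
    ∃ w, mk k (C (a - b)) = hbar k • w := by
  cases hab <;>
    [refine exists_mk_C_eq 1 .H_Vp ?_; refine exists_mk_C_eq 1 .H_Vm ?_;
      refine exists_mk_C_eq 1 .Vp_Vm ?_; refine exists_mk_C_eq 1 .H_X ?_;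
      refine exists_mk_C_eq 1 .H_Y ?_; refine exists_mk_C_eq 1 .X_Y ?_;
      -- The factors -4 and 4 convert v₊² - ¼J₊ and v₋² + ¼J₋ into the classical relations J₊ - 4v₊²
      -- and J₋ + 4v₋².
      refine exists_mk_C_eq (-4) .Vp_sq ?_; refine exists_mk_C_eq 4 .Vm_sq ?_;
      refine exists_mk_C_eq 1 .X_Vp ?_; refine exists_mk_C_eq 1 .Y_Vm ?_;
      refine exists_mk_C_eq 1 .X_Vm ?_; refine exists_mk_C_eq 1 .Y_Vp ?_] <;>
    simp only [map_add, map_sub, map_mul, map_neg, map_zero, constantCoeff_smul,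
      PowerSeries.constantCoeff_C, PowerSeries.constantCoeff_X, constantCoeff_coshSer,
      constantCoeff_sinhSer, constantCoeff_sinhDivSer, mul_one, one_mul, mul_zero, zero_mul] <;>
    module

theorem exists_mk_C_eq_of_mem {x : FreeAlgebra k Gen} (hx : x ∈ classicalIdeal k) :
    ∃ w, mk k (C x) = hbar k • w := by
  have h1 : classicalIdeal k ≤ TwoSidedIdeal.ker
      (((Ideal.Quotient.mk (hPow (hbar k) (Uh k) 1)).comp (mk k : FreeSer k →+* Uh k)).comp
        (C : FreeAlgebra k Gen →+* FreeSer k)) := by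
    refine TwoSidedIdeal.span_le.2 ?_
    rintro _ ⟨a, b, hab, rfl⟩
    obtain ⟨w, hw⟩ := exists_mk_C_sub_eq hab
    rw [SetLike.mem_coe, TwoSidedIdeal.mem_ker]
    refine Ideal.Quotient.eq_zero_iff_mem.2 ⟨w, ?_⟩
    rw [pow_one]
    exact hw
  obtain ⟨w, hw⟩ := Ideal.Quotient.eq_zero_iff_mem.1 ((TwoSidedIdeal.mem_ker _).1 (h1 hx))
  exact ⟨w, by rwa [pow_one] at hw⟩

/-- If u reduces to 0, the constant term of a representative lies in the classical ideal, whose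
elements are multiples of h in `Uh k`; the remaining terms are visibly multiples of h. -/
theorem reduction_eq_zero_iff {u : Uh k} : reduction k u = 0 ↔ ∃ w, u = hbar k • w := by
  constructor
  · intro hu
    obtain ⟨x, rfl⟩ := mk_surjective k u
    rw [reduction_mk, U0.mk_eq_zero] at hu
    obtain ⟨w, hw⟩ := exists_mk_C_eq_of_mem hu
    obtain ⟨w', hw'⟩ := exists_mk_eq x
    exact ⟨w + w', by rw [hw', hw, smul_add]⟩
  · rintro ⟨w, rfl⟩
    rw [reduction_smul, PowerSeries.constantCoeff_X, zero_smul]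

theorem reduction_C (x : FreeAlgebra k Gen) : reduction k (mk k (C x)) = U0.mk k x := by
  rw [reduction_mk, PowerSeries.constantCoeff_C]

theorem reduction_surjective : Function.Surjective (reduction k) := by
  intro u
  obtain ⟨x, rfl⟩ := U0.mk_surjective k u
  exact ⟨_, reduction_C x⟩

/-! #### Topological generation -/

/-- J₀, J₊, J₋ are quadratic in v₊ and v₋, so these two generate U(osp(2/1)). Hence H is superfluous
as a topological generator. -/
theorem exists_mem_adjoin_reduction (u : U0 k) :
    ∃ s ∈ Algebra.adjoin k⟦X⟧ ({Vp k, Vm k} : Set (Uh k)), reduction k s = u := by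
  obtain ⟨x, rfl⟩ := U0.mk_surjective k u
  have hp : Vp k ∈ Algebra.adjoin k⟦X⟧ ({Vp k, Vm k} : Set (Uh k)) :=
    Algebra.subset_adjoin (Set.mem_insert _ _)
  have hm : Vm k ∈ Algebra.adjoin k⟦X⟧ ({Vp k, Vm k} : Set (Uh k)) :=
    Algebra.subset_adjoin (Set.mem_insert_of_mem _ rfl)
  have key : ∀ (c : k) (u : Uh k), reduction k ((C c : k⟦X⟧) • u) = c • reduction k u := by
    intro c u
    rw [reduction_smul, PowerSeries.constantCoeff_C]
  induction x using FreeAlgebra.induction with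
  | grade0 c =>
    exact ⟨algebraMap k⟦X⟧ _ (C c), Subalgebra.algebraMap_mem _ _, by
      rw [Algebra.algebraMap_eq_smul_one, key, map_one, AlgHom.commutes,
        Algebra.algebraMap_eq_smul_one]⟩
  | grade1 g =>
    cases g with
    | H =>
      refine ⟨(C (-2 : k) : k⟦X⟧) • (Vp k * Vm k + Vm k * Vp k),
        Subalgebra.smul_mem _ (add_mem (mul_mem hp hm) (mul_mem hm hp)) _, ?_⟩
      have e := U0.mk_rel (ClassicalRel.vp_vm (k := k))
      simp only [map_add, map_mul, map_smul] at e
      rw [key, map_add, map_mul, map_mul, reduction_gen, reduction_gen]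
      simp only [U0.gen]
      rw [e]
      module
    | X =>
      refine ⟨(C (4 : k) : k⟦X⟧) • (Vp k * Vp k), Subalgebra.smul_mem _ (mul_mem hp hp) _, ?_⟩
      rw [key, map_mul, reduction_gen, U0.mk_rel (ClassicalRel.Jp_eq (k := k)), map_smul, map_mul]
      rfl
    | Y =>
      refine ⟨(C (-4 : k) : k⟦X⟧) • (Vm k * Vm k), Subalgebra.smul_mem _ (mul_mem hm hm) _, ?_⟩
      rw [key, map_mul, reduction_gen, U0.mk_rel (ClassicalRel.Jm_eq (k := k)), map_smul, map_mul]
      rfl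
    | Vp => exact ⟨_, hp, reduction_gen k _⟩
    | Vm => exact ⟨_, hm, reduction_gen k _⟩
  | mul a b ha hb =>
    obtain ⟨s, hs, es⟩ := ha
    obtain ⟨t, ht, et⟩ := hb
    exact ⟨s * t, mul_mem hs ht, by rw [map_mul, es, et, map_mul]⟩
  | add a b ha hb =>
    obtain ⟨s, hs, es⟩ := ha
    obtain ⟨t, ht, et⟩ := hb
    exact ⟨s + t, add_mem hs ht, by rw [map_add, es, et, map_add]⟩

theorem exists_mem_adjoin (u : Uh k) (n : ℕ) :
    ∃ s ∈ Algebra.adjoin k⟦X⟧ ({Vp k, Vm k} : Set (Uh k)), ∃ w, u = s + hbar k ^ n • w := by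
  induction n with
  | zero => exact ⟨0, zero_mem _, u, by rw [pow_zero, one_smul, zero_add]⟩
  | succ n ih =>
    obtain ⟨s, hs, w, hw⟩ := ih
    obtain ⟨t, ht, e⟩ := exists_mem_adjoin_reduction (reduction k w)
    obtain ⟨z, hz⟩ := reduction_eq_zero_iff.1 (show reduction k (w - t) = 0 by
      rw [map_sub, e, sub_self])
    refine ⟨s + hbar k ^ n • t, add_mem hs (Subalgebra.smul_mem _ ht _), z, ?_⟩
    rw [hw, pow_succ, mul_smul, ← hz, smul_sub]
    abel

variable {𝒞 : Type*} [Ring 𝒞] [Algebra k⟦X⟧ 𝒞] [HAdic k 𝒞]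

/-- The subalgebra generated by V₊ and V₋ is dense and homomorphisms are continuous. This reduces
most identities between homomorphisms, including coassociativity, to two elements. -/
theorem hom_ext {f g : Uh k →ₐ[k⟦X⟧] 𝒞} (hp : f (Vp k) = g (Vp k)) (hm : f (Vm k) = g (Vm k)) :
    f = g := by
  ext u
  refine eq_of_forall_mod (k := k) fun n => ?_
  obtain ⟨s, hs, w, rfl⟩ := exists_mem_adjoin u n
  have : s ∈ AlgHom.equalizer f g := by
    refine Algebra.adjoin_le ?_ hs
    rintro _ (rfl | rfl)
    · exact hp
    · exact hm
  refine ⟨f w - g w, ?_⟩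
  rw [map_add, map_add, map_smul, map_smul, show f s = g s from this, smul_sub]
  abel

end Uh

/-! ### The isomorphism with `U(osp(2/1))⟦h⟧` -/

namespace U0

variable (k : Type*) [Field k]

instance : Algebra k⟦X⟧ (U0 k)⟦X⟧ :=
  (PowerSeries.map (algebraMap k (U0 k))).toAlgebra' (by
    intro c x
    ext n
    rw [PowerSeries.coeff_mul, PowerSeries.coeff_mul, ← Finset.Nat.sum_antidiagonal_swap]
    refine Finset.sum_congr rfl fun p _ => ?_
    rw [PowerSeries.coeff_map]
    exact Algebra.commutes _ _)

variable {k}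

theorem series_smul_def (c : k⟦X⟧) (x : (U0 k)⟦X⟧) :
    c • x = PowerSeries.map (algebraMap k (U0 k)) c * x := rfl

theorem hbar_smul_series (x : (U0 k)⟦X⟧) : hbar k • x = PowerSeries.X * x := by
  rw [series_smul_def, PowerSeries.map_X]

instance : HAdic k (U0 k)⟦X⟧ := HAdic.powerSeries hbar_smul_series
instance : HTorsionFree k (U0 k)⟦X⟧ := HTorsionFree.powerSeries hbar_smul_series

theorem C_smul_C (c : k) (x : U0 k) : (C c : k⟦X⟧) • (C x : (U0 k)⟦X⟧) = C (c • x) := by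
  rw [series_smul_def, PowerSeries.map_C, ← map_mul, Algebra.smul_def]

theorem ofNat_smul_C (m : ℕ) [m.AtLeastTwo] (x : U0 k) :
    (OfNat.ofNat m : k⟦X⟧) • (C x : (U0 k)⟦X⟧) = C ((OfNat.ofNat m : k) • x) := by
  rw [← C_smul_C, map_ofNat]

theorem constantCoeff_smul (c : k⟦X⟧) (x : (U0 k)⟦X⟧) :
    PowerSeries.constantCoeff (c • x) =
      PowerSeries.constantCoeff c • PowerSeries.constantCoeff x := by
  rw [series_smul_def, map_mul, Algebra.smul_def]
  rfl

theorem constantCoeff_expH (x : (U0 k)⟦X⟧) : PowerSeries.constantCoeff (expH k x) = 1 := by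
  obtain ⟨y, hy⟩ := expH_eq_one_add (k := k) x
  rw [hy]
  simp [constantCoeff_smul]

variable [CharZero k]

/-- The factor 8 makes J equal to 4J₀, so that the brackets with J have the integral eigenvalues 2
and -2. -/
theorem isClassicalPair : IsClassicalPair (k := k) (C (gen k .Vp) : (U0 k)⟦X⟧)
    (C ((8 : k) • gen k .Vm)) := by
  have e0 := mk_rel (ClassicalRel.vp_vm (k := k))
  have e1 := mk_rel (ClassicalRel.J0_vp (k := k))
  have e2 := mk_rel (ClassicalRel.J0_vm (k := k))
  simp only [map_add, map_sub, map_mul, map_smul] at e0 e1 e2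
  have hJ : gen k .Vp * (8 : k) • gen k .Vm + (8 : k) • gen k .Vm * gen k .Vp =
      -((4 : k) • gen k .H) := by
    rw [mul_smul_comm, smul_mul_assoc, ← smul_add]
    simp only [gen]
    rw [e0]
    module
  have h2 : ∀ x : U0 k, (2 : k⟦X⟧) • (C x : (U0 k)⟦X⟧) = C ((2 : k) • x) := ofNat_smul_C 2
  constructor
  · simp only [h2, ← map_mul, ← map_add, ← map_neg]
    rw [hJ, neg_neg, smul_mul_assoc, mul_smul_comm]
    refine congrArg _ ?_
    simp only [gen]
    rw [eq_add_of_sub_eq e1]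
    module
  · simp only [h2, ← map_mul, ← map_add, ← map_neg, ← map_sub]
    rw [hJ, neg_neg]
    simp only [smul_mul_assoc, mul_smul_comm]
    refine congrArg _ ?_
    simp only [gen]
    rw [eq_add_of_sub_eq e2]
    module

end U0

namespace Uh

variable (k : Type*) [Field k] [CharZero k]

/-- The homomorphism `U_h(osp(2/1)) → U(osp(2/1))⟦h⟧`. -/
def toSeries : Uh k →ₐ[k⟦X⟧] (U0 k)⟦X⟧ := U0.isClassicalPair.lift k

variable {k}

theorem constantCoeff_Tpow (c : k) (v : (U0 k)⟦X⟧) :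
    PowerSeries.constantCoeff (IsClassicalPair.T k c v) = 1 := U0.constantCoeff_expH _

theorem constantCoeff_toSeries_Vp :
    PowerSeries.constantCoeff (toSeries k (Vp k)) = U0.gen k .Vp := by
  rw [toSeries, IsClassicalPair.lift_Vp, IsClassicalPair.Vp, map_mul, constantCoeff_Tpow,
    PowerSeries.constantCoeff_C, mul_one]

theorem constantCoeff_toSeries_Vm :
    PowerSeries.constantCoeff (toSeries k (Vm k)) = U0.gen k .Vm := by
  rw [toSeries, IsClassicalPair.lift_Vm, IsClassicalPair.Vm, U0.constantCoeff_smul, map_mul,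
    constantCoeff_Tpow, mul_one, kappa]
  simp only [map_sub, U0.constantCoeff_smul, map_mul, PowerSeries.constantCoeff_X, mul_zero,
    zero_smul, sub_zero, PowerSeries.constantCoeff_C, smul_smul]
  norm_num

/-- V₊ and V₋ are sent to v₊ and v₋ up to multiples of h, and the other elements follow by density.
This is the input for both injectivity and surjectivity. -/
theorem constantCoeff_toSeries (u : Uh k) :
    PowerSeries.constantCoeff (toSeries k u) = reduction k u := by
  obtain ⟨s, hs, w, rfl⟩ := exists_mem_adjoin u 1
  have key : ∀ s : Uh k, s ∈ Algebra.adjoin k⟦X⟧ ({Vp k, Vm k} : Set (Uh k)) →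
      PowerSeries.constantCoeff (toSeries k s) = reduction k s := by
    intro s hs
    induction hs using Algebra.adjoin_induction with
    | mem x hx =>
      rcases hx with rfl | rfl
      · rw [constantCoeff_toSeries_Vp, reduction_gen]
      · rw [constantCoeff_toSeries_Vm, reduction_gen]
    | algebraMap c =>
      rw [Algebra.algebraMap_eq_smul_one, map_smul, U0.constantCoeff_smul, reduction_smul, map_one,
        map_one, map_one]
    | add x y _ _ hx hy => rw [map_add, map_add, hx, hy, map_add]
    | mul x y _ _ hx hy => rw [map_mul, map_mul, hx, hy, map_mul]
  rw [map_add, map_add, key s hs, map_add, map_smul, U0.constantCoeff_smul, reduction_smul, pow_one,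
    PowerSeries.constantCoeff_X, zero_smul, zero_smul]

/-- An element of the kernel reduces to 0, hence is hw; the target being torsion free, w is again in
the kernel. Repetition shows divisibility by every power of h. -/
theorem toSeries_injective : Function.Injective (toSeries k) := by
  rw [injective_iff_map_eq_zero]
  intro u hu
  refine HAdic.eq_zero (k := k) u fun n => ?_
  have : ∃ y, u = hbar k ^ n • y ∧ toSeries k y = 0 := by
    induction n with
    | zero => exact ⟨u, by rw [pow_zero, one_smul], hu⟩
    | succ n ih =>
      obtain ⟨y, rfl, hy⟩ := ih
      obtain ⟨w, rfl⟩ := reduction_eq_zero_iff.1 (show reduction k y = 0 by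
        rw [← constantCoeff_toSeries, hy, map_zero])
      refine ⟨w, by rw [pow_succ, mul_smul], HTorsionFree.eq_zero (k := k) _ ?_⟩
      rw [← map_smul, hy]
  exact this.imp fun _ h => h.1

/-- Lift the constant term of y through `reduction`, subtract, divide by h and repeat; the lifts are
the coefficients of a convergent series. -/
theorem toSeries_surjective : Function.Surjective (toSeries k) := by
  choose σ hσ using reduction_surjective (k := k)
  have key : ∀ y : (U0 k)⟦X⟧, ∃ z,
      y = toSeries k (σ (PowerSeries.constantCoeff y)) + hbar k • z := by
    intro y
    obtain ⟨z, hz⟩ := PowerSeries.X_dvd_iff.2 (show PowerSeries.constantCoeff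
      (y - toSeries k (σ (PowerSeries.constantCoeff y))) = 0 by
        rw [map_sub, constantCoeff_toSeries, hσ, sub_self])
    exact ⟨z, by rw [U0.hbar_smul_series, ← hz, add_sub_cancel]⟩
  -- τ is one step of the approximation: the remainder divided by h.
  choose τ hτ using key
  intro y
  refine ⟨hsum k fun n => σ (PowerSeries.constantCoeff (τ^[n] y)), ?_⟩
  rw [map_hsum]
  refine (eq_hsum fun n => ⟨τ^[n] y, ?_⟩).symm
  induction n with
  | zero => simp
  | succ n ih =>
    rw [Finset.sum_range_succ, add_assoc, pow_succ, mul_smul, ← smul_add,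
      Function.iterate_succ_apply', ← hτ, ← ih]

/-- Torsion-freeness is inherited from U(osp(2/1))⟦h⟧ through the injection `toSeries`. -/
instance : HTorsionFree k (Uh k) where
  eq_zero u hu := by
    refine toSeries_injective ?_
    rw [map_zero]
    refine HTorsionFree.eq_zero (k := k) _ ?_
    rw [← map_smul, hu, map_zero]

end Uh

/-! ### The classical generators inside `U_h(osp(2/1))` -/

namespace IsClassicalPair

variable {k : Type*} [Field k] [CharZero k] {𝒞 : Type*} [Ring 𝒞] [Algebra k⟦X⟧ 𝒞] [HAdic k 𝒞]

theorem X_neg (v : 𝒞) : X k (-v) = X k v := by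
  rw [X, X, neg_mul_neg]

theorem T_neg (c : k) (v : 𝒞) : T k c (-v) = T k c v := by
  rw [T, T, X_neg]

theorem g_neg (v : 𝒞) : g k (-v) = -g k v :=
  (eq_g (by rw [T_neg, neg_mul, g_mul])).symm

theorem Vm_neg (v W : 𝒞) : Vm k (-v) (-W) = -Vm k v W := by
  simp only [Vm, T_neg, g_neg, kappa, neg_mul, mul_neg, neg_neg, sub_mul, smul_mul_assoc, smul_sub,
    smul_neg]
  module

/-- κ is W modulo h and its correction is linear in W through J, so W - W' is h times a linear
expression in W - W'. It is therefore divisible by every power of h. -/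
theorem Vm_injective {v W W' : 𝒞} (h : Vm k v W = Vm k v W') : W = W' := by
  have e1 := eq_Vm_smul (k := k) v W
  have e2 := eq_Vm_smul (k := k) v W'
  rw [h, e2] at e1
  have u : IsUnit (T k (1 / 2) v) := expH_isUnit _
  have e3 := u.mul_right_cancel e1
  have e4 : W - W' = hbar k • -((4 : k⟦X⟧) • ((v * (W - W') + (W - W') * v) * g k v)) := by
    simp only [kappa] at e3
    simp only [mul_sub, sub_mul, neg_mul, add_mul, smul_sub, smul_add] at e3 ⊢
    linear_combination (norm := module) -e3
  have e5 : ∀ n : ℕ, ∃ y, W - W' = hbar k ^ n • y := by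
    intro n
    induction n with
    | zero => exact ⟨_, by rw [pow_zero, one_smul]⟩
    | succ n ih =>
      obtain ⟨y, hy⟩ := ih
      refine ⟨-((4 : k⟦X⟧) • ((v * y + y * v) * g k v)), ?_⟩
      rw [e4, hy]
      simp only [mul_smul_comm, smul_mul_assoc, ← smul_add, ← smul_neg, pow_succ, mul_smul]
      module
  exact sub_eq_zero.1 (HAdic.eq_zero (k := k) _ e5)

theorem Vp_mul_T (v : 𝒞) : Vp k v * T k (1 / 2) v = v := by
  rw [Vp, mul_assoc, T_mul_T, neg_add_cancel, T_zero, mul_one]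

end IsClassicalPair

namespace Uh

variable (k : Type*) [Field k] [CharZero k]

/-- The classical odd positive root vector inside `U_h(osp(2/1))`. -/
def clv : Uh k := (toSeries_surjective (C (U0.gen k .Vp))).choose

/-- The (rescaled) classical odd negative root vector inside `U_h(osp(2/1))`. -/
def clW : Uh k := (toSeries_surjective (C ((8 : k) • U0.gen k .Vm))).choose

variable {k}

theorem toSeries_clv : toSeries k (clv k) = C (U0.gen k .Vp) :=
  (toSeries_surjective (C (U0.gen k .Vp))).choose_spec

theorem toSeries_clW : toSeries k (clW k) = C ((8 : k) • U0.gen k .Vm) :=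
  (toSeries_surjective (C ((8 : k) • U0.gen k .Vm))).choose_spec

theorem reduction_clv : reduction k (clv k) = U0.gen k .Vp := by
  rw [← constantCoeff_toSeries, toSeries_clv, PowerSeries.constantCoeff_C]

theorem reduction_clW : reduction k (clW k) = (8 : k) • U0.gen k .Vm := by
  rw [← constantCoeff_toSeries, toSeries_clW, PowerSeries.constantCoeff_C]

theorem isClassicalPair : IsClassicalPair (k := k) (clv k) (clW k) := by
  have p := U0.isClassicalPair (k := k)
  rw [← toSeries_clv, ← toSeries_clW] at p
  constructor <;> refine toSeries_injective ?_
  · simpa only [map_neg, map_add, map_mul, map_smul] using p.J_v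
  · simpa only [map_neg, map_add, map_mul, map_sub, map_smul] using p.J_W

theorem X_clv : IsClassicalPair.X k (clv k) = X k := by
  refine toSeries_injective ?_
  rw [IsClassicalPair.map_X, toSeries_clv, toSeries, IsClassicalPair.lift_X]

theorem T_clv (c : k) : IsClassicalPair.T k c (clv k) = Tpow k c := by
  refine toSeries_injective ?_
  rw [IsClassicalPair.map_T, toSeries_clv, toSeries, IsClassicalPair.lift_Tpow]

end Uh

namespace IsClassicalPair

variable {k : Type*} [Field k] [CharZero k] {𝒞 𝒟 : Type*} [Ring 𝒞] [Algebra k⟦X⟧ 𝒞] [HAdic k 𝒞]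
  [Ring 𝒟] [Algebra k⟦X⟧ 𝒟] [HAdic k 𝒟]

theorem map_Vp {F : Type*} [FunLike F 𝒞 𝒟] [AlgHomClass F k⟦X⟧ 𝒞 𝒟] (f : F) (v : 𝒞) :
    f (Vp k v) = Vp k (f v) := by
  rw [Vp, map_mul, map_T, Vp]

theorem map_Vm {F : Type*} [FunLike F 𝒞 𝒟] [AlgHomClass F k⟦X⟧ 𝒞 𝒟] (f : F) (v W : 𝒞) :
    f (Vm k v W) = Vm k (f v) (f W) := by
  simp only [Vm, kappa, map_smul, map_mul, map_sub, map_neg, map_add, map_T, map_g]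

end IsClassicalPair

namespace Uh

variable {k : Type*} [Field k] [CharZero k]

theorem Vp_clv : IsClassicalPair.Vp k (clv k) = Vp k := by
  refine toSeries_injective ?_
  rw [IsClassicalPair.map_Vp, toSeries_clv, toSeries, IsClassicalPair.lift_Vp]

theorem Vm_clv : IsClassicalPair.Vm k (clv k) (clW k) = Vm k := by
  refine toSeries_injective ?_
  rw [IsClassicalPair.map_Vm, toSeries_clv, toSeries_clW, toSeries, IsClassicalPair.lift_Vm]

theorem parity_Vp : parity k (Vp k) = -Vp k := by
  rw [Vp, gen, parity_mk, serParity_C, freeParity_Vp, map_neg, map_neg]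

theorem parity_Vm : parity k (Vm k) = -Vm k := by
  rw [Vm, gen, parity_mk, serParity_C, freeParity_Vm, map_neg, map_neg]

theorem parity_Tpow (c : k) : parity k (Tpow k c) = Tpow k c := by
  rw [Tpow, parity_mk, serParity_expSer]

theorem clv_eq : clv k = Vp k * Tpow k (1 / 2) := by
  rw [← Vp_clv, ← T_clv, IsClassicalPair.Vp_mul_T]

theorem parity_clv : parity k (clv k) = -clv k := by
  rw [clv_eq, map_mul, parity_Vp, parity_Tpow, neg_mul]

/-- Parity carries V₋(v, W) to V₋(-v, σW), and to -V₋(v, W) = V₋(-v, -W); since V₋ determines its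
second argument, σW = -W. -/
theorem parity_clW : parity k (clW k) = -clW k := by
  refine IsClassicalPair.Vm_injective (k := k) (v := -clv k) ?_
  rw [IsClassicalPair.Vm_neg, Vm_clv, ← parity_Vm, ← Vm_clv, IsClassicalPair.map_Vm, parity_clv]

variable {𝒞 : Type*} [Ring 𝒞] [Algebra k⟦X⟧ 𝒞] [HAdic k 𝒞]

theorem lift_clv [HTorsionFree k 𝒞] {v W : 𝒞} (p : IsClassicalPair (k := k) v W) :
    p.lift k (clv k) = v := by
  rw [clv_eq, map_mul, p.lift_Vp, p.lift_Tpow, IsClassicalPair.Vp_mul_T]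

theorem lift_clW [HTorsionFree k 𝒞] {v W : 𝒞} (p : IsClassicalPair (k := k) v W) :
    p.lift k (clW k) = W := by
  refine IsClassicalPair.Vm_injective (k := k) (v := v) ?_
  rw [← p.lift_Vm, ← Vm_clv, IsClassicalPair.map_Vm, lift_clv]

theorem hom_ext_classical {f g : Uh k →ₐ[k⟦X⟧] 𝒞} (hv : f (clv k) = g (clv k))
    (hW : f (clW k) = g (clW k)) : f = g := by
  refine hom_ext ?_ ?_
  · rw [← Vp_clv, IsClassicalPair.map_Vp, IsClassicalPair.map_Vp, hv]
  · rw [← Vm_clv, IsClassicalPair.map_Vm, IsClassicalPair.map_Vm, hv, hW]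

end Uh

end SuperJordanian

end

noncomputable section

namespace SuperJordanian


open PowerSeries (C coeff)
open scoped Nat

/-! ### Homomorphisms out of graded tensor products -/

section SuperTensor

open GradedTensorProduct (includeLeft includeRight)

variable {K A B D E F : Type*} [CommRing K] [Ring A] [Algebra K A] [Ring B] [Algebra K B]
  [Ring D] [Algebra K D] [Ring E] [Algebra K E] [Ring F] [Algebra K F]
  {𝒜 : ZMod 2 → Submodule K A} {ℬ : ZMod 2 → Submodule K B} {𝒟 : ZMod 2 → Submodule K D}

variable (𝒜 ℬ) in
/-- Two homomorphisms have supercommuting images. -/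
def SuperCommute (f : A →ₐ[K] E) (g : B →ₐ[K] E) : Prop :=
  ∀ ⦃i j : ZMod 2⦄ (a : 𝒜 i) (b : ℬ j), f a * g b = (-1 : ℤˣ) ^ (j * i) • (g b * f a)

namespace SuperCommute

theorem symm {f : A →ₐ[K] E} {g : B →ₐ[K] E} (h : SuperCommute 𝒜 ℬ f g) :
    SuperCommute ℬ 𝒜 g f := by
  intro j i b a
  rw [h a b, smul_smul, mul_comm i j, Int.units_mul_self, one_smul]

theorem comp {f : A →ₐ[K] E} {g : B →ₐ[K] E} (h : SuperCommute 𝒜 ℬ f g) (ψ : E →ₐ[K] F) :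
    SuperCommute 𝒜 ℬ (ψ.comp f) (ψ.comp g) := by
  intro i j a b
  have := congrArg ψ (h a b)
  rwa [Units.smul_def, map_zsmul, map_mul, map_mul, ← Units.smul_def] at this

theorem comp_even {f : A →ₐ[K] E} {g : B →ₐ[K] E} (h : SuperCommute 𝒜 ℬ f g) {σ : A →ₐ[K] A}
    {τ : B →ₐ[K] B} (hσ : ∀ i, ∀ a ∈ 𝒜 i, σ a ∈ 𝒜 i) (hτ : ∀ i, ∀ b ∈ ℬ i, τ b ∈ ℬ i) :
    SuperCommute 𝒜 ℬ (f.comp σ) (g.comp τ) :=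
  fun i j a b => h ⟨σ a, hσ i a a.2⟩ ⟨τ b, hτ j b b.2⟩

variable [GradedAlgebra 𝒜] [GradedAlgebra ℬ] [GradedAlgebra 𝒟]

variable (𝒜 ℬ) in
theorem inclusions : SuperCommute 𝒜 ℬ (includeLeft 𝒜 ℬ) (includeRight 𝒜 ℬ) :=
  ((GradedTensorProduct.liftEquiv 𝒜 ℬ).symm (AlgHom.id K _)).prop

/-- The homomorphism out of the graded tensor product defined by supercommuting homomorphisms. -/
def lift {f : A →ₐ[K] E} {g : B →ₐ[K] E} (h : SuperCommute 𝒜 ℬ f g) : 𝒜 ᵍ⊗[K] ℬ →ₐ[K] E :=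
  GradedTensorProduct.lift 𝒜 ℬ f g h

theorem lift_tmul {f : A →ₐ[K] E} {g : B →ₐ[K] E} (h : SuperCommute 𝒜 ℬ f g) (a : A) (b : B) :
    h.lift (a ᵍ⊗ₜ[K] b) = f a * g b := rfl

theorem lift_includeLeft {f : A →ₐ[K] E} {g : B →ₐ[K] E} (h : SuperCommute 𝒜 ℬ f g) (a : A) :
    h.lift (includeLeft 𝒜 ℬ a) = f a := by
  rw [GradedTensorProduct.includeLeft_apply, lift_tmul, map_one, mul_one]

theorem lift_includeRight {f : A →ₐ[K] E} {g : B →ₐ[K] E} (h : SuperCommute 𝒜 ℬ f g) (b : B) :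
    h.lift (includeRight 𝒜 ℬ b) = g b := by
  rw [GradedTensorProduct.includeRight_apply, lift_tmul, map_one, one_mul]

/-- Iterating the universal property of the super tensor product requires that a lifted homomorphism
supercommute with the third one; the signs add up on products of homogeneous tensors. -/
theorem lift_left {f : A →ₐ[K] E} {g : B →ₐ[K] E} {l : D →ₐ[K] E} (h : SuperCommute 𝒜 ℬ f g)
    (hf : SuperCommute 𝒜 𝒟 f l) (hg : SuperCommute ℬ 𝒟 g l) :
    SuperCommute (tensorGrading 𝒜 ℬ) 𝒟 h.lift l := by
  rintro i j ⟨z, hz⟩ d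
  change h.lift z * l d = (-1 : ℤˣ) ^ (j * i) • (l d * h.lift z)
  induction hz using Submodule.span_induction with
  | zero => simp
  | add x y _ _ hx hy => rw [map_add, add_mul, mul_add, hx, hy, smul_add]
  | smul c x _ hx => rw [map_smul, smul_mul_assoc, mul_smul_comm, hx, smul_comm]
  | mem x hx =>
    obtain ⟨m, n, rfl, a, ha, b, hb, rfl⟩ := hx
    have e1 := hf ⟨a, ha⟩ d
    have e2 := hg ⟨b, hb⟩ d
    dsimp only at e1 e2
    rw [lift_tmul, mul_assoc, e2, mul_smul_comm, ← mul_assoc, e1, smul_mul_assoc, smul_smul,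
      ← uzpow_add, mul_assoc, mul_add, add_comm]

end SuperCommute

theorem eq_of_homogeneous [GradedAlgebra 𝒜] {M : Type*} [AddCommGroup M] [Module K M]
    {f g : A →ₗ[K] M} (h : ∀ i, ∀ a ∈ 𝒜 i, f a = g a) (a : A) : f a = g a := by
  have : f = g := DirectSum.decompose_lhom_ext 𝒜 fun i => by
    ext ⟨a, ha⟩
    exact h i a ha
  rw [this]

end SuperTensor

section Legs

open GradedTensorProduct (includeLeft includeRight)

variable {K A : Type*} [CommRing K] [Ring A] [Algebra K A]
  (𝒜 : ZMod 2 → Submodule K A) [GradedAlgebra 𝒜]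

/-- `a ↦ a ⊗ 1 ⊗ 1`. -/
def inc₁ : A →ₐ[K] T3 𝒜 := (includeLeft (tensorGrading 𝒜 𝒜) 𝒜).comp (includeLeft 𝒜 𝒜)
/-- `a ↦ 1 ⊗ a ⊗ 1`. -/
def inc₂ : A →ₐ[K] T3 𝒜 := (includeLeft (tensorGrading 𝒜 𝒜) 𝒜).comp (includeRight 𝒜 𝒜)
/-- `a ↦ 1 ⊗ 1 ⊗ a`. -/
def inc₃ : A →ₐ[K] T3 𝒜 := includeRight (tensorGrading 𝒜 𝒜) 𝒜

theorem tmul_eq (a b : A) : (a ᵍ⊗ₜ[K] b : T2 𝒜) = includeLeft 𝒜 𝒜 a * includeRight 𝒜 𝒜 b :=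
  (GradedTensorProduct.tmul_one_mul_one_tmul 𝒜 𝒜 a b).symm

theorem tmul_tmul_eq (a b c : A) :
    ((a ᵍ⊗ₜ[K] b : T2 𝒜) ᵍ⊗ₜ[K] c : T3 𝒜) = inc₁ 𝒜 a * inc₂ 𝒜 b * inc₃ 𝒜 c := by
  rw [inc₁, inc₂, inc₃, AlgHom.comp_apply, AlgHom.comp_apply, ← map_mul, ← tmul_eq]
  exact (GradedTensorProduct.tmul_one_mul_one_tmul (tensorGrading 𝒜 𝒜) 𝒜 _ c).symm

theorem superCommute₁₂ : SuperCommute 𝒜 𝒜 (inc₁ 𝒜) (inc₂ 𝒜) :=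
  (SuperCommute.inclusions 𝒜 𝒜).comp _

theorem superCommute₁₃ : SuperCommute 𝒜 𝒜 (inc₁ 𝒜) (inc₃ 𝒜) := by
  intro i j a b
  have h : includeLeft 𝒜 𝒜 (a : A) ∈ tensorGrading 𝒜 𝒜 i := Submodule.subset_span
    ⟨i, 0, add_zero i, a, a.2, 1, SetLike.one_mem_graded 𝒜, rfl⟩
  exact SuperCommute.inclusions (tensorGrading 𝒜 𝒜) 𝒜 ⟨_, h⟩ b

theorem superCommute₂₃ : SuperCommute 𝒜 𝒜 (inc₂ 𝒜) (inc₃ 𝒜) := by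
  intro i j a b
  have h : includeRight 𝒜 𝒜 (a : A) ∈ tensorGrading 𝒜 𝒜 i := Submodule.subset_span
    ⟨0, i, zero_add i, 1, SetLike.one_mem_graded 𝒜, a, a.2, rfl⟩
  exact SuperCommute.inclusions (tensorGrading 𝒜 𝒜) 𝒜 ⟨_, h⟩ b

/-- `leg12` as a homomorphism. -/
def hom₁₂ : T2 𝒜 →ₐ[K] T3 𝒜 := (superCommute₁₂ 𝒜).lift
/-- `leg13` as a homomorphism. -/
def hom₁₃ : T2 𝒜 →ₐ[K] T3 𝒜 := (superCommute₁₃ 𝒜).lift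
/-- `leg23` as a homomorphism. -/
def hom₂₃ : T2 𝒜 →ₐ[K] T3 𝒜 := (superCommute₂₃ 𝒜).lift

variable {𝒜} in
theorem T2_linear_ext {M : Type*} [AddCommGroup M] [Module K M] {f g : T2 𝒜 →ₗ[K] M}
    (h : ∀ a b, f (a ᵍ⊗ₜ[K] b) = g (a ᵍ⊗ₜ[K] b)) : f = g := by
  refine LinearMap.ext fun z => ?_
  refine tensor_induction 𝒜 𝒜 (p := fun z => f z = g z) ?_ h (fun x y hx hy => ?_) z
  · rw [map_zero, map_zero]
  · rw [map_add, map_add, hx, hy]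

theorem leg12_eq : leg12 𝒜 = (hom₁₂ 𝒜).toLinearMap := T2_linear_ext fun a b => by
  rw [leg12, snocTensor_tmul, tmul_tmul_eq, map_one, mul_one]
  rfl

theorem leg13_eq : leg13 𝒜 = (hom₁₃ 𝒜).toLinearMap := T2_linear_ext fun a b => by
  rw [leg13_tmul, tmul_tmul_eq, map_one, mul_one]
  rfl

theorem leg23_eq : leg23 𝒜 = (hom₂₃ 𝒜).toLinearMap := T2_linear_ext fun a b => by
  rw [leg23, consTensor_tmul, tmul_tmul_eq, map_one, one_mul]
  rfl

theorem snocTensor_eq (b : A) (z : T2 𝒜) : snocTensor 𝒜 b z = hom₁₂ 𝒜 z * inc₃ 𝒜 b := by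
  have : snocTensor 𝒜 b = LinearMap.mulRight K (inc₃ 𝒜 b) ∘ₗ (hom₁₂ 𝒜).toLinearMap :=
    T2_linear_ext fun x y => by
      rw [snocTensor_tmul, tmul_tmul_eq]
      rfl
  rw [this]
  rfl

theorem consTensor_eq (a : A) (z : T2 𝒜) : consTensor 𝒜 a z = inc₁ 𝒜 a * hom₂₃ 𝒜 z := by
  have : consTensor 𝒜 a = LinearMap.mulLeft K (inc₁ 𝒜 a) ∘ₗ (hom₂₃ 𝒜).toLinearMap :=
    T2_linear_ext fun x y => by
      rw [consTensor_tmul, tmul_tmul_eq, mul_assoc]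
      rfl
  rw [this]
  rfl

/-- The super flip as a homomorphism. -/
def flipHom : T2 𝒜 →ₐ[K] T2 𝒜 := (SuperCommute.inclusions 𝒜 𝒜).symm.lift

theorem superFlip_eq : superFlip 𝒜 = (flipHom 𝒜).toLinearMap := by
  refine T2_linear_ext fun a b => ?_
  let f : A →ₗ[K] A →ₗ[K] T2 𝒜 := (TensorProduct.mk K A A).compr₂
    (superFlip 𝒜 ∘ₗ (GradedTensorProduct.of K 𝒜 𝒜).toLinearMap)
  let g : A →ₗ[K] A →ₗ[K] T2 𝒜 := (TensorProduct.mk K A A).compr₂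
    ((flipHom 𝒜).toLinearMap ∘ₗ (GradedTensorProduct.of K 𝒜 𝒜).toLinearMap)
  change f a b = g a b
  refine eq_of_homogeneous (𝒜 := 𝒜) (f := f a) (g := g a) (fun j b hb => ?_) b
  refine eq_of_homogeneous (𝒜 := 𝒜) (f := f.flip b) (g := g.flip b) (fun i a ha => ?_) a
  change GradedTensorProduct.comm 𝒜 𝒜 (a ᵍ⊗ₜ[K] b) = includeRight 𝒜 𝒜 a * includeLeft 𝒜 𝒜 b
  rw [GradedTensorProduct.comm_coe_tmul_coe 𝒜 𝒜 ⟨a, ha⟩ ⟨b, hb⟩]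
  rw [(SuperCommute.inclusions 𝒜 𝒜).symm ⟨a, ha⟩ ⟨b, hb⟩, tmul_eq]

/-- The exchange of the first two tensor factors. -/
def swap₁₂ : T3 𝒜 →ₐ[K] T3 𝒜 :=
  ((superCommute₁₂ 𝒜).symm.lift_left (superCommute₂₃ 𝒜) (superCommute₁₃ 𝒜)).lift

/-- The exchange of the last two tensor factors. -/
def swap₂₃ : T3 𝒜 →ₐ[K] T3 𝒜 :=
  ((superCommute₁₃ 𝒜).lift_left (superCommute₁₂ 𝒜) (superCommute₂₃ 𝒜).symm).lift

variable (a : A)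

theorem flipHom_left : flipHom 𝒜 (includeLeft 𝒜 𝒜 a) = includeRight 𝒜 𝒜 a :=
  SuperCommute.lift_includeLeft _ a
theorem flipHom_right : flipHom 𝒜 (includeRight 𝒜 𝒜 a) = includeLeft 𝒜 𝒜 a :=
  SuperCommute.lift_includeRight _ a
theorem hom₁₂_left : hom₁₂ 𝒜 (includeLeft 𝒜 𝒜 a) = inc₁ 𝒜 a := SuperCommute.lift_includeLeft _ a
theorem hom₁₂_right : hom₁₂ 𝒜 (includeRight 𝒜 𝒜 a) = inc₂ 𝒜 a :=
  SuperCommute.lift_includeRight _ a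
theorem hom₁₃_left : hom₁₃ 𝒜 (includeLeft 𝒜 𝒜 a) = inc₁ 𝒜 a := SuperCommute.lift_includeLeft _ a
theorem hom₁₃_right : hom₁₃ 𝒜 (includeRight 𝒜 𝒜 a) = inc₃ 𝒜 a :=
  SuperCommute.lift_includeRight _ a
theorem hom₂₃_left : hom₂₃ 𝒜 (includeLeft 𝒜 𝒜 a) = inc₂ 𝒜 a := SuperCommute.lift_includeLeft _ a
theorem hom₂₃_right : hom₂₃ 𝒜 (includeRight 𝒜 𝒜 a) = inc₃ 𝒜 a :=
  SuperCommute.lift_includeRight _ a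

theorem swap₁₂_inc₁ : swap₁₂ 𝒜 (inc₁ 𝒜 a) = inc₂ 𝒜 a :=
  (SuperCommute.lift_includeLeft _ _).trans (SuperCommute.lift_includeLeft _ _)
theorem swap₁₂_inc₂ : swap₁₂ 𝒜 (inc₂ 𝒜 a) = inc₁ 𝒜 a :=
  (SuperCommute.lift_includeLeft _ _).trans (SuperCommute.lift_includeRight _ _)
theorem swap₁₂_inc₃ : swap₁₂ 𝒜 (inc₃ 𝒜 a) = inc₃ 𝒜 a := SuperCommute.lift_includeRight _ _
theorem swap₂₃_inc₁ : swap₂₃ 𝒜 (inc₁ 𝒜 a) = inc₁ 𝒜 a :=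
  (SuperCommute.lift_includeLeft _ _).trans (SuperCommute.lift_includeLeft _ _)
theorem swap₂₃_inc₂ : swap₂₃ 𝒜 (inc₂ 𝒜 a) = inc₃ 𝒜 a :=
  (SuperCommute.lift_includeLeft _ _).trans (SuperCommute.lift_includeRight _ _)
theorem swap₂₃_inc₃ : swap₂₃ 𝒜 (inc₃ 𝒜 a) = inc₂ 𝒜 a := SuperCommute.lift_includeRight _ _

end Legs

/-! #### Parity on the tensor square -/

section TensorParity

open GradedTensorProduct (includeLeft includeRight)

variable {K A : Type*} [CommRing K] [Ring A] [Algebra K A]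
  {𝒜 : ZMod 2 → Submodule K A} [GradedAlgebra 𝒜] {σ : A →ₐ[K] A}
  (hσ : ∀ i, ∀ a ∈ 𝒜 i, σ a = (-1 : ℤˣ) ^ i • a)

include hσ in
theorem parity_mem (i : ZMod 2) (a : A) (ha : a ∈ 𝒜 i) : σ a ∈ 𝒜 i := by
  rw [hσ i a ha, Units.smul_def]
  exact zsmul_mem ha _

/-- The parity automorphism of the tensor square. -/
def tensorParity : T2 𝒜 →ₐ[K] T2 𝒜 :=
  ((SuperCommute.inclusions 𝒜 𝒜).comp_even (parity_mem hσ) (parity_mem hσ)).lift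

theorem tensorParity_of_mem {i : ZMod 2} {z : T2 𝒜} (hz : z ∈ tensorGrading 𝒜 𝒜 i) :
    tensorParity hσ z = (-1 : ℤˣ) ^ i • z := by
  induction hz using Submodule.span_induction with
  | zero => simp
  | add x y _ _ hx hy => rw [map_add, hx, hy, smul_add]
  | smul c x _ hx => rw [map_smul, hx, smul_comm]
  | mem x hx =>
    obtain ⟨m, n, rfl, a, ha, b, hb, rfl⟩ := hx
    rw [tensorParity, SuperCommute.lift_tmul, AlgHom.comp_apply, AlgHom.comp_apply, hσ m a ha,
      hσ n b hb, tmul_eq]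
    simp only [Units.smul_def, map_zsmul]
    rw [smul_mul_smul_comm, uzpow_add, Units.val_mul]

/-- Twice the projection onto degree i is 1 + (-1)^i σ. Stated with the factor 2, this needs no
division in the base ring. -/
theorem exists_mem_tensorGrading (i : ZMod 2) (z : T2 𝒜) :
    ∃ t ∈ tensorGrading 𝒜 𝒜 i, (2 : ℕ) • t = z + (-1 : ℤˣ) ^ i • tensorParity hσ z := by
  let f : T2 𝒜 →ₗ[K] T2 𝒜 := 2 • GradedAlgebra.proj (tensorGrading 𝒜 𝒜) i
  let g : T2 𝒜 →ₗ[K] T2 𝒜 :=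
    LinearMap.id + (((-1 : ℤˣ) ^ i : ℤˣ) : ℤ) • (tensorParity hσ).toLinearMap
  refine ⟨GradedAlgebra.proj (tensorGrading 𝒜 𝒜) i z, SetLike.coe_mem _, ?_⟩
  change f z = g z
  refine eq_of_homogeneous (𝒜 := tensorGrading 𝒜 𝒜) (fun j t ht => ?_) z
  change 2 • GradedAlgebra.proj (tensorGrading 𝒜 𝒜) i t = t + (-1 : ℤˣ) ^ i • tensorParity hσ t
  rw [tensorParity_of_mem hσ ht, smul_smul, ← uzpow_add, GradedAlgebra.proj_apply,
    DirectSum.decompose_of_mem _ ht, DirectSum.coe_of_apply]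
  have : i + j = if j = i then 0 else 1 := by
    clear f g ht
    revert i j
    decide
  rw [this]
  split_ifs
  · rw [uzpow_zero, one_smul, two_smul]
  · rw [uzpow_one, Units.neg_smul, one_smul, add_neg_cancel]
    exact smul_zero _

end TensorParity

end SuperJordanian

end

noncomputable section

namespace SuperJordanian


open PowerSeries (C coeff)
open scoped Nat

/-! ### The completed tensor powers -/

namespace Compl

section Algebra

variable {K : Type*} [CommRing K] {h : K} {A B : Type*} [Ring A] [Algebra K A] [Ring B] [Algebra K B]

theorem liftLevel_mul (f : A →ₐ[K] Compl h B) (n : ℕ) (x y : A ⧸ hPow h A n) :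
    liftLevel f.toLinearMap n (x * y) =
      liftLevel f.toLinearMap n x * liftLevel f.toLinearMap n y := by
  obtain ⟨a, rfl⟩ := Ideal.Quotient.mk_surjective x
  obtain ⟨b, rfl⟩ := Ideal.Quotient.mk_surjective y
  rw [← map_mul, liftLevel_mk, liftLevel_mk, liftLevel_mk, AlgHom.toLinearMap_apply, map_mul]
  rfl

/-- The continuous extension of an algebra homomorphism. -/
def liftHom (f : A →ₐ[K] Compl h B) : Compl h A →ₐ[K] Compl h B :=
  AlgHom.ofLinearMap (lift f.toLinearMap) (by
    rw [← map_one (of h), lift_of, AlgHom.toLinearMap_apply, map_one]) (fun x y =>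
    Subtype.ext (funext fun n => liftLevel_mul f n (x.1 n) (y.1 n)))

theorem liftHom_of (f : A →ₐ[K] Compl h B) (a : A) : liftHom f (of h a) = f a := rfl

/-- The homomorphism of completions induced by an algebra homomorphism. -/
def mapHom (f : A →ₐ[K] B) : Compl h A →ₐ[K] Compl h B := liftHom ((of h).comp f)

theorem mapHom_of (f : A →ₐ[K] B) (a : A) : mapHom f (of h a) = of h (f a) := rfl

theorem map_eq (f : A →ₐ[K] B) : map (h := h) f.toLinearMap = (mapHom f).toLinearMap := rfl

theorem mapHom_comp_of {E : Type*} [Ring E] [Algebra K E] {f : A →ₐ[K] B} {g : E →ₐ[K] A}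
    {g' : E →ₐ[K] B} {a a' : E} (e : f (g a) = g' a') :
    mapHom f ((of h).comp g a) = (of h).comp g' a' :=
  congrArg (of h) e

theorem mapHom_val (f : A →ₐ[K] B) (x : Compl h A) {n : ℕ} {a : A}
    (e : x.1 n = Ideal.Quotient.mk _ a) : (mapHom f x).1 n = Ideal.Quotient.mk _ (f a) :=
  (congrArg (liftLevel ((of h).comp f).toLinearMap n) e).trans rfl

end Algebra

section Adic

variable {k : Type*} [Field k] {B : Type*} [Ring B] [Algebra k⟦X⟧ B]

theorem hbar_pow_smul_quotient {n m : ℕ} (e : m ≤ n) (x : B ⧸ hPow (hbar k) B m) :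
    hbar k ^ n • x = 0 := by
  obtain ⟨b, rfl⟩ := Ideal.Quotient.mk_surjective x
  refine Ideal.Quotient.eq_zero_iff_mem.2 ⟨hbar k ^ (n - m) • b, ?_⟩
  rw [smul_smul, ← pow_add, Nat.add_sub_cancel' e]

theorem sum_range_quotient {N m : ℕ} (e : m ≤ N) (x : ℕ → B ⧸ hPow (hbar k) B m) :
    ∑ i ∈ Finset.range N, hbar k ^ i • x i = ∑ i ∈ Finset.range m, hbar k ^ i • x i := by
  refine (Finset.sum_subset (Finset.range_mono e) fun i _ hi => ?_).symm
  exact hbar_pow_smul_quotient (by simpa using hi) _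

/-- The sum of a power series in `h` with coefficients in the completion. -/
def seriesSum (a : ℕ → Compl (hbar k) B) : Compl (hbar k) B :=
  ⟨fun m => ∑ i ∈ Finset.range m, hbar k ^ i • (a i).1 m, fun m n hmn => by
    have e : ∀ i (z : B ⧸ hPow (hbar k) B n), Ideal.Quotient.factor (hPow_anti (hbar k) B hmn)
        (hbar k ^ i • z) = hbar k ^ i • Ideal.Quotient.factor (hPow_anti (hbar k) B hmn) z := by
      intro i z
      obtain ⟨b, rfl⟩ := Ideal.Quotient.mk_surjective z
      rfl
    simp only [map_sum, e, (a _).2 m n hmn]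
    exact sum_range_quotient hmn _⟩

theorem seriesSum_val (a : ℕ → Compl (hbar k) B) (m : ℕ) {N : ℕ} (e : m ≤ N) :
    (seriesSum a).1 m = ∑ i ∈ Finset.range N, hbar k ^ i • (a i).1 m :=
  (sum_range_quotient e _).symm

theorem val_add (x y : Compl (hbar k) B) (m : ℕ) : (x + y).1 m = x.1 m + y.1 m := rfl

theorem val_smul (c : k⟦X⟧) (x : Compl (hbar k) B) (m : ℕ) : (c • x).1 m = c • x.1 m := rfl

theorem val_sum (a : ℕ → Compl (hbar k) B) (s : Finset ℕ) (m : ℕ) :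
    (∑ i ∈ s, a i).1 m = ∑ i ∈ s, (a i).1 m := by
  induction s using Finset.cons_induction with
  | empty => rfl
  | cons i s hi ih => rw [Finset.sum_cons, Finset.sum_cons, val_add, ih]

theorem ext_val {x y : Compl (hbar k) B} (h : ∀ m, x.1 m = y.1 m) : x = y :=
  Subtype.ext (funext h)

instance : HAdic k (Compl (hbar k) B) where
  eq_zero x hx := ext_val fun m => by
    obtain ⟨y, rfl⟩ := hx m
    rw [val_smul, hbar_pow_smul_quotient le_rfl]
    rfl
  exists_sum a := by
    refine ⟨seriesSum a, fun n => ⟨seriesSum fun i => a (n + i), ext_val fun m => ?_⟩⟩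
    -- Modulo hᵐ the sum may be cut at n + m instead of m, and then it splits at n.
    rw [seriesSum_val a m (Nat.le_add_left m n), val_add, val_sum, val_smul,
      seriesSum_val _ m le_rfl, Finset.sum_range_add, Finset.smul_sum]
    simp only [val_smul, smul_smul, pow_add]

/-- Representatives of the successive components differ by hᵐ times something. From the n-th one on,
these differences add up to hⁿ times a convergent series, so the error is hⁿ times an element of the
completion and not merely zero modulo hⁿ. -/
theorem exists_of (x : Compl (hbar k) B) (n : ℕ) :
    ∃ b y, x = of (hbar k) b + hbar k ^ n • y := by
  choose b hb using fun m => Ideal.Quotient.mk_surjective (x.1 m)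
  have hc : ∀ m, ∃ c, b (m + 1) = b m + hbar k ^ m • c := by
    intro m
    have e := x.2 m (m + 1) (Nat.le_succ m)
    rw [← hb, ← hb, Ideal.Quotient.factor_mk, Ideal.Quotient.eq] at e
    obtain ⟨c, hc⟩ := e
    exact ⟨c, by rw [← hc, add_sub_cancel]⟩
  choose c hc using hc
  have hs : ∀ m, b (n + m) = b n + hbar k ^ n • ∑ i ∈ Finset.range m, hbar k ^ i • c (n + i) := by
    intro m
    induction m with
    | zero => simp
    | succ m ih =>
      rw [← add_assoc, hc, ih, Finset.sum_range_succ, smul_add, smul_smul, ← pow_add, add_assoc]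
  refine ⟨b n, seriesSum fun i => of (hbar k) (c (n + i)), ext_val fun m => ?_⟩
  -- The component of level m is read off from level n + m, where the representative is known
  -- relative to `b n`.
  rw [← x.2 m (n + m) (Nat.le_add_left m n), ← hb, Ideal.Quotient.factor_mk, hs, _root_.map_add, val_add,
    val_smul, seriesSum_val _ m le_rfl]
  refine congrArg₂ _ rfl ?_
  change hbar k ^ n • Ideal.Quotient.mk (hPow (hbar k) B m) _ = _
  rw [map_sum]
  rfl

theorem linear_ext {𝒟 : Type*} [Ring 𝒟] [Algebra k⟦X⟧ 𝒟] [HAdic k 𝒟]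
    {f g : Compl (hbar k) B →ₗ[k⟦X⟧] 𝒟} (h : ∀ b, f (of _ b) = g (of _ b)) : f = g := by
  ext x
  refine eq_of_forall_mod (k := k) fun n => ?_
  obtain ⟨b, y, rfl⟩ := exists_of x n
  refine ⟨f y - g y, ?_⟩
  rw [_root_.map_add, _root_.map_add, _root_.map_smul, _root_.map_smul, h, smul_sub]
  abel

/-- One level is lost: if b represents x modulo hᵐ⁺¹, then hb = hᵐ⁺¹c, so b = hᵐc and x vanishes
modulo hᵐ. -/
instance [HTorsionFree k B] : HTorsionFree k (Compl (hbar k) B) where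
  eq_zero x hx := ext_val fun m => by
    obtain ⟨b, hb⟩ := Ideal.Quotient.mk_surjective (x.1 (m + 1))
    have e := congrArg (fun z : Compl (hbar k) B => z.1 (m + 1)) hx
    change hbar k • x.1 (m + 1) = 0 at e
    rw [← hb] at e
    obtain ⟨c, hc⟩ := Ideal.Quotient.eq_zero_iff_mem.1
      (show Ideal.Quotient.mk (hPow (hbar k) B (m + 1)) (hbar k • b) = 0 from e)
    rw [pow_succ', mul_smul] at hc
    rw [← x.2 m (m + 1) (Nat.le_succ m), ← hb, Ideal.Quotient.factor_mk]
    exact Ideal.Quotient.eq_zero_iff_mem.2 ⟨c, hbar_smul_inj hc⟩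

end Adic

end Compl

section Flat

variable {k : Type*} [Field k] {A : Type*} [Ring A] [Algebra k⟦X⟧ A]

/-- k⟦h⟧ is a discrete valuation ring with uniformiser h, so a nonzero scalar is a unit times a
power of h. Torsion-freeness over it gives flatness, which, unlike torsion-freeness over a general
base, passes to tensor products. -/
theorem HTorsionFree.isTorsionFree [HTorsionFree k A] : Module.IsTorsionFree k⟦X⟧ A where
  isSMulRegular r hr := by
    obtain ⟨n, u, rfl⟩ := IsDiscreteValuationRing.eq_unit_mul_pow_irreducible hr.ne_zero
      (PowerSeries.X_prime (R := k)).irreducible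
    refine (u.isUnit.isSMulRegular A).mul (IsSMulRegular.pow n ?_)
    exact fun x y e => hbar_smul_inj e

theorem HTorsionFree.of_flat [Module.Flat k⟦X⟧ A] : HTorsionFree k A where
  eq_zero x hx := by
    have := Module.IsTorsionFree.isSMulRegular (M := A)
      (IsRegular.of_ne_zero (PowerSeries.X_ne_zero (R := k)))
    exact this (hx.trans (smul_zero _).symm)

variable (𝒜 : ZMod 2 → Submodule k⟦X⟧ A) [GradedAlgebra 𝒜]

theorem flat_T2 [Module.Flat k⟦X⟧ A] : Module.Flat k⟦X⟧ (T2 𝒜) :=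
  Module.Flat.of_linearEquiv (GradedTensorProduct.of k⟦X⟧ 𝒜 𝒜).symm

theorem flat_T3 [Module.Flat k⟦X⟧ A] : Module.Flat k⟦X⟧ (T3 𝒜) :=
  letI := flat_T2 𝒜
  Module.Flat.of_linearEquiv (GradedTensorProduct.of k⟦X⟧ (tensorGrading 𝒜 𝒜) 𝒜).symm

end Flat

/-! #### The completed tensor square and cube of a complete superalgebra -/

section Square

open GradedTensorProduct (includeLeft includeRight)

variable {k : Type*} [Field k] {A : Type*} [Ring A] [Algebra k⟦X⟧ A]
  (𝒜 : ZMod 2 → Submodule k⟦X⟧ A) [GradedAlgebra 𝒜]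

/-- `a ↦ a ⊗ 1`. -/
def inl : A →ₐ[k⟦X⟧] Compl (hbar k) (T2 𝒜) := (Compl.of (hbar k)).comp (includeLeft 𝒜 𝒜)
/-- `a ↦ 1 ⊗ a`. -/
def inr : A →ₐ[k⟦X⟧] Compl (hbar k) (T2 𝒜) := (Compl.of (hbar k)).comp (includeRight 𝒜 𝒜)
/-- `a ↦ a ⊗ 1 ⊗ 1`. -/
def in₁ : A →ₐ[k⟦X⟧] Compl (hbar k) (T3 𝒜) := (Compl.of (hbar k)).comp (inc₁ 𝒜)
/-- `a ↦ 1 ⊗ a ⊗ 1`. -/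
def in₂ : A →ₐ[k⟦X⟧] Compl (hbar k) (T3 𝒜) := (Compl.of (hbar k)).comp (inc₂ 𝒜)
/-- `a ↦ 1 ⊗ 1 ⊗ a`. -/
def in₃ : A →ₐ[k⟦X⟧] Compl (hbar k) (T3 𝒜) := (Compl.of (hbar k)).comp (inc₃ 𝒜)

theorem of_tmul (a b : A) : Compl.of (hbar k) (a ᵍ⊗ₜ[k⟦X⟧] b : T2 𝒜) = inl 𝒜 a * inr 𝒜 b := by
  rw [tmul_eq, map_mul]
  rfl

theorem superCommute_inl_inr : SuperCommute 𝒜 𝒜 (inl 𝒜) (inr 𝒜) :=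
  (SuperCommute.inclusions 𝒜 𝒜).comp (Compl.of (hbar k))

theorem superCommute_in₁_in₂ : SuperCommute 𝒜 𝒜 (in₁ 𝒜) (in₂ 𝒜) :=
  (superCommute₁₂ 𝒜).comp (Compl.of (hbar k))

theorem superCommute_in₁_in₃ : SuperCommute 𝒜 𝒜 (in₁ 𝒜) (in₃ 𝒜) :=
  (superCommute₁₃ 𝒜).comp (Compl.of (hbar k))

theorem superCommute_in₂_in₃ : SuperCommute 𝒜 𝒜 (in₂ 𝒜) (in₃ 𝒜) :=
  (superCommute₂₃ 𝒜).comp (Compl.of (hbar k))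

/-- The super flip of the completed tensor square. -/
def flip₂ : Compl (hbar k) (T2 𝒜) →ₐ[k⟦X⟧] Compl (hbar k) (T2 𝒜) := Compl.mapHom (flipHom 𝒜)
/-- `z ↦ z₁₂`. -/
def to₁₂ : Compl (hbar k) (T2 𝒜) →ₐ[k⟦X⟧] Compl (hbar k) (T3 𝒜) := Compl.mapHom (hom₁₂ 𝒜)
/-- `z ↦ z₁₃`. -/
def to₁₃ : Compl (hbar k) (T2 𝒜) →ₐ[k⟦X⟧] Compl (hbar k) (T3 𝒜) := Compl.mapHom (hom₁₃ 𝒜)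
/-- `z ↦ z₂₃`. -/
def to₂₃ : Compl (hbar k) (T2 𝒜) →ₐ[k⟦X⟧] Compl (hbar k) (T3 𝒜) := Compl.mapHom (hom₂₃ 𝒜)
/-- The exchange of the first two factors. -/
def sw₁₂ : Compl (hbar k) (T3 𝒜) →ₐ[k⟦X⟧] Compl (hbar k) (T3 𝒜) := Compl.mapHom (swap₁₂ 𝒜)
/-- The exchange of the last two factors. -/
def sw₂₃ : Compl (hbar k) (T3 𝒜) →ₐ[k⟦X⟧] Compl (hbar k) (T3 𝒜) := Compl.mapHom (swap₂₃ 𝒜)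

theorem map_superFlip (z : Compl (hbar k) (T2 𝒜)) : Compl.map (superFlip 𝒜) z = flip₂ 𝒜 z := by
  rw [superFlip_eq, Compl.map_eq]
  rfl

theorem map_leg12 (z : Compl (hbar k) (T2 𝒜)) : Compl.map (leg12 𝒜) z = to₁₂ 𝒜 z := by
  rw [leg12_eq, Compl.map_eq]
  rfl

theorem map_leg13 (z : Compl (hbar k) (T2 𝒜)) : Compl.map (leg13 𝒜) z = to₁₃ 𝒜 z := by
  rw [leg13_eq, Compl.map_eq]
  rfl

theorem map_leg23 (z : Compl (hbar k) (T2 𝒜)) : Compl.map (leg23 𝒜) z = to₂₃ 𝒜 z := by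
  rw [leg23_eq, Compl.map_eq]
  rfl

section Apply

variable (a : A)

theorem flip₂_inl : flip₂ 𝒜 (inl 𝒜 a) = inr 𝒜 a :=
  Compl.mapHom_comp_of (flipHom_left 𝒜 a)
theorem flip₂_inr : flip₂ 𝒜 (inr 𝒜 a) = inl 𝒜 a :=
  Compl.mapHom_comp_of (flipHom_right 𝒜 a)
theorem to₁₂_inl : to₁₂ 𝒜 (inl 𝒜 a) = in₁ 𝒜 a :=
  Compl.mapHom_comp_of (hom₁₂_left 𝒜 a)
theorem to₁₂_inr : to₁₂ 𝒜 (inr 𝒜 a) = in₂ 𝒜 a :=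
  Compl.mapHom_comp_of (hom₁₂_right 𝒜 a)
theorem to₁₃_inl : to₁₃ 𝒜 (inl 𝒜 a) = in₁ 𝒜 a :=
  Compl.mapHom_comp_of (hom₁₃_left 𝒜 a)
theorem to₁₃_inr : to₁₃ 𝒜 (inr 𝒜 a) = in₃ 𝒜 a :=
  Compl.mapHom_comp_of (hom₁₃_right 𝒜 a)
theorem to₂₃_inl : to₂₃ 𝒜 (inl 𝒜 a) = in₂ 𝒜 a :=
  Compl.mapHom_comp_of (hom₂₃_left 𝒜 a)
theorem to₂₃_inr : to₂₃ 𝒜 (inr 𝒜 a) = in₃ 𝒜 a :=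
  Compl.mapHom_comp_of (hom₂₃_right 𝒜 a)
theorem sw₁₂_in₁ : sw₁₂ 𝒜 (in₁ 𝒜 a) = in₂ 𝒜 a :=
  Compl.mapHom_comp_of (swap₁₂_inc₁ 𝒜 a)
theorem sw₁₂_in₂ : sw₁₂ 𝒜 (in₂ 𝒜 a) = in₁ 𝒜 a :=
  Compl.mapHom_comp_of (swap₁₂_inc₂ 𝒜 a)
theorem sw₁₂_in₃ : sw₁₂ 𝒜 (in₃ 𝒜 a) = in₃ 𝒜 a :=
  Compl.mapHom_comp_of (swap₁₂_inc₃ 𝒜 a)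
theorem sw₂₃_in₁ : sw₂₃ 𝒜 (in₁ 𝒜 a) = in₁ 𝒜 a :=
  Compl.mapHom_comp_of (swap₂₃_inc₁ 𝒜 a)
theorem sw₂₃_in₂ : sw₂₃ 𝒜 (in₂ 𝒜 a) = in₃ 𝒜 a :=
  Compl.mapHom_comp_of (swap₂₃_inc₂ 𝒜 a)
theorem sw₂₃_in₃ : sw₂₃ 𝒜 (in₃ 𝒜 a) = in₂ 𝒜 a :=
  Compl.mapHom_comp_of (swap₂₃_inc₃ 𝒜 a)

end Apply

section Ext

variable {𝒜} {𝒟 : Type*} [Ring 𝒟] [Algebra k⟦X⟧ 𝒟] [HAdic k 𝒟]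

theorem square_linear_ext {f g : Compl (hbar k) (T2 𝒜) →ₗ[k⟦X⟧] 𝒟}
    (h : ∀ a b, f (inl 𝒜 a * inr 𝒜 b) = g (inl 𝒜 a * inr 𝒜 b)) : f = g := by
  refine Compl.linear_ext fun z => ?_
  have : f ∘ₗ (Compl.of (hbar k)).toLinearMap = g ∘ₗ (Compl.of (hbar k)).toLinearMap :=
    T2_linear_ext fun a b => by
      change f (Compl.of (hbar k) (a ᵍ⊗ₜ[k⟦X⟧] b : T2 𝒜)) = g (Compl.of (hbar k) (a ᵍ⊗ₜ[k⟦X⟧] b : T2 𝒜))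
      rw [of_tmul, h]
  exact LinearMap.congr_fun this z

theorem square_hom_ext {f g : Compl (hbar k) (T2 𝒜) →ₐ[k⟦X⟧] 𝒟}
    (hl : f.comp (inl 𝒜) = g.comp (inl 𝒜)) (hr : f.comp (inr 𝒜) = g.comp (inr 𝒜)) : f = g := by
  have : f.toLinearMap = g.toLinearMap := square_linear_ext fun a b => by
    rw [AlgHom.toLinearMap_apply, AlgHom.toLinearMap_apply, map_mul, map_mul]
    exact congrArg₂ _ (DFunLike.congr_fun hl a) (DFunLike.congr_fun hr b)
  exact AlgHom.toLinearMap_injective this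

end Ext

/-! #### Parity and homogeneous elements -/

variable {𝒜} {σ : A →ₐ[k⟦X⟧] A} (hσ : ∀ i, ∀ a ∈ 𝒜 i, σ a = (-1 : ℤˣ) ^ i • a)

/-- The parity automorphism of the completed tensor square. -/
def squareParity : Compl (hbar k) (T2 𝒜) →ₐ[k⟦X⟧] Compl (hbar k) (T2 𝒜) :=
  Compl.mapHom (tensorParity hσ)

theorem squareParity_inl (a : A) : squareParity hσ (inl 𝒜 a) = inl 𝒜 (σ a) :=
  Compl.mapHom_comp_of (SuperCommute.lift_includeLeft
    ((SuperCommute.inclusions 𝒜 𝒜).comp_even (parity_mem hσ) (parity_mem hσ)) a)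

theorem squareParity_inr (a : A) : squareParity hσ (inr 𝒜 a) = inr 𝒜 (σ a) :=
  Compl.mapHom_comp_of (SuperCommute.lift_includeRight
    ((SuperCommute.inclusions 𝒜 𝒜).comp_even (parity_mem hσ) (parity_mem hσ)) a)

/-- Since 2 is invertible, an eigenvector of parity with eigenvalue (-1)^i is, modulo each hⁿ, the
image of its own projection ½(1 + (-1)^i σ) to degree i. -/
theorem isHomog_of_squareParity [CharZero k] {i : ZMod 2} {z : Compl (hbar k) (T2 𝒜)}
    (e : squareParity hσ z = (-1 : ℤˣ) ^ i • z) : IsHomog i z := by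
  intro n
  obtain ⟨t, ht⟩ := Ideal.Quotient.mk_surjective (z.1 n)
  obtain ⟨t', ht', e'⟩ := exists_mem_tensorGrading hσ i t
  have h2 : (C (1 / 2 : k) : k⟦X⟧) * 2 = 1 := by
    rw [← map_ofNat (C : k →+* k⟦X⟧) 2, ← map_mul, ← map_one (C : k →+* k⟦X⟧)]
    norm_num
  refine ⟨t', ht', ?_⟩
  have e1 : Ideal.Quotient.mk (hPow (hbar k) (T2 𝒜) n) (tensorParity hσ t) =
      (-1 : ℤˣ) ^ i • z.1 n := by
    rw [← Compl.mapHom_val (tensorParity hσ) z ht.symm]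
    exact congrArg (fun w : Compl (hbar k) (T2 𝒜) => w.1 n) e
  have e2 := congrArg (Ideal.Quotient.mk (hPow (hbar k) (T2 𝒜) n)) e'
  rw [map_nsmul, map_add, Units.smul_def, map_zsmul, e1, ← Units.smul_def, smul_smul, ← uzpow_add,
    CharTwo.add_self_eq_zero, uzpow_zero, one_smul, ht, ← two_nsmul] at e2
  have e3 := congrArg (fun w => (C (1 / 2 : k) : k⟦X⟧) • w) e2
  have key : ∀ w : T2 𝒜 ⧸ hPow (hbar k) (T2 𝒜) n, (C (1 / 2 : k) : k⟦X⟧) • (2 : ℕ) • w = w := by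
    intro w
    rw [← Nat.cast_smul_eq_nsmul k⟦X⟧, smul_smul, Nat.cast_ofNat, h2, one_smul]
  simpa only [key] using e3.symm

theorem IsHomog.to₁₂_mul_in₃ {i j : ZMod 2} {z : Compl (hbar k) (T2 𝒜)} (hz : IsHomog i z) {b : A}
    (hb : b ∈ 𝒜 j) : to₁₂ 𝒜 z * in₃ 𝒜 b = (-1 : ℤˣ) ^ (j * i) • (in₃ 𝒜 b * to₁₂ 𝒜 z) := by
  refine Compl.ext_val fun n => ?_
  obtain ⟨t, ht, e⟩ := hz n
  have e1 : (to₁₂ 𝒜 z).1 n = Ideal.Quotient.mk _ (hom₁₂ 𝒜 t) := Compl.mapHom_val (hom₁₂ 𝒜) z e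
  change (to₁₂ 𝒜 z).1 n * Ideal.Quotient.mk _ (inc₃ 𝒜 b) =
    (-1 : ℤˣ) ^ (j * i) • (Ideal.Quotient.mk _ (inc₃ 𝒜 b) * (to₁₂ 𝒜 z).1 n)
  have sc : SuperCommute (tensorGrading 𝒜 𝒜) 𝒜 (hom₁₂ 𝒜) (inc₃ 𝒜) :=
    (superCommute₁₂ 𝒜).lift_left (superCommute₁₃ 𝒜) (superCommute₂₃ 𝒜)
  have := sc ⟨t, ht⟩ ⟨b, hb⟩
  dsimp only at this
  rw [e1, ← map_mul, this, Units.smul_def, map_zsmul, map_mul, Units.smul_def]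

theorem IsHomog.in₁_mul_to₂₃ {i j : ZMod 2} {z : Compl (hbar k) (T2 𝒜)} (hz : IsHomog i z) {a : A}
    (ha : a ∈ 𝒜 j) : in₁ 𝒜 a * to₂₃ 𝒜 z = (-1 : ℤˣ) ^ (i * j) • (to₂₃ 𝒜 z * in₁ 𝒜 a) := by
  refine Compl.ext_val fun n => ?_
  obtain ⟨t, ht, e⟩ := hz n
  have e1 : (to₂₃ 𝒜 z).1 n = Ideal.Quotient.mk _ (hom₂₃ 𝒜 t) := Compl.mapHom_val (hom₂₃ 𝒜) z e
  change Ideal.Quotient.mk _ (inc₁ 𝒜 a) * (to₂₃ 𝒜 z).1 n =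
    (-1 : ℤˣ) ^ (i * j) • ((to₂₃ 𝒜 z).1 n * Ideal.Quotient.mk _ (inc₁ 𝒜 a))
  have sc : SuperCommute (tensorGrading 𝒜 𝒜) 𝒜 (hom₂₃ 𝒜) (inc₁ 𝒜) :=
    (superCommute₂₃ 𝒜).lift_left (superCommute₁₂ 𝒜).symm (superCommute₁₃ 𝒜).symm
  have := sc.symm ⟨a, ha⟩ ⟨t, ht⟩
  dsimp only at this
  rw [e1, ← map_mul, this, Units.smul_def, map_zsmul, map_mul, Units.smul_def]

/-! #### `Δ ⊗ id` and `id ⊗ Δ` -/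

section Apply

variable {f : A →ₐ[k⟦X⟧] Compl (hbar k) (T2 𝒜)} (hf : ∀ i, ∀ a ∈ 𝒜 i, IsHomog i (f a))

include hf in
theorem superCommute_left : SuperCommute 𝒜 𝒜 ((to₁₂ 𝒜).comp f) (in₃ 𝒜) :=
  fun i _ a b => (hf i a a.2).to₁₂_mul_in₃ b.2

include hf in
theorem superCommute_right : SuperCommute 𝒜 𝒜 (in₁ 𝒜) ((to₂₃ 𝒜).comp f) :=
  fun _ j a b => (hf j b b.2).in₁_mul_to₂₃ a.2

/-- `f ⊗ id` as a homomorphism. -/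
def leftHom : Compl (hbar k) (T2 𝒜) →ₐ[k⟦X⟧] Compl (hbar k) (T3 𝒜) :=
  Compl.liftHom (superCommute_left hf).lift

/-- `id ⊗ f` as a homomorphism. -/
def rightHom : Compl (hbar k) (T2 𝒜) →ₐ[k⟦X⟧] Compl (hbar k) (T3 𝒜) :=
  Compl.liftHom (superCommute_right hf).lift

theorem leftHom_inl (a : A) : leftHom hf (inl 𝒜 a) = to₁₂ 𝒜 (f a) :=
  (Compl.liftHom_of _ _).trans ((superCommute_left hf).lift_includeLeft a)

theorem leftHom_inr (a : A) : leftHom hf (inr 𝒜 a) = in₃ 𝒜 a :=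
  (Compl.liftHom_of _ _).trans ((superCommute_left hf).lift_includeRight a)

theorem rightHom_inl (a : A) : rightHom hf (inl 𝒜 a) = in₁ 𝒜 a :=
  (Compl.liftHom_of _ _).trans ((superCommute_right hf).lift_includeLeft a)

theorem rightHom_inr (a : A) : rightHom hf (inr 𝒜 a) = to₂₃ 𝒜 (f a) :=
  (Compl.liftHom_of _ _).trans ((superCommute_right hf).lift_includeRight a)

theorem map_snocTensor (b : A) (z : Compl (hbar k) (T2 𝒜)) :
    Compl.map (snocTensor 𝒜 b) z = to₁₂ 𝒜 z * in₃ 𝒜 b := by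
  have : Compl.map (h := hbar k) (snocTensor 𝒜 b) =
      LinearMap.mulRight k⟦X⟧ (in₃ 𝒜 b) ∘ₗ (to₁₂ 𝒜).toLinearMap := Compl.linear_ext fun z => by
    rw [Compl.map_of, snocTensor_eq, map_mul]
    rfl
  rw [this]
  rfl

theorem map_consTensor (a : A) (z : Compl (hbar k) (T2 𝒜)) :
    Compl.map (consTensor 𝒜 a) z = in₁ 𝒜 a * to₂₃ 𝒜 z := by
  have : Compl.map (h := hbar k) (consTensor 𝒜 a) =
      LinearMap.mulLeft k⟦X⟧ (in₁ 𝒜 a) ∘ₗ (to₂₃ 𝒜).toLinearMap := Compl.linear_ext fun z => by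
    rw [Compl.map_of, consTensor_eq, map_mul]
    rfl
  rw [this]
  rfl

/-- Because f preserves degrees, the images f(a)₁₂ and b₃ supercommute, so the linear map f ⊗ id is
an algebra homomorphism. It is then determined on the two legs. -/
theorem applyLeft_eq (z : Compl (hbar k) (T2 𝒜)) : applyLeft f.toLinearMap z = leftHom hf z := by
  have : applyLeft f.toLinearMap = (leftHom hf).toLinearMap := square_linear_ext fun a b => by
    rw [AlgHom.toLinearMap_apply, map_mul (leftHom hf), leftHom_inl, leftHom_inr,
      ← map_snocTensor, ← of_tmul]
    exact applyLeft_tmul _ a b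
  rw [this]
  rfl

theorem applyRight_eq (z : Compl (hbar k) (T2 𝒜)) : applyRight f.toLinearMap z = rightHom hf z := by
  have : applyRight f.toLinearMap = (rightHom hf).toLinearMap := square_linear_ext fun a b => by
    rw [AlgHom.toLinearMap_apply, map_mul (rightHom hf), rightHom_inl, rightHom_inr,
      ← map_consTensor, ← of_tmul]
    exact applyRight_tmul _ a b
  rw [this]
  rfl

end Apply

end Square

end SuperJordanian

end

noncomputable section

namespace SuperJordanian


open PowerSeries (C coeff)
open scoped Nat

/-! ### The twist -/

section Calculus

variable {R 𝒞 : Type*} [CommRing R] [Ring 𝒞] [Algebra R 𝒞]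

namespace TwistedCalculus

variable {η : R} {W J g T T' s : 𝒞} (c : TwistedCalculus η W J g T T')
include c

/-- 2ηg²(1 + T) = T - 1 is divided by 1 + T; here s is the inverse of 1 + T. -/
theorem two_smul_g_g (hs : (1 + T) * s = 1) : (2 : R) • η • (g * g) = 1 - (2 : R) • s := by
  have h := congrArg (fun z => z * s) c.g_g
  have e : (2 : R) • η • (g * g + g * (g * T)) * s = (2 : R) • η • (g * g * ((1 + T) * s)) := by
    simp only [smul_mul_assoc, mul_add, add_mul, mul_assoc, mul_one, one_mul]
  have e2 : (T - 1) * s = (1 + T) * s - (2 : R) • s := by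
    simp only [sub_mul, add_mul, one_mul, two_smul]
    abel
  rwa [e, e2, hs, mul_one] at h

/-- The relation {v, W} = -J with v = g + gT, after T has been moved past W, contains {g, W}(1 + T);
multiplication by s isolates {g, W}. -/
theorem g_mul_W (hs : (1 + T) * s = 1) : g * W = -(W * g) - (J + 1 - T') * s := by
  have h2 : (2 : R) • η • (g * (g * T') + g * g) = 1 - T' := by
    have := congrArg (fun z => z * T') c.g_g
    simpa only [smul_mul_assoc, add_mul, sub_mul, mul_assoc, c.T_T', one_mul, mul_one] using this
  have h : (g * W + W * g) * (1 + T) = -(J + 1 - T') := by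
    have e1 := c.g_W
    have e2 := congrArg (fun z => g * z) c.T_W
    linear_combination (norm := skip) e1 - e2 - h2
    simp only [mul_add, add_mul, mul_one, mul_assoc, mul_smul_comm]
    module
  have h' := congrArg (fun z => z * s) h
  rw [mul_assoc, hs, mul_one] at h'
  rw [eq_sub_of_add_eq h']
  simp only [neg_mul]
  abel

end TwistedCalculus

/-- Two supercommuting twisted calculi. -/
structure TwoCalculi (η : R) (W₁ J₁ g₁ x x' s₁ W₂ J₂ g₂ y y' s₂ : 𝒞) : Prop where
  fst : TwistedCalculus η W₁ J₁ g₁ x x'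
  snd : TwistedCalculus η W₂ J₂ g₂ y y'
  s₁_eq : (1 + x) * s₁ = 1
  s₂_eq : (1 + y) * s₂ = 1
  g_g : g₂ * g₁ = -(g₁ * g₂)
  g_W : g₂ * W₁ = -(W₁ * g₂)
  W_g : g₁ * W₂ = -(W₂ * g₁)
  J_g : g₁ * J₂ = J₂ * g₁
  g_J : g₂ * J₁ = J₁ * g₂
  x_g : x * g₂ = g₂ * x
  x'_g : x' * g₂ = g₂ * x'
  s₁_g : s₁ * g₂ = g₂ * s₁
  y_g : y * g₁ = g₁ * y
  y'_g : y' * g₁ = g₁ * y'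
  x_y : y * x = x * y
  x'_y : y * x' = x' * y
  x_y' : y' * x = x * y'

namespace TwoCalculi

variable {η : R} {W₁ J₁ g₁ x x' s₁ W₂ J₂ g₂ y y' s₂ : 𝒞}
  (t : TwoCalculi η W₁ J₁ g₁ x x' s₁ W₂ J₂ g₂ y y' s₂)
include t

theorem g_sq_mul₁ (z : 𝒞) : (2 : R) • η • (g₁ * (g₁ * z)) = z - (2 : R) • (s₁ * z) := by
  have := congrArg (fun w => w * z) (t.fst.two_smul_g_g t.s₁_eq)
  simpa only [smul_mul_assoc, sub_mul, one_mul, mul_assoc] using this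

/-- The first factor of the twist, applied to the coproduct of `v`. -/
theorem one_sub_mul_sum : (1 - (2 : R) • η • (g₁ * g₂)) * ((g₁ + g₁ * x) * y + (g₂ + g₂ * y)) =
    (g₁ + g₂) * (1 + x * y) := by
  have e1 := t.fst.g_g
  have e2 := t.snd.g_g
  linear_combination (norm := (simp only [mul_add, add_mul, mul_sub, sub_mul, mul_one, one_mul,
    mul_assoc, smul_mul_assoc, mul_smul_comm, smul_add, smul_sub, smul_neg, mul_neg, neg_mul,
    t.g_g, assoc_of_eq t.g_g, t.fst.T_g, assoc_of_eq t.fst.T_g, t.snd.T_g, assoc_of_eq t.snd.T_g,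
    t.x_g, assoc_of_eq t.x_g, t.y_g, assoc_of_eq t.y_g, t.x_y, assoc_of_eq t.x_y]; module))
    e1 * (g₂ * y) - g₁ * e2

/-- Both this product and the one in `one_sub_mul_sum` equal (g₁ + g₂)(1 + T₁T₂). Hence the odd
factor of the twist conjugates v₁T₂ + v₂ into v₁ + T₁v₂. -/
theorem sum_mul_one_sub : ((g₁ + g₁ * x) + x * (g₂ + g₂ * y)) * (1 - (2 : R) • η • (g₁ * g₂)) =
    (g₁ + g₂) * (1 + x * y) := by
  have e1 := t.fst.g_g
  have e2 := t.snd.g_g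
  linear_combination (norm := (simp only [mul_add, add_mul, mul_sub, sub_mul, mul_one, one_mul,
    mul_assoc, smul_mul_assoc, mul_smul_comm, smul_add, smul_sub, smul_neg, mul_neg, neg_mul,
    t.g_g, assoc_of_eq t.g_g, t.fst.T_g, assoc_of_eq t.fst.T_g, t.snd.T_g, assoc_of_eq t.snd.T_g,
    t.x_g, assoc_of_eq t.x_g, t.y_g, assoc_of_eq t.y_g, t.x_y, assoc_of_eq t.x_y]; module))
    -(e1 * g₂) + g₁ * (e2 * x)

/-- This is the core of the computation of Δ(V₋). G stands for g of the mixed element v₁T₂ + v₂. The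
last bracket is the κ-element of the sum pair after conjugation by the even factor of the twist, and
κ₁T₂⁻¹ + κ₂ is what conjugation by the odd factor 1 - c, with c = 2ηg₁g₂, must turn it into. The
auxiliary identities give the products and commutators of c with the generators. -/
theorem kappa_twist {G : 𝒞} (hG : (1 - (2 : R) • η • (g₁ * g₂)) * G = g₁ + g₂)
    (hG' : G * (1 + x * y) = (g₁ + g₁ * x) * y + (g₂ + g₂ * y)) (hx : x * G = G * x)
    (hy : y * G = G * y) :
    (kappa η W₁ J₁ g₁ x' * y' + kappa η W₂ J₂ g₂ y') * (1 - (2 : R) • η • (g₁ * g₂)) =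
      (1 - (2 : R) • η • (g₁ * g₂)) *
        (W₁ * y' + W₂ + η • (J₁ * (y' * (y' * (g₂ + g₂ * y)))) - η • ((J₁ * (y' * y') + J₂) * G) -
          η • (G - G * (x' * y'))) := by
  set c := (2 : R) • η • (g₁ * g₂) with hc
  have gW := t.fst.g_mul_W t.s₁_eq
  have gW' := t.snd.g_mul_W t.s₂_eq
  have A1 : c * W₁ = W₁ * c + (2 : R) • η • ((J₁ + 1 - x') * (s₁ * g₂)) := by
    simp only [hc, mul_add, add_mul, mul_sub, sub_mul, mul_one, one_mul, mul_assoc, smul_mul_assoc,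
      mul_smul_comm, mul_neg, neg_mul, t.g_W, gW, assoc_of_eq gW]
    module
  have A2 : c * W₂ = W₂ * c - (2 : R) • η • ((J₂ + 1 - y') * (g₁ * s₂)) := by
    simp only [hc, mul_add, add_mul, mul_sub, sub_mul, mul_one, one_mul, mul_assoc, smul_mul_assoc,
      mul_smul_comm, mul_neg, neg_mul, t.W_g, assoc_of_eq t.W_g, gW', assoc_of_eq t.J_g,
      assoc_of_eq t.y'_g]
    module
  have A3 : c * J₁ = J₁ * c - (2 : R) • (c * x') := by
    simp only [hc, mul_assoc, smul_mul_assoc, mul_smul_comm, sub_mul, t.g_J, assoc_of_eq t.fst.g_J,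
      t.x'_g]
    module
  have A4 : c * J₂ = J₂ * c - (2 : R) • (c * y') := by
    simp only [hc, mul_assoc, smul_mul_assoc, mul_smul_comm, mul_sub, t.snd.g_J, assoc_of_eq t.J_g]
    module
  have A5 : g₁ * c = g₂ - (2 : R) • (s₁ * g₂) := by
    rw [hc, mul_smul_comm, mul_smul_comm, t.g_sq_mul₁]
  have A6 : g₂ * c = -(g₁ - (2 : R) • (g₁ * s₂)) := by
    have := t.snd.two_smul_g_g t.s₂_eq
    rw [hc, mul_smul_comm, mul_smul_comm, ← mul_assoc, t.g_g, neg_mul, mul_assoc, smul_neg,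
      smul_neg, ← mul_smul_comm, ← mul_smul_comm, this, mul_sub, mul_one, mul_smul_comm]
  have A7 : c * (g₂ + g₂ * y) = g₁ * (y - 1) := by
    rw [← t.snd.g_g, hc]
    simp only [mul_add, smul_mul_assoc, mul_smul_comm, mul_assoc, smul_add]
  -- The element G has no closed form here, but x'y'² + y' = x'y'²(1 + xy), and (1 + xy)G is given
  -- by `hG'`.
  have A8 : c * (x' * (y' * y') + y') * G =
      x' * (y' * y') * (g₁ * (y - 1) + g₂ * (y * (1 - x))) := by
    have e1 : x' * (y' * y') + y' = x' * (y' * y') * (1 + x * y) := by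
      simp only [mul_add, mul_one, one_mul, mul_assoc, t.x_y', assoc_of_eq t.x_y', t.snd.T'_T,
        t.fst.T'_T, assoc_of_eq t.fst.T'_T]
    have e2 : c * (x' * (y' * y')) = x' * (y' * y') * c := by
      simp only [hc, mul_assoc, smul_mul_assoc, mul_smul_comm, t.y'_g, assoc_of_eq t.y'_g,
        assoc_of_eq t.fst.T'_g, t.snd.T'_g, assoc_of_eq t.snd.T'_g, assoc_of_eq t.x'_g]
    have e3 : (1 + x * y) * G = (g₁ + g₁ * x) * y + (g₂ + g₂ * y) := by
      rw [← hG', add_mul, mul_add, one_mul, mul_one, mul_assoc, hy, ← mul_assoc, hx, mul_assoc]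
    have e4 := t.one_sub_mul_sum
    rw [← hc, sub_mul, one_mul, sub_eq_iff_eq_add, ← sub_eq_iff_eq_add'] at e4
    rw [e1, ← mul_assoc, e2, mul_assoc, mul_assoc, e3, ← e4]
    congr 1
    simp only [mul_add, add_mul, mul_sub, mul_one, mul_assoc, t.x_y]
    abel
  have A9 : c * y' = y' * c := by
    simp only [hc, mul_assoc, smul_mul_assoc, mul_smul_comm, assoc_of_eq t.y'_g, t.snd.T'_g]
  clear_value c
  clear hG' gW gW'
  -- Each summand moves c past one factor; `hG` and `A8` account for the terms containing G.
  linear_combination (norm := skip)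
    A1 * y' + W₁ * A9 + A2 - η • (J₁ * g₁ * A9) + η • (J₁ * A5 * y') - η • ((g₁ - g₁ * x') * A9)
      + η • ((1 - x') * A5 * y') + η • (J₂ * A6) + η • ((1 - y') * A6)
      + η • (A3 * (y' * (y' * (g₂ + g₂ * y)))) + η • (J₁ * A7 * (y' * y'))
      - (2 : R) • η • (A7 * (x' * (y' * y'))) - η • (A3 * (y' * y') * G) - η • (A4 * G)
      - η • (J₁ * A9 * y' * G) - η • (J₁ * y' * A9 * G) + η • (J₁ * (y' * y') * hG)
      + η • (J₂ * hG) + (2 : R) • η • A8 + η • (hG * (1 - x' * y'))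
  simp only [kappa, mul_add, add_mul, mul_sub, sub_mul, mul_one,
    one_mul, mul_assoc, smul_mul_assoc, mul_smul_comm, smul_add, smul_sub, smul_neg, mul_neg,
    neg_mul, t.fst.T'_g, assoc_of_eq t.fst.T'_g, t.snd.T'_g, assoc_of_eq t.snd.T'_g,
    t.x_g, assoc_of_eq t.x_g, t.x'_g, assoc_of_eq t.x'_g, t.y_g, assoc_of_eq t.y_g, t.y'_g,
    assoc_of_eq t.y'_g, t.s₁_g, assoc_of_eq t.s₁_g, t.x_y,
    assoc_of_eq t.x_y, t.x'_y, assoc_of_eq t.x'_y, t.x_y', assoc_of_eq t.x_y',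
    t.fst.T_T', t.fst.T'_T, assoc_of_eq t.fst.T_T', assoc_of_eq t.fst.T'_T,
    t.snd.T_T', t.snd.T'_T, assoc_of_eq t.snd.T_T', assoc_of_eq t.snd.T'_T]
  module

end TwoCalculi

end Calculus

end SuperJordanian

end

noncomputable section

namespace SuperJordanian


open PowerSeries (C coeff)
open scoped Nat

/-- Conjugation by a unit. -/
def conjHom (R : Type*) {𝒞 : Type*} [CommRing R] [Ring 𝒞] [Algebra R 𝒞] (u : 𝒞ˣ) : 𝒞 →ₐ[R] 𝒞 where
  toFun a := u * a * ↑u⁻¹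
  map_one' := by rw [mul_one, Units.mul_inv]
  map_mul' a b := by simp only [mul_assoc, Units.inv_mul_cancel_left]
  map_zero' := by rw [mul_zero, zero_mul]
  map_add' a b := by rw [mul_add, add_mul]
  commutes' r := by rw [← Algebra.commutes, mul_assoc, Units.mul_inv, mul_one]

theorem conjHom_mul {R 𝒞 : Type*} [CommRing R] [Ring 𝒞] [Algebra R 𝒞] (u : 𝒞ˣ) (a : 𝒞) :
    conjHom R u a * u = u * a := Units.inv_mul_cancel_right _ _

theorem conjHom_eq {R 𝒞 : Type*} [CommRing R] [Ring 𝒞] [Algebra R 𝒞] {u : 𝒞ˣ} {a b : 𝒞}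
    (e : ↑u * a = b * u) : conjHom R u a = b :=
  (Units.mul_inv_eq_iff_eq_mul u).2 e

theorem mul_mul_comm_of_anti {𝒞 : Type*} [Ring 𝒞] {z a b : 𝒞} (ha : z * a = -(a * z))
    (hb : z * b = -(b * z)) : z * (a * b) = a * b * z := by
  rw [← mul_assoc, ha, neg_mul, mul_assoc, hb, mul_neg, neg_neg, mul_assoc]

theorem mul_mul_comm_of_comm {𝒞 : Type*} [Ring 𝒞] {z a b : 𝒞} (ha : z * a = a * z)
    (hb : z * b = b * z) : z * (a * b) = a * b * z := by
  rw [← mul_assoc, ha, mul_assoc, hb, mul_assoc]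

/-! ### The twist of two supercommuting classical pairs; conjugation by its even factor -/

section Twist

variable {k : Type*} [Field k]
variable {𝒞 𝒟 : Type*} [Ring 𝒞] [Algebra k⟦X⟧ 𝒞] [Ring 𝒟] [Algebra k⟦X⟧ 𝒟]

/-- The (rescaled) Cartan element of a classical pair. -/
def cartan (v W : 𝒞) : 𝒞 := -(v * W + W * v)

theorem map_cartan {F : Type*} [FunLike F 𝒞 𝒟] [AlgHomClass F k⟦X⟧ 𝒞 𝒟] (f : F) (v W : 𝒞) :
    f (cartan v W) = cartan (f v) (f W) := by
  simp only [cartan, map_neg, map_add, map_mul]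

theorem mul_cartan_of_anti {z v W : 𝒞} (hv : z * v = -(v * z)) (hW : z * W = -(W * z)) :
    z * cartan v W = cartan v W * z := by
  rw [cartan, mul_neg, mul_add, mul_mul_comm_of_anti hv hW, mul_mul_comm_of_anti hW hv, neg_mul,
    add_mul]

theorem mul_cartan_of_comm {z v W : 𝒞} (hv : z * v = v * z) (hW : z * W = W * z) :
    z * cartan v W = cartan v W * z := by
  rw [cartan, mul_neg, mul_add, mul_mul_comm_of_comm hv hW, mul_mul_comm_of_comm hW hv, neg_mul,
    add_mul]

namespace IsClassicalPair

variable [HAdic k 𝒞] [HAdic k 𝒟] {v z : 𝒞}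

theorem X_comm_of_anti (h : z * v = -(v * z)) : X k v * z = z * X k v :=
  X_mul_comm (mul_mul_comm_of_anti h h).symm

theorem X_comm_of_comm (h : z * v = v * z) : X k v * z = z * X k v :=
  X_mul_comm (mul_mul_comm_of_comm h h).symm

theorem T_comm_of_anti (c : k) (h : z * v = -(v * z)) : T k c v * z = z * T k c v :=
  T_mul_comm c (mul_mul_comm_of_anti h h).symm

theorem T_comm_of_comm (c : k) (h : z * v = v * z) : T k c v * z = z * T k c v :=
  T_mul_comm c (mul_mul_comm_of_comm h h).symm

variable [CharZero k]

theorem g_comm_of_comm (h : z * v = v * z) : z * g k v = g k v * z := by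
  refine (isUnit_one_add_T k v).mul_right_cancel ?_
  have e : (1 + T k 1 v) * z = z * (1 + T k 1 v) := by
    rw [add_mul, mul_add, T_comm_of_comm 1 h, one_mul, mul_one]
  rw [mul_assoc, mul_assoc, ← e, g_mul, ← mul_assoc, g_mul, h]

theorem g_comm_of_anti (h : z * v = -(v * z)) : z * g k v = -(g k v * z) := by
  refine (isUnit_one_add_T k v).mul_right_cancel ?_
  have e : (1 + T k 1 v) * z = z * (1 + T k 1 v) := by
    rw [add_mul, mul_add, T_comm_of_anti 1 h, one_mul, mul_one]
  rw [mul_assoc, neg_mul, mul_assoc, ← e, g_mul, ← mul_assoc, g_mul, h]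


theorem cartan_v {W : 𝒞} (p : IsClassicalPair (k := k) v W) :
    cartan v W * v = v * cartan v W + (2 : k⟦X⟧) • v := p.J_v

theorem cartan_W {W : 𝒞} (p : IsClassicalPair (k := k) v W) :
    cartan v W * W = W * cartan v W - (2 : k⟦X⟧) • W := p.J_W

end IsClassicalPair

open SuperJordanian.IsClassicalPair (X T g Vp Vm)

/-- A pair of supercommuting classical pairs. -/
structure IsSuperPair (v₁ W₁ v₂ W₂ : 𝒞) : Prop where
  fst : IsClassicalPair (k := k) v₁ W₁
  snd : IsClassicalPair (k := k) v₂ W₂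
  v_v : v₂ * v₁ = -(v₁ * v₂)
  v_W : v₂ * W₁ = -(W₁ * v₂)
  W_v : W₂ * v₁ = -(v₁ * W₂)
  W_W : W₂ * W₁ = -(W₁ * W₂)

variable [HAdic k 𝒞] [HAdic k 𝒟] [CharZero k]

variable (k) in
/-- The odd quadratic factor of the twist. -/
def oddTwist (v₁ v₂ : 𝒞) : 𝒞 := 1 - (2 : k⟦X⟧) • ((4 : k⟦X⟧) * hbar k) • (g k v₁ * g k v₂)

variable (k) in
/-- The Cartan factor of the twist. -/
def evenTwist (J₁ X₂ : 𝒞) : 𝒞 := expH k ((C (1 / 2) : k⟦X⟧) • (J₁ * X₂))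

variable (k) in
/-- The twist. -/
def twist (v₁ W₁ v₂ : 𝒞) : 𝒞 := oddTwist k v₁ v₂ * evenTwist k (cartan v₁ W₁) (X k v₂)

theorem map_oddTwist {F : Type*} [FunLike F 𝒞 𝒟] [AlgHomClass F k⟦X⟧ 𝒞 𝒟] (f : F) (v₁ v₂ : 𝒞) :
    f (oddTwist k v₁ v₂) = oddTwist k (f v₁) (f v₂) := by
  simp only [oddTwist, map_sub, map_one, map_smul, map_mul, IsClassicalPair.map_g]

theorem map_evenTwist {F : Type*} [FunLike F 𝒞 𝒟] [AlgHomClass F k⟦X⟧ 𝒞 𝒟] (f : F) (J X : 𝒞) :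
    f (evenTwist k J X) = evenTwist k (f J) (f X) := by
  rw [evenTwist, map_expH, map_smul, map_mul, evenTwist]

theorem map_twist {F : Type*} [FunLike F 𝒞 𝒟] [AlgHomClass F k⟦X⟧ 𝒞 𝒟] (f : F) (v₁ W₁ v₂ : 𝒞) :
    f (twist k v₁ W₁ v₂) = twist k (f v₁) (f W₁) (f v₂) := by
  rw [twist, map_mul, map_oddTwist, map_evenTwist, map_cartan, IsClassicalPair.map_X, twist]

theorem isUnit_oddTwist (v₁ v₂ : 𝒞) : IsUnit (oddTwist k v₁ v₂) := by
  have : oddTwist k v₁ v₂ = 1 + hbar k • (-((8 : k⟦X⟧) • (g k v₁ * g k v₂))) := by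
    rw [oddTwist]
    module
  rw [this]
  exact isUnit_one_add_hbar_smul k _

theorem isUnit_evenTwist (J X : 𝒞) : IsUnit (evenTwist k J X) := expH_isUnit _

theorem isUnit_twist (v₁ W₁ v₂ : 𝒞) : IsUnit (twist k v₁ W₁ v₂) :=
  (isUnit_oddTwist _ _).mul (isUnit_evenTwist _ _)

theorem evenTwist_comm {J X z : 𝒞} (hJ : J * z = z * J) (hX : X * z = z * X) :
    evenTwist k J X * z = z * evenTwist k J X :=
  expH_commute (by rw [smul_mul_assoc, mul_smul_comm, (mul_mul_comm_of_comm hJ.symm hX.symm)])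

theorem evenTwist_add_left {J J' X : 𝒞} (h : J * X * (J' * X) = J' * X * (J * X)) :
    evenTwist k (J + J') X = evenTwist k J X * evenTwist k J' X := by
  rw [evenTwist, add_mul, smul_add, expH_add, evenTwist, evenTwist]
  rw [smul_mul_smul_comm, h, smul_mul_smul_comm]

theorem evenTwist_add_right {J X X' : 𝒞} (h : J * X * (J * X') = J * X' * (J * X)) :
    evenTwist k J (X + X') = evenTwist k J X * evenTwist k J X' := by
  rw [evenTwist, mul_add, smul_add, expH_add, evenTwist, evenTwist]
  rw [smul_mul_smul_comm, h, smul_mul_smul_comm]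

theorem C_half_mul_two : (C (1 / 2 : k) : k⟦X⟧) * 2 = 1 := by
  rw [← map_ofNat (C : k →+* k⟦X⟧) 2, ← map_mul, ← map_one (C : k →+* k⟦X⟧)]
  norm_num

namespace IsSuperPair

variable {v₁ W₁ v₂ W₂ : 𝒞} (p : IsSuperPair (k := k) v₁ W₁ v₂ W₂)
include p

theorem v_v' : v₁ * v₂ = -(v₂ * v₁) := by rw [p.v_v, neg_neg]
theorem W_v' : v₁ * W₂ = -(W₂ * v₁) := by rw [p.W_v, neg_neg]
theorem v_W' : W₁ * v₂ = -(v₂ * W₁) := by rw [p.v_W, neg_neg]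
theorem W_W' : W₁ * W₂ = -(W₂ * W₁) := by rw [p.W_W, neg_neg]

theorem symm : IsSuperPair (k := k) v₂ W₂ v₁ W₁ := ⟨p.snd, p.fst, p.v_v', p.W_v', p.v_W', p.W_W'⟩

theorem v_J : v₂ * cartan v₁ W₁ = cartan v₁ W₁ * v₂ := mul_cartan_of_anti p.v_v p.v_W
theorem W_J : W₂ * cartan v₁ W₁ = cartan v₁ W₁ * W₂ := mul_cartan_of_anti p.W_v p.W_W
theorem J_J : cartan v₂ W₂ * cartan v₁ W₁ = cartan v₁ W₁ * cartan v₂ W₂ :=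
  (mul_cartan_of_comm p.v_J.symm p.W_J.symm).symm
theorem J_v : cartan v₂ W₂ * v₁ = v₁ * cartan v₂ W₂ := p.symm.v_J.symm
theorem J_W : cartan v₂ W₂ * W₁ = W₁ * cartan v₂ W₂ := p.symm.W_J.symm

theorem T_v (c : k) : T k c v₂ * v₁ = v₁ * T k c v₂ := IsClassicalPair.T_comm_of_anti c p.v_v'
theorem T_W (c : k) : T k c v₂ * W₁ = W₁ * T k c v₂ := IsClassicalPair.T_comm_of_anti c p.v_W'
theorem T_J (c : k) : T k c v₂ * cartan v₁ W₁ = cartan v₁ W₁ * T k c v₂ :=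
  IsClassicalPair.T_comm_of_comm c p.v_J.symm
theorem X_v : X k v₂ * v₁ = v₁ * X k v₂ := IsClassicalPair.X_comm_of_anti p.v_v'
theorem X_W : X k v₂ * W₁ = W₁ * X k v₂ := IsClassicalPair.X_comm_of_anti p.v_W'
theorem X_J : X k v₂ * cartan v₁ W₁ = cartan v₁ W₁ * X k v₂ :=
  IsClassicalPair.X_comm_of_comm p.v_J.symm
theorem X_X : X k v₂ * X k v₁ = X k v₁ * X k v₂ :=
  (IsClassicalPair.X_comm_of_comm p.X_v).symm
theorem T_T (c d : k) : T k c v₂ * T k d v₁ = T k d v₁ * T k c v₂ :=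
  (IsClassicalPair.T_comm_of_comm d (p.T_v c)).symm
theorem g_v : g k v₂ * v₁ = -(v₁ * g k v₂) := by
  rw [IsClassicalPair.g_comm_of_anti p.v_v', neg_neg]
theorem g_W : g k v₂ * W₁ = -(W₁ * g k v₂) := by
  rw [IsClassicalPair.g_comm_of_anti p.v_W', neg_neg]
theorem g_g : g k v₂ * g k v₁ = -(g k v₁ * g k v₂) := IsClassicalPair.g_comm_of_anti p.g_v
theorem g_J : g k v₂ * cartan v₁ W₁ = cartan v₁ W₁ * g k v₂ := mul_cartan_of_anti p.g_v p.g_W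
theorem T_g (c : k) : T k c v₂ * g k v₁ = g k v₁ * T k c v₂ :=
  IsClassicalPair.g_comm_of_comm (p.T_v c)
theorem X_g : X k v₂ * g k v₁ = g k v₁ * X k v₂ := IsClassicalPair.g_comm_of_comm p.X_v

theorem sum_J : cartan (v₁ + v₂) (W₁ + W₂) = cartan v₁ W₁ + cartan v₂ W₂ := by
  simp only [cartan, mul_add, add_mul, p.v_W, p.W_v]
  abel

/-- Cross terms cancel because odd elements of different copies anticommute, and J is additive. In
the tensor square this pair defines the undeformed coproduct. -/
theorem sum : IsClassicalPair (k := k) (v₁ + v₂) (W₁ + W₂) where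
  J_v := by
    change cartan _ _ * _ = _ * cartan _ _ + _
    simp only [p.sum_J, add_mul, mul_add, p.fst.cartan_v, p.snd.cartan_v, p.v_J, p.J_v]
    module
  J_W := by
    change cartan _ _ * _ = _ * cartan _ _ - _
    simp only [p.sum_J, add_mul, mul_add, p.fst.cartan_W, p.snd.cartan_W, p.W_J, p.J_W]
    module

theorem twoCalculi : TwoCalculi ((4 : k⟦X⟧) * hbar k) W₁ (cartan v₁ W₁) (g k v₁) (T k 1 v₁)
    (T k (-1) v₁) ↑(IsClassicalPair.isUnit_one_add_T k v₁).unit⁻¹ W₂ (cartan v₂ W₂) (g k v₂)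
    (T k 1 v₂) (T k (-1) v₂) ↑(IsClassicalPair.isUnit_one_add_T k v₂).unit⁻¹ where
  fst := p.fst.twistedCalculus rfl
  snd := p.snd.twistedCalculus rfl
  s₁_eq := (IsClassicalPair.isUnit_one_add_T k v₁).mul_val_inv
  s₂_eq := (IsClassicalPair.isUnit_one_add_T k v₂).mul_val_inv
  g_g := p.g_g
  g_W := p.g_W
  W_g := p.symm.g_W
  J_g := p.symm.g_J
  g_J := p.g_J
  x_g := p.symm.T_g 1
  x'_g := p.symm.T_g (-1)
  s₁_g := (Commute.units_inv_left (u := (IsClassicalPair.isUnit_one_add_T k v₁).unit)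
    ((Commute.one_left _).add_left (p.symm.T_g 1))).eq
  y_g := p.T_g 1
  y'_g := p.T_g (-1)
  x_y := p.T_T 1 1
  x'_y := p.T_T 1 (-1)
  x_y' := p.T_T (-1) 1

/-! #### Conjugation by the even factor -/

/-- J₁v₁ = v₁(J₁ + 2), so moving v₁ through exp(½hJ₁X₂) splits off exp(hX₂) = T₂. -/
theorem evenTwist_v₁ : evenTwist k (cartan v₁ W₁) (X k v₂) * v₁ =
    v₁ * T k 1 v₂ * evenTwist k (cartan v₁ W₁) (X k v₂) := by
  have e : (C (1 / 2 : k) : k⟦X⟧) • (cartan v₁ W₁ * X k v₂) * v₁ =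
      v₁ * (X k v₂ + (C (1 / 2 : k) : k⟦X⟧) • (cartan v₁ W₁ * X k v₂)) := by
    rw [smul_mul_assoc, mul_assoc, p.X_v, ← mul_assoc, p.fst.cartan_v, add_mul, smul_mul_assoc,
      smul_add, smul_smul, C_half_mul_two, one_smul, mul_add, mul_smul_comm, mul_assoc, add_comm]
  rw [evenTwist, expH_semiconj e, expH_add, IsClassicalPair.T_one, mul_assoc]
  rw [smul_mul_assoc, mul_smul_comm, ← mul_assoc, p.X_J]

theorem evenTwist_W₁ : evenTwist k (cartan v₁ W₁) (X k v₂) * W₁ =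
    W₁ * T k (-1) v₂ * evenTwist k (cartan v₁ W₁) (X k v₂) := by
  have e : (C (1 / 2 : k) : k⟦X⟧) • (cartan v₁ W₁ * X k v₂) * W₁ =
      W₁ * (-X k v₂ + (C (1 / 2 : k) : k⟦X⟧) • (cartan v₁ W₁ * X k v₂)) := by
    rw [smul_mul_assoc, mul_assoc, p.X_W, ← mul_assoc, p.fst.cartan_W, sub_mul, smul_mul_assoc,
      smul_sub, smul_smul, C_half_mul_two, one_smul, mul_add, mul_smul_comm, mul_assoc, mul_neg]
    abel
  rw [evenTwist, expH_semiconj e, expH_add, IsClassicalPair.T_neg_one, mul_assoc]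
  rw [smul_mul_assoc, mul_smul_comm, neg_mul, ← mul_assoc, p.X_J, mul_neg]

theorem evenTwist_v₂ : evenTwist k (cartan v₁ W₁) (X k v₂) * v₂ =
    v₂ * evenTwist k (cartan v₁ W₁) (X k v₂) :=
  evenTwist_comm p.v_J.symm (IsClassicalPair.X_mul_self v₂)

theorem evenTwist_J₁ : evenTwist k (cartan v₁ W₁) (X k v₂) * cartan v₁ W₁ =
    cartan v₁ W₁ * evenTwist k (cartan v₁ W₁) (X k v₂) :=
  evenTwist_comm rfl p.X_J

/-- W₂ does not commute with X₂: the bracket [½J₁X₂, W₂] = 4J₁v₂T₂⁻² commutes with J₁X₂, so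
`expH_derivation` applies and the series stops after the first correction. -/
theorem evenTwist_W₂ : evenTwist k (cartan v₁ W₁) (X k v₂) * W₂ =
    (W₂ + ((4 : k⟦X⟧) * hbar k) • (cartan v₁ W₁ * (T k (-1) v₂ * (T k (-1) v₂ * v₂)))) *
      evenTwist k (cartan v₁ W₁) (X k v₂) := by
  have h48 : (C (1 / 2 : k) : k⟦X⟧) * 8 = 4 := by
    linear_combination 4 * C_half_mul_two (k := k)
  have e1 : T k (-1) v₂ * (T k (-1) v₂ * v₂) = v₂ * T k (-2) v₂ := by
    rw [← mul_assoc, IsClassicalPair.T_mul_T, IsClassicalPair.T_mul_self]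
    norm_num
  have e2 : X k v₂ * (v₂ * T k (-2) v₂) = v₂ * T k (-2) v₂ * X k v₂ := by
    rw [← mul_assoc, IsClassicalPair.X_mul_self, mul_assoc, IsClassicalPair.X_mul_T, mul_assoc]
  have e3 : v₂ * T k (-2) v₂ * cartan v₁ W₁ = cartan v₁ W₁ * (v₂ * T k (-2) v₂) := by
    rw [mul_assoc, p.T_J, ← mul_assoc, p.v_J, mul_assoc]
  rw [evenTwist, expH_derivation (u := (4 : k⟦X⟧) • (cartan v₁ W₁ * (v₂ * T k (-2) v₂))) (y := W₂),
    e1, add_mul, smul_mul_assoc, smul_mul_assoc]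
  · module
  · rw [smul_mul_assoc, mul_assoc, p.snd.X_W rfl, mul_add, ← mul_assoc, ← p.W_J, mul_smul_comm,
      mul_smul_comm, smul_add, smul_smul, h48, mul_assoc]
  · simp only [smul_mul_assoc, mul_smul_comm, mul_assoc]
    rw [smul_comm]
    congr 3
    have e4 := p.X_J
    simp only [mul_assoc] at e2 e3 e4
    rw [← mul_assoc (X k v₂), e4, mul_assoc, e2, ← mul_assoc (T k (-2) v₂) _, p.T_J]
    simp only [mul_assoc, assoc_of_eq p.v_J]

/-- J₂ = -(v₂W₂ + W₂v₂) is conjugated factor by factor. The correction contains 8hv₂²T₂⁻² = 1 -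
T₂⁻². -/
theorem evenTwist_J₂ : evenTwist k (cartan v₁ W₁) (X k v₂) * cartan v₂ W₂ =
    (cartan v₂ W₂ - cartan v₁ W₁ + cartan v₁ W₁ * (T k (-1) v₂ * T k (-1) v₂)) *
      evenTwist k (cartan v₁ W₁) (X k v₂) := by
  have e5 := p.evenTwist_W₂
  have e6 := p.evenTwist_v₂
  have e7 : (2 : k⟦X⟧) • ((4 : k⟦X⟧) * hbar k) • (v₂ * v₂ * (T k (-1) v₂ * T k (-1) v₂)) =
      1 - T k (-1) v₂ * T k (-1) v₂ := by
    have := congrArg (fun z => z * T k (-2) v₂) (IsClassicalPair.T_sq (k := k) v₂)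
    simp only [IsClassicalPair.T_mul_T, add_mul, one_mul, smul_mul_assoc] at this ⊢
    norm_num [IsClassicalPair.T_zero] at this ⊢
    linear_combination (norm := module) -this
  set E := evenTwist k (cartan v₁ W₁) (X k v₂)
  have t := IsClassicalPair.T_mul_self (k := k) (-1) v₂
  have hJ : cartan v₂ W₂ = -(v₂ * W₂ + W₂ * v₂) := rfl
  have a : E * (v₂ * W₂) = v₂ * (E * W₂) := by rw [← mul_assoc, e6, mul_assoc]
  have b : E * (W₂ * v₂) = (W₂ + ((4 : k⟦X⟧) * hbar k) •
      (cartan v₁ W₁ * (T k (-1) v₂ * (T k (-1) v₂ * v₂)))) * v₂ * E := by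
    rw [← mul_assoc, e5, mul_assoc, e6, mul_assoc]
  have c := congrArg (fun z => cartan v₁ W₁ * z * E) e7
  rw [e5] at a
  rw [hJ, mul_neg, mul_add, a, b]
  have vJ := p.v_J
  simp only [mul_add, add_mul, sub_mul, mul_sub, mul_one, neg_mul, smul_mul_assoc, mul_smul_comm,
    mul_assoc, t, assoc_of_eq t, assoc_of_eq vJ] at c ⊢
  linear_combination (norm := module) -c

end IsSuperPair

end Twist

end SuperJordanian

end

noncomputable section

namespace SuperJordanian


open PowerSeries (C coeff)
open scoped Nat

section Calculus

variable {R 𝒞 : Type*} [CommRing R] [Ring 𝒞] [Algebra R 𝒞]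

theorem kappa_comm {η : R} {W J g T' z : 𝒞} (hW : z * W = W * z) (hJ : z * J = J * z)
    (hg : z * g = g * z) (hT : z * T' = T' * z) :
    z * kappa η W J g T' = kappa η W J g T' * z := by
  simp only [kappa, mul_sub, sub_mul, mul_smul_comm, smul_mul_assoc, mul_mul_comm_of_comm hJ hg,
    mul_mul_comm_of_comm hg hT, hW, hg]

end Calculus

/-! ### Conjugation of X, V₊, V₋ by the full twist, and its cocycle identity -/

section Twist

variable {k : Type*} [Field k] [CharZero k]
variable {𝒞 : Type*} [Ring 𝒞] [Algebra k⟦X⟧ 𝒞] [HAdic k 𝒞] [HTorsionFree k 𝒞]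

open SuperJordanian.IsClassicalPair (X T g Vp Vm)

theorem IsClassicalPair.T_two (v : 𝒞) : T k 2 v = 1 + (8 : k⟦X⟧) • hbar k • (v * v) := by
  rw [← T_sq, T_mul_T, one_add_one_eq_two]

namespace IsSuperPair

variable {v₁ W₁ v₂ W₂ : 𝒞} (p : IsSuperPair (k := k) v₁ W₁ v₂ W₂)
include p

/-- The cross terms of (v₁T₂ + v₂)² cancel, so 1 + 8h(v₁T₂ + v₂)² = 1 + 8hv₁²T₂² + 8hv₂² = T₁²T₂².
Injectivity of the exponential on commuting elements gives additivity of X, which is why X is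
primitive for the twisted coproduct. -/
theorem X_mixed : X k (v₁ * T k 1 v₂ + v₂) = X k v₁ + X k v₂ := by
  have e1 : T k 2 (v₁ * T k 1 v₂ + v₂) = T k 2 v₁ * T k 2 v₂ := by
    have h1 := p.T_v 1
    have h2 := IsClassicalPair.T_mul_self (k := k) 1 v₂
    have h3 := p.v_v
    have h4 := IsClassicalPair.T_mul_T (k := k) 1 1 v₂
    rw [one_add_one_eq_two] at h4
    simp only [IsClassicalPair.T_two v₁, IsClassicalPair.T_two (_ + _), mul_add, add_mul, mul_assoc,
      h1, h2, h3, h4, assoc_of_eq h1, assoc_of_eq h2, assoc_of_eq h3, smul_mul_assoc, one_mul,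
      neg_mul, smul_add]
    rw [IsClassicalPair.T_two v₂]
    module
  have c1 : X k v₁ * X k v₂ = X k v₂ * X k v₁ := p.X_X.symm
  have c2 : ∀ z, z * v₁ = v₁ * z → z * v₂ = v₂ * z →
      X k (v₁ * T k 1 v₂ + v₂) * z = z * X k (v₁ * T k 1 v₂ + v₂) := by
    intro z h1 h2
    refine IsClassicalPair.X_comm_of_comm ?_
    rw [mul_add, add_mul, h2,
      mul_mul_comm_of_comm h1 (IsClassicalPair.T_comm_of_comm 1 h2).symm]
  -- The doubles are compared, since T² and not T is polynomial in v.
  have e2 : (C 2 : k⟦X⟧) • X k (v₁ * T k 1 v₂ + v₂) = (C 2 : k⟦X⟧) • (X k v₁ + X k v₂) := by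
    refine expH_injective (k := k) ?_ ?_
    · rw [smul_mul_smul_comm, smul_mul_smul_comm, mul_add, add_mul,
        c2 _ (IsClassicalPair.X_mul_self v₁) p.symm.X_v, c2 _ p.X_v (IsClassicalPair.X_mul_self v₂)]
    · rw [smul_add, expH_add]
      · exact e1
      · rw [smul_mul_smul_comm, smul_mul_smul_comm, c1]
  rw [map_ofNat] at e2
  exact ofNat_smul_inj (k := k) 2 e2

theorem T_mixed (c : k) : T k c (v₁ * T k 1 v₂ + v₂) = T k c v₁ * T k c v₂ := by
  rw [T, p.X_mixed, smul_add, expH_add]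
  · rfl
  · rw [smul_mul_smul_comm, smul_mul_smul_comm, p.X_X]

theorem g_mixed : g k (v₁ * T k 1 v₂ + v₂) * (1 + T k 1 v₁ * T k 1 v₂) =
    (g k v₁ + g k v₁ * T k 1 v₁) * T k 1 v₂ + (g k v₂ + g k v₂ * T k 1 v₂) := by
  rw [← p.T_mixed, IsClassicalPair.g_mul, IsClassicalPair.g_eq, IsClassicalPair.g_eq]

/-- Multiplying by 1 + T₁T₂, which is 1 + T of the mixed element, reduces this to `one_sub_mul_sum`.
-/
theorem oddTwist_mul_g :
    oddTwist k v₁ v₂ * g k (v₁ * T k 1 v₂ + v₂) = g k v₁ + g k v₂ := by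
  refine (IsClassicalPair.isUnit_one_add_T k (v₁ * T k 1 v₂ + v₂)).mul_right_cancel ?_
  rw [p.T_mixed, mul_assoc, p.g_mixed]
  exact p.twoCalculi.one_sub_mul_sum

theorem oddTwist_mul_mixed : oddTwist k v₁ v₂ * (v₁ * T k 1 v₂ + v₂) =
    (v₁ + T k 1 v₁ * v₂) * oddTwist k v₁ v₂ := by
  have h := p.twoCalculi.one_sub_mul_sum.trans p.twoCalculi.sum_mul_one_sub.symm
  rwa [IsClassicalPair.g_eq, IsClassicalPair.g_eq] at h

omit [HTorsionFree k 𝒞] p in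
theorem oddTwist_comm {z : 𝒞} (h₁ : z * g k v₁ = g k v₁ * z) (h₂ : z * g k v₂ = g k v₂ * z) :
    z * oddTwist k v₁ v₂ = oddTwist k v₁ v₂ * z := by
  rw [oddTwist, mul_sub, sub_mul, mul_one, one_mul, mul_smul_comm, mul_smul_comm, smul_mul_assoc,
    smul_mul_assoc, mul_mul_comm_of_comm h₁ h₂]

theorem oddTwist_T₁ (c : k) : T k c v₁ * oddTwist k v₁ v₂ = oddTwist k v₁ v₂ * T k c v₁ :=
  oddTwist_comm (IsClassicalPair.T_mul_g c v₁) (p.symm.T_g c)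

theorem oddTwist_T₂ (c : k) : T k c v₂ * oddTwist k v₁ v₂ = oddTwist k v₁ v₂ * T k c v₂ :=
  oddTwist_comm (p.T_g c) (IsClassicalPair.T_mul_g c v₂)

theorem oddTwist_X₁ : X k v₁ * oddTwist k v₁ v₂ = oddTwist k v₁ v₂ * X k v₁ :=
  oddTwist_comm (IsClassicalPair.g_comm_of_comm (IsClassicalPair.X_mul_self v₁)) p.symm.X_g

theorem oddTwist_X₂ : X k v₂ * oddTwist k v₁ v₂ = oddTwist k v₁ v₂ * X k v₂ :=
  oddTwist_comm p.X_g (IsClassicalPair.g_comm_of_comm (IsClassicalPair.X_mul_self v₂))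

theorem conj_evenTwist_v : conjHom k⟦X⟧ (isUnit_evenTwist (k := k) (cartan v₁ W₁) (X k v₂)).unit (v₁ + v₂) =
    v₁ * T k 1 v₂ + v₂ :=
  conjHom_eq (by
    change evenTwist _ _ _ * _ = _ * evenTwist _ _ _
    rw [mul_add, p.evenTwist_v₁, p.evenTwist_v₂, add_mul])

theorem conj_evenTwist_W : conjHom k⟦X⟧ (isUnit_evenTwist (k := k) (cartan v₁ W₁) (X k v₂)).unit (W₁ + W₂) =
    W₁ * T k (-1) v₂ + W₂ +
      ((4 : k⟦X⟧) * hbar k) • (cartan v₁ W₁ * (T k (-1) v₂ * (T k (-1) v₂ * v₂))) :=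
  conjHom_eq (by
    change evenTwist _ _ _ * _ = _ * evenTwist _ _ _
    rw [mul_add, p.evenTwist_W₁, p.evenTwist_W₂, add_assoc, add_mul _ (W₂ + _)])

theorem conj_evenTwist_J : conjHom k⟦X⟧ (isUnit_evenTwist (k := k) (cartan v₁ W₁) (X k v₂)).unit
    (cartan (v₁ + v₂) (W₁ + W₂)) =
      cartan v₁ W₁ * (T k (-1) v₂ * T k (-1) v₂) + cartan v₂ W₂ :=
  conjHom_eq (by
    change evenTwist _ _ _ * _ = _ * evenTwist _ _ _
    rw [p.sum_J, mul_add, p.evenTwist_J₁, p.evenTwist_J₂, ← add_mul]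
    congr 1
    abel)

/-- Conjugation is an algebra homomorphism and X is natural, so the conjugate of X(v₁ + v₂) is X of
the conjugate of v₁ + v₂. The same reasoning gives `evenTwist_g` and `evenTwist_T`. -/
theorem evenTwist_X : evenTwist k (cartan v₁ W₁) (X k v₂) * X k (v₁ + v₂) =
    (X k v₁ + X k v₂) * evenTwist k (cartan v₁ W₁) (X k v₂) := by
  rw [← p.X_mixed, ← p.conj_evenTwist_v, ← IsClassicalPair.map_X]
  exact (conjHom_mul (R := k⟦X⟧)
    (isUnit_evenTwist (k := k) (cartan v₁ W₁) (X k v₂)).unit _).symm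

theorem evenTwist_g : evenTwist k (cartan v₁ W₁) (X k v₂) * g k (v₁ + v₂) =
    g k (v₁ * T k 1 v₂ + v₂) * evenTwist k (cartan v₁ W₁) (X k v₂) := by
  rw [← p.conj_evenTwist_v, ← IsClassicalPair.map_g]
  exact (conjHom_mul (R := k⟦X⟧)
    (isUnit_evenTwist (k := k) (cartan v₁ W₁) (X k v₂)).unit _).symm

theorem evenTwist_T (c : k) : evenTwist k (cartan v₁ W₁) (X k v₂) * T k c (v₁ + v₂) =
    T k c v₁ * T k c v₂ * evenTwist k (cartan v₁ W₁) (X k v₂) := by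
  rw [← p.T_mixed, ← p.conj_evenTwist_v, ← IsClassicalPair.map_T]
  exact (conjHom_mul (R := k⟦X⟧)
    (isUnit_evenTwist (k := k) (cartan v₁ W₁) (X k v₂)).unit _).symm

/-! #### Conjugation by the twist -/

theorem twist_X : twist k v₁ W₁ v₂ * X k (v₁ + v₂) = (X k v₁ + X k v₂) * twist k v₁ W₁ v₂ := by
  rw [twist, mul_assoc, p.evenTwist_X, ← mul_assoc, mul_add, ← p.oddTwist_X₁, ← p.oddTwist_X₂,
    ← add_mul, mul_assoc]

theorem twist_T (c : k) : twist k v₁ W₁ v₂ * T k c (v₁ + v₂) =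
    T k c v₁ * T k c v₂ * twist k v₁ W₁ v₂ := by
  rw [twist, mul_assoc, p.evenTwist_T, ← mul_assoc, ← mul_assoc, ← p.oddTwist_T₁,
    mul_assoc (T k c v₁), ← p.oddTwist_T₂]
  simp only [mul_assoc]

theorem twist_v : twist k v₁ W₁ v₂ * (v₁ + v₂) = (v₁ + T k 1 v₁ * v₂) * twist k v₁ W₁ v₂ := by
  have e : evenTwist k (cartan v₁ W₁) (X k v₂) * (v₁ + v₂) =
      (v₁ * T k 1 v₂ + v₂) * evenTwist k (cartan v₁ W₁) (X k v₂) := by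
    rw [mul_add, p.evenTwist_v₁, p.evenTwist_v₂, add_mul]
  rw [twist, mul_assoc, e, ← mul_assoc, p.oddTwist_mul_mixed, mul_assoc]

/-- The two factors of the twist turn v₁ + v₂ into v₁T₂ + v₂ and then into v₁ + T₁v₂; multiplying by
(T₁T₂)^{-1/2} gives the skew-primitive form. -/
theorem twist_Vp : twist k v₁ W₁ v₂ * Vp k (v₁ + v₂) =
    (Vp k v₁ * T k (-(1 / 2)) v₂ + T k (1 / 2) v₁ * Vp k v₂) * twist k v₁ W₁ v₂ := by
  rw [Vp, ← mul_assoc, p.twist_v, mul_assoc, p.twist_T, ← mul_assoc, ← mul_assoc]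
  congr 1
  have e : T k 1 v₁ * T k (-(1 / 2)) v₁ = T k (1 / 2) v₁ := by
    rw [IsClassicalPair.T_mul_T]
    norm_num
  rw [add_mul, add_mul, Vp, Vp, ← e, mul_assoc (T k 1 v₁) v₂, ← p.symm.T_v]
  simp only [mul_assoc]

/-- After multiplication by 8 the claim concerns κ. The even factor carries the κ-element of the sum
pair to that of the conjugated elements by naturality, and the odd factor is then treated by
`kappa_twist`; T₁^{1/2}T₂^{1/2} commutes with the odd factor. -/
theorem twist_Vm : twist k v₁ W₁ v₂ * Vm k (v₁ + v₂) (W₁ + W₂) =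
    (Vm k v₁ W₁ * T k (-(1 / 2)) v₂ + T k (1 / 2) v₁ * Vm k v₂ W₂) * twist k v₁ W₁ v₂ := by
  set η : k⟦X⟧ := 4 * hbar k with hη
  set κ₁ := kappa η W₁ (cartan v₁ W₁) (g k v₁) (T k (-1) v₁) with hκ₁
  set κ₂ := kappa η W₂ (cartan v₂ W₂) (g k v₂) (T k (-1) v₂) with hκ₂
  have e1 : (8 : k⟦X⟧) • Vm k v₁ W₁ = κ₁ * T k (1 / 2) v₁ := IsClassicalPair.eq_Vm_smul _ _
  have e2 : (8 : k⟦X⟧) • Vm k v₂ W₂ = κ₂ * T k (1 / 2) v₂ := IsClassicalPair.eq_Vm_smul _ _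
  have e3 : (8 : k⟦X⟧) • Vm k (v₁ + v₂) (W₁ + W₂) =
      kappa η (W₁ + W₂) (cartan (v₁ + v₂) (W₁ + W₂)) (g k (v₁ + v₂)) (T k (-1) (v₁ + v₂)) *
        T k (1 / 2) (v₁ + v₂) := IsClassicalPair.eq_Vm_smul _ _
  have key := p.twoCalculi.kappa_twist (G := g k (v₁ * T k 1 v₂ + v₂)) p.oddTwist_mul_g p.g_mixed
    (by
      refine IsClassicalPair.g_comm_of_comm ?_
      rw [mul_add, add_mul, p.symm.T_v,
        mul_mul_comm_of_comm (IsClassicalPair.T_mul_self 1 v₁) (p.T_T 1 1).symm])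
    (by
      refine IsClassicalPair.g_comm_of_comm ?_
      rw [mul_add, add_mul, IsClassicalPair.T_mul_self, mul_mul_comm_of_comm (p.T_v 1) rfl])
  have e4 : evenTwist k (cartan v₁ W₁) (X k v₂) *
      kappa η (W₁ + W₂) (cartan (v₁ + v₂) (W₁ + W₂)) (g k (v₁ + v₂)) (T k (-1) (v₁ + v₂)) =
      kappa η (W₁ * T k (-1) v₂ + W₂ + η • (cartan v₁ W₁ * (T k (-1) v₂ * (T k (-1) v₂ * v₂))))
        (cartan v₁ W₁ * (T k (-1) v₂ * T k (-1) v₂) + cartan v₂ W₂) (g k (v₁ * T k 1 v₂ + v₂))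
        (T k (-1) v₁ * T k (-1) v₂) * evenTwist k (cartan v₁ W₁) (X k v₂) := by
    rw [← p.conj_evenTwist_W, ← p.conj_evenTwist_J, ← p.T_mixed, ← p.conj_evenTwist_v,
      ← IsClassicalPair.map_g, ← IsClassicalPair.map_T, kappa, kappa, ← map_mul, ← map_mul,
      ← map_sub, ← map_smul, ← map_smul, ← map_sub, ← map_sub]
    exact (conjHom_mul (R := k⟦X⟧)
    (isUnit_evenTwist (k := k) (cartan v₁ W₁) (X k v₂)).unit _).symm
  have e5 : T k (-1) v₂ * (T k (1 / 2) v₁ * T k (1 / 2) v₂) = T k (1 / 2) v₁ * T k (-(1 / 2)) v₂ := by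
    rw [← mul_assoc, p.T_T, mul_assoc, IsClassicalPair.T_mul_T]
    norm_num
  have e6 : κ₂ * T k (1 / 2) v₁ = T k (1 / 2) v₁ * κ₂ := by
    rw [hκ₂, kappa_comm (p.symm.T_W _) (p.symm.T_J _) (p.symm.T_g _) (p.symm.T_T _ _)]
  refine ofNat_smul_inj (k := k) 8 ?_
  change (8 : k⟦X⟧) • _ = (8 : k⟦X⟧) • _
  have e7 : (8 : k⟦X⟧) •
      ((Vm k v₁ W₁ * T k (-(1 / 2)) v₂ + T k (1 / 2) v₁ * Vm k v₂ W₂) * twist k v₁ W₁ v₂) =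
      (κ₁ * T k (-1) v₂ + κ₂) * oddTwist k v₁ v₂ *
        ((T k (1 / 2) v₁ * T k (1 / 2) v₂) * evenTwist k (cartan v₁ W₁) (X k v₂)) := by
    have e8 : oddTwist k v₁ v₂ * ((T k (1 / 2) v₁ * T k (1 / 2) v₂) *
        evenTwist k (cartan v₁ W₁) (X k v₂)) =
        T k (1 / 2) v₁ * T k (1 / 2) v₂ * twist k v₁ W₁ v₂ := by
      rw [twist, ← mul_assoc, ← mul_assoc, ← p.oddTwist_T₁, mul_assoc (T k (1 / 2) v₁),
        ← p.oddTwist_T₂]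
      simp only [mul_assoc]
    rw [mul_assoc, e8, ← smul_mul_assoc, smul_add, ← smul_mul_assoc, ← mul_smul_comm, e1, e2,
      ← mul_assoc (κ₁ * _ + κ₂)]
    refine congrArg (· * twist k v₁ W₁ v₂) ?_
    rw [add_mul, mul_assoc κ₁, mul_assoc κ₁, e5, ← mul_assoc κ₂, e6, mul_assoc (T k (1 / 2) v₁)]
  rw [e7, ← mul_smul_comm, e3, twist, mul_assoc, ← mul_assoc (evenTwist _ _ _), e4, mul_assoc,
    p.evenTwist_T, ← mul_assoc]
  congr 1
  rw [IsClassicalPair.g_eq, ← hη, ← hκ₁, ← hκ₂] at key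
  exact key.symm

end IsSuperPair

/-! #### The cocycle identity -/

/-- Write E for the even factors. Moving them to the right and using `oddTwist_mul_g`, both sides
become (1 - 8h(g₁g₂ + g₁g₃ + g₂g₃)) E₁₂E₁₃E₂₃. The even parts agree because J is additive and E₂₃
carries X(v₂ + v₃) to X₂ + X₃. -/
theorem twist_cocycle {v₁ W₁ v₂ W₂ v₃ W₃ : 𝒞} (p₁₂ : IsSuperPair (k := k) v₁ W₁ v₂ W₂)
    (p₁₃ : IsSuperPair (k := k) v₁ W₁ v₃ W₃) (p₂₃ : IsSuperPair (k := k) v₂ W₂ v₃ W₃) :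
    twist k v₁ W₁ v₂ * twist k (v₁ + v₂) (W₁ + W₂) v₃ =
      twist k v₂ W₂ v₃ * twist k v₁ W₁ (v₂ + v₃) := by
  have a1 : evenTwist k (cartan v₁ W₁) (X k v₂) * g k v₃ =
      g k v₃ * evenTwist k (cartan v₁ W₁) (X k v₂) := evenTwist_comm p₁₃.g_J.symm p₂₃.symm.X_g
  have a2 : evenTwist k (cartan v₂ W₂) (X k v₃) * g k v₁ =
      g k v₁ * evenTwist k (cartan v₂ W₂) (X k v₃) :=
    evenTwist_comm p₁₂.symm.g_J.symm p₁₃.X_g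
  have l1 : oddTwist k v₁ v₂ * (evenTwist k (cartan v₁ W₁) (X k v₂) * oddTwist k (v₁ + v₂) v₃) =
      (oddTwist k v₁ v₂ - (2 : k⟦X⟧) • ((4 : k⟦X⟧) * hbar k) • ((g k v₁ + g k v₂) * g k v₃)) *
        evenTwist k (cartan v₁ W₁) (X k v₂) := by
    have e1 : evenTwist k (cartan v₁ W₁) (X k v₂) * (g k (v₁ + v₂) * g k v₃) =
        g k (v₁ * T k 1 v₂ + v₂) * g k v₃ * evenTwist k (cartan v₁ W₁) (X k v₂) := by
      rw [← mul_assoc, p₁₂.evenTwist_g, mul_assoc, a1, mul_assoc]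
    have e2 : oddTwist k (v₁ + v₂) v₃ =
        1 - (2 : k⟦X⟧) • ((4 : k⟦X⟧) * hbar k) • (g k (v₁ + v₂) * g k v₃) := rfl
    rw [e2, mul_sub, mul_one, mul_smul_comm, mul_smul_comm, e1, mul_sub,
      mul_smul_comm, mul_smul_comm, ← mul_assoc, ← mul_assoc, p₁₂.oddTwist_mul_g, sub_mul,
      smul_mul_assoc, smul_mul_assoc]
  have l2 : evenTwist k (cartan v₂ W₂) (X k v₃) * oddTwist k v₁ (v₂ + v₃) =
      (1 - (2 : k⟦X⟧) • ((4 : k⟦X⟧) * hbar k) • (g k v₁ * g k (v₂ * T k 1 v₃ + v₃))) *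
        evenTwist k (cartan v₂ W₂) (X k v₃) := by
    rw [oddTwist, mul_sub, sub_mul, mul_one, one_mul, mul_smul_comm, mul_smul_comm, smul_mul_assoc,
      smul_mul_assoc, ← mul_assoc, a2, mul_assoc, p₂₃.evenTwist_g, mul_assoc]
  have l3 : oddTwist k v₂ v₃ *
      (1 - (2 : k⟦X⟧) • ((4 : k⟦X⟧) * hbar k) • (g k v₁ * g k (v₂ * T k 1 v₃ + v₃))) =
      oddTwist k v₁ v₂ - (2 : k⟦X⟧) • ((4 : k⟦X⟧) * hbar k) • ((g k v₁ + g k v₂) * g k v₃) := by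
    have e1 : g k v₁ * oddTwist k v₂ v₃ = oddTwist k v₂ v₃ * g k v₁ := by
      rw [oddTwist, mul_sub, sub_mul, mul_one, one_mul, mul_smul_comm, mul_smul_comm,
        smul_mul_assoc, smul_mul_assoc, mul_mul_comm_of_anti p₁₂.symm.g_g p₁₃.symm.g_g]
    rw [mul_sub, mul_one, mul_smul_comm, mul_smul_comm, ← mul_assoc, ← e1, mul_assoc,
      p₂₃.oddTwist_mul_g, oddTwist, oddTwist, mul_add, add_mul]
    module
  have m1 : evenTwist k (cartan (v₁ + v₂) (W₁ + W₂)) (X k v₃) =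
      evenTwist k (cartan v₁ W₁) (X k v₃) * evenTwist k (cartan v₂ W₂) (X k v₃) := by
    rw [p₁₂.sum_J, evenTwist_add_left]
    have h1 := p₁₃.X_J
    have h2 := p₂₃.X_J
    have h3 := p₁₂.J_J
    simp only [mul_assoc, assoc_of_eq h1, assoc_of_eq h2, assoc_of_eq h3]
  have m2 : evenTwist k (cartan v₂ W₂) (X k v₃) * evenTwist k (cartan v₁ W₁) (X k (v₂ + v₃)) =
      evenTwist k (cartan v₁ W₁) (X k v₂) * evenTwist k (cartan v₁ W₁) (X k v₃) *
        evenTwist k (cartan v₂ W₂) (X k v₃) := by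
    have h1 := p₁₃.X_J
    have h2 := p₁₂.X_J
    have h3 := p₂₃.X_X
    have h4 : evenTwist k (cartan v₂ W₂) (X k v₃) * cartan v₁ W₁ =
        cartan v₁ W₁ * evenTwist k (cartan v₂ W₂) (X k v₃) := evenTwist_comm p₁₂.J_J p₁₃.X_J
    rw [← evenTwist_add_right (by simp only [mul_assoc, assoc_of_eq h1, assoc_of_eq h2, h3])]
    refine (expH_semiconj ?_).symm
    rw [mul_smul_comm, smul_mul_assoc, mul_assoc, ← p₂₃.evenTwist_X, ← mul_assoc, ← h4, mul_assoc]
  rw [← mul_assoc] at l1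
  have l4 := congrArg (fun z => z * evenTwist k (cartan v₂ W₂) (X k v₃)) l3
  simp only [mul_assoc] at l1 l2 l4 m2
  calc _ = (oddTwist k v₁ v₂ * (evenTwist k (cartan v₁ W₁) (X k v₂) * oddTwist k (v₁ + v₂) v₃)) *
        evenTwist k (cartan (v₁ + v₂) (W₁ + W₂)) (X k v₃) := by simp only [twist, mul_assoc]
    _ = oddTwist k v₂ v₃ * (evenTwist k (cartan v₂ W₂) (X k v₃) * oddTwist k v₁ (v₂ + v₃)) *
        evenTwist k (cartan v₁ W₁) (X k (v₂ + v₃)) := by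
      rw [l1, l2, l4, m1, mul_assoc, mul_assoc, m2]
    _ = _ := by simp only [twist, mul_assoc]

end Twist

end SuperJordanian

end

noncomputable section

namespace SuperJordanian


open PowerSeries (C coeff)
open scoped Nat

/-! ### The coproduct -/

section Generic

variable {k : Type*} [Field k] {A : Type*} [Ring A] [Algebra k⟦X⟧ A]
  {𝒜 : ZMod 2 → Submodule k⟦X⟧ A} [GradedAlgebra 𝒜]

theorem map_add_mul {R 𝒞 𝒟 : Type*} [CommRing R] [Ring 𝒞] [Algebra R 𝒞] [Ring 𝒟] [Algebra R 𝒟]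
    {a b c d z : 𝒞} (h : z = a * b + c * d) (E : 𝒞 →ₐ[R] 𝒟) :
    E z = E a * E b + E c * E d := by
  rw [h, map_add, map_mul, map_mul]

theorem add_mul_mul_aux {𝒟 : Type*} [Ring 𝒟] (v₁ v₂ v₃ t₁ t₂ s₂ s₃ : 𝒟) :
    (v₁ * s₂ + t₁ * v₂) * s₃ + t₁ * t₂ * v₃ = v₁ * (s₂ * s₃) + t₁ * (v₂ * s₃ + t₂ * v₃) := by
  simp only [mul_add, add_mul, mul_assoc, add_assoc]

/-- With t and t' group-like, both sides are V⊗t'⊗t' + t⊗V⊗t' + t⊗t⊗V. -/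
theorem coassoc_of_coproduct {D : A →ₐ[k⟦X⟧] Compl (hbar k) (T2 𝒜)}
    (hD : ∀ i, ∀ a ∈ 𝒜 i, IsHomog i (D a)) {t t' V : A} (ht : D t = inl 𝒜 t * inr 𝒜 t)
    (ht' : D t' = inl 𝒜 t' * inr 𝒜 t') (hV : D V = inl 𝒜 V * inr 𝒜 t' + inl 𝒜 t * inr 𝒜 V) :
    ((leftHom hD).comp D) V = ((rightHom hD).comp D) V := by
  rw [AlgHom.comp_apply, AlgHom.comp_apply]
  have e1 := map_add_mul hV (leftHom hD)
  have e2 := map_add_mul hV (rightHom hD)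
  have e3 := map_add_mul hV (to₁₂ 𝒜)
  have e4 := map_add_mul hV (to₂₃ 𝒜)
  rw [leftHom_inl, leftHom_inl, leftHom_inr, leftHom_inr, e3, ht, map_mul (to₁₂ 𝒜), to₁₂_inl,
    to₁₂_inl, to₁₂_inr, to₁₂_inr, to₁₂_inr, add_mul_mul_aux] at e1
  rw [rightHom_inl, rightHom_inl, rightHom_inr, rightHom_inr, e4, ht', map_mul (to₂₃ 𝒜), to₂₃_inl,
    to₂₃_inl, to₂₃_inl, to₂₃_inr, to₂₃_inr] at e2
  rw [e1, e2]

theorem applyLeft_eq_applyRight {D : A →ₐ[k⟦X⟧] Compl (hbar k) (T2 𝒜)}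
    (hD : ∀ i, ∀ a ∈ 𝒜 i, IsHomog i (D a)) (h : (leftHom hD).comp D = (rightHom hD).comp D) (a : A) :
    applyLeft D.toLinearMap (D a) = applyRight D.toLinearMap (D a) := by
  rw [applyLeft_eq hD, applyRight_eq hD, ← AlgHom.comp_apply, h, AlgHom.comp_apply]

end Generic

section SuperPair

variable {k : Type*} [Field k] [CharZero k]
variable {𝒞 : Type*} [Ring 𝒞] [Algebra k⟦X⟧ 𝒞]

namespace Uh

theorem parity_of_mem (i : ZMod 2) (a : Uh k) (ha : a ∈ grading k i) :
    parity k a = (-1 : ℤˣ) ^ i • a := ha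

theorem mem_odd {a : Uh k} (ha : parity k a = -a) : a ∈ grading k 1 := by
  change parity k a = (-1 : ℤˣ) ^ (1 : ZMod 2) • a
  rw [uzpow_one, Units.neg_smul, one_smul, ha]

theorem mem_even {a : Uh k} (ha : parity k a = a) : a ∈ grading k 0 := by
  change parity k a = (-1 : ℤˣ) ^ (0 : ZMod 2) • a
  rw [uzpow_zero, one_smul, ha]

end Uh

namespace SuperCommute

variable {f g : Uh k →ₐ[k⟦X⟧] 𝒞} (h : SuperCommute (Uh.grading k) (Uh.grading k) f g)
include h

theorem odd_odd {a b : Uh k} (ha : Uh.parity k a = -a) (hb : Uh.parity k b = -b) :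
    g b * f a = -(f a * g b) := by
  have := h ⟨a, Uh.mem_odd ha⟩ ⟨b, Uh.mem_odd hb⟩
  dsimp only at this
  rw [this, mul_one, uzpow_one, Units.neg_smul, one_smul, neg_neg]

theorem even_left {a : Uh k} (ha : Uh.parity k a = a) (b : Uh k) : g b * f a = f a * g b := by
  refine eq_of_homogeneous (𝒜 := Uh.grading k)
    (f := LinearMap.mulRight k⟦X⟧ (f a) ∘ₗ g.toLinearMap)
    (g := LinearMap.mulLeft k⟦X⟧ (f a) ∘ₗ g.toLinearMap) (fun j b hb => ?_) b
  have := h ⟨a, Uh.mem_even ha⟩ ⟨b, hb⟩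
  rw [mul_zero, uzpow_zero, one_smul] at this
  exact this.symm

theorem even_right {b : Uh k} (hb : Uh.parity k b = b) (a : Uh k) : g b * f a = f a * g b :=
  (h.symm.even_left hb a).symm

theorem isSuperPair : IsSuperPair (k := k) (f (Uh.clv k)) (f (Uh.clW k)) (g (Uh.clv k))
    (g (Uh.clW k)) where
  fst := Uh.isClassicalPair.map f
  snd := Uh.isClassicalPair.map g
  v_v := h.odd_odd Uh.parity_clv Uh.parity_clv
  v_W := h.odd_odd Uh.parity_clW Uh.parity_clv
  W_v := h.odd_odd Uh.parity_clv Uh.parity_clW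
  W_W := h.odd_odd Uh.parity_clW Uh.parity_clW

end SuperCommute

end SuperPair

namespace Uh

/-! ### Torsion-freeness of the tensor powers and relations inside the quantum algebra -/

section Relations

variable {k : Type*} [Field k] [CharZero k]

instance : Module.Flat k⟦X⟧ (Uh k) :=
  letI := HTorsionFree.isTorsionFree (k := k) (A := Uh k)
  inferInstance

instance : HTorsionFree k (Compl (hbar k) (T2 (grading k))) :=
  letI := flat_T2 (grading k)
  letI := HTorsionFree.of_flat (k := k) (A := T2 (grading k))
  inferInstance

/-- Required for the cocycle identity, whose three pairs live in the tensor cube. -/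
instance : HTorsionFree k (Compl (hbar k) (T3 (grading k))) :=
  letI := flat_T3 (grading k)
  letI := HTorsionFree.of_flat (k := k) (A := T3 (grading k))
  inferInstance

theorem isQuantumTriple : IsQuantumTriple (k := k) (X k) (Vp k) (Vm k) := by
  have := isClassicalPair.isQuantumTriple k
  rwa [X_clv, Vp_clv, Vm_clv] at this

/-- Uniqueness identifies this lift with the identity, so its values express H, Y and T^c through
V₊, V₋ and X. -/
theorem lift_isQuantumTriple : isQuantumTriple.lift = AlgHom.id k⟦X⟧ (Uh k) :=
  hom_ext (isQuantumTriple.lift_Vp) (isQuantumTriple.lift_Vm)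

theorem H_eq : H k = -((2 : k⟦X⟧) • (Vp k * Vm k + Vm k * Vp k)) := by
  have := isQuantumTriple.lift_H (k := k) (𝒞 := Uh k)
  rwa [lift_isQuantumTriple] at this

theorem Y_eq : Y k = -((4 : k⟦X⟧) • (Vm k * Vm k)) := by
  have := isQuantumTriple.lift_Y (k := k) (𝒞 := Uh k)
  rwa [lift_isQuantumTriple] at this

theorem Tpow_eq (c : k) : Tpow k c = expH k ((C c : k⟦X⟧) • X k) := by
  have := isQuantumTriple.lift_Tpow (k := k) (𝒞 := Uh k) c
  rwa [lift_isQuantumTriple] at this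

theorem Tpow_mul_Tpow (c d : k) : Tpow k c * Tpow k d = Tpow k (c + d) := by
  rw [← T_clv, ← T_clv, ← T_clv, IsClassicalPair.T_mul_T]

theorem Tpow_mul_Vp (c : k) : Tpow k c * Vp k = Vp k * Tpow k c := by
  rw [Tpow_eq]
  exact expH_commute (by rw [smul_mul_assoc, mul_smul_comm, isQuantumTriple.X_Vp])

theorem Tpow_mul_Vm (c : k) : Tpow k c * Vm k =
    Vm k * Tpow k c + (C c * hbar k) • (Vp k * Tpow k c) := by
  have hV := isQuantumTriple.X_Vp (k := k) (𝒞 := Uh k)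
  rw [Tpow_eq, expH_derivation (u := (C c : k⟦X⟧) • Vp k) (y := Vm k), smul_mul_assoc]
  · module
  · rw [smul_mul_assoc, isQuantumTriple.X_Vm, smul_add, mul_smul_comm]
  · rw [smul_mul_smul_comm, smul_mul_smul_comm, hV]

theorem parity_X : parity k (X k) = X k := by
  rw [← X_clv, IsClassicalPair.map_X, parity_clv, IsClassicalPair.X_neg]

end Relations

end Uh

namespace SuperCommute

open Uh

variable {k : Type*} [Field k] [CharZero k]
variable {𝒞 : Type*} [Ring 𝒞] [Algebra k⟦X⟧ 𝒞]
variable {f g D : Uh k →ₐ[k⟦X⟧] 𝒞} (s : SuperCommute (grading k) (grading k) f g)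
include s

/-- The product of two sums in the form of the coproduct of an odd generator. -/
theorem coproduct_mul {a b : Uh k} (ha : parity k a = -a) (hb : parity k b = -b) (c c' : k) :
    (f a * g (Tpow k c) + f (Tpow k c') * g a) * (f b * g (Tpow k c) + f (Tpow k c') * g b) =
    f (a * b) * g (Tpow k (c + c)) + f (Tpow k (c' + c')) * g (a * b) +
      f (a * Tpow k c') * g (Tpow k c * b) - f (Tpow k c' * b) * g (a * Tpow k c) := by
  have e1 := s.odd_odd hb ha
  have e2 := s.even_right (parity_Tpow c) b
  have e3 := s.even_right (parity_Tpow c) (Tpow k c')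
  have e4 := s.even_left (parity_Tpow c') a
  simp only [← Tpow_mul_Tpow, map_mul, mul_add, add_mul, mul_assoc, assoc_of_eq e1, assoc_of_eq e2,
    assoc_of_eq e3, assoc_of_eq e4, neg_mul, mul_neg]
  abel

omit s in
theorem two_mul_half_hbar : (2 : k⟦X⟧) * (C (1 / 2) * hbar k) = hbar k := by
  linear_combination hbar k * C_half_mul_two (k := k)

/-- In -2{D(V₊), D(V₋)} the mixed terms would cancel if T^{±1/2} commuted with V₋. The two
commutators contribute -½h each, whence the coefficient 2h. -/
theorem map_H (hp : D (Vp k) = f (Vp k) * g (Tpow k (-(1 / 2))) + f (Tpow k (1 / 2)) * g (Vp k))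
    (hm : D (Vm k) = f (Vm k) * g (Tpow k (-(1 / 2))) + f (Tpow k (1 / 2)) * g (Vm k)) :
    D (H k) = f (H k) * g (Tpow k (-1)) + f (Tpow k 1) * g (H k) +
      (2 * hbar k) • (f (Vp k * Tpow k (1 / 2)) * g (Vp k * Tpow k (-(1 / 2)))) := by
  have e1 := Tpow_mul_Vm (k := k) (1 / 2)
  have e2 := Tpow_mul_Vm (k := k) (-(1 / 2))
  have e3 : (-(1 / 2) : k) + -(1 / 2) = -1 := by norm_num
  have e4 : (1 / 2 : k) + 1 / 2 = 1 := by norm_num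
  rw [map_neg (C : k →+* k⟦X⟧), neg_mul, neg_smul] at e2
  rw [H_eq, map_neg, map_smul, map_add, map_mul, map_mul, hp, hm,
    s.coproduct_mul parity_Vp parity_Vm, s.coproduct_mul parity_Vm parity_Vp, e1, e2, e3, e4,
    Tpow_mul_Vp, Tpow_mul_Vp]
  have h2 := two_mul_half_hbar (k := k)
  simp only [map_neg, map_add, map_smul, mul_add, add_mul, smul_mul_assoc, mul_smul_comm, neg_mul,
    mul_neg]
  generalize (C (1 / 2) : k⟦X⟧) * hbar k = d at h2 ⊢
  rw [← h2]
  module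

theorem map_Y
    (hm : D (Vm k) = f (Vm k) * g (Tpow k (-(1 / 2))) + f (Tpow k (1 / 2)) * g (Vm k)) :
    D (Y k) = f (Y k) * g (Tpow k (-1)) + f (Tpow k 1) * g (Y k) +
      (2 * hbar k) • (f (Vp k * Tpow k (1 / 2)) * g (Tpow k (-(1 / 2)) * Vm k)) +
      (2 * hbar k) • (f (Tpow k (1 / 2) * Vm k) * g (Vp k * Tpow k (-(1 / 2)))) := by
  have e1 := eq_sub_of_add_eq (Tpow_mul_Vm (k := k) (1 / 2)).symm
  have e2 := eq_sub_of_add_eq (Tpow_mul_Vm (k := k) (-(1 / 2))).symm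
  have e3 : (-(1 / 2) : k) + -(1 / 2) = -1 := by norm_num
  have e4 : (1 / 2 : k) + 1 / 2 = 1 := by norm_num
  rw [map_neg (C : k →+* k⟦X⟧), neg_mul, neg_smul] at e2
  rw [Y_eq, map_neg, map_smul, map_mul, hm, s.coproduct_mul parity_Vm parity_Vm, e1, e2, e3, e4]
  have h2 := two_mul_half_hbar (k := k)
  simp only [map_neg, map_add, map_sub, map_smul, mul_add, add_mul, mul_sub, sub_mul,
    smul_mul_assoc, mul_smul_comm, neg_mul, mul_neg]
  generalize (C (1 / 2) : k⟦X⟧) * hbar k = d at h2 ⊢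
  rw [← h2]
  module

omit s in
theorem parity_map {E : 𝒞 →ₐ[k⟦X⟧] 𝒞} (hf : ∀ a, E (f a) = f (parity k a))
    (hg : ∀ a, E (g a) = g (parity k a)) {a : Uh k} (ha : parity k a = -a) {c c' : k}
    (h : D a = f a * g (Tpow k c) + f (Tpow k c') * g a) : E (D a) = D (parity k a) := by
  rw [ha, map_neg, h, map_add, map_mul, map_mul]
  simp only [hf, hg, ha, parity_Tpow, map_neg, neg_mul, mul_neg, neg_add]

end SuperCommute

namespace Uh

section Comul

variable (k : Type*) [Field k] [CharZero k]

theorem squarePair : IsSuperPair (k := k) (inl (grading k) (clv k)) (inl (grading k) (clW k))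
    (inr (grading k) (clv k)) (inr (grading k) (clW k)) :=
  (superCommute_inl_inr (grading k)).isSuperPair

/-- The undeformed coproduct. -/
def comul₀ : Uh k →ₐ[k⟦X⟧] Compl (hbar k) (T2 (grading k)) := (squarePair k).sum.lift k

/-- The twist, as a unit of the completed tensor square. -/
def twistUnit : (Compl (hbar k) (T2 (grading k)))ˣ :=
  (isUnit_twist (k := k) (inl (grading k) (clv k)) (inl (grading k) (clW k))
    (inr (grading k) (clv k))).unit

theorem twistUnit_val : (twistUnit k : Compl (hbar k) (T2 (grading k))) =
    twist k (inl (grading k) (clv k)) (inl (grading k) (clW k)) (inr (grading k) (clv k)) := rfl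

/-- The coproduct. -/
def comul : Uh k →ₐ[k⟦X⟧] Compl (hbar k) (T2 (grading k)) :=
  (conjHom k⟦X⟧ (twistUnit k)).comp (comul₀ k)

theorem comul_mul_twist (a : Uh k) : comul k a * twistUnit k = twistUnit k * comul₀ k a :=
  conjHom_mul (R := k⟦X⟧) (twistUnit k) _

theorem comul_eq {a : Uh k} {z : Compl (hbar k) (T2 (grading k))}
    (e : twistUnit k * comul₀ k a = z * twistUnit k) : comul k a = z :=
  conjHom_eq (R := k⟦X⟧) e

local notation "ι₁" => inl (grading k)
local notation "ι₂" => inr (grading k)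

theorem comul_Vp : comul k (Vp k) = ι₁ (Vp k) * ι₂ (Tpow k (-(1 / 2))) +
    ι₁ (Tpow k (1 / 2)) * ι₂ (Vp k) := by
  refine comul_eq k ?_
  rw [twistUnit_val, comul₀, IsClassicalPair.lift_Vp, (squarePair k).twist_Vp,
    ← IsClassicalPair.map_Vp, ← IsClassicalPair.map_Vp, ← IsClassicalPair.map_T,
    ← IsClassicalPair.map_T, Vp_clv, T_clv, T_clv]

theorem comul_Vm : comul k (Vm k) = ι₁ (Vm k) * ι₂ (Tpow k (-(1 / 2))) +
    ι₁ (Tpow k (1 / 2)) * ι₂ (Vm k) := by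
  refine comul_eq k ?_
  rw [twistUnit_val, comul₀, IsClassicalPair.lift_Vm, (squarePair k).twist_Vm,
    ← IsClassicalPair.map_Vm, ← IsClassicalPair.map_Vm, ← IsClassicalPair.map_T,
    ← IsClassicalPair.map_T, Vm_clv, T_clv, T_clv]

theorem comul_X : comul k (X k) = ι₁ (X k) + ι₂ (X k) := by
  refine comul_eq k ?_
  rw [twistUnit_val, comul₀, IsClassicalPair.lift_X, (squarePair k).twist_X,
    ← IsClassicalPair.map_X, ← IsClassicalPair.map_X, X_clv]

theorem comul_Tpow (c : k) : comul k (Tpow k c) = ι₁ (Tpow k c) * ι₂ (Tpow k c) := by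
  refine comul_eq k ?_
  rw [twistUnit_val, comul₀, IsClassicalPair.lift_Tpow, (squarePair k).twist_T,
    ← IsClassicalPair.map_T, ← IsClassicalPair.map_T, T_clv]

theorem comul_H : comul k (H k) = ι₁ (H k) * ι₂ (Tpow k (-1)) + ι₁ (Tpow k 1) * ι₂ (H k) +
    (2 * hbar k) • (ι₁ (Vp k * Tpow k (1 / 2)) * ι₂ (Vp k * Tpow k (-(1 / 2)))) :=
  (superCommute_inl_inr (grading k)).map_H (comul_Vp k) (comul_Vm k)

theorem comul_Y : comul k (Y k) = ι₁ (Y k) * ι₂ (Tpow k (-1)) + ι₁ (Tpow k 1) * ι₂ (Y k) +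
    (2 * hbar k) • (ι₁ (Vp k * Tpow k (1 / 2)) * ι₂ (Tpow k (-(1 / 2)) * Vm k)) +
    (2 * hbar k) • (ι₁ (Tpow k (1 / 2) * Vm k) * ι₂ (Vp k * Tpow k (-(1 / 2)))) :=
  (superCommute_inl_inr (grading k)).map_Y (comul_Vm k)

theorem squareParity_comul_hom :
    (squareParity (parity_of_mem (k := k))).comp (comul k) = (comul k).comp (parity k) := by
  have h : ∀ V : Uh k, parity k V = -V →
      comul k V = ι₁ V * ι₂ (Tpow k (-(1 / 2))) + ι₁ (Tpow k (1 / 2)) * ι₂ V →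
      squareParity (parity_of_mem (k := k)) (comul k V) = comul k (parity k V) := fun V hV h =>
    SuperCommute.parity_map (f := ι₁) (g := ι₂) (D := comul k)
      (E := squareParity (parity_of_mem (k := k))) (squareParity_inl _) (squareParity_inr _) hV h
  refine hom_ext ?_ ?_ <;> rw [AlgHom.comp_apply, AlgHom.comp_apply]
  · exact h _ parity_Vp (comul_Vp k)
  · exact h _ parity_Vm (comul_Vm k)

theorem squareParity_comul (a : Uh k) :
    squareParity (parity_of_mem (k := k)) (comul k a) = comul k (parity k a) := by
  rw [← AlgHom.comp_apply, squareParity_comul_hom, AlgHom.comp_apply]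

theorem comul_even (i : ZMod 2) (a : Uh k) (ha : a ∈ grading k i) : IsHomog i (comul k a) := by
  refine isHomog_of_squareParity (parity_of_mem (k := k)) ?_
  rw [squareParity_comul, parity_of_mem i a ha, Units.smul_def, map_zsmul, Units.smul_def]

theorem coassoc_hom : (leftHom (comul_even k)).comp (comul k) =
    (rightHom (comul_even k)).comp (comul k) :=
  hom_ext (coassoc_of_coproduct _ (comul_Tpow k _) (comul_Tpow k _) (comul_Vp k))
    (coassoc_of_coproduct _ (comul_Tpow k _) (comul_Tpow k _) (comul_Vm k))

theorem coassoc (a : Uh k) :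
    applyLeft (comul k).toLinearMap (comul k a) = applyRight (comul k).toLinearMap (comul k a) :=
  applyLeft_eq_applyRight (comul_even k) (coassoc_hom k) a

end Comul

end Uh

end SuperJordanian

end

noncomputable section

namespace SuperJordanian


open PowerSeries (C coeff)
open scoped Nat

/-! ### The counit and the antipode -/

section GenericCounit

open GradedTensorProduct (includeLeft includeRight)

variable {k : Type*} [Field k] {A : Type*} [Ring A] [Algebra k⟦X⟧ A]
  {𝒜 : ZMod 2 → Submodule k⟦X⟧ A} [GradedAlgebra 𝒜] {ε : A →ₐ[k⟦X⟧] k⟦X⟧}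

theorem superCommute_counit (hε : ∀ a ∈ 𝒜 1, ε a = 0) :
    SuperCommute 𝒜 𝒜 ((Algebra.ofId k⟦X⟧ A).comp ε) (AlgHom.id k⟦X⟧ A) := by
  intro i j a b
  change algebraMap k⟦X⟧ A (ε a) * b = (-1 : ℤˣ) ^ (j * i) • (b * algebraMap k⟦X⟧ A (ε a))
  have hi : i = 0 ∨ i = 1 := by
    clear a
    revert i
    decide
  rcases hi with rfl | rfl
  · rw [mul_zero, uzpow_zero, one_smul, Algebra.commutes]
  · rw [hε a a.2, map_zero, zero_mul, mul_zero, smul_zero]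

/-- `ε ⊗ id` as a homomorphism. -/
def counitLeft (hε : ∀ a ∈ 𝒜 1, ε a = 0) : Compl (hbar k) (T2 𝒜) →ₐ[k⟦X⟧] Compl (hbar k) A :=
  Compl.mapHom (superCommute_counit hε).lift

/-- `id ⊗ ε` as a homomorphism. -/
def counitRight (hε : ∀ a ∈ 𝒜 1, ε a = 0) : Compl (hbar k) (T2 𝒜) →ₐ[k⟦X⟧] Compl (hbar k) A :=
  Compl.mapHom (superCommute_counit hε).symm.lift

variable (hε : ∀ a ∈ 𝒜 1, ε a = 0)

theorem map_functionalLeft (z : Compl (hbar k) (T2 𝒜)) :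
    Compl.map (functionalLeft 𝒜 ε.toLinearMap) z = counitLeft hε z := by
  have : functionalLeft 𝒜 ε.toLinearMap = (superCommute_counit hε).lift.toLinearMap :=
    T2_linear_ext fun a b => rfl
  rw [this, Compl.map_eq]
  rfl

theorem map_functionalRight (z : Compl (hbar k) (T2 𝒜)) :
    Compl.map (functionalRight 𝒜 ε.toLinearMap) z = counitRight hε z := by
  have : functionalRight 𝒜 ε.toLinearMap = (superCommute_counit hε).symm.lift.toLinearMap :=
    T2_linear_ext fun a b => rfl
  rw [this, Compl.map_eq]
  rfl

theorem counitLeft_inl (a : A) :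
    counitLeft hε (inl 𝒜 a) = Compl.of (hbar k) (algebraMap k⟦X⟧ A (ε a)) :=
  congrArg (Compl.of (hbar k)) ((superCommute_counit hε).lift_includeLeft a)

theorem counitLeft_inr (a : A) : counitLeft hε (inr 𝒜 a) = Compl.of (hbar k) a :=
  congrArg (Compl.of (hbar k)) ((superCommute_counit hε).lift_includeRight a)

theorem counitRight_inl (a : A) : counitRight hε (inl 𝒜 a) = Compl.of (hbar k) a :=
  congrArg (Compl.of (hbar k)) ((superCommute_counit hε).symm.lift_includeLeft a)

theorem counitRight_inr (a : A) :
    counitRight hε (inr 𝒜 a) = Compl.of (hbar k) (algebraMap k⟦X⟧ A (ε a)) :=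
  congrArg (Compl.of (hbar k)) ((superCommute_counit hε).symm.lift_includeRight a)

variable {D : A →ₐ[k⟦X⟧] Compl (hbar k) (T2 𝒜)} {t t' V : A}

theorem counitLeft_of_coproduct (hV : D V = inl 𝒜 V * inr 𝒜 t' + inl 𝒜 t * inr 𝒜 V)
    (h0 : ε V = 0) (ht : ε t = 1) : ((counitLeft hε).comp D) V = Compl.of (hbar k) V := by
  rw [AlgHom.comp_apply, map_add_mul hV, counitLeft_inl, counitLeft_inl, counitLeft_inr,
    counitLeft_inr, h0, ht, map_zero, map_zero, map_one, map_one, zero_mul, one_mul, zero_add]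

theorem counitRight_of_coproduct (hV : D V = inl 𝒜 V * inr 𝒜 t' + inl 𝒜 t * inr 𝒜 V)
    (h0 : ε V = 0) (ht : ε t' = 1) : ((counitRight hε).comp D) V = Compl.of (hbar k) V := by
  rw [AlgHom.comp_apply, map_add_mul hV, counitRight_inl, counitRight_inl, counitRight_inr,
    counitRight_inr, h0, ht, map_zero, map_zero, map_one, map_one, mul_zero, mul_one, add_zero]

end GenericCounit

section GenericAntipode

variable {k : Type*} [Field k] {A : Type*} [Ring A] [Algebra k⟦X⟧ A]
  {𝒜 : ZMod 2 → Submodule k⟦X⟧ A} [GradedAlgebra 𝒜]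

theorem map_mulMap (f g : A →ₗ[k⟦X⟧] A) (a b : A) :
    Compl.map (mulMap 𝒜 f g) (inl 𝒜 a * inr 𝒜 b) = Compl.of (hbar k) (f a * g b) := by
  rw [← of_tmul, Compl.map_of]
  rfl

theorem inl_mul_inr_mul {i j : ZMod 2} {b c : A} (hb : b ∈ 𝒜 i) (hc : c ∈ 𝒜 j) (a d : A) :
    inl 𝒜 a * inr 𝒜 c * (inl 𝒜 b * inr 𝒜 d) =
      (-1 : ℤˣ) ^ (i * j) • (inl 𝒜 (a * b) * inr 𝒜 (c * d)) := by
  have := (superCommute_inl_inr 𝒜).symm ⟨c, hc⟩ ⟨b, hb⟩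
  dsimp only at this
  rw [mul_assoc, ← mul_assoc (inr 𝒜 c), this, smul_mul_assoc, mul_smul_comm, map_mul, map_mul,
    mul_assoc, mul_assoc]

variable {σ : A →ₐ[k⟦X⟧] A} (hσ : ∀ i, ∀ a ∈ 𝒜 i, σ a = (-1 : ℤˣ) ^ i • a) {S : A →ₗ[k⟦X⟧] A}
  (hS : ∀ i, ∀ a ∈ 𝒜 i, S a ∈ 𝒜 i)
  (hS' : ∀ i j, ∀ a ∈ 𝒜 i, ∀ b ∈ 𝒜 j, S (a * b) = (-1 : ℤˣ) ^ (i * j) • (S b * S a))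

/-- The sign automorphism `a ↦ (-1)^{i |a|} a`. -/
def signHom (σ : A →ₐ[k⟦X⟧] A) (i : ZMod 2) : A →ₐ[k⟦X⟧] A :=
  if i = 0 then AlgHom.id k⟦X⟧ A else σ

include hσ in
theorem signHom_of_mem (i : ZMod 2) {j : ZMod 2} {a : A} (ha : a ∈ 𝒜 j) :
    signHom σ i a = (-1 : ℤˣ) ^ (i * j) • a := by
  have hi : i = 0 ∨ i = 1 := by
    revert i
    decide
  rcases hi with rfl | rfl
  · rw [zero_mul, uzpow_zero, one_smul]
    rfl
  · rw [one_mul]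
    exact hσ j a ha

include hσ hS hS' in
-- For z = a⊗d one gets S(b)S(a)dc with the sign (-1)^{|b|(|a|+|d|)}: one part from moving b past d,
-- the other from reversing the product ab. The sign depends only on the total degree of z, so it is
-- the automorphism `signHom`.
theorem map_mulMap_left_mul (z : Compl (hbar k) (T2 𝒜)) {i : ZMod 2} {b : A} (hb : b ∈ 𝒜 i)
    (c : A) : Compl.map (mulMap 𝒜 S .id) (z * (inl 𝒜 b * inr 𝒜 c)) = Compl.of (hbar k) (S b) *
      Compl.mapHom (signHom σ i) (Compl.map (mulMap 𝒜 S .id) z) * Compl.of (hbar k) c := by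
  let f : Compl (hbar k) (T2 𝒜) →ₗ[k⟦X⟧] Compl (hbar k) A :=
    Compl.map (mulMap 𝒜 S .id) ∘ₗ LinearMap.mulRight k⟦X⟧ (inl 𝒜 b * inr 𝒜 c)
  let g : Compl (hbar k) (T2 𝒜) →ₗ[k⟦X⟧] Compl (hbar k) A :=
    LinearMap.mulRight k⟦X⟧ (Compl.of (hbar k) c) ∘ₗ
      LinearMap.mulLeft k⟦X⟧ (Compl.of (hbar k) (S b)) ∘ₗ
      (Compl.mapHom (signHom σ i)).toLinearMap ∘ₗ Compl.map (mulMap 𝒜 S .id)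
  have hfg : f = g := by
    refine square_linear_ext fun a d => ?_
    refine eq_of_homogeneous (𝒜 := 𝒜) (f := f ∘ₗ LinearMap.mulLeft k⟦X⟧ (inl 𝒜 a) ∘ₗ
      (inr 𝒜).toLinearMap) (g := g ∘ₗ LinearMap.mulLeft k⟦X⟧ (inl 𝒜 a) ∘ₗ (inr 𝒜).toLinearMap)
      (fun j d hd => ?_) d
    refine eq_of_homogeneous (𝒜 := 𝒜) (f := f ∘ₗ LinearMap.mulRight k⟦X⟧ (inr 𝒜 d) ∘ₗ
      (inl 𝒜).toLinearMap) (g := g ∘ₗ LinearMap.mulRight k⟦X⟧ (inr 𝒜 d) ∘ₗ (inl 𝒜).toLinearMap)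
      (fun l a ha => ?_) a
    change Compl.map (mulMap 𝒜 S .id) (inl 𝒜 a * inr 𝒜 d * (inl 𝒜 b * inr 𝒜 c)) =
      Compl.of (hbar k) (S b) * Compl.mapHom (signHom σ i)
        (Compl.map (mulMap 𝒜 S .id) (inl 𝒜 a * inr 𝒜 d)) * Compl.of (hbar k) c
    rw [inl_mul_inr_mul hb hd, map_mulMap, Compl.mapHom_of, ← map_mul, ← map_mul, map_mul (signHom σ i),
      signHom_of_mem hσ i (hS l a ha), LinearMap.id_apply, signHom_of_mem hσ i hd, Units.smul_def,
      map_zsmul, map_mulMap, ← map_zsmul, ← Units.smul_def, hS' l i a ha b hb, LinearMap.id_apply]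
    simp only [smul_mul_assoc, mul_smul_comm, smul_smul, mul_assoc]
    rw [mul_comm l i, mul_comm]
  exact LinearMap.congr_fun hfg z

include hσ hS hS' in
theorem map_mulMap_right_mul (z : Compl (hbar k) (T2 𝒜)) {i : ZMod 2} (b : A) {c : A}
    (hc : c ∈ 𝒜 i) : Compl.map (mulMap 𝒜 .id S) (inl 𝒜 b * inr 𝒜 c * z) = Compl.of (hbar k) b *
      Compl.mapHom (signHom σ i) (Compl.map (mulMap 𝒜 .id S) z) * Compl.of (hbar k) (S c) := by
  let f : Compl (hbar k) (T2 𝒜) →ₗ[k⟦X⟧] Compl (hbar k) A :=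
    Compl.map (mulMap 𝒜 .id S) ∘ₗ LinearMap.mulLeft k⟦X⟧ (inl 𝒜 b * inr 𝒜 c)
  let g : Compl (hbar k) (T2 𝒜) →ₗ[k⟦X⟧] Compl (hbar k) A :=
    LinearMap.mulRight k⟦X⟧ (Compl.of (hbar k) (S c)) ∘ₗ
      LinearMap.mulLeft k⟦X⟧ (Compl.of (hbar k) b) ∘ₗ
      (Compl.mapHom (signHom σ i)).toLinearMap ∘ₗ Compl.map (mulMap 𝒜 .id S)
  have hfg : f = g := by
    refine square_linear_ext fun a d => ?_
    refine eq_of_homogeneous (𝒜 := 𝒜) (f := f ∘ₗ LinearMap.mulLeft k⟦X⟧ (inl 𝒜 a) ∘ₗ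
      (inr 𝒜).toLinearMap) (g := g ∘ₗ LinearMap.mulLeft k⟦X⟧ (inl 𝒜 a) ∘ₗ (inr 𝒜).toLinearMap)
      (fun j d hd => ?_) d
    refine eq_of_homogeneous (𝒜 := 𝒜) (f := f ∘ₗ LinearMap.mulRight k⟦X⟧ (inr 𝒜 d) ∘ₗ
      (inl 𝒜).toLinearMap) (g := g ∘ₗ LinearMap.mulRight k⟦X⟧ (inr 𝒜 d) ∘ₗ (inl 𝒜).toLinearMap)
      (fun l a ha => ?_) a
    change Compl.map (mulMap 𝒜 .id S) (inl 𝒜 b * inr 𝒜 c * (inl 𝒜 a * inr 𝒜 d)) =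
      Compl.of (hbar k) b * Compl.mapHom (signHom σ i)
        (Compl.map (mulMap 𝒜 .id S) (inl 𝒜 a * inr 𝒜 d)) * Compl.of (hbar k) (S c)
    rw [inl_mul_inr_mul ha hc, map_mulMap, Compl.mapHom_of, ← map_mul, ← map_mul, map_mul (signHom σ i),
      signHom_of_mem hσ i (hS j d hd), LinearMap.id_apply, signHom_of_mem hσ i ha, Units.smul_def,
      map_zsmul, map_mulMap, ← map_zsmul, ← Units.smul_def, hS' i j c hc d hd, LinearMap.id_apply]
    simp only [smul_mul_assoc, mul_smul_comm, smul_smul, mul_assoc]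
    rw [mul_comm l i, mul_comm]
  exact LinearMap.congr_fun hfg z

include hσ hS hS' in
-- A scalar is even and central, so it can be pulled out from between S(b) and c in
-- `map_mulMap_left_mul`. With the additional factor w the antipode axiom becomes stable under
-- products.
theorem map_mulMap_left_of_counit {z : Compl (hbar k) (T2 𝒜)} {e : k⟦X⟧}
    (hz : Compl.map (mulMap 𝒜 S .id) z = Compl.of (hbar k) (algebraMap k⟦X⟧ A e))
    (w : Compl (hbar k) (T2 𝒜)) :
    Compl.map (mulMap 𝒜 S .id) (z * w) = e • Compl.map (mulMap 𝒜 S .id) w := by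
  let f : Compl (hbar k) (T2 𝒜) →ₗ[k⟦X⟧] Compl (hbar k) A :=
    Compl.map (mulMap 𝒜 S .id) ∘ₗ LinearMap.mulLeft k⟦X⟧ z
  let g : Compl (hbar k) (T2 𝒜) →ₗ[k⟦X⟧] Compl (hbar k) A :=
    LinearMap.lsmul k⟦X⟧ (Compl (hbar k) A) e ∘ₗ Compl.map (mulMap 𝒜 S .id)
  have hfg : f = g := by
    refine square_linear_ext fun b c => ?_
    refine eq_of_homogeneous (𝒜 := 𝒜) (f := f ∘ₗ LinearMap.mulRight k⟦X⟧ (inr 𝒜 c) ∘ₗ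
      (inl 𝒜).toLinearMap) (g := g ∘ₗ LinearMap.mulRight k⟦X⟧ (inr 𝒜 c) ∘ₗ (inl 𝒜).toLinearMap)
      (fun l b hb => ?_) b
    change Compl.map (mulMap 𝒜 S .id) (z * (inl 𝒜 b * inr 𝒜 c)) =
      e • Compl.map (mulMap 𝒜 S .id) (inl 𝒜 b * inr 𝒜 c)
    rw [map_mulMap_left_mul hσ hS hS' z hb, hz, Compl.mapHom_of, AlgHom.commutes, map_mulMap,
      ← map_mul, ← map_mul, ← Algebra.commutes, mul_assoc, ← Algebra.smul_def, map_smul]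
    rfl
  exact LinearMap.congr_fun hfg w

include hσ hS hS' in
theorem map_mulMap_right_of_counit {z : Compl (hbar k) (T2 𝒜)} {e : k⟦X⟧}
    (hz : Compl.map (mulMap 𝒜 .id S) z = Compl.of (hbar k) (algebraMap k⟦X⟧ A e))
    (w : Compl (hbar k) (T2 𝒜)) :
    Compl.map (mulMap 𝒜 .id S) (w * z) = e • Compl.map (mulMap 𝒜 .id S) w := by
  let f : Compl (hbar k) (T2 𝒜) →ₗ[k⟦X⟧] Compl (hbar k) A :=
    Compl.map (mulMap 𝒜 .id S) ∘ₗ LinearMap.mulRight k⟦X⟧ z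
  let g : Compl (hbar k) (T2 𝒜) →ₗ[k⟦X⟧] Compl (hbar k) A :=
    LinearMap.lsmul k⟦X⟧ (Compl (hbar k) A) e ∘ₗ Compl.map (mulMap 𝒜 .id S)
  have hfg : f = g := by
    refine square_linear_ext fun b c => ?_
    refine eq_of_homogeneous (𝒜 := 𝒜) (f := f ∘ₗ LinearMap.mulLeft k⟦X⟧ (inl 𝒜 b) ∘ₗ
      (inr 𝒜).toLinearMap) (g := g ∘ₗ LinearMap.mulLeft k⟦X⟧ (inl 𝒜 b) ∘ₗ (inr 𝒜).toLinearMap)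
      (fun l c hc => ?_) c
    change Compl.map (mulMap 𝒜 .id S) (inl 𝒜 b * inr 𝒜 c * z) =
      e • Compl.map (mulMap 𝒜 .id S) (inl 𝒜 b * inr 𝒜 c)
    rw [map_mulMap_right_mul hσ hS hS' z b hc, hz, Compl.mapHom_of, AlgHom.commutes, map_mulMap,
      ← map_mul, ← map_mul, ← Algebra.commutes, mul_assoc, ← Algebra.smul_def, map_smul]
    rfl
  exact LinearMap.congr_fun hfg w

end GenericAntipode

end SuperJordanian

end

noncomputable section

namespace SuperJordanian


open PowerSeries (C coeff)
open scoped Nat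

/-! ### The endomorphism algebra as a complete algebra -/

section EndAdic

variable {k : Type*} [Field k] {A : Type*} [Ring A] [Algebra k⟦X⟧ A]

instance [HTorsionFree k A] : HTorsionFree k (Module.End k⟦X⟧ A) where
  eq_zero f hf := LinearMap.ext fun x =>
    HTorsionFree.eq_zero (k := k) (f x) (LinearMap.congr_fun hf x)

/-- The pointwise sum of a power series in `h` of endomorphisms. -/
def endSeries [HAdic k A] (f : ℕ → Module.End k⟦X⟧ A) : Module.End k⟦X⟧ A where
  toFun x := hsum k fun n => f n x
  map_add' x y := by simp only [map_add, hsum_add]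
  map_smul' c x := by simp only [map_smul, RingHom.id_apply, smul_hsum]

theorem hsum_eq_sum_add [HAdic k A] (a : ℕ → A) (n : ℕ) : hsum k a =
    ∑ i ∈ Finset.range n, hbar k ^ i • a i + hbar k ^ n • hsum k fun i => a (n + i) := by
  induction n with
  | zero => simp
  | succ n ih =>
    rw [ih, hsum_eq_zero_add (fun i => a (n + i)), Finset.sum_range_succ, smul_add, smul_smul,
      ← pow_succ, add_zero, add_assoc]
    simp only [add_assoc, add_comm 1]

instance [HAdic k A] : HAdic k (Module.End k⟦X⟧ A) where
  eq_zero f hf := LinearMap.ext fun x => HAdic.eq_zero (k := k) (f x) fun n => by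
    obtain ⟨g, rfl⟩ := hf n
    exact ⟨g x, rfl⟩
  exists_sum f := by
    refine ⟨endSeries f, fun n => ⟨endSeries fun i => f (n + i), LinearMap.ext fun x => ?_⟩⟩
    rw [LinearMap.add_apply, LinearMap.sum_apply]
    exact hsum_eq_sum_add _ n

/-- Right multiplication depends linearly on z, hence continuously, and reversing the order of
factors does not affect powers of one element. -/
theorem expH_mulRight [HAdic k A] (z : A) :
    expH k (LinearMap.mulRight k⟦X⟧ z) = LinearMap.mulRight k⟦X⟧ (expH k z) := by
  have e : ∀ a : ℕ → A, LinearMap.mulRight k⟦X⟧ (hsum k a) =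
      hsum k fun n => LinearMap.mulRight k⟦X⟧ (a n) := fun a =>
    map_hsum ((LinearMap.mul k⟦X⟧ A).flip) a
  rw [expH, expH, e]
  refine hsum_congr fun n => ?_
  rw [LinearMap.pow_mulRight]
  ext x
  simp

end EndAdic

namespace Uh

variable {k : Type*} [Field k] [CharZero k]

instance : HAdic k k⟦X⟧ := HAdic.powerSeries fun _ => rfl
instance : HTorsionFree k k⟦X⟧ := HTorsionFree.powerSeries fun _ => rfl

theorem linear_ext {𝒞 : Type*} [Ring 𝒞] [Algebra k⟦X⟧ 𝒞] [HAdic k 𝒞] {f g : Uh k →ₗ[k⟦X⟧] 𝒞}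
    (h : ∀ a ∈ Algebra.adjoin k⟦X⟧ ({Vp k, Vm k} : Set (Uh k)), f a = g a) : f = g := by
  ext u
  refine eq_of_forall_mod (k := k) fun n => ?_
  obtain ⟨s, hs, w, rfl⟩ := exists_mem_adjoin u n
  refine ⟨f w - g w, ?_⟩
  rw [map_add, map_add, map_smul, map_smul, h s hs, smul_sub]
  abel

/-! ### The counit, from the zero triple -/

variable (k) in
theorem isQuantumTriple_zero : IsQuantumTriple (k := k) (0 : k⟦X⟧) 0 0 where
  X_Vp := rfl
  Vp_sq := by simp
  X_Vm := by simp
  H_Vm := by simp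

variable (k) in
/-- The counit. -/
def counit : Uh k →ₐ[k⟦X⟧] k⟦X⟧ := (isQuantumTriple_zero k).lift

theorem counit_Vp : counit k (Vp k) = 0 := IsQuantumTriple.lift_Vp _
theorem counit_Vm : counit k (Vm k) = 0 := IsQuantumTriple.lift_Vm _

theorem counit_gen (g : Gen) : counit k (gen k g) = 0 := by
  cases g
  · change counit k (H k) = 0
    rw [H_eq, map_neg, map_smul, map_add, map_mul, map_mul, counit_Vp, counit_Vm]
    simp
  · exact IsQuantumTriple.lift_X _
  · change counit k (Y k) = 0
    rw [Y_eq, map_neg, map_smul, map_mul, counit_Vm]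
    simp
  · exact counit_Vp
  · exact counit_Vm

theorem counit_Tpow (c : k) : counit k (Tpow k c) = 1 := by
  rw [counit, IsQuantumTriple.lift_Tpow, smul_zero, expH_zero]

theorem counit_parity (a : Uh k) : counit k (parity k a) = counit k a := by
  have : (counit k).comp (parity k) = counit k := hom_ext
    (by rw [AlgHom.comp_apply, parity_Vp, map_neg, counit_Vp, neg_zero])
    (by rw [AlgHom.comp_apply, parity_Vm, map_neg, counit_Vm, neg_zero])
  rw [← AlgHom.comp_apply, this]

theorem counit_odd (a : Uh k) (ha : a ∈ grading k 1) : counit k a = 0 := by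
  have := counit_parity a
  rw [parity_of_mem 1 a ha, uzpow_one, Units.neg_smul, one_smul, map_neg] at this
  refine ofNat_smul_inj (k := k) 2 ?_
  rw [smul_zero, ofNat_smul_eq_nsmul, two_nsmul]
  linear_combination -this

theorem counit_left (a : Uh k) :
    Compl.map (functionalLeft (grading k) (counit k).toLinearMap) (comul k a) =
      Compl.of (hbar k) a := by
  have : (counitLeft counit_odd).comp (comul k) = Compl.of (hbar k) :=
    hom_ext (counitLeft_of_coproduct _ (comul_Vp k) counit_Vp (counit_Tpow _))
      (counitLeft_of_coproduct _ (comul_Vm k) counit_Vm (counit_Tpow _))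
  rw [map_functionalLeft counit_odd, ← AlgHom.comp_apply, this]

theorem counit_right (a : Uh k) :
    Compl.map (functionalRight (grading k) (counit k).toLinearMap) (comul k a) =
      Compl.of (hbar k) a := by
  have : (counitRight counit_odd).comp (comul k) = Compl.of (hbar k) :=
    hom_ext (counitRight_of_coproduct _ (comul_Vp k) counit_Vp (counit_Tpow _))
      (counitRight_of_coproduct _ (comul_Vm k) counit_Vm (counit_Tpow _))
  rw [map_functionalRight counit_odd, ← AlgHom.comp_apply, this]

/-! #### The antipode -/

variable (k) in
/-- The image of `V₋` under the antipode. -/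
def antiVm : Uh k := -Vm k + (C (1 / 2) * hbar k) • Vp k

theorem parity_antiVm : parity k (antiVm k) = -antiVm k := by
  rw [antiVm, map_add, map_neg, map_smul, parity_Vp, parity_Vm, smul_neg, neg_add]

variable (k) in
/-- The operator `x ↦ (-1)^{|x|} x y`. -/
def oddRight (y : Uh k) : Module.End k⟦X⟧ (Uh k) :=
  LinearMap.mulRight k⟦X⟧ y ∘ₗ (parity k).toLinearMap

theorem oddRight_apply (y x : Uh k) : oddRight k y x = parity k x * y := rfl

/-- S(V₋) differs from -V₋ by ½hV₊, so besides the relation for V₋ only the bracket of V₊² with V₋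
occurs, and that one comes from `Vp_sq`. -/
theorem antiVm_bracket : (16 : k⟦X⟧) •
    ((antiVm k * -Vp k + -Vp k * antiVm k) * antiVm k -
      antiVm k * (antiVm k * -Vp k + -Vp k * antiVm k)) =
    antiVm k * (expH k (X k) + expH k (-X k)) + (expH k (X k) + expH k (-X k)) * antiVm k := by
  have t := isQuantumTriple (k := k)
  have h1 := t.H_Vm
  have h2 := t.Vp_sq
  have c1 : expH k (X k) * Vp k = Vp k * expH k (X k) := expH_commute t.X_Vp
  have c2 : expH k (-X k) * Vp k = Vp k * expH k (-X k) :=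
    expH_commute (by rw [neg_mul, t.X_Vp, mul_neg])
  have d1 : expH k (X k) * Vm k = Vm k * expH k (X k) + hbar k • (Vp k * expH k (X k)) :=
    expH_derivation t.X_Vm t.X_Vp
  have d2 : expH k (-X k) * Vm k = Vm k * expH k (-X k) - hbar k • (Vp k * expH k (-X k)) := by
    rw [expH_derivation (u := -Vp k) (y := Vm k), neg_mul, smul_neg, sub_eq_add_neg]
    · rw [neg_mul, t.X_Vm, mul_neg, neg_add]
    · rw [neg_mul, neg_mul, mul_neg, mul_neg, t.X_Vp]
  have e := C_half_mul_two (k := k)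
  rw [antiVm]
  generalize (C (1 / 2) : k⟦X⟧) = d at *
  generalize expH k (X k) = E at *
  generalize expH k (-X k) = E' at *
  have h3 := congrArg (fun z => z * Vm k - Vm k * z) h2
  simp only [sub_mul, mul_sub, mul_add, add_mul, mul_neg, neg_mul, neg_neg, smul_mul_assoc,
    mul_smul_comm, mul_assoc, smul_add, smul_sub, smul_neg, smul_smul, c1, c2, d1, d2, neg_add]
    at h1 h3 ⊢
  have hd : d = d * d * 2 := by linear_combination -d * e
  linear_combination (norm := skip) (-1 : k⟦X⟧) • h1 + (2 * d : k⟦X⟧) • h3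
  match_scalars <;> grind

variable (k) in
-- An anti-homomorphism is turned into a homomorphism by letting a act on x as (-1)^{|a||x|} x S(a).
-- The universal property then applies, since endomorphisms form a complete torsion-free algebra.
theorem isQuantumTriple_antipode : IsQuantumTriple (k := k)
    (LinearMap.mulRight k⟦X⟧ (-X k)) (oddRight k (-Vp k)) (oddRight k (antiVm k)) where
  X_Vp := by
    ext x
    simp only [Module.End.mul_apply, LinearMap.mulRight_apply, oddRight_apply, map_mul, map_neg,
      parity_X, parity_Vp, mul_assoc, mul_neg, neg_mul, isQuantumTriple.X_Vp]
  Vp_sq := by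
    have e : -LinearMap.mulRight k⟦X⟧ (-X k) = LinearMap.mulRight k⟦X⟧ (X k) := by
      ext x
      simp
    rw [e, expH_mulRight, expH_mulRight]
    ext x
    have := congrArg (fun z => x * z) (isQuantumTriple (k := k)).Vp_sq
    simp only [mul_smul_comm, mul_sub] at this
    simp only [Module.End.mul_apply, LinearMap.smul_apply, LinearMap.sub_apply,
      LinearMap.mulRight_apply, oddRight_apply, map_mul, map_neg, parity_parity, parity_Vp, mul_assoc,
      mul_neg, neg_mul, neg_neg, smul_neg, this, neg_sub]
  X_Vm := by
    ext x
    have e : antiVm k * X k = X k * antiVm k + Vp k := by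
      rw [antiVm, add_mul, mul_add, neg_mul, mul_neg, smul_mul_assoc, mul_smul_comm,
        isQuantumTriple.X_Vp, isQuantumTriple.X_Vm]
      abel
    simp only [Module.End.mul_apply, LinearMap.add_apply, LinearMap.mulRight_apply, oddRight_apply,
      map_mul, map_neg, parity_X, mul_assoc, mul_neg, neg_mul, e, mul_add, neg_add]
  H_Vm := by
    have e : -LinearMap.mulRight k⟦X⟧ (-X k) = LinearMap.mulRight k⟦X⟧ (X k) := by
      ext x
      simp
    rw [e, expH_mulRight, expH_mulRight]
    ext x
    have p : ∀ z : Uh k, parity k z = z → parity k (expH k z) = expH k z := fun z hz => by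
      rw [map_expH, hz]
    have p1 := p (X k) parity_X
    have p2 := p (-X k) (by rw [map_neg, parity_X])
    have := congrArg (fun z => parity k x * z) (antiVm_bracket (k := k))
    simp only [mul_smul_comm, mul_sub, mul_add, add_mul, mul_neg, neg_mul, neg_neg, smul_neg] at this
    simp only [Module.End.mul_apply, LinearMap.smul_apply, LinearMap.sub_apply, LinearMap.add_apply,
      LinearMap.mulRight_apply, oddRight_apply, map_mul, map_neg, map_add, parity_parity, parity_Vp,
      parity_antiVm, p1, p2, add_mul, mul_assoc, mul_neg, neg_mul, neg_neg, smul_neg]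
    linear_combination (norm := skip) this
    simp only [mul_assoc]
    module

variable (k) in
/-- The homomorphism sending a homogeneous `a` to the operator `x ↦ (-1)^{|a||x|} x S(a)`. -/
def antipodeHom : Uh k →ₐ[k⟦X⟧] Module.End k⟦X⟧ (Uh k) := (isQuantumTriple_antipode k).lift

theorem antipodeHom_Vp : antipodeHom k (Vp k) = oddRight k (-Vp k) := IsQuantumTriple.lift_Vp _
theorem antipodeHom_Vm : antipodeHom k (Vm k) = oddRight k (antiVm k) := IsQuantumTriple.lift_Vm _

variable (k) in
/-- The antipode. -/
def antipode : Uh k →ₗ[k⟦X⟧] Uh k := LinearMap.applyₗ (1 : Uh k) ∘ₗ (antipodeHom k).toLinearMap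

theorem antipode_apply (a : Uh k) : antipode k a = antipodeHom k a 1 := rfl

theorem antipode_Vp : antipode k (Vp k) = -Vp k := by
  rw [antipode_apply, antipodeHom_Vp, oddRight_apply, map_one, one_mul]

theorem antipode_Vm : antipode k (Vm k) = -Vm k + (C (1 / 2) * hbar k) • Vp k := by
  rw [antipode_apply, antipodeHom_Vm, oddRight_apply, map_one, one_mul, antiVm]

theorem antipode_X : antipode k (X k) = -X k := by
  rw [antipode_apply, antipodeHom, IsQuantumTriple.lift_X, LinearMap.mulRight_apply, one_mul]

theorem antipode_Tpow (c : k) : antipode k (Tpow k c) = Tpow k (-c) := by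
  have e : (C c : k⟦X⟧) • LinearMap.mulRight k⟦X⟧ (-X k) =
      LinearMap.mulRight k⟦X⟧ ((C (-c) : k⟦X⟧) • X k) := by
    ext x
    simp
  rw [antipode_apply, antipodeHom, IsQuantumTriple.lift_Tpow, e, expH_mulRight,
    LinearMap.mulRight_apply, one_mul, ← Tpow_eq]

/-- The algebra of all `a` such that `x ↦ (-1)^{|a||x|} x S(a)` and left multiplications
supercommute. -/
def antipodeDomain (τ : Uh k →ₐ[k⟦X⟧] Uh k) (L : Module.End k⟦X⟧ (Uh k)) :
    Subalgebra k⟦X⟧ (Uh k) where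
  carrier := {a | antipodeHom k a * L = L * antipodeHom k (τ a)}
  mul_mem' {a b} ha hb := by
    rw [Set.mem_ofPred_eq] at *
    rw [map_mul, map_mul, map_mul, mul_assoc, hb, ← mul_assoc, ha, mul_assoc]
  add_mem' {a b} ha hb := by
    rw [Set.mem_ofPred_eq] at *
    rw [map_add, map_add, map_add, add_mul, mul_add, ha, hb]
  algebraMap_mem' c := by
    rw [Set.mem_ofPred_eq, AlgHom.commutes, AlgHom.commutes, AlgHom.commutes, Algebra.commutes]

/-- For fixed L and τ the elements satisfying the identity form a subalgebra, so V₊ and V₋ suffice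
by density. It is used with L the parity or a left multiplication. -/
theorem antipodeHom_mul {τ : Uh k →ₐ[k⟦X⟧] Uh k} {L : Module.End k⟦X⟧ (Uh k)}
    (hp : antipodeHom k (Vp k) * L = L * antipodeHom k (τ (Vp k)))
    (hm : antipodeHom k (Vm k) * L = L * antipodeHom k (τ (Vm k))) (a : Uh k) :
    antipodeHom k a * L = L * antipodeHom k (τ a) := by
  let f : Uh k →ₗ[k⟦X⟧] Module.End k⟦X⟧ (Uh k) :=
    LinearMap.mulRight k⟦X⟧ L ∘ₗ (antipodeHom k).toLinearMap
  let g : Uh k →ₗ[k⟦X⟧] Module.End k⟦X⟧ (Uh k) :=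
    LinearMap.mulLeft k⟦X⟧ L ∘ₗ (antipodeHom k).toLinearMap ∘ₗ τ.toLinearMap
  have hfg : f = g := linear_ext fun a ha => by
    refine Algebra.adjoin_le (S := antipodeDomain τ L) ?_ ha
    rintro _ (rfl | rfl)
    · exact hp
    · exact hm
  exact LinearMap.congr_fun hfg a

theorem parity_antipode (a : Uh k) : parity k (antipode k a) = antipode k (parity k a) := by
  have := antipodeHom_mul (τ := parity k) (L := (parity k).toLinearMap) ?_ ?_ (parity k a)
  · have := LinearMap.congr_fun this 1
    rw [Module.End.mul_apply, Module.End.mul_apply, AlgHom.toLinearMap_apply, map_one,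
      parity_parity] at this
    exact this.symm
  · rw [parity_Vp, map_neg, antipodeHom_Vp]
    ext x
    simp [oddRight_apply, Module.End.mul_apply, parity_Vp]
  · rw [parity_Vm, map_neg, antipodeHom_Vm]
    ext x
    simp [oddRight_apply, Module.End.mul_apply, parity_antiVm]

theorem antipode_mem (i : ZMod 2) (a : Uh k) (ha : a ∈ grading k i) :
    antipode k a ∈ grading k i := by
  change parity k (antipode k a) = (-1 : ℤˣ) ^ i • antipode k a
  rw [parity_antipode, parity_of_mem i a ha, Units.smul_def, map_zsmul, Units.smul_def]

/-- Left multiplication by an even y commutes with the signed right multiplications; evaluating at 1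
gives the value at y. -/
theorem antipodeHom_apply_even {y : Uh k} (hy : parity k y = y) (a : Uh k) :
    antipodeHom k a y = y * antipode k a := by
  have := antipodeHom_mul (τ := AlgHom.id k⟦X⟧ (Uh k)) (L := LinearMap.mulLeft k⟦X⟧ y) ?_ ?_ a
  · have := LinearMap.congr_fun this 1
    rwa [Module.End.mul_apply, Module.End.mul_apply, LinearMap.mulLeft_apply, mul_one] at this
  · rw [AlgHom.id_apply, antipodeHom_Vp]
    ext x
    simp [oddRight_apply, Module.End.mul_apply, hy, mul_assoc]
  · rw [AlgHom.id_apply, antipodeHom_Vm]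
    ext x
    simp [oddRight_apply, Module.End.mul_apply, hy, mul_assoc]

theorem antipodeHom_apply_odd {y : Uh k} (hy : parity k y = -y) (a : Uh k) :
    antipodeHom k a y = y * antipode k (parity k a) := by
  have := antipodeHom_mul (τ := parity k) (L := LinearMap.mulLeft k⟦X⟧ y) ?_ ?_ a
  · have := LinearMap.congr_fun this 1
    rwa [Module.End.mul_apply, Module.End.mul_apply, LinearMap.mulLeft_apply, mul_one] at this
  · rw [parity_Vp, map_neg, antipodeHom_Vp]
    ext x
    simp [oddRight_apply, Module.End.mul_apply, hy, mul_assoc]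
  · rw [parity_Vm, map_neg, antipodeHom_Vm]
    ext x
    simp [oddRight_apply, Module.End.mul_apply, hy, mul_assoc]

/-- S(ab) is the operator of a applied to S(b), and S(b) is homogeneous of the degree of b. -/
theorem antipode_mul (i j : ZMod 2) (a : Uh k) (ha : a ∈ grading k i) (b : Uh k)
    (hb : b ∈ grading k j) :
    antipode k (a * b) = (-1 : ℤˣ) ^ (i * j) • (antipode k b * antipode k a) := by
  have hp := parity_of_mem j _ (antipode_mem j b hb)
  rw [antipode_apply, map_mul, Module.End.mul_apply, ← antipode_apply]
  have hj : j = 0 ∨ j = 1 := by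
    clear hp hb
    revert j
    decide
  rcases hj with rfl | rfl
  · rw [uzpow_zero, one_smul] at hp
    rw [antipodeHom_apply_even hp, mul_zero, uzpow_zero, one_smul]
  · rw [uzpow_one, Units.neg_smul, one_smul] at hp
    rw [antipodeHom_apply_odd hp, mul_one, parity_of_mem i a ha, Units.smul_def, map_zsmul,
      mul_smul_comm, Units.smul_def]

theorem antipode_odd_mul {a b : Uh k} (ha : parity k a = -a) (hb : parity k b = -b) :
    antipode k (a * b) = -(antipode k b * antipode k a) := by
  rw [antipode_mul 1 1 a (mem_odd ha) b (mem_odd hb), mul_one, uzpow_one, Units.neg_smul, one_smul]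

theorem antipode_H : antipode k (H k) = -H k - (2 * hbar k) • (Vp k * Vp k) := by
  rw [H_eq, map_neg, map_smul, map_add, antipode_odd_mul parity_Vp parity_Vm,
    antipode_odd_mul parity_Vm parity_Vp, antipode_Vp, antipode_Vm]
  have h2 := SuperCommute.two_mul_half_hbar (k := k)
  generalize (C (1 / 2) : k⟦X⟧) * hbar k = d at h2 ⊢
  rw [← h2]
  simp only [mul_add, add_mul, neg_mul, mul_neg, smul_mul_assoc, mul_smul_comm]
  module

theorem antipode_Y : antipode k (Y k) =
    -Y k + hbar k • H k + hbar k ^ 2 • (Vp k * Vp k) := by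
  rw [H_eq, Y_eq, map_neg, map_smul, antipode_odd_mul parity_Vm parity_Vm, antipode_Vm]
  have h2 := SuperCommute.two_mul_half_hbar (k := k)
  generalize (C (1 / 2) : k⟦X⟧) * hbar k = d at h2 ⊢
  rw [← h2]
  simp only [mul_add, add_mul, neg_mul, mul_neg, smul_mul_assoc, mul_smul_comm]
  module

/-- The algebra of all `a` for which the left antipode axiom holds. -/
def leftAntipodeDomain (F : Compl (hbar k) (T2 (grading k)) →ₗ[k⟦X⟧] Compl (hbar k) (Uh k)) :
    Subalgebra k⟦X⟧ (Uh k) where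
  carrier := {a | ∀ w, F (comul k a * w) = counit k a • F w}
  mul_mem' {a b} ha hb := fun w => by
    rw [map_mul (comul k), map_mul (counit k), mul_assoc, ha, hb, smul_smul]
  add_mem' {a b} ha hb := fun w => by
    rw [map_add, map_add, add_mul, map_add, ha, hb, add_smul]
  algebraMap_mem' c := fun w => by
    rw [AlgHom.commutes, AlgHom.commutes, ← Algebra.smul_def, map_smul]
    rfl

/-- The algebra of all `a` for which the right antipode axiom holds. -/
def rightAntipodeDomain (F : Compl (hbar k) (T2 (grading k)) →ₗ[k⟦X⟧] Compl (hbar k) (Uh k)) :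
    Subalgebra k⟦X⟧ (Uh k) where
  carrier := {a | ∀ w, F (w * comul k a) = counit k a • F w}
  mul_mem' {a b} ha hb := fun w => by
    rw [map_mul (comul k), map_mul (counit k), ← mul_assoc, hb, ha, smul_smul, mul_comm]
  add_mem' {a b} ha hb := fun w => by
    rw [map_add, map_add, mul_add, map_add, ha, hb, add_smul]
  algebraMap_mem' c := fun w => by
    rw [AlgHom.commutes, AlgHom.commutes, ← Algebra.commutes, ← Algebra.smul_def, map_smul]
    rfl

theorem map_mulMap_of_coproduct {f g : Uh k →ₗ[k⟦X⟧] Uh k} {t t' V : Uh k}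
    (hV : comul k V = inl (grading k) V * inr (grading k) t' +
      inl (grading k) t * inr (grading k) V) (e : f V * g t' + f t * g V = 0)
    (h0 : counit k V = 0) :
    Compl.map (mulMap (grading k) f g) (comul k V) =
      Compl.of (hbar k) (algebraMap k⟦X⟧ (Uh k) (counit k V)) := by
  rw [hV, map_add, map_mulMap, map_mulMap, ← map_add, e, h0, map_zero, map_zero, map_zero]

theorem antipode_left (a : Uh k) : Compl.map (mulMap (grading k) (antipode k) .id) (comul k a) =
    Compl.of (hbar k) (algebraMap k⟦X⟧ (Uh k) (counit k a)) := by
  have one : Compl.map (mulMap (grading k) (antipode k) .id) (1 : Compl (hbar k) (T2 (grading k))) =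
      (1 : Compl (hbar k) (Uh k)) := by
    have := map_mulMap (k := k) (𝒜 := grading k) (antipode k) .id 1 1
    rwa [map_one (inl _), map_one (inr _), mul_one, antipode_apply, map_one (antipodeHom k), Module.End.one_apply,
      LinearMap.id_apply, mul_one, map_one (Compl.of (hbar k))] at this
  let f : Uh k →ₗ[k⟦X⟧] Compl (hbar k) (Uh k) :=
    Compl.map (mulMap (grading k) (antipode k) .id) ∘ₗ (comul k).toLinearMap
  let g : Uh k →ₗ[k⟦X⟧] Compl (hbar k) (Uh k) :=
    ((Algebra.ofId k⟦X⟧ (Compl (hbar k) (Uh k))).comp (counit k)).toLinearMap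
  have hfg : f = g := linear_ext fun a ha => by
    -- The axiom with an arbitrary right factor w holds on a subalgebra; w = 1 recovers the axiom
    -- itself.
    have := Algebra.adjoin_le
      (S := leftAntipodeDomain (Compl.map (mulMap (grading k) (antipode k) .id))) ?_ ha 1
    · rw [mul_one, one, ← Algebra.algebraMap_eq_smul_one] at this
      exact this
    · rintro _ (rfl | rfl)
      · refine map_mulMap_left_of_counit parity_of_mem antipode_mem antipode_mul
          (map_mulMap_of_coproduct (comul_Vp k) ?_ counit_Vp)
        rw [antipode_Vp, antipode_Tpow, LinearMap.id_apply, LinearMap.id_apply, neg_mul,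
          Tpow_mul_Vp, neg_add_cancel]
      · refine map_mulMap_left_of_counit parity_of_mem antipode_mem antipode_mul
          (map_mulMap_of_coproduct (comul_Vm k) ?_ counit_Vm)
        rw [antipode_Vm, antipode_Tpow, LinearMap.id_apply, LinearMap.id_apply, Tpow_mul_Vm,
          map_neg (C : k →+* k⟦X⟧), add_mul, smul_mul_assoc, neg_mul]
        module
  have := LinearMap.congr_fun hfg a
  exact this.trans (AlgHom.commutes (Compl.of (hbar k)) (counit k a)).symm

theorem antipode_right (a : Uh k) : Compl.map (mulMap (grading k) .id (antipode k)) (comul k a) =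
    Compl.of (hbar k) (algebraMap k⟦X⟧ (Uh k) (counit k a)) := by
  have one : Compl.map (mulMap (grading k) .id (antipode k)) (1 : Compl (hbar k) (T2 (grading k))) =
      (1 : Compl (hbar k) (Uh k)) := by
    have := map_mulMap (k := k) (𝒜 := grading k) .id (antipode k) 1 1
    rwa [map_one (inl _), map_one (inr _), mul_one, antipode_apply, map_one (antipodeHom k), Module.End.one_apply,
      LinearMap.id_apply, mul_one, map_one (Compl.of (hbar k))] at this
  let f : Uh k →ₗ[k⟦X⟧] Compl (hbar k) (Uh k) :=
    Compl.map (mulMap (grading k) .id (antipode k)) ∘ₗ (comul k).toLinearMap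
  let g : Uh k →ₗ[k⟦X⟧] Compl (hbar k) (Uh k) :=
    ((Algebra.ofId k⟦X⟧ (Compl (hbar k) (Uh k))).comp (counit k)).toLinearMap
  have hfg : f = g := linear_ext fun a ha => by
    -- Here the arbitrary factor stands on the left.
    have := Algebra.adjoin_le
      (S := rightAntipodeDomain (Compl.map (mulMap (grading k) .id (antipode k)))) ?_ ha 1
    · rw [one_mul, one, ← Algebra.algebraMap_eq_smul_one] at this
      exact this
    · rintro _ (rfl | rfl)
      · refine map_mulMap_right_of_counit parity_of_mem antipode_mem antipode_mul
          (map_mulMap_of_coproduct (comul_Vp k) ?_ counit_Vp)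
        rw [antipode_Vp, antipode_Tpow, LinearMap.id_apply, LinearMap.id_apply, mul_neg,
          Tpow_mul_Vp, neg_neg, add_neg_cancel]
      · refine map_mulMap_right_of_counit parity_of_mem antipode_mem antipode_mul
          (map_mulMap_of_coproduct (comul_Vm k) ?_ counit_Vm)
        rw [antipode_Vm, antipode_Tpow, LinearMap.id_apply, LinearMap.id_apply, neg_neg, mul_add,
          mul_neg, Tpow_mul_Vm, mul_smul_comm, Tpow_mul_Vp]
        abel
  have := LinearMap.congr_fun hfg a
  exact this.trans (AlgHom.commutes (Compl.of (hbar k)) (counit k a)).symm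

variable (k) in
/-- The Hopf superalgebra structure of `U_h(osp(2/1))`. -/
def hopf : HopfSuperalgebra (hbar k) (grading k) where
  comul := comul k
  counit := counit k
  antipode := antipode k
  comul_even := comul_even k
  counit_even := counit_odd
  antipode_even := antipode_mem
  coassoc := coassoc k
  counit_left := counit_left
  counit_right := counit_right
  antipode_left := antipode_left
  antipode_right := antipode_right

end Uh

end SuperJordanian

end

noncomputable section

namespace SuperJordanian


open PowerSeries (C coeff)
open scoped Nat

/-! ### The universal `R`-matrix -/

section GenericTriangular

/-- Both d and d' are conjugate to the same d₀, by u and u' respectively. -/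
theorem intertwine_of_twist {M : Type*} [Monoid M] {u u' : Mˣ} {d d' d₀ : M} (h : d * u = u * d₀)
    (h' : d' * u' = u' * d₀) : ((u' * u⁻¹ : Mˣ) : M) * d = d' * (u' * u⁻¹ : Mˣ) := by
  have e : ↑u⁻¹ * d = d₀ * ↑u⁻¹ := by
    rw [Units.inv_mul_eq_iff_eq_mul, ← mul_assoc, ← h, Units.mul_inv_cancel_right]
  rw [Units.val_mul, mul_assoc, e, ← mul_assoc, ← h', mul_assoc]

variable {R B E : Type*} [CommRing R] [Ring B] [Algebra R B] [Ring E] [Algebra R E]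

/-- The data from which the hexagon identities follow: the maps `z ↦ z₁₂, z₁₃, z₂₃`, `Δ ⊗ id`,
`id ⊗ Δ`, the flips, and a unit satisfying the cocycle identity. -/
structure HexagonData (l r t₁₂ t₁₃ t₂₃ : B →ₐ[R] E) (f : B →ₐ[R] B) (s₁₂ s₂₃ : E →ₐ[R] E) (u : Bˣ)
    (θ θ' : E) : Prop where
  left : l u * t₁₂ u = t₁₂ u * θ
  right : r u * t₂₃ u = t₂₃ u * θ'
  cocycle : t₁₂ u * θ = t₂₃ u * θ'
  s₁₂_θ : s₁₂ θ = θ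
  s₂₃_θ' : s₂₃ θ' = θ'
  s₁₂_t₁₂ : ∀ z, s₁₂ (t₁₂ z) = t₁₂ (f z)
  s₂₃_t₂₃ : ∀ z, s₂₃ (t₂₃ z) = t₂₃ (f z)
  s₂₃_t₁₂ : ∀ z, s₂₃ (t₁₂ z) = t₁₃ z
  s₁₂_t₂₃ : ∀ z, s₁₂ (t₂₃ z) = t₁₃ z
  s₂₃_t₁₃ : ∀ z, s₂₃ (t₁₃ z) = t₁₂ z
  s₁₂_t₁₃ : ∀ z, s₁₂ (t₁₃ z) = t₂₃ z
  left_flip : ∀ z, l (f z) = s₂₃ (s₁₂ (r z))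
  right_flip : ∀ z, r (f z) = s₁₂ (s₂₃ (l z))

namespace HexagonData

variable {l r t₁₂ t₁₃ t₂₃ : B →ₐ[R] E} {f : B →ₐ[R] B} {s₁₂ s₂₃ : E →ₐ[R] E} {u : Bˣ} {θ θ' : E}
  (h : HexagonData l r t₁₂ t₁₃ t₂₃ f s₁₂ s₂₃ u θ θ')
include h

theorem isUnit : IsUnit (t₁₂ u * θ) := by
  rw [← h.left]
  exact (u.isUnit.map l).mul (u.isUnit.map t₁₂)

omit h in
theorem map_mul_cancel (t : B →ₐ[R] E) (b : B) (z : E) : t (b * ↑u⁻¹) * (t u * z) = t b * z := by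
  rw [← mul_assoc, ← map_mul, Units.inv_mul_cancel_right]

theorem s₁₂_apply : s₁₂ (t₁₂ u * θ) = t₁₂ (f u * ↑u⁻¹) * (t₁₂ u * θ) := by
  rw [map_mul s₁₂, h.s₁₂_t₁₂, h.s₁₂_θ, map_mul_cancel]

theorem s₂₃_apply : s₂₃ (t₁₂ u * θ) = t₂₃ (f u * ↑u⁻¹) * (t₁₂ u * θ) := by
  rw [h.cocycle, map_mul s₂₃, h.s₂₃_t₂₃, h.s₂₃_θ', map_mul_cancel]

/-- Put R = f(u)u⁻¹ and let Φ be the common value of the two sides of the cocycle identity. From its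
two expressions, s₁₂Φ = R₁₂Φ and s₂₃Φ = R₂₃Φ. The image l(R)Φ is s₂₃s₁₂Φ = s₂₃(R₁₂Φ) = R₁₃R₂₃Φ, and
the unit Φ is cancelled. -/
theorem map_left : l (f u * ↑u⁻¹) = t₁₃ (f u * ↑u⁻¹) * t₂₃ (f u * ↑u⁻¹) := by
  refine h.isUnit.mul_right_cancel ?_
  have e : l (f u * ↑u⁻¹) * (t₁₂ u * θ) = s₂₃ (s₁₂ (t₁₂ u * θ)) := by
    rw [← h.left, map_mul_cancel, h.left, h.cocycle, ← h.right, map_mul s₁₂, map_mul s₂₃,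
      ← h.left_flip, h.s₁₂_t₂₃, h.s₂₃_t₁₃]
  rw [e, h.s₁₂_apply, map_mul s₂₃, h.s₂₃_t₁₂, h.s₂₃_apply, mul_assoc]

theorem map_right : r (f u * ↑u⁻¹) = t₁₃ (f u * ↑u⁻¹) * t₁₂ (f u * ↑u⁻¹) := by
  refine h.isUnit.mul_right_cancel ?_
  have e : r (f u * ↑u⁻¹) * (t₁₂ u * θ) = s₁₂ (s₂₃ (t₁₂ u * θ)) := by
    rw [h.cocycle, ← h.right, map_mul_cancel, h.right, ← h.cocycle, ← h.left, map_mul s₂₃,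
      map_mul s₁₂, ← h.right_flip, h.s₂₃_t₁₂, h.s₁₂_t₁₃]
  rw [e, h.s₂₃_apply, map_mul s₁₂, h.s₁₂_t₂₃, h.s₁₂_apply, mul_assoc]

end HexagonData

end GenericTriangular

section GenericLegs

variable {k : Type*} [Field k] {A : Type*} [Ring A] [Algebra k⟦X⟧ A]
  {𝒜 : ZMod 2 → Submodule k⟦X⟧ A} [GradedAlgebra 𝒜]

theorem square_hom_apply {𝒟 : Type*} [Ring 𝒟] [Algebra k⟦X⟧ 𝒟] [HAdic k 𝒟]
    {f g : Compl (hbar k) (T2 𝒜) →ₐ[k⟦X⟧] 𝒟} (hl : ∀ a, f (inl 𝒜 a) = g (inl 𝒜 a))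
    (hr : ∀ a, f (inr 𝒜 a) = g (inr 𝒜 a)) (z : Compl (hbar k) (T2 𝒜)) : f z = g z := by
  rw [square_hom_ext (f := f) (g := g) (AlgHom.ext hl) (AlgHom.ext hr)]

theorem flip₂_flip₂ (z : Compl (hbar k) (T2 𝒜)) : flip₂ 𝒜 (flip₂ 𝒜 z) = z :=
  square_hom_apply (f := (flip₂ 𝒜).comp (flip₂ 𝒜)) (g := AlgHom.id k⟦X⟧ _)
    (fun a => by rw [AlgHom.comp_apply, flip₂_inl, flip₂_inr, AlgHom.id_apply])
    (fun a => by rw [AlgHom.comp_apply, flip₂_inr, flip₂_inl, AlgHom.id_apply]) z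

theorem sw₁₂_to₁₂ (z : Compl (hbar k) (T2 𝒜)) : sw₁₂ 𝒜 (to₁₂ 𝒜 z) = to₁₂ 𝒜 (flip₂ 𝒜 z) :=
  square_hom_apply (f := (sw₁₂ 𝒜).comp (to₁₂ 𝒜)) (g := (to₁₂ 𝒜).comp (flip₂ 𝒜))
    (fun a => by rw [AlgHom.comp_apply, AlgHom.comp_apply, to₁₂_inl, sw₁₂_in₁, flip₂_inl, to₁₂_inr])
    (fun a => by rw [AlgHom.comp_apply, AlgHom.comp_apply, to₁₂_inr, sw₁₂_in₂, flip₂_inr, to₁₂_inl])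
    z

theorem sw₂₃_to₂₃ (z : Compl (hbar k) (T2 𝒜)) : sw₂₃ 𝒜 (to₂₃ 𝒜 z) = to₂₃ 𝒜 (flip₂ 𝒜 z) :=
  square_hom_apply (f := (sw₂₃ 𝒜).comp (to₂₃ 𝒜)) (g := (to₂₃ 𝒜).comp (flip₂ 𝒜))
    (fun a => by rw [AlgHom.comp_apply, AlgHom.comp_apply, to₂₃_inl, sw₂₃_in₂, flip₂_inl, to₂₃_inr])
    (fun a => by rw [AlgHom.comp_apply, AlgHom.comp_apply, to₂₃_inr, sw₂₃_in₃, flip₂_inr, to₂₃_inl])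
    z

theorem sw₂₃_to₁₂ (z : Compl (hbar k) (T2 𝒜)) : sw₂₃ 𝒜 (to₁₂ 𝒜 z) = to₁₃ 𝒜 z :=
  square_hom_apply (f := (sw₂₃ 𝒜).comp (to₁₂ 𝒜)) (g := to₁₃ 𝒜)
    (fun a => by rw [AlgHom.comp_apply, to₁₂_inl, sw₂₃_in₁, to₁₃_inl])
    (fun a => by rw [AlgHom.comp_apply, to₁₂_inr, sw₂₃_in₂, to₁₃_inr]) z

theorem sw₁₂_to₂₃ (z : Compl (hbar k) (T2 𝒜)) : sw₁₂ 𝒜 (to₂₃ 𝒜 z) = to₁₃ 𝒜 z :=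
  square_hom_apply (f := (sw₁₂ 𝒜).comp (to₂₃ 𝒜)) (g := to₁₃ 𝒜)
    (fun a => by rw [AlgHom.comp_apply, to₂₃_inl, sw₁₂_in₂, to₁₃_inl])
    (fun a => by rw [AlgHom.comp_apply, to₂₃_inr, sw₁₂_in₃, to₁₃_inr]) z

theorem sw₂₃_to₁₃ (z : Compl (hbar k) (T2 𝒜)) : sw₂₃ 𝒜 (to₁₃ 𝒜 z) = to₁₂ 𝒜 z :=
  square_hom_apply (f := (sw₂₃ 𝒜).comp (to₁₃ 𝒜)) (g := to₁₂ 𝒜)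
    (fun a => by rw [AlgHom.comp_apply, to₁₃_inl, sw₂₃_in₁, to₁₂_inl])
    (fun a => by rw [AlgHom.comp_apply, to₁₃_inr, sw₂₃_in₃, to₁₂_inr]) z

theorem sw₁₂_to₁₃ (z : Compl (hbar k) (T2 𝒜)) : sw₁₂ 𝒜 (to₁₃ 𝒜 z) = to₂₃ 𝒜 z :=
  square_hom_apply (f := (sw₁₂ 𝒜).comp (to₁₃ 𝒜)) (g := to₂₃ 𝒜)
    (fun a => by rw [AlgHom.comp_apply, to₁₃_inl, sw₁₂_in₁, to₂₃_inl])
    (fun a => by rw [AlgHom.comp_apply, to₁₃_inr, sw₁₂_in₃, to₂₃_inr]) z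

variable {D : A →ₐ[k⟦X⟧] Compl (hbar k) (T2 𝒜)} (hD : ∀ i, ∀ a ∈ 𝒜 i, IsHomog i (D a))

theorem leftHom_flip₂ (z : Compl (hbar k) (T2 𝒜)) :
    leftHom hD (flip₂ 𝒜 z) = sw₂₃ 𝒜 (sw₁₂ 𝒜 (rightHom hD z)) :=
  square_hom_apply (f := (leftHom hD).comp (flip₂ 𝒜))
    (g := ((sw₂₃ 𝒜).comp (sw₁₂ 𝒜)).comp (rightHom hD))
    (fun a => by
      rw [AlgHom.comp_apply, AlgHom.comp_apply, AlgHom.comp_apply, flip₂_inl, leftHom_inr,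
        rightHom_inl, sw₁₂_in₁, sw₂₃_in₂])
    (fun a => by
      rw [AlgHom.comp_apply, AlgHom.comp_apply, AlgHom.comp_apply, flip₂_inr, leftHom_inl,
        rightHom_inr, sw₁₂_to₂₃, sw₂₃_to₁₃]) z

theorem rightHom_flip₂ (z : Compl (hbar k) (T2 𝒜)) :
    rightHom hD (flip₂ 𝒜 z) = sw₁₂ 𝒜 (sw₂₃ 𝒜 (leftHom hD z)) :=
  square_hom_apply (f := (rightHom hD).comp (flip₂ 𝒜))
    (g := ((sw₁₂ 𝒜).comp (sw₂₃ 𝒜)).comp (leftHom hD))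
    (fun a => by
      rw [AlgHom.comp_apply, AlgHom.comp_apply, AlgHom.comp_apply, flip₂_inl, rightHom_inr,
        leftHom_inl, sw₂₃_to₁₂, sw₁₂_to₁₃])
    (fun a => by
      rw [AlgHom.comp_apply, AlgHom.comp_apply, AlgHom.comp_apply, flip₂_inr, rightHom_inl,
        leftHom_inr, sw₂₃_in₃, sw₁₂_in₂]) z

/-- An even element of the tensor square commutes with the remaining tensor factor. -/
theorem IsHomog.to₁₂_comm {z : Compl (hbar k) (T2 𝒜)} (hz : IsHomog 0 z) (b : A) :
    to₁₂ 𝒜 z * in₃ 𝒜 b = in₃ 𝒜 b * to₁₂ 𝒜 z := by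
  refine eq_of_homogeneous (𝒜 := 𝒜) (f := LinearMap.mulLeft k⟦X⟧ (to₁₂ 𝒜 z) ∘ₗ (in₃ 𝒜).toLinearMap)
    (g := LinearMap.mulRight k⟦X⟧ (to₁₂ 𝒜 z) ∘ₗ (in₃ 𝒜).toLinearMap) (fun j b hb => ?_) b
  have := hz.to₁₂_mul_in₃ hb
  rw [mul_zero, uzpow_zero, one_smul] at this
  exact this

theorem IsHomog.to₂₃_comm {z : Compl (hbar k) (T2 𝒜)} (hz : IsHomog 0 z) (a : A) :
    to₂₃ 𝒜 z * in₁ 𝒜 a = in₁ 𝒜 a * to₂₃ 𝒜 z := by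
  refine eq_of_homogeneous (𝒜 := 𝒜) (f := LinearMap.mulLeft k⟦X⟧ (to₂₃ 𝒜 z) ∘ₗ (in₁ 𝒜).toLinearMap)
    (g := LinearMap.mulRight k⟦X⟧ (to₂₃ 𝒜 z) ∘ₗ (in₁ 𝒜).toLinearMap) (fun j a ha => ?_) a
  have := hz.in₁_mul_to₂₃ ha
  rw [zero_mul, uzpow_zero, one_smul] at this
  exact this.symm

end GenericLegs

section TwistConj

variable {k : Type*} [Field k] [CharZero k] {𝒞 : Type*} [Ring 𝒞] [Algebra k⟦X⟧ 𝒞] [HAdic k 𝒞]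

theorem twist_neg (v₁ W₁ v₂ : 𝒞) : twist k (-v₁) (-W₁) (-v₂) = twist k v₁ W₁ v₂ := by
  rw [twist, twist, oddTwist, oddTwist, IsClassicalPair.g_neg, IsClassicalPair.g_neg,
    IsClassicalPair.X_neg, cartan, cartan, neg_mul_neg, neg_mul_neg, neg_mul_neg]

/-- The twist is natural under algebra homomorphisms, in particular under conjugation by x. -/
theorem twist_mul_of_semiconj {x v₁ W₁ v₂ v₁' W₁' v₂' : 𝒞} (hx : IsUnit x) (h1 : v₁' * x = x * v₁)
    (h2 : W₁' * x = x * W₁) (h3 : v₂' * x = x * v₂) :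
    twist k v₁' W₁' v₂' * x = x * twist k v₁ W₁ v₂ := by
  obtain ⟨u, rfl⟩ := hx
  have := map_twist (k := k) (conjHom k⟦X⟧ u) v₁ W₁ v₂
  rw [conjHom_eq (R := k⟦X⟧) h1.symm, conjHom_eq (R := k⟦X⟧) h2.symm,
    conjHom_eq (R := k⟦X⟧) h3.symm] at this
  rw [← this, conjHom_mul]

end TwistConj

end SuperJordanian

end

noncomputable section

namespace SuperJordanian


open PowerSeries (C coeff)
open scoped Nat

namespace Uh

/-! ### The R-matrix of the quantum superalgebra -/

section RMatrix

variable (k : Type*) [Field k] [CharZero k]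

local notation "ι₁" => inl (grading k)
local notation "ι₂" => inr (grading k)

theorem comul₀_clv : comul₀ k (clv k) = ι₁ (clv k) + ι₂ (clv k) := lift_clv _
theorem comul₀_clW : comul₀ k (clW k) = ι₁ (clW k) + ι₂ (clW k) := lift_clW _

theorem flip₂_comul₀ (a : Uh k) : flip₂ (grading k) (comul₀ k a) = comul₀ k a := by
  have : (flip₂ (grading k)).comp (comul₀ k) = comul₀ k := hom_ext_classical
    (by rw [AlgHom.comp_apply, comul₀_clv, map_add, flip₂_inl, flip₂_inr, add_comm])
    (by rw [AlgHom.comp_apply, comul₀_clW, map_add, flip₂_inl, flip₂_inr, add_comm])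
  rw [← AlgHom.comp_apply, this]

theorem twistUnit_even : IsHomog 0 (twistUnit k : Compl (hbar k) (T2 (grading k))) := by
  refine isHomog_of_squareParity (parity_of_mem (k := k)) ?_
  rw [uzpow_zero, one_smul, twistUnit_val, map_twist, squareParity_inl, squareParity_inl,
    squareParity_inr, parity_clv, parity_clW, map_neg, map_neg, map_neg, twist_neg]

/-- The flipped twist. -/
def twistUnitOp : (Compl (hbar k) (T2 (grading k)))ˣ :=
  Units.map (flip₂ (grading k) : Compl (hbar k) (T2 (grading k)) →* _) (twistUnit k)

theorem twistUnitOp_val : (twistUnitOp k : Compl (hbar k) (T2 (grading k))) =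
    flip₂ (grading k) (twistUnit k) := rfl

/-- The universal `R`-matrix. -/
def rUnit : (Compl (hbar k) (T2 (grading k)))ˣ := twistUnitOp k * (twistUnit k)⁻¹

theorem flip₂_comul_mul (a : Uh k) : flip₂ (grading k) (comul k a) * twistUnitOp k =
    twistUnitOp k * comul₀ k a := by
  rw [twistUnitOp_val, ← map_mul, comul_mul_twist, map_mul, flip₂_comul₀]

theorem rUnit_intertwines (a : Uh k) : rUnit k * comul k a =
    flip₂ (grading k) (comul k a) * rUnit k :=
  intertwine_of_twist (comul_mul_twist k a) (flip₂_comul_mul k a)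

theorem flip₂_rUnit_mul : flip₂ (grading k) (rUnit k) * rUnit k = 1 := by
  have : Units.map (flip₂ (grading k) : Compl (hbar k) (T2 (grading k)) →* _) (twistUnitOp k) =
      twistUnit k := Units.ext (flip₂_flip₂ _)
  have e : Units.map (flip₂ (grading k) : Compl (hbar k) (T2 (grading k)) →* _) (rUnit k) *
      rUnit k = 1 := by
    rw [rUnit, map_mul, map_inv, this, ← twistUnitOp]
    group
  exact congrArg Units.val e

theorem rUnit_even : IsHomog 0 (rUnit k : Compl (hbar k) (T2 (grading k))) := by
  refine isHomog_of_squareParity (parity_of_mem (k := k)) ?_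
  have e1 : squareParity (parity_of_mem (k := k)) (twistUnit k) = twistUnit k := by
    rw [twistUnit_val, map_twist, squareParity_inl, squareParity_inl, squareParity_inr, parity_clv,
      parity_clW, map_neg, map_neg, map_neg, twist_neg]
  have e2 : squareParity (parity_of_mem (k := k)) (twistUnitOp k) = twistUnitOp k := by
    rw [twistUnitOp_val, twistUnit_val, map_twist, map_twist, flip₂_inl, flip₂_inl, flip₂_inr,
      squareParity_inl, squareParity_inr, squareParity_inr, parity_clv, parity_clW, map_neg, map_neg,
      map_neg, twist_neg]
  have e3 : rUnit k * twistUnit k = twistUnitOp k := inv_mul_cancel_right _ _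
  rw [uzpow_zero, one_smul]
  refine (twistUnit k).isUnit.mul_right_cancel ?_
  rw [← e1, ← map_mul, ← Units.val_mul, e3, e2, e1, ← e3, Units.val_mul]

/-- The twist with values in the sum of the first two factors and the third one. -/
def twist₁₂₃ : Compl (hbar k) (T3 (grading k)) :=
  twist k (in₁ (grading k) (clv k) + in₂ (grading k) (clv k))
    (in₁ (grading k) (clW k) + in₂ (grading k) (clW k)) (in₃ (grading k) (clv k))

/-- The twist with values in the first factor and the sum of the last two. -/
def twist₁₂₃' : Compl (hbar k) (T3 (grading k)) :=
  twist k (in₁ (grading k) (clv k)) (in₁ (grading k) (clW k))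
    (in₂ (grading k) (clv k) + in₃ (grading k) (clv k))

theorem to₁₂_comul_mul (a : Uh k) : to₁₂ (grading k) (comul k a) * to₁₂ (grading k) (twistUnit k) =
    to₁₂ (grading k) (twistUnit k) * to₁₂ (grading k) (comul₀ k a) := by
  rw [← map_mul, comul_mul_twist, map_mul]

theorem to₂₃_comul_mul (a : Uh k) : to₂₃ (grading k) (comul k a) * to₂₃ (grading k) (twistUnit k) =
    to₂₃ (grading k) (twistUnit k) * to₂₃ (grading k) (comul₀ k a) := by
  rw [← map_mul, comul_mul_twist, map_mul]

theorem leftHom_twist : leftHom (comul_even k) (twistUnit k) =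
    twist k (to₁₂ (grading k) (comul k (clv k))) (to₁₂ (grading k) (comul k (clW k)))
      (in₃ (grading k) (clv k)) := by
  rw [twistUnit_val, map_twist, leftHom_inl, leftHom_inl, leftHom_inr]

theorem rightHom_twist : rightHom (comul_even k) (twistUnit k) =
    twist k (in₁ (grading k) (clv k)) (in₁ (grading k) (clW k))
      (to₂₃ (grading k) (comul k (clv k))) := by
  rw [twistUnit_val, map_twist, rightHom_inl, rightHom_inl, rightHom_inr]

/-- Conjugation by F₁₂ takes Δ₀ ⊗ id to Δ ⊗ id on the first two legs and fixes the third leg,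
because F is even. -/
theorem leftHom_twist_mul : leftHom (comul_even k) (twistUnit k) * to₁₂ (grading k) (twistUnit k) =
    to₁₂ (grading k) (twistUnit k) * twist₁₂₃ k := by
  have e1 := to₁₂_comul_mul k (clv k)
  have e2 := to₁₂_comul_mul k (clW k)
  rw [comul₀_clv, map_add, to₁₂_inl, to₁₂_inr] at e1
  rw [comul₀_clW, map_add, to₁₂_inl, to₁₂_inr] at e2
  rw [leftHom_twist]
  exact twist_mul_of_semiconj (k := k)
    ((twistUnit k).isUnit.map (to₁₂ (grading k)))
    e1 e2 ((twistUnit_even k).to₁₂_comm (clv k)).symm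

theorem rightHom_twist_mul : rightHom (comul_even k) (twistUnit k) *
    to₂₃ (grading k) (twistUnit k) = to₂₃ (grading k) (twistUnit k) * twist₁₂₃' k := by
  have e1 := to₂₃_comul_mul k (clv k)
  rw [comul₀_clv, map_add, to₂₃_inl, to₂₃_inr] at e1
  rw [rightHom_twist]
  exact twist_mul_of_semiconj (k := k)
    ((twistUnit k).isUnit.map (to₂₃ (grading k)))
    ((twistUnit_even k).to₂₃_comm (clv k)).symm ((twistUnit_even k).to₂₃_comm (clW k)).symm e1

theorem to₁₂_mul_eq_to₂₃_mul : to₁₂ (grading k) (twistUnit k) * twist₁₂₃ k =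
    to₂₃ (grading k) (twistUnit k) * twist₁₂₃' k := by
  have := twist_cocycle (superCommute_in₁_in₂ (grading k)).isSuperPair
    (superCommute_in₁_in₃ (grading k)).isSuperPair (superCommute_in₂_in₃ (grading k)).isSuperPair
  rw [twistUnit_val, map_twist, map_twist, to₁₂_inl, to₁₂_inl, to₁₂_inr, to₂₃_inl, to₂₃_inl,
    to₂₃_inr]
  exact this

theorem sw₁₂_twist : sw₁₂ (grading k) (twist₁₂₃ k) = twist₁₂₃ k := by
  rw [twist₁₂₃, map_twist, map_add, map_add, sw₁₂_in₁, sw₁₂_in₁, sw₁₂_in₂, sw₁₂_in₂, sw₁₂_in₃,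
    add_comm, add_comm (in₂ (grading k) (clW k))]

theorem sw₂₃_twist : sw₂₃ (grading k) (twist₁₂₃' k) = twist₁₂₃' k := by
  rw [twist₁₂₃', map_twist, map_add, sw₂₃_in₁, sw₂₃_in₁, sw₂₃_in₂, sw₂₃_in₃, add_comm]

theorem hexagonData : HexagonData (leftHom (comul_even k)) (rightHom (comul_even k))
    (to₁₂ (grading k)) (to₁₃ (grading k)) (to₂₃ (grading k)) (flip₂ (grading k))
    (sw₁₂ (grading k)) (sw₂₃ (grading k)) (twistUnit k) (twist₁₂₃ k) (twist₁₂₃' k) where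
  left := leftHom_twist_mul k
  right := rightHom_twist_mul k
  cocycle := to₁₂_mul_eq_to₂₃_mul k
  s₁₂_θ := sw₁₂_twist k
  s₂₃_θ' := sw₂₃_twist k
  s₁₂_t₁₂ := sw₁₂_to₁₂
  s₂₃_t₂₃ := sw₂₃_to₂₃
  s₂₃_t₁₂ := sw₂₃_to₁₂
  s₁₂_t₂₃ := sw₁₂_to₂₃
  s₂₃_t₁₃ := sw₂₃_to₁₃
  s₁₂_t₁₃ := sw₁₂_to₁₃
  left_flip := leftHom_flip₂ _
  right_flip := rightHom_flip₂ _

theorem comulOp_eq (a : Uh k) : (hopf k).comulOp a = flip₂ (grading k) (comul k a) :=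
  map_superFlip (grading k) (comul k a)

theorem isTriangular : (hopf k).IsTriangular (rUnit k : Compl (hbar k) (T2 (grading k))) where
  even := rUnit_even k
  isUnit := (rUnit k).isUnit
  intertwines a := by
    rw [comulOp_eq]
    exact rUnit_intertwines k a
  comul_left := by
    rw [map_leg13, map_leg23]
    exact (applyLeft_eq (comul_even k) _).trans (hexagonData k).map_left
  comul_right := by
    rw [map_leg13, map_leg12]
    exact (applyRight_eq (comul_even k) _).trans (hexagonData k).map_right
  unitary := by
    rw [map_superFlip]
    exact flip₂_rUnit_mul k

end RMatrix

end Uh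

end SuperJordanian

end

noncomputable section

namespace SuperJordanian


open PowerSeries (C coeff)
open scoped Nat

/-! ### The classical limit -/

section SecondOrder

variable {k : Type*} [Field k] [CharZero k] {𝒞 : Type*} [Ring 𝒞] [Algebra k⟦X⟧ 𝒞] [HAdic k 𝒞]

theorem twist_eq_one_add (v₁ W₁ v₂ : 𝒞) : ∃ y : 𝒞, twist k v₁ W₁ v₂ = 1 + hbar k •
    ((C (1 / 2) : k⟦X⟧) • (cartan v₁ W₁ * IsClassicalPair.X k v₂) -
      (8 : k⟦X⟧) • (IsClassicalPair.g k v₁ * IsClassicalPair.g k v₂) + hbar k • y) := by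
  obtain ⟨z, hz⟩ := expH_eq_one_add (k := k)
    ((C (1 / 2) : k⟦X⟧) • (cartan v₁ W₁ * IsClassicalPair.X k v₂))
  rw [twist, oddTwist, evenTwist, hz]
  refine ⟨z - (8 : k⟦X⟧) • (IsClassicalPair.g k v₁ * IsClassicalPair.g k v₂ *
    ((C (1 / 2) : k⟦X⟧) • (cartan v₁ W₁ * IsClassicalPair.X k v₂))) - ((8 : k⟦X⟧) * hbar k) •
    (IsClassicalPair.g k v₁ * IsClassicalPair.g k v₂ * z), ?_⟩
  simp only [sub_mul, mul_add, one_mul, mul_one, smul_mul_assoc, mul_smul_comm]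
  module

theorem exists_coproduct_odd {B : Type*} [Ring B] [Algebra k⟦X⟧ B] (f e : B →ₐ[k⟦X⟧] 𝒞)
    {a t t' y y' : B} (ht : t = 1 + hbar k • y) (ht' : t' = 1 + hbar k • y') :
    f a * e t' + f t * e a = f a * e 1 + f 1 * e a + hbar k • (f a * e y' + f y * e a) := by
  rw [ht, ht']
  simp only [map_add, map_one, map_smul, mul_add, add_mul, one_mul, mul_one, smul_mul_assoc,
    mul_smul_comm]
  module

end SecondOrder

/-! ### Reduction modulo h of the tensor square -/

section Reduction

open GradedTensorProduct (includeLeft includeRight)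

variable (k : Type*) [Field k] [CharZero k]

/-- k⟦h⟧ acts through its residue field, so that reduction modulo h becomes a homomorphism of
k⟦h⟧-algebras. -/
instance : Algebra k⟦X⟧ (T2 (U0.grading k)) :=
  Algebra.compHom _ (PowerSeries.constantCoeff (R := k))

namespace Uh

theorem reduction_algebraMap (c : k⟦X⟧) : reduction k (algebraMap k⟦X⟧ (Uh k) c) =
    algebraMap k (U0 k) (PowerSeries.constantCoeff c) := by
  rw [Algebra.algebraMap_eq_smul_one, reduction_smul, map_one, Algebra.algebraMap_eq_smul_one]

theorem parity_reduction (u : Uh k) : U0.parity k (reduction k u) = reduction k (parity k u) := by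
  obtain ⟨x, rfl⟩ := mk_surjective k u
  rw [parity_mk, reduction_mk, reduction_mk, U0.parity_mk]
  rfl

theorem reduction_mem (i : ZMod 2) (u : Uh k) (hu : u ∈ grading k i) :
    reduction k u ∈ U0.grading k i := by
  change U0.parity k (reduction k u) = (-1 : ℤˣ) ^ i • reduction k u
  rw [parity_reduction, parity_of_mem i u hu, Units.smul_def, map_zsmul, Units.smul_def]

/-- `a ↦ ā ⊗ 1`. -/
def redLeft : Uh k →ₐ[k⟦X⟧] T2 (U0.grading k) where
  __ := (includeLeft (U0.grading k) (U0.grading k) : U0 k →+* _).comp (reduction k)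
  commutes' c := (congrArg (includeLeft (U0.grading k) (U0.grading k))
    (reduction_algebraMap k c)).trans (AlgHom.commutes _ _)

/-- `a ↦ 1 ⊗ ā`. -/
def redRight : Uh k →ₐ[k⟦X⟧] T2 (U0.grading k) where
  __ := (includeRight (U0.grading k) (U0.grading k) : U0 k →+* _).comp (reduction k)
  commutes' c := (congrArg (includeRight (U0.grading k) (U0.grading k))
    (reduction_algebraMap k c)).trans (AlgHom.commutes _ _)

theorem superCommute_red : SuperCommute (grading k) (grading k) (redLeft k) (redRight k) :=
  fun i j a b => SuperCommute.inclusions (U0.grading k) (U0.grading k)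
    ⟨_, reduction_mem k i a a.2⟩ ⟨_, reduction_mem k j b b.2⟩

theorem reductionTensor_eq (z : T2 (grading k)) :
    reductionTensor k z = (superCommute_red k).lift z := by
  induction z using tensor_induction with
  | h0 => rw [map_zero, map_zero]
  | ha x y hx hy => rw [map_add, map_add, hx, hy]
  | ht a b =>
    rw [SuperCommute.lift_tmul]
    exact tmul_eq (U0.grading k) (reduction k a) (reduction k b)

theorem reduction₂_of (z : T2 (grading k)) :
    reduction₂ k (Compl.of (hbar k) z) = (superCommute_red k).lift z :=
  reductionTensor_eq k z

theorem reduction₂_hbar (z : Compl (hbar k) (T2 (grading k))) : reduction₂ k (hbar k • z) = 0 := by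
  rw [LinearMap.map_smulₛₗ, PowerSeries.constantCoeff_X, zero_smul]

theorem exists_reduction₂ (z : Compl (hbar k) (T2 (grading k))) :
    ∃ b y, z = Compl.of (hbar k) b + hbar k • y ∧
      reduction₂ k z = (superCommute_red k).lift b := by
  obtain ⟨b, y, rfl⟩ := Compl.exists_of z 1
  refine ⟨b, y, by rw [pow_one], ?_⟩
  rw [map_add, pow_one, reduction₂_hbar, add_zero, reduction₂_of]

/-- Modulo h every element comes from the uncompleted square, where reduction is the homomorphism
lifted from the two legs. -/
theorem reduction₂_mul (z w : Compl (hbar k) (T2 (grading k))) :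
    reduction₂ k (z * w) = reduction₂ k z * reduction₂ k w := by
  obtain ⟨b, y, hz, ez⟩ := exists_reduction₂ k z
  obtain ⟨c, x, hw, ew⟩ := exists_reduction₂ k w
  have : z * w = Compl.of (hbar k) (b * c) +
      hbar k • (Compl.of (hbar k) b * x + y * w) := by
    rw [smul_add, ← mul_smul_comm, ← smul_mul_assoc, map_mul, ← add_assoc, ← mul_add, ← hw,
      ← add_mul, ← hz]
  rw [this, map_add, reduction₂_hbar, add_zero, reduction₂_of, map_mul, ez, ew]

theorem reduction₂_one : reduction₂ k 1 = 1 := by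
  rw [← map_one (Compl.of (hbar k)), reduction₂_of, map_one]

theorem reduction₂_inl (a : Uh k) : reduction₂ k (inl (grading k) a) =
    includeLeft (U0.grading k) (U0.grading k) (reduction k a) :=
  (reduction₂_of k _).trans ((superCommute_red k).lift_includeLeft a)

theorem reduction₂_inr (a : Uh k) : reduction₂ k (inr (grading k) a) =
    includeRight (U0.grading k) (U0.grading k) (reduction k a) :=
  (reduction₂_of k _).trans ((superCommute_red k).lift_includeRight a)

theorem reduction₂_ofNat_smul (m : ℕ) [m.AtLeastTwo] (z : Compl (hbar k) (T2 (grading k))) :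
    reduction₂ k ((OfNat.ofNat m : k⟦X⟧) • z) = (OfNat.ofNat m : k) • reduction₂ k z := by
  rw [LinearMap.map_smulₛₗ, map_ofNat]

theorem reduction₂_C_smul (c : k) (z : Compl (hbar k) (T2 (grading k))) :
    reduction₂ k ((C c : k⟦X⟧) • z) = c • reduction₂ k z := by
  rw [LinearMap.map_smulₛₗ, PowerSeries.constantCoeff_C]

theorem reduction_g : reduction k (IsClassicalPair.g k (clv k)) =
    (1 / 2 : k) • U0.gen k .Vp := by
  have h := congrArg (reduction k) (IsClassicalPair.g_eq (k := k) (clv k))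
  obtain ⟨y, hy⟩ := IsClassicalPair.T_eq_one_add (k := k) 1 (clv k)
  rw [map_add, map_mul, hy, map_add, map_one, reduction_smul, PowerSeries.constantCoeff_X, zero_smul,
    add_zero, mul_one, reduction_clv, ← two_smul k] at h
  rw [← h, smul_smul]
  norm_num

theorem reduction_cartan : reduction k (cartan (clv k) (clW k)) = (4 : k) • U0.gen k .H := by
  have h : U0.gen k .Vp * U0.gen k .Vm + U0.gen k .Vm * U0.gen k .Vp =
      -(1 / 2 : k) • U0.gen k .H := by
    have := U0.mk_rel (k := k) ClassicalRel.vp_vm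
    simp only [map_add, map_mul, map_smul] at this
    exact this
  rw [cartan, map_neg, map_add, map_mul, map_mul, reduction_clv, reduction_clW, mul_smul_comm,
    smul_mul_assoc, ← smul_add, h]
  module

theorem exists_Tpow (c : k) : ∃ y, Tpow k c = 1 + hbar k • y ∧
    reduction k y = c • U0.gen k .X := by
  obtain ⟨y, hy⟩ := expH_eq_one_add (k := k) ((C c : k⟦X⟧) • X k)
  refine ⟨(C c : k⟦X⟧) • X k + hbar k • y, ?_, ?_⟩
  · rw [Tpow_eq, hy]
    module
  · rw [map_add, reduction_smul, reduction_smul, PowerSeries.constantCoeff_X, zero_smul, add_zero,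
      PowerSeries.constantCoeff_C, X, reduction_gen]

end Uh

end Reduction

end SuperJordanian

end

noncomputable section

namespace SuperJordanian


open PowerSeries (C coeff)
open scoped Nat

/-! ### The classical bialgebra -/

section GenericClassical

variable {K A E : Type*} [Field K] [Ring A] [Algebra K A] [Ring E] [Algebra K E]
  {𝒜 : ZMod 2 → Submodule K A} {f e : A →ₐ[K] E}

/-- The tensor `J ⊗ P - P ⊗ J - 2 v ⊗ v`. -/
def classicalR (f e : A →ₐ[K] E) (J P v : A) : E :=
  f J * e P - f P * e J - (2 : K) • (f v * e v)

variable (s : SuperCommute 𝒜 𝒜 f e)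
include s

theorem SuperCommute.comm_of_even_right {a b : A} {i : ZMod 2} (ha : a ∈ 𝒜 i) (hb : b ∈ 𝒜 0) :
    e b * f a = f a * e b := by
  have := s.symm ⟨b, hb⟩ ⟨a, ha⟩
  rwa [mul_zero, uzpow_zero, one_smul] at this

theorem SuperCommute.comm_of_even_left {a b : A} {i : ZMod 2} (ha : a ∈ 𝒜 0) (hb : b ∈ 𝒜 i) :
    e b * f a = f a * e b := by
  have := s.symm ⟨b, hb⟩ ⟨a, ha⟩
  rwa [zero_mul, uzpow_zero, one_smul] at this

theorem SuperCommute.anticomm_of_odd {a b : A} (ha : a ∈ 𝒜 1) (hb : b ∈ 𝒜 1) :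
    e b * f a = -(f a * e b) := by
  have := s.symm ⟨b, hb⟩ ⟨a, ha⟩
  rwa [mul_one, uzpow_one, Units.neg_smul, one_smul] at this

variable {J P v x a b c : A} (hJ : J ∈ 𝒜 0) (hP : P ∈ 𝒜 0) (hv : v ∈ 𝒜 1)
include hJ hP hv

/-- The Leibniz rule leg by leg, with a, b, c the brackets of J, P, v with x. -/
theorem classicalR_bracket_even (hx : x ∈ 𝒜 0) (ha : J * x = x * J + a) (hb : P * x = x * P + b)
    (hc : v * x = x * v + c) : classicalR f e J P v * (f x + e x) - (f x + e x) * classicalR f e J P v =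
    f a * e P + f J * e b - f b * e J - f P * e a - (2 : K) • (f c * e v) -
      (2 : K) • (f v * e c) := by
  have e1 := s.comm_of_even_left hx hP
  have e2 := s.comm_of_even_left hx hJ
  have e3 := s.comm_of_even_left hx hv
  have e4 := s.comm_of_even_right hP hx
  have e5 := s.comm_of_even_right hJ hx
  have e6 := s.comm_of_even_right hv hx
  obtain rfl := eq_sub_of_add_eq' ha.symm
  obtain rfl := eq_sub_of_add_eq' hb.symm
  obtain rfl := eq_sub_of_add_eq' hc.symm
  simp only [classicalR, map_sub, map_mul, mul_add, add_mul, mul_sub, sub_mul, smul_mul_assoc,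
    mul_smul_comm, mul_assoc, e1, e2, e3, assoc_of_eq e4, assoc_of_eq e5, assoc_of_eq e6]
  module

theorem classicalR_bracket_odd (hx : x ∈ 𝒜 1) (ha : J * x = x * J + a) (hb : P * x = x * P + b)
    (hc : v * x + x * v = c) :
    classicalR f e J P v * (f x + e x) - (f x + e x) * classicalR f e J P v =
    f a * e P + f J * e b - f b * e J - f P * e a + (2 : K) • (f c * e v) -
      (2 : K) • (f v * e c) := by
  have e1 := s.comm_of_even_right hx hP
  have e2 := s.comm_of_even_right hx hJ
  have e3 := s.anticomm_of_odd hx hv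
  have e4 := s.comm_of_even_left hP hx
  have e5 := s.comm_of_even_left hJ hx
  have e6 := s.anticomm_of_odd hv hx
  obtain rfl := eq_sub_of_add_eq' ha.symm
  obtain rfl := eq_sub_of_add_eq' hb.symm
  subst hc
  simp only [classicalR, map_add, map_sub, map_mul, mul_add, add_mul, mul_sub, sub_mul, smul_mul_assoc,
    mul_smul_comm, mul_assoc, e1, e2, e3, assoc_of_eq e4, assoc_of_eq e5, assoc_of_eq e6, mul_neg,
    neg_mul]
  module

end GenericClassical

section GenericCYBE

variable {K A E : Type*} [Field K] [CharZero K] [Ring A] [Algebra K A] [Ring E] [Algebra K E]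
  {𝒜 : ZMod 2 → Submodule K A} {f₁ f₂ f₃ : A →ₐ[K] E} {J P v : A}

/-- Only the relations of the Borel part spanned by J₀, J₊, v₊ enter. Factors are sorted by leg,
with signs for the odd ones, and then ordered inside each leg. -/
theorem classicalR_cybe (s₁₂ : SuperCommute 𝒜 𝒜 f₁ f₂) (s₁₃ : SuperCommute 𝒜 𝒜 f₁ f₃)
    (s₂₃ : SuperCommute 𝒜 𝒜 f₂ f₃) (hJ : J ∈ 𝒜 0) (hP : P ∈ 𝒜 0) (hv : v ∈ 𝒜 1)
    (hJP : J * P = P * J + P) (hJv : J * v = v * J + (1 / 2 : K) • v) (hPv : P * v = v * P)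
    (hvv : v * v = (1 / 4 : K) • P) :
    (classicalR f₁ f₂ J P v * classicalR f₁ f₃ J P v -
      classicalR f₁ f₃ J P v * classicalR f₁ f₂ J P v) +
    (classicalR f₁ f₂ J P v * classicalR f₂ f₃ J P v -
      classicalR f₂ f₃ J P v * classicalR f₁ f₂ J P v) +
    (classicalR f₁ f₃ J P v * classicalR f₂ f₃ J P v -
      classicalR f₂ f₃ J P v * classicalR f₁ f₃ J P v) = 0 := by
  have key : ∀ {f e : A →ₐ[K] E}, SuperCommute 𝒜 𝒜 f e →
      e J * f J = f J * e J ∧ e J * f P = f P * e J ∧ e J * f v = f v * e J ∧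
      e P * f J = f J * e P ∧ e P * f P = f P * e P ∧ e P * f v = f v * e P ∧
      e v * f J = f J * e v ∧ e v * f P = f P * e v ∧ e v * f v = -(f v * e v) := fun s =>
    ⟨s.comm_of_even_left hJ hJ, s.comm_of_even_left hP hJ, s.comm_of_even_right hv hJ,
      s.comm_of_even_left hJ hP, s.comm_of_even_left hP hP, s.comm_of_even_right hv hP,
      s.comm_of_even_left hJ hv, s.comm_of_even_left hP hv, s.anticomm_of_odd hv hv⟩
  have rel : ∀ f : A →ₐ[K] E, f J * f P = f P * f J + f P ∧
      f J * f v = f v * f J + (1 / 2 : K) • f v ∧ f P * f v = f v * f P ∧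
      f v * f v = (1 / 4 : K) • f P := fun f => by
    refine ⟨?_, ?_, ?_, ?_⟩
    · rw [← map_mul, hJP, map_add, map_mul]
    · rw [← map_mul, hJv, map_add, map_mul, map_smul]
    · rw [← map_mul, hPv, map_mul]
    · rw [← map_mul, hvv, map_smul]
  obtain ⟨a1, a2, a3, a4, a5, a6, a7, a8, a9⟩ := key s₁₂
  obtain ⟨b1, b2, b3, b4, b5, b6, b7, b8, b9⟩ := key s₁₃
  obtain ⟨c1, c2, c3, c4, c5, c6, c7, c8, c9⟩ := key s₂₃
  obtain ⟨p1, p2, p3, p4⟩ := rel f₁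
  obtain ⟨q1, q2, q3, q4⟩ := rel f₂
  obtain ⟨r1, r2, r3, r4⟩ := rel f₃
  simp only [classicalR, mul_add, add_mul, mul_sub, sub_mul, smul_mul_assoc, mul_smul_comm, mul_assoc,
    mul_neg, neg_mul, assoc_of_eq a1, assoc_of_eq a2, assoc_of_eq a3, assoc_of_eq a4,
    assoc_of_eq a5, assoc_of_eq a6, assoc_of_eq a7, assoc_of_eq a8, assoc_of_eq a9, assoc_of_eq b1,
    assoc_of_eq b2, assoc_of_eq b3, assoc_of_eq b4, assoc_of_eq b5, assoc_of_eq b6, assoc_of_eq b7,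
    assoc_of_eq b8, assoc_of_eq b9, assoc_of_eq c1, assoc_of_eq c2, assoc_of_eq c3, assoc_of_eq c4,
    assoc_of_eq c5, assoc_of_eq c6, assoc_of_eq c7, assoc_of_eq c8, assoc_of_eq c9, assoc_of_eq p1,
    assoc_of_eq p2, assoc_of_eq p3, assoc_of_eq p4, assoc_of_eq q1, assoc_of_eq q2, assoc_of_eq q3,
    assoc_of_eq q4, a1, a2, a3, a4, a5, a6, a7, a8, a9, b1, b2,
    b3, b4, b5, b6, b7, b8, b9, c1, c2, c3, c4, c5, c6, c7, c8, c9, p1, p2, p3, p4, q1, q2, q3, q4, r1,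
    r2, r3, r4]
  match_scalars <;> norm_num

end GenericCYBE

/-! ### The r-matrix and its cocommutator in U(osp(2/1)) -/

namespace U0

open GradedTensorProduct (includeLeft includeRight)

variable (k : Type*) [Field k] [CharZero k]

theorem mem_even {a : U0 k} (ha : parity k a = a) : a ∈ grading k 0 := by
  change parity k a = (-1 : ℤˣ) ^ (0 : ZMod 2) • a
  rw [uzpow_zero, one_smul, ha]

theorem mem_odd {a : U0 k} (ha : parity k a = -a) : a ∈ grading k 1 := by
  change parity k a = (-1 : ℤˣ) ^ (1 : ZMod 2) • a
  rw [uzpow_one, Units.neg_smul, one_smul, ha]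

theorem H_mem : gen k .H ∈ grading k 0 := mem_even k (by rw [gen, parity_mk, freeParity_H])
theorem X_mem : gen k .X ∈ grading k 0 := mem_even k (by rw [gen, parity_mk, freeParity_X])
theorem Y_mem : gen k .Y ∈ grading k 0 := mem_even k (by rw [gen, parity_mk, freeParity_Y])
theorem Vp_mem : gen k .Vp ∈ grading k 1 := mem_odd k (by
  rw [gen, parity_mk, freeParity_Vp, map_neg])
theorem Vm_mem : gen k .Vm ∈ grading k 1 := mem_odd k (by
  rw [gen, parity_mk, freeParity_Vm, map_neg])

local notation "J₀" => gen k Gen.H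
local notation "J₊" => gen k Gen.X
local notation "J₋" => gen k Gen.Y
local notation "v₊" => gen k Gen.Vp
local notation "v₋" => gen k Gen.Vm

theorem rel_H_Vp : J₀ * v₊ - v₊ * J₀ = (1 / 2 : k) • v₊ := mk_rel ClassicalRel.J0_vp
theorem rel_H_Vm : J₀ * v₋ - v₋ * J₀ = -(1 / 2 : k) • v₋ := mk_rel ClassicalRel.J0_vm
theorem rel_Vp_Vm : v₊ * v₋ + v₋ * v₊ = -(1 / 2 : k) • J₀ := mk_rel ClassicalRel.vp_vm
theorem rel_H_X : J₀ * J₊ - J₊ * J₀ = J₊ := mk_rel ClassicalRel.J0_Jp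
theorem rel_H_Y : J₀ * J₋ - J₋ * J₀ = -J₋ := mk_rel ClassicalRel.J0_Jm
theorem rel_X_Y : J₊ * J₋ - J₋ * J₊ = (2 : k) • J₀ := mk_rel ClassicalRel.Jp_Jm
theorem rel_X : J₊ = (4 : k) • (v₊ * v₊) := mk_rel ClassicalRel.Jp_eq
theorem rel_X_Vp : J₊ * v₊ - v₊ * J₊ = 0 := mk_rel ClassicalRel.Jp_vp
theorem rel_X_Vm : J₊ * v₋ - v₋ * J₊ = v₊ := mk_rel ClassicalRel.Jp_vm
theorem rel_Y_Vp : J₋ * v₊ - v₊ * J₋ = v₋ := mk_rel ClassicalRel.Jm_vp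

theorem Vp_sq : v₊ * v₊ = (1 / 4 : k) • J₊ := by
  conv_rhs => rw [rel_X]
  rw [smul_smul]
  norm_num

theorem sc : SuperCommute (grading k) (grading k) (includeLeft (grading k) (grading k))
    (includeRight (grading k) (grading k)) := SuperCommute.inclusions _ _

theorem wedge_eq (x y : U0 k) : wedge k x y =
    includeLeft (grading k) (grading k) x * includeRight (grading k) (grading k) y -
      includeRight (grading k) (grading k) x * includeLeft (grading k) (grading k) y := by
  rw [wedge, superFlip_eq, tmul_eq, AlgHom.toLinearMap_apply, map_mul, flipHom_left, flipHom_right]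

theorem rMatrix_eq : rMatrix k = classicalR (includeLeft (grading k) (grading k))
    (includeRight (grading k) (grading k)) J₀ J₊ v₊ := by
  rw [rMatrix, wedge_eq, wedge_eq, (sc k).comm_of_even_left (X_mem k) (H_mem k),
    (sc k).anticomm_of_odd (Vp_mem k) (Vp_mem k), classicalR]
  module

theorem superFlip_rMatrix : superFlip (grading k) (rMatrix k) = -rMatrix k := by
  rw [rMatrix, wedge_eq, wedge_eq, superFlip_eq, AlgHom.toLinearMap_apply]
  simp only [map_sub, map_mul, flipHom_left, flipHom_right]
  abel

theorem cybe : CYBE k (rMatrix k) := by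
  have h := classicalR_cybe (superCommute₁₂ (grading k)) (superCommute₁₃ (grading k))
    (superCommute₂₃ (grading k)) (H_mem k) (X_mem k) (Vp_mem k)
    (eq_add_of_sub_eq' (rel_H_X k)) (eq_add_of_sub_eq' (rel_H_Vp k))
    (sub_eq_zero.1 (rel_X_Vp k)) (Vp_sq k)
  have e12 : leg12 (grading k) (rMatrix k) =
      classicalR (inc₁ (grading k)) (inc₂ (grading k)) J₀ J₊ v₊ := by
    rw [leg12_eq, rMatrix_eq, AlgHom.toLinearMap_apply]
    simp only [classicalR, map_sub, map_mul, map_smul, hom₁₂_left, hom₁₂_right]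
  have e13 : leg13 (grading k) (rMatrix k) =
      classicalR (inc₁ (grading k)) (inc₃ (grading k)) J₀ J₊ v₊ := by
    rw [leg13_eq, rMatrix_eq, AlgHom.toLinearMap_apply]
    simp only [classicalR, map_sub, map_mul, map_smul, hom₁₃_left, hom₁₃_right]
  have e23 : leg23 (grading k) (rMatrix k) =
      classicalR (inc₂ (grading k)) (inc₃ (grading k)) J₀ J₊ v₊ := by
    rw [leg23_eq, rMatrix_eq, AlgHom.toLinearMap_apply]
    simp only [classicalR, map_sub, map_mul, map_smul, hom₂₃_left, hom₂₃_right]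
  rw [CYBE, e12, e13, e23]
  exact h

theorem primitive_eq (x : U0 k) : primitive k x =
    includeLeft (grading k) (grading k) x + includeRight (grading k) (grading k) x := by
  rw [primitive, GradedTensorProduct.includeLeft_apply, GradedTensorProduct.includeRight_apply]

theorem cocommutator_H : cocommutator k J₀ = -rMatrix k := by
  rw [cocommutator, primitive_eq, rMatrix_eq, classicalR_bracket_even (sc k) (H_mem k) (X_mem k)
    (Vp_mem k) (H_mem k) (a := 0) (b := -J₊) (c := -((1 / 2 : k) • v₊)) (by rw [add_zero])
    (by linear_combination (norm := module) -rel_H_X k)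
    (by linear_combination (norm := module) -rel_H_Vp k), classicalR]
  simp only [map_zero, map_neg, map_smul, zero_mul, mul_zero, mul_neg, neg_mul, smul_mul_assoc,
    mul_smul_comm]
  module

theorem cocommutator_X : cocommutator k J₊ = 0 := by
  rw [cocommutator, primitive_eq, rMatrix_eq, classicalR_bracket_even (sc k) (H_mem k) (X_mem k)
    (Vp_mem k) (X_mem k) (a := J₊) (b := 0) (c := 0)
    (by linear_combination (norm := module) rel_H_X k) (by rw [add_zero])
    (by linear_combination (norm := module) -rel_X_Vp k)]
  simp only [map_zero, zero_mul, mul_zero]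
  module

theorem cocommutator_Y : cocommutator k J₋ =
    J₊ ᵍ⊗ₜ[k] J₋ - J₋ ᵍ⊗ₜ[k] J₊ + (2 : k) • (v₊ ᵍ⊗ₜ[k] v₋) + (2 : k) • (v₋ ᵍ⊗ₜ[k] v₊) := by
  rw [cocommutator, primitive_eq, rMatrix_eq, classicalR_bracket_even (sc k) (H_mem k) (X_mem k)
    (Vp_mem k) (Y_mem k) (a := -J₋) (b := (2 : k) • J₀) (c := -v₋)
    (by linear_combination (norm := module) rel_H_Y k)
    (by linear_combination (norm := module) rel_X_Y k)
    (by linear_combination (norm := module) -rel_Y_Vp k)]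
  simp only [tmul_eq, map_neg, map_smul, mul_neg, neg_mul, smul_mul_assoc, mul_smul_comm]
  module

theorem cocommutator_Vp : cocommutator k v₊ =
    (1 / 2 : k) • (J₊ ᵍ⊗ₜ[k] v₊) - (1 / 2 : k) • (v₊ ᵍ⊗ₜ[k] J₊) := by
  rw [cocommutator, primitive_eq, rMatrix_eq, classicalR_bracket_odd (sc k) (H_mem k) (X_mem k)
    (Vp_mem k) (Vp_mem k) (a := (1 / 2 : k) • v₊) (b := 0) (c := (1 / 2 : k) • J₊)
    (by linear_combination (norm := module) rel_H_Vp k)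
    (by linear_combination (norm := module) rel_X_Vp k)
    (by linear_combination (norm := module) (2 : k) • Vp_sq k)]
  simp only [tmul_eq, map_zero, map_smul, zero_mul, mul_zero, smul_mul_assoc, mul_smul_comm]
  module

theorem cocommutator_Vm : cocommutator k v₋ =
    (1 / 2 : k) • (J₊ ᵍ⊗ₜ[k] v₋) - (1 / 2 : k) • (v₋ ᵍ⊗ₜ[k] J₊) := by
  rw [cocommutator, primitive_eq, rMatrix_eq, classicalR_bracket_odd (sc k) (H_mem k) (X_mem k)
    (Vp_mem k) (Vm_mem k) (a := -((1 / 2 : k) • v₋)) (b := v₊) (c := -((1 / 2 : k) • J₀))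
    (by linear_combination (norm := module) rel_H_Vm k)
    (by linear_combination (norm := module) rel_X_Vm k)
    (by linear_combination (norm := module) rel_Vp_Vm k)]
  simp only [tmul_eq, map_neg, map_smul, neg_mul, mul_neg, smul_mul_assoc, mul_smul_comm]
  module

end U0

end SuperJordanian

end

noncomputable section

namespace SuperJordanian


open PowerSeries (C coeff)
open scoped Nat

namespace Uh

/-! ### First-order terms of the twist, the R-matrix and the coproduct -/

section Limits

open GradedTensorProduct (includeLeft includeRight)

variable (k : Type*) [Field k] [CharZero k]

local notation "ι₁" => inl (grading k)
local notation "ι₂" => inr (grading k)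
local notation "κ₁" => includeLeft (U0.grading k) (U0.grading k)
local notation "κ₂" => includeRight (U0.grading k) (U0.grading k)

theorem tens_eq (a b : Uh k) : tens k a b = ι₁ a * ι₂ b := of_tmul (grading k) a b

theorem reduction₂_inl_mul_inr (a b : Uh k) : reduction₂ k (ι₁ a * ι₂ b) =
    (reduction k a) ᵍ⊗ₜ[k] (reduction k b) := by
  rw [reduction₂_mul, reduction₂_inl, reduction₂_inr, tmul_eq]

theorem exists_twist : ∃ y, (twistUnit k : Compl (hbar k) (T2 (grading k))) = 1 + hbar k • y ∧
    reduction₂ k y = (2 : k) • (κ₁ (U0.gen k .H) * κ₂ (U0.gen k .X)) -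
      (2 : k) • (κ₁ (U0.gen k .Vp) * κ₂ (U0.gen k .Vp)) := by
  obtain ⟨y, hy⟩ := twist_eq_one_add (k := k) (ι₁ (clv k)) (ι₁ (clW k)) (ι₂ (clv k))
  refine ⟨_, (twistUnit_val k).trans hy, ?_⟩
  rw [map_add, map_sub, reduction₂_hbar, reduction₂_C_smul, reduction₂_ofNat_smul, reduction₂_mul,
    reduction₂_mul, ← map_cartan, ← IsClassicalPair.map_X, ← IsClassicalPair.map_g,
    ← IsClassicalPair.map_g, X_clv, reduction₂_inl, reduction₂_inl, reduction₂_inr, reduction₂_inr,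
    reduction_g, reduction_cartan, X, reduction_gen]
  simp only [map_smul, smul_mul_assoc, mul_smul_comm]
  module

theorem exists_twistOp : ∃ y, (twistUnitOp k : Compl (hbar k) (T2 (grading k))) =
    1 + hbar k • y ∧ reduction₂ k y = (2 : k) • (κ₂ (U0.gen k .H) * κ₁ (U0.gen k .X)) -
      (2 : k) • (κ₂ (U0.gen k .Vp) * κ₁ (U0.gen k .Vp)) := by
  have e : (twistUnitOp k : Compl (hbar k) (T2 (grading k))) =
      twist k (ι₂ (clv k)) (ι₂ (clW k)) (ι₁ (clv k)) := by
    rw [twistUnitOp_val, twistUnit_val, map_twist, flip₂_inl, flip₂_inl, flip₂_inr]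
  obtain ⟨y, hy⟩ := twist_eq_one_add (k := k) (ι₂ (clv k)) (ι₂ (clW k)) (ι₁ (clv k))
  refine ⟨_, e.trans hy, ?_⟩
  rw [map_add, map_sub, reduction₂_hbar, reduction₂_C_smul, reduction₂_ofNat_smul, reduction₂_mul,
    reduction₂_mul, ← map_cartan, ← IsClassicalPair.map_X, ← IsClassicalPair.map_g,
    ← IsClassicalPair.map_g, X_clv, reduction₂_inl, reduction₂_inl, reduction₂_inr, reduction₂_inr,
    reduction_g, reduction_cartan, X, reduction_gen]
  simp only [map_smul, smul_mul_assoc, mul_smul_comm]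
  module

theorem unit_mul_inv_eq {R B : Type*} [CommRing R] [Ring B] [Algebra R B] {h : R} {u u' : Bˣ} {y y' : B}
    (hu : (u : B) = 1 + h • y) (hu' : (u' : B) = 1 + h • y') :
    ((u' * u⁻¹ : Bˣ) : B) = 1 + h • ((y' - y) * ↑u⁻¹) := by
  have : (u' : B) = u + h • (y' - y) := by
    rw [hu, hu', smul_sub]
    abel
  rw [Units.val_mul, this, add_mul, Units.mul_inv, smul_mul_assoc]

/-- F⁻¹ is 1 modulo h, so the first-order term of F₂₁F⁻¹ is the difference of those of F₂₁ and F.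
The odd parts add up instead of cancelling, by the sign of the super flip. -/
theorem exists_rUnit : ∃ w, (rUnit k : Compl (hbar k) (T2 (grading k))) = 1 + hbar k • w ∧
    reduction₂ k w = -((2 : k) • U0.rMatrix k) := by
  obtain ⟨y, hy, ey⟩ := exists_twist k
  obtain ⟨y', hy', ey'⟩ := exists_twistOp k
  refine ⟨_, unit_mul_inv_eq hy hy', ?_⟩
  have e1 : reduction₂ k (twistUnit k) = 1 := by
    rw [hy, map_add, reduction₂_hbar, reduction₂_one, add_zero]
  have e2 : reduction₂ k ↑(twistUnit k)⁻¹ = 1 := by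
    have := reduction₂_mul k (twistUnit k) ↑(twistUnit k)⁻¹
    rw [Units.mul_inv, reduction₂_one, e1, one_mul] at this
    exact this.symm
  rw [reduction₂_mul, e2, mul_one, map_sub, ey, ey', U0.rMatrix, U0.wedge_eq, U0.wedge_eq]
  module

theorem sub_eq_of_intertwine {R B : Type*} [CommRing R] [Ring B] [Algebra R B] {h : R}
    {x d d' w : B} (hx : x = 1 + h • w) (e : x * d = d' * x) :
    d - d' = h • (d' * w - w * d) := by
  rw [hx, add_mul, mul_add, one_mul, mul_one, smul_mul_assoc, mul_smul_comm] at e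
  rw [smul_sub]
  linear_combination (norm := module) e

/-- Substituting R = 1 + hw in RΔ(a) = Δᵒᵖ(a)R gives Δ(a) - Δᵒᵖ(a) = h(Δᵒᵖ(a)w - wΔ(a)). Modulo h
the two coproducts agree and w is -2r₂. -/
theorem exists_sub_comulOp (a : Uh k) : ∃ w, (hopf k).comul a - (hopf k).comulOp a = hbar k • w ∧
    reduction₂ k w = (2 : k) • (U0.rMatrix k * reduction₂ k ((hopf k).comul a) -
      reduction₂ k ((hopf k).comul a) * U0.rMatrix k) := by
  obtain ⟨w, hw, ew⟩ := exists_rUnit k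
  have h := sub_eq_of_intertwine hw (rUnit_intertwines k a)
  rw [comulOp_eq]
  change ∃ w, comul k a - flip₂ (grading k) (comul k a) = hbar k • w ∧
    reduction₂ k w = (2 : k) • (U0.rMatrix k * reduction₂ k (comul k a) -
      reduction₂ k (comul k a) * U0.rMatrix k)
  have e : reduction₂ k (flip₂ (grading k) (comul k a)) = reduction₂ k (comul k a) := by
    have := congrArg (reduction₂ k) h
    rw [map_sub, reduction₂_hbar, sub_eq_zero] at this
    exact this.symm
  refine ⟨_, h, ?_⟩
  rw [map_sub, reduction₂_mul, reduction₂_mul, e, ew]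
  simp only [neg_mul, mul_neg, smul_mul_assoc, mul_smul_comm]
  module

/-- T^c is 1 + chX modulo h², which accounts for the terms J₊ ⊗ g and g ⊗ J₊. For H and Y the
explicit terms with coefficient 2h contribute with T replaced by 1. -/
theorem exists_comul_gen (g : Gen) : ∃ w,
    comul k (gen k g) = tens k (gen k g) 1 + tens k 1 (gen k g) + hbar k • w ∧
      reduction₂ k w = U0.cocommutator k (U0.gen k g) := by
  obtain ⟨y₁, h₁, r₁⟩ := exists_Tpow k 1
  obtain ⟨y₂, h₂, r₂⟩ := exists_Tpow k (-1)
  obtain ⟨y₃, h₃, r₃⟩ := exists_Tpow k (1 / 2)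
  obtain ⟨y₄, h₄, r₄⟩ := exists_Tpow k (-(1 / 2))
  have t₃ : reduction k (Tpow k (1 / 2)) = 1 := by
    rw [h₃, map_add, map_one, reduction_smul, PowerSeries.constantCoeff_X, zero_smul, add_zero]
  have t₄ : reduction k (Tpow k (-(1 / 2))) = 1 := by
    rw [h₄, map_add, map_one, reduction_smul, PowerSeries.constantCoeff_X, zero_smul, add_zero]
  rw [tens_eq, tens_eq]
  cases g
  · refine ⟨ι₁ (H k) * ι₂ y₂ + ι₁ y₁ * ι₂ (H k) + (2 : k⟦X⟧) •
      (ι₁ (Vp k * Tpow k (1 / 2)) * ι₂ (Vp k * Tpow k (-(1 / 2)))), ?_, ?_⟩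
    · rw [smul_add (hbar k), smul_smul, mul_comm (hbar k), ← add_assoc,
        ← exists_coproduct_odd ι₁ ι₂ h₁ h₂]
      exact comul_H k
    · rw [map_add, map_add, reduction₂_ofNat_smul, reduction₂_inl_mul_inr, reduction₂_inl_mul_inr,
        reduction₂_inl_mul_inr, map_mul, map_mul, t₃, t₄, r₁, r₂, H, Vp, reduction_gen,
        reduction_gen, mul_one, U0.cocommutator_H, U0.rMatrix_eq, classicalR]
      simp only [tmul_eq, map_smul, mul_smul_comm, smul_mul_assoc]
      module
  · refine ⟨0, ?_, ?_⟩
    · rw [smul_zero, add_zero, map_one ι₁, map_one ι₂, mul_one, one_mul]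
      exact comul_X k
    · rw [map_zero, U0.cocommutator_X]
  · refine ⟨ι₁ (Y k) * ι₂ y₂ + ι₁ y₁ * ι₂ (Y k) + (2 : k⟦X⟧) •
      (ι₁ (Vp k * Tpow k (1 / 2)) * ι₂ (Tpow k (-(1 / 2)) * Vm k)) + (2 : k⟦X⟧) •
      (ι₁ (Tpow k (1 / 2) * Vm k) * ι₂ (Vp k * Tpow k (-(1 / 2)))), ?_, ?_⟩
    · rw [smul_add (hbar k), smul_add (hbar k), smul_smul, smul_smul, mul_comm (hbar k), ← add_assoc,
        ← add_assoc, ← exists_coproduct_odd ι₁ ι₂ h₁ h₂]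
      exact comul_Y k
    · rw [map_add, map_add, map_add, reduction₂_ofNat_smul, reduction₂_ofNat_smul,
        reduction₂_inl_mul_inr, reduction₂_inl_mul_inr, reduction₂_inl_mul_inr,
        reduction₂_inl_mul_inr, map_mul, map_mul, map_mul, map_mul, t₃, t₄, r₁, r₂, Y, Vp, Vm,
        reduction_gen, reduction_gen, reduction_gen, mul_one, one_mul,
        U0.cocommutator_Y]
      simp only [tmul_eq, map_smul, mul_smul_comm, smul_mul_assoc]
      module
  · refine ⟨ι₁ (Vp k) * ι₂ y₄ + ι₁ y₃ * ι₂ (Vp k), ?_, ?_⟩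
    · rw [← exists_coproduct_odd ι₁ ι₂ h₃ h₄]
      exact comul_Vp k
    · rw [map_add, reduction₂_inl_mul_inr, reduction₂_inl_mul_inr, r₃, r₄, Vp, reduction_gen,
        U0.cocommutator_Vp]
      simp only [tmul_eq, map_smul, mul_smul_comm, smul_mul_assoc]
      module
  · refine ⟨ι₁ (Vm k) * ι₂ y₄ + ι₁ y₃ * ι₂ (Vm k), ?_, ?_⟩
    · rw [← exists_coproduct_odd ι₁ ι₂ h₃ h₄]
      exact comul_Vm k
    · rw [map_add, reduction₂_inl_mul_inr, reduction₂_inl_mul_inr, r₃, r₄, Vm, reduction_gen,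
        U0.cocommutator_Vm]
      simp only [tmul_eq, map_smul, mul_smul_comm, smul_mul_assoc]
      module

end Limits

end Uh

end SuperJordanian

end

/-! ### Assembly of the four assertions -/

theorem mainTheorem1 (k : Type*) [Field k] [CharZero k] :
    -- `U_h(osp(2/1))` is a topologically free `k⟦h⟧`-module: `h`-adically complete, torsion free
    (IsAdicComplete (Ideal.span {hbar k}) (Uh k) ∧ ∀ u : Uh k, hbar k • u = 0 → u = 0) ∧
    -- `U_h / h U_h = U(osp(2/1))`, compatibly with the generators
    (Function.Surjective (Uh.reduction k) ∧
      (∀ u : Uh k, Uh.reduction k u = 0 ↔ ∃ w : Uh k, u = hbar k • w) ∧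
      ∀ g : Gen, Uh.reduction k (Uh.gen k g) = U0.gen k g) ∧
    -- `U_h(osp(2/1))` is topologically generated by `H`, `V₊`, `V₋`
    (∀ (u : Uh k) (n : ℕ),
      ∃ s ∈ Algebra.adjoin k⟦X⟧ ({Uh.H k, Uh.Vp k, Uh.Vm k} : Set (Uh k)),
        ∃ w : Uh k, u = s + hbar k ^ n • w) ∧
    -- the classical bialgebra: `r₂` is skew and solves the classical Yang-Baxter equation,
    -- and the cocommutator takes the following values
    (superFlip (U0.grading k) (U0.rMatrix k) = -U0.rMatrix k ∧ U0.CYBE k (U0.rMatrix k) ∧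
      U0.cocommutator k (U0.gen k .H) = -U0.rMatrix k ∧
      U0.cocommutator k (U0.gen k .X) = 0 ∧
      U0.cocommutator k (U0.gen k .Y) =
        U0.gen k .X ᵍ⊗ₜ[k] U0.gen k .Y - U0.gen k .Y ᵍ⊗ₜ[k] U0.gen k .X
          + (2 : k) • (U0.gen k .Vp ᵍ⊗ₜ[k] U0.gen k .Vm)
          + (2 : k) • (U0.gen k .Vm ᵍ⊗ₜ[k] U0.gen k .Vp) ∧
      U0.cocommutator k (U0.gen k .Vp) = (1 / 2 : k) • (U0.gen k .X ᵍ⊗ₜ[k] U0.gen k .Vp)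
        - (1 / 2 : k) • (U0.gen k .Vp ᵍ⊗ₜ[k] U0.gen k .X) ∧
      U0.cocommutator k (U0.gen k .Vm) = (1 / 2 : k) • (U0.gen k .X ᵍ⊗ₜ[k] U0.gen k .Vm)
        - (1 / 2 : k) • (U0.gen k .Vm ᵍ⊗ₜ[k] U0.gen k .X)) ∧
    -- the Hopf superalgebra structure
    ∃ 𝓗 : HopfSuperalgebra (hbar k) (Uh.grading k),
      -- the coproduct
      (𝓗.comul (Uh.H k) =
          Uh.tens k (Uh.H k) (Uh.Tpow k (-1)) + Uh.tens k (Uh.Tpow k 1) (Uh.H k)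
            + (2 * hbar k) •
              Uh.tens k (Uh.Vp k * Uh.Tpow k (1 / 2)) (Uh.Vp k * Uh.Tpow k (-(1 / 2))) ∧
        𝓗.comul (Uh.X k) = Uh.tens k (Uh.X k) 1 + Uh.tens k 1 (Uh.X k) ∧
        𝓗.comul (Uh.Y k) =
          Uh.tens k (Uh.Y k) (Uh.Tpow k (-1)) + Uh.tens k (Uh.Tpow k 1) (Uh.Y k)
            + (2 * hbar k) •
              Uh.tens k (Uh.Vp k * Uh.Tpow k (1 / 2)) (Uh.Tpow k (-(1 / 2)) * Uh.Vm k)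
            + (2 * hbar k) •
              Uh.tens k (Uh.Tpow k (1 / 2) * Uh.Vm k) (Uh.Vp k * Uh.Tpow k (-(1 / 2))) ∧
        𝓗.comul (Uh.Vp k) = Uh.tens k (Uh.Vp k) (Uh.Tpow k (-(1 / 2)))
          + Uh.tens k (Uh.Tpow k (1 / 2)) (Uh.Vp k) ∧
        𝓗.comul (Uh.Vm k) = Uh.tens k (Uh.Vm k) (Uh.Tpow k (-(1 / 2)))
          + Uh.tens k (Uh.Tpow k (1 / 2)) (Uh.Vm k)) ∧
      -- the counit
      (∀ g : Gen, 𝓗.counit (Uh.gen k g) = 0) ∧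
      -- the antipode, a super-antihomomorphism
      (𝓗.antipode (Uh.H k) = -Uh.H k - (2 * hbar k) • (Uh.Vp k * Uh.Vp k) ∧
        𝓗.antipode (Uh.X k) = -Uh.X k ∧
        𝓗.antipode (Uh.Y k) =
          -Uh.Y k + hbar k • Uh.H k + hbar k ^ 2 • (Uh.Vp k * Uh.Vp k) ∧
        𝓗.antipode (Uh.Vp k) = -Uh.Vp k ∧
        𝓗.antipode (Uh.Vm k) = -Uh.Vm k + (PowerSeries.C (1 / 2 : k) * hbar k) • Uh.Vp k ∧
        ∀ i j, ∀ a ∈ Uh.grading k i, ∀ b ∈ Uh.grading k j,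
          𝓗.antipode (a * b) = ((-1 : ℤˣ) ^ (i * j)) • (𝓗.antipode b * 𝓗.antipode a)) ∧
      -- the first-order term of the coproduct of each generator is the cocommutator
      (∀ g : Gen, ∃ w,
        𝓗.comul (Uh.gen k g) = Uh.tens k (Uh.gen k g) 1 + Uh.tens k 1 (Uh.gen k g) + hbar k • w ∧
        Uh.reduction₂ k w = U0.cocommutator k (U0.gen k g)) ∧
      (∀ a : Uh k, ∃ w, 𝓗.comul a - 𝓗.comulOp a = hbar k • w ∧
        Uh.reduction₂ k w = (2 : k) • (U0.rMatrix k * Uh.reduction₂ k (𝓗.comul a)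
          - Uh.reduction₂ k (𝓗.comul a) * U0.rMatrix k)) ∧
      -- triangularity, with classical limit `r₂`
      ∃ R, 𝓗.IsTriangular R ∧
        ∃ w, R = 1 + hbar k • w ∧ Uh.reduction₂ k w = -((2 : k) • U0.rMatrix k) := by
  refine ⟨⟨HAdic.isAdicComplete, HTorsionFree.eq_zero⟩,
    ⟨Uh.reduction_surjective, fun u => Uh.reduction_eq_zero_iff, Uh.reduction_gen k⟩,
    fun u n => ?_, ⟨U0.superFlip_rMatrix k, U0.cybe k, U0.cocommutator_H k, U0.cocommutator_X k,
      U0.cocommutator_Y k, U0.cocommutator_Vp k, U0.cocommutator_Vm k⟩,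
    Uh.hopf k, ⟨?_, ?_, ?_, ?_, ?_⟩, Uh.counit_gen, ⟨Uh.antipode_H, Uh.antipode_X, Uh.antipode_Y,
      Uh.antipode_Vp, Uh.antipode_Vm, Uh.antipode_mul⟩, Uh.exists_comul_gen k,
    Uh.exists_sub_comulOp k, _, Uh.isTriangular k, Uh.exists_rUnit k⟩
  · obtain ⟨s, hs, w, hw⟩ := Uh.exists_mem_adjoin u n
    -- V₊ and V₋ alone already generate a dense subalgebra.
    exact ⟨s, Algebra.adjoin_mono (Set.subset_insert _ _) hs, w, hw⟩
  · simp only [Uh.tens_eq]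
    exact Uh.comul_H k
  · rw [Uh.tens_eq, Uh.tens_eq, map_one (inl _), map_one (inr _), mul_one, one_mul]
    exact Uh.comul_X k
  · simp only [Uh.tens_eq]
    exact Uh.comul_Y k
  · rw [Uh.tens_eq, Uh.tens_eq]
    exact Uh.comul_Vp k
  · rw [Uh.tens_eq, Uh.tens_eq]
    exact Uh.comul_Vm k
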